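/- Let $\mathbf k$ be a field. Let ${\it Ass}$ be the symmetric operad for associative algebras, ${\it Ass}(n)=\mathbf k[\Sigma_n]$ for $n\ge 1$, and let ${\it Cycl}$ be the right ${\it Ass}$-module with ${\it Cycl}(n)=\mathbf k[\mathbf Z_n\backslash\Sigma_n]$ for $n\ge1$, whose structure is induced from that of ${\it Ass}$ by the projections $\Sigma_n\to\mathbf Z_n\backslash\Sigma_n$, where $\mathbf Z_n\subset\Sigma_n$ is the group of cyclic permutations (so that ${\it Cycl}$-traces on an associative algebra are linear maps $T$ with $T(ab)=T(ba)$). Recall that an operad $\mathcal P$ is quadratic if $\mathcal P=\mathcal F(E)/(R)$ with $E=\mathcal P(2)$ and $R\subset\mathcal F(E)(3)$, where $\mathcal F(E)$ is the free operad on $E$; a right module $M$ over it is quadratic if $M=(X\circ\mathcal P)/(G)$ with $X=M(1)$ and $G\subset (X\circ\mathcal P)(2)$, where $X\circ\mathcal P$ is the free right $\mathcal P$-module on $X$. The Koszul duals are $\mathcal P^!=\mathcal F(E^*\otimes{\rm sgn})/(R^\perp)$ and the $\mathcal P^!$-module $M^!=(X^*\circ\mathcal P^!)/(G^\perp)$.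 Let ${\bf s}\mathcal P(n)={\rm sgn}\otimes\uparrow^{n-1}\mathcal P(n)$ and ${\bf s}M(n)={\rm sgn}\otimes\uparrow^{n-1}M(n)$ be the operadic suspensions, and for finite-dimensional $\mathcal P(n)$, $M(n)$ let $$\Omega(({\bf s}M)^*,({\bf s}\mathcal P)^*)=\bigl(({\bf s}M)^*\circ\mathcal F(\downarrow({\bf s}\mathcal P)^*),\partial\bigr)$$ be the cobar construction of the comodule $({\bf s}M)^*$ over the cooperad $({\bf s}\mathcal P)^*$. Here duals are graded so that $({\bf s}M)^*(n)$ and $({\bf s}\mathcal P)^*(n)$ lie in degree $n-1$, the sum over trees only involves operadic vertices with at least two inputs, and $\partial$, of degree $-1$, is induced by the cooperad and comodule structure maps. The projections $({\bf s}M)^*\to({\bf s}M)^*(1)=X^*=M^!(1)$ and $\downarrow({\bf s}\mathcal P)^*\to\downarrow({\bf s}\mathcal P)^*(2)=E^*\otimes{\rm sgn}=\mathcal P^!(2)$ induce a map of differential graded modules $$\pi:\Omega(({\bf s}M)^*,({\bf s}\mathcal P)^*)\to(M^!,\partial=0),$$ and $M$ is called Koszul if $\pi$ is a homology isomorphism.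 Theorem. The operad ${\it Ass}$ and the ${\it Ass}$-module ${\it Cycl}$ are quadratic and Koszul self-dual, ${\it Ass}^!={\it Ass}$ and ${\it Cycl}^!={\it Cycl}$, and the module ${\it Cycl}$ is Koszul. That is, for every $n\ge1$, the map $$\pi:\Omega(({\bf s}{\it Cycl})^*,({\bf s}{\it Ass})^*)(n)\to{\it Cycl}^!(n)={\it Cycl}(n)$$ is a homology isomorphism: the homology of the cobar construction vanishes in positive degrees, and $\pi$ induces an isomorphism in degree $0$. -/

import Mathlib

universe u

open scoped TensorProduct

namespace Koszul

/-! ### Symmetric operads and right modules over a field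

Collections are written in the coordinate-free way: a collection is a functor from finite sets and
bijections to vector spaces, `obj (Fin n)` being its `n`-th piece.  The right action of a
permutation `σ` on `obj (Fin n)` is `map σ⁻¹`. -/

/-- A collection (symmetric sequence) of `k`-vector spaces, concentrated in arities `≥ 1`. -/
structure Collection (k : Type u) [Field k] where
  obj : (A : Type) → [Finite A] → Type u
  [addCommGroup : ∀ (A : Type) [Finite A], AddCommGroup (obj A)]
  [module : ∀ (A : Type) [Finite A], Module k (obj A)]
  map : ∀ {A B : Type} [Finite A] [Finite B], (A ≃ B) → (obj A →ₗ[k] obj B)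
  map_refl : ∀ (A : Type) [Finite A] (x : obj A), map (Equiv.refl A) x = x
  map_trans : ∀ {A B C : Type} [Finite A] [Finite B] [Finite C] (e : A ≃ B) (f : B ≃ C)
    (x : obj A), map (e.trans f) x = map f (map e x)
  subsingleton_obj : ∀ (A : Type) [Finite A] [IsEmpty A], Subsingleton (obj A)

attribute [instance] Collection.addCommGroup Collection.module

/-- A symmetric operad in `k`-vector spaces, in May's form.  The structure map `comp` is
`γ : P(l) ⊗ P(m₁) ⊗ ⋯ ⊗ P(m_l) → P(m₁ + ⋯ + m_l)`, the sum being a disjoint union. -/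
structure Operad (k : Type u) [Field k] extends Collection k where
  comp : ∀ {A : Type} [Finite A] {B : A → Type} [∀ a, Finite (B a)],
    obj A →ₗ[k] MultilinearMap k (fun a => obj (B a)) (obj (Σ a, B a))
  unit : obj Unit
  comp_map : ∀ {A A' : Type} [Finite A] [Finite A'] {B : A → Type} [∀ a, Finite (B a)]
    {B' : A' → Type} [∀ a, Finite (B' a)] (e : A ≃ A') (f : ∀ a, B a ≃ B' (e a))
    (p : obj A) (q : ∀ a, obj (B a)) (q' : ∀ a, obj (B' a)), (∀ a, q' (e a) = map (f a) (q a)) →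
    map (Equiv.sigmaCongr e f) (comp p q) = comp (map e p) q'
  comp_assoc : ∀ {A : Type} [Finite A] {B : A → Type} [∀ a, Finite (B a)]
    {C : ∀ a, B a → Type} [∀ a b, Finite (C a b)] (p : obj A) (q : ∀ a, obj (B a))
    (r : ∀ x : (Σ a, B a), obj (C x.1 x.2)),
    map (Equiv.sigmaAssoc C) (comp (comp p q) r) =
      comp p (fun a => comp (q a) (fun b => r ⟨a, b⟩))
  unit_comp : ∀ {B : Type} [Finite B] (q : obj B),
    map (Equiv.uniqueSigma fun _ : Unit => B) (comp unit fun _ => q) = q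
  comp_unit : ∀ {A : Type} [Finite A] (p : obj A),
    map (Equiv.sigmaUnique A fun _ => Unit) (comp p fun _ => unit) = p

/-- A right module over an operad: the operad axioms with the first occurrence of `P` replaced
by `M`. -/
structure RightModule {k : Type u} [Field k] (P : Operad k) extends Collection k where
  comp : ∀ {A : Type} [Finite A] {B : A → Type} [∀ a, Finite (B a)],
    obj A →ₗ[k] MultilinearMap k (fun a => P.obj (B a)) (obj (Σ a, B a))
  comp_map : ∀ {A A' : Type} [Finite A] [Finite A'] {B : A → Type} [∀ a, Finite (B a)]
    {B' : A' → Type} [∀ a, Finite (B' a)] (e : A ≃ A') (f : ∀ a, B a ≃ B' (e a))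
    (p : obj A) (q : ∀ a, P.obj (B a)) (q' : ∀ a, P.obj (B' a)),
    (∀ a, q' (e a) = P.map (f a) (q a)) →
    map (Equiv.sigmaCongr e f) (comp p q) = comp (map e p) q'
  comp_assoc : ∀ {A : Type} [Finite A] {B : A → Type} [∀ a, Finite (B a)]
    {C : ∀ a, B a → Type} [∀ a b, Finite (C a b)] (p : obj A) (q : ∀ a, P.obj (B a))
    (r : ∀ x : (Σ a, B a), P.obj (C x.1 x.2)),
    map (Equiv.sigmaAssoc C) (comp (comp p q) r) =
      comp p (fun a => P.comp (q a) (fun b => r ⟨a, b⟩))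
  comp_unit : ∀ {A : Type} [Finite A] (p : obj A),
    map (Equiv.sigmaUnique A fun _ => Unit) (comp p fun _ => P.unit) = p

/-- An operad is a right module over itself. -/
abbrev Operad.self {k : Type u} [Field k] (P : Operad k) : RightModule P where
  toCollection := P.toCollection
  comp := P.comp
  comp_map := P.comp_map
  comp_assoc := P.comp_assoc
  comp_unit := P.comp_unit

/-- Morphisms of operads. -/
structure Operad.Hom {k : Type u} [Field k] (P Q : Operad k) where
  app : ∀ (A : Type) [Finite A], P.obj A →ₗ[k] Q.obj A
  app_map : ∀ {A B : Type} [Finite A] [Finite B] (e : A ≃ B) (p : P.obj A),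
    app B (P.map e p) = Q.map e (app A p)
  app_comp : ∀ {A : Type} [Finite A] {B : A → Type} [∀ a, Finite (B a)] (p : P.obj A)
    (q : ∀ a, P.obj (B a)), app _ (P.comp p q) = Q.comp (app A p) (fun a => app (B a) (q a))
  app_unit : app Unit P.unit = Q.unit

/-- Morphisms of right modules over an operad. -/
structure RightModule.Hom {k : Type u} [Field k] {P : Operad k} (M N : RightModule P) where
  app : ∀ (A : Type) [Finite A], M.obj A →ₗ[k] N.obj A
  app_map : ∀ {A B : Type} [Finite A] [Finite B] (e : A ≃ B) (p : M.obj A),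
    app B (M.map e p) = N.map e (app A p)
  app_comp : ∀ {A : Type} [Finite A] {B : A → Type} [∀ a, Finite (B a)] (p : M.obj A)
    (q : ∀ a, P.obj (B a)), app _ (M.comp p q) = N.comp (app A p) q

section PartialComposition

variable {k : Type u} [Field k] {P : Operad k}

open Classical in
/-- The family of units at the fibres of `f` over the points different from `a`
(and `0`, which is never used, over `a`). -/
noncomputable def unitFamily (P : Operad k) {I A : Type} [Finite I] [Finite A] (f : I → A) (a : A)
    (hf : ∀ b, b ≠ a → ∃! i, f i = b) (b : A) : P.obj {i // f i = b} :=
  if h : b ≠ a then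
    letI : Unique {i // f i = b} := Classical.choice ((unique_subtype_iff_existsUnique _).2 (hf b h))
    P.map (Equiv.ofUnique Unit {i // f i = b}) P.unit
  else 0

open Classical in
/-- The partial composition `x ∘ₐ p = ν(x; 1, …, 1, p, 1, …, 1)` with `p` at the place `a`.  The
inputs of the result are the elements of `I`; `f : I → A` tells which element of `A` they come
from, so that the inputs of `p` are the elements of the fibre over `a`. -/
noncomputable def RightModule.partialComp (M : RightModule P) {I A : Type} [Finite I] [Finite A]
    (f : I → A) (a : A) (hf : ∀ b, b ≠ a → ∃! i, f i = b) :
    M.obj A →ₗ[k] P.obj {i // f i = a} →ₗ[k] M.obj I :=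
  LinearMap.mk₂ k
    (fun x p => M.map (Equiv.sigmaFiberEquiv f)
      (M.comp x (Function.update (unitFamily P f a hf) a p)))
    (by intro x y p; simp) (by intro c x p; simp) (by intro x p q; simp) (by intro c x p; simp)

end PartialComposition

/-! ### Quadratic operads and quadratic modules -/

section Quadratic

variable {k : Type u} [Field k]

/-- The map `{1, 2, 3} → {1, 2}` with fibres `{1, 2}` and `{3}`. -/
def firstTwo (i : Fin 3) : Fin 2 := if i = 2 then 1 else 0

/-- The two elements of the first fibre of `firstTwo`. -/
noncomputable def firstTwoEquiv : Fin 2 ≃ {i : Fin 3 // firstTwo i = 0} :=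
  Equiv.ofBijective (fun i => ⟨i.castSucc, by revert i; decide⟩)
    ⟨fun i j h => by simpa using h, by rintro ⟨i, hi⟩; revert i; decide⟩

/-- The composition `p ∘₁ q = γ(p; q, 1)` from `P(2) ⊗ P(2)` to `P(3)`. -/
noncomputable def Operad.circOne (P : Operad k) :
    P.obj (Fin 2) ⊗[k] P.obj (Fin 2) →ₗ[k] P.obj (Fin 3) :=
  TensorProduct.lift
    ((P.self.partialComp firstTwo 0 (by unfold ExistsUnique; decide)).compl₂ (P.map firstTwoEquiv))

/-- With `E = P(2)`, the arity `3` part of the free operad on `E` is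
`F(E)(3) = (E ⊗ E) ⊕ (E ⊗ E) ⊕ (E ⊗ E)`, one summand `E ∘₁ E` for each of the three binary trees
with three leaves (they differ by a cyclic permutation of the leaves).  This is the
canonical map `F(E)(3) → P(3)`; its kernel is the space `R` of quadratic relations of `P`. -/
noncomputable def Operad.evalThree (P : Operad k)
    (w : Fin 3 → P.obj (Fin 2) ⊗[k] P.obj (Fin 2)) : P.obj (Fin 3) :=
  ∑ i : Fin 3, P.map (finRotate 3 ^ (i : ℕ)) (P.circOne (w i))

/-- `P` is quadratic, `P = F(E)/(R)` with `E = P(2)` and `R ⊂ F(E)(3)`: every equivariant map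
`P(2) → Q(2)` to an operad `Q` that respects the relations of `P` in arity `3` extends uniquely to a
morphism of operads. -/
def Operad.IsQuadratic (P : Operad.{u} k) : Prop :=
  ∀ (Q : Operad.{u} k) (f : P.obj (Fin 2) →ₗ[k] Q.obj (Fin 2)),
    (∀ (σ : Equiv.Perm (Fin 2)) (p : P.obj (Fin 2)), f (P.map σ p) = Q.map σ (f p)) →
    (∀ w : Fin 3 → P.obj (Fin 2) ⊗[k] P.obj (Fin 2), P.evalThree w = 0 →
      Q.evalThree (fun i => TensorProduct.map f f (w i)) = 0) →
    ∃! φ : Operad.Hom P Q, φ.app (Fin 2) = f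

/-- With `X = M(1)` and `E = P(2)`, the canonical map `(X ∘ P)(2) = X ⊗ E → M(2)`; its kernel is
the space `G` of quadratic relations of `M`. -/
noncomputable def RightModule.evalTwo {P : Operad k} (M : RightModule P) :
    M.obj Unit ⊗[k] P.obj (Fin 2) →ₗ[k] M.obj (Σ _ : Unit, Fin 2) :=
  TensorProduct.lift (LinearMap.mk₂ k (fun x p => M.comp x (fun _ => p))
    (by intro x y p; simp) (by intro c x p; simp)
    (by
      intro x p q
      have h := (M.comp (B := fun _ : Unit => Fin 2) x).map_update_add (fun _ => p) () p q
      have e : ∀ z : P.obj (Fin 2),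
          Function.update (fun _ : Unit => p) () z = fun _ => z := by
        intro z; funext i; cases i; simp
      simpa only [e] using h)
    (by
      intro c x p
      have h := (M.comp (B := fun _ : Unit => Fin 2) x).map_update_smul (fun _ => p) () c p
      have e : ∀ z : P.obj (Fin 2),
          Function.update (fun _ : Unit => p) () z = fun _ => z := by
        intro z; funext i; cases i; simp
      simpa only [e] using h))

/-- `M` is quadratic, `M = (X ∘ P)/(G)` with `X = M(1)` and `G ⊂ (X ∘ P)(2)`: every map
`M(1) → N(1)` to a `P`-module `N` that respects the relations of `M` in arity `2` extends uniquely
to a morphism of `P`-modules. -/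
def RightModule.IsQuadratic {P : Operad.{u} k} (M : RightModule.{u} P) : Prop :=
  ∀ (N : RightModule.{u} P) (f : M.obj Unit →ₗ[k] N.obj Unit),
    (∀ w : M.obj Unit ⊗[k] P.obj (Fin 2), M.evalTwo w = 0 →
      N.evalTwo (TensorProduct.map f LinearMap.id w) = 0) →
    ∃! φ : RightModule.Hom M N, φ.app Unit = f

/-- The pairing of `V ⊗ W` with `V' ⊗ W'` induced by pairings of `V` with `V'` and of `W` with
`W'`. -/
noncomputable def tensorPairing {V W V' W' : Type u} [AddCommGroup V] [Module k V]
    [AddCommGroup W] [Module k W] [AddCommGroup V'] [Module k V'] [AddCommGroup W'] [Module k W']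
    (b : V →ₗ[k] V' →ₗ[k] k) (c : W →ₗ[k] W' →ₗ[k] k) (x : V ⊗[k] W) (y : V' ⊗[k] W') : k :=
  TensorProduct.dualDistrib k V W (TensorProduct.map b.flip c.flip y) x

/-- Quadratic (Koszul) duality.  For a quadratic module `M = (X ∘ P)/(G)` over a quadratic operad
`P = F(E)/(R)`, an element of `QuadraticDual M N` identifies the operad `Q` with the Koszul dual
`P^! = F(E^* ⊗ sgn)/(R^⊥)` and the `Q`-module `N` with the Koszul dual
`M^! = (X^* ∘ P^!)/(G^⊥)`: both are quadratic, the perfect pairing `pairE` identifies `Q(2)` with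
`E^* ⊗ sgn` and the perfect pairing `pairX` identifies `N(1)` with `X^*`, and the
quadratic relations of `Q` and `N` are the annihilators of those of `P` and `M`. -/
structure QuadraticDual {P Q : Operad.{u} k} (M : RightModule.{u} P) (N : RightModule.{u} Q) where
  quadratic_P : P.IsQuadratic
  quadratic_M : M.IsQuadratic
  quadratic_Q : Q.IsQuadratic
  quadratic_N : N.IsQuadratic
  pairE : P.obj (Fin 2) →ₗ[k] Q.obj (Fin 2) →ₗ[k] k
  perfect_pairE : pairE.IsPerfPair
  pairE_map : ∀ (σ : Equiv.Perm (Fin 2)) (p : P.obj (Fin 2)) (q : Q.obj (Fin 2)),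
    pairE (P.map σ p) (Q.map σ q) = (Equiv.Perm.sign σ : ℤ) • pairE p q
  pairX : M.obj Unit →ₗ[k] N.obj Unit →ₗ[k] k
  perfect_pairX : pairX.IsPerfPair
  relations_Q : ∀ w' : Fin 3 → Q.obj (Fin 2) ⊗[k] Q.obj (Fin 2), Q.evalThree w' = 0 ↔
    ∀ w : Fin 3 → P.obj (Fin 2) ⊗[k] P.obj (Fin 2), P.evalThree w = 0 →
      ∑ i, tensorPairing pairE pairE (w i) (w' i) = 0
  relations_N : ∀ w' : N.obj Unit ⊗[k] Q.obj (Fin 2), N.evalTwo w' = 0 ↔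
    ∀ w : M.obj Unit ⊗[k] P.obj (Fin 2), M.evalTwo w = 0 → tensorPairing pairX pairE w w' = 0

end Quadratic

/-! ### Trees

A rooted tree with leaves labelled by `1, …, n`, all of whose vertices except possibly the root are
at least binary, is encoded by the family `T` of the sets of leaves which lie below its non-root
vertices (the root is drawn at the top).  These vertices correspond to the internal edges of the
tree, a vertex being the lower end of its edge.  The root vertex is written `⊤`; it may have any positive number of inputs, and it has exactly one input if
`T` contains the set of all leaves (for `n ≥ 2`). -/

section Trees

variable {n : ℕ}

/-- The families of subsets which encode trees. -/
structure IsTree (T : Finset (Finset (Fin n))) : Prop where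
  two_le_card : ∀ S ∈ T, 2 ≤ S.card
  nested : ∀ S ∈ T, ∀ S' ∈ T, S ⊆ S' ∨ S' ⊆ S ∨ Disjoint S S'

/-- The edges of the tree: the internal ones and the leaves. -/
def edges (T : Finset (Finset (Fin n))) : Finset (Finset (Fin n)) :=
  T ∪ Finset.univ.image singleton

/-- The input edges of the vertex `v`: the maximal ones among the edges strictly below `v`. -/
def inputs (T : Finset (Finset (Fin n))) (v : WithTop (Finset (Fin n))) :
    Set (Finset (Fin n)) :=
  {C | C ∈ edges T ∧ (C : WithTop (Finset (Fin n))) < v ∧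
    ∀ D ∈ edges T, (D : WithTop (Finset (Fin n))) < v → ¬ C ⊂ D}

theorem IsTree.erase {T : Finset (Finset (Fin n))} (hT : IsTree T) (S : Finset (Fin n)) :
    IsTree (T.erase S) :=
  ⟨fun U hU => hT.two_le_card U (Finset.mem_of_mem_erase hU),
    fun U hU V hV => hT.nested U (Finset.mem_of_mem_erase hU) V (Finset.mem_of_mem_erase hV)⟩

theorem IsTree.edges_nested {T : Finset (Finset (Fin n))} (hT : IsTree T) {C D : Finset (Fin n)}
    (hC : C ∈ edges T) (hD : D ∈ edges T) : C ⊆ D ∨ D ⊆ C ∨ Disjoint C D := by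
  have key : ∀ (i : Fin n) (U : Finset (Fin n)), {i} ⊆ U ∨ Disjoint {i} U := by
    intro i U
    by_cases h : i ∈ U
    · left; simpa using h
    · right; simpa using h
  simp only [edges, Finset.mem_union, Finset.mem_image, Finset.mem_univ, true_and] at hC hD
  rcases hC with hC | ⟨i, rfl⟩
  · rcases hD with hD | ⟨j, rfl⟩
    · exact hT.nested _ hC _ hD
    · rcases key j C with h | h
      · exact Or.inr (Or.inl h)
      · exact Or.inr (Or.inr h.symm)
  · rcases key i D with h | h
    · exact Or.inl h
    · exact Or.inr (Or.inr h)

theorem IsTree.edges_nonempty {T : Finset (Finset (Fin n))} (hT : IsTree T) {C : Finset (Fin n)}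
    (hC : C ∈ edges T) : C.Nonempty := by
  simp only [edges, Finset.mem_union, Finset.mem_image, Finset.mem_univ, true_and] at hC
  rcases hC with hC | ⟨i, rfl⟩
  · have := hT.two_le_card _ hC
    exact Finset.card_pos.1 (by omega)
  · simp

theorem IsTree.mem_edges_erase {T : Finset (Finset (Fin n))} (hT : IsTree T)
    {S : Finset (Fin n)} (hS : S ∈ T) (C : Finset (Fin n)) :
    C ∈ edges (T.erase S) ↔ C ∈ edges T ∧ C ≠ S := by
  simp only [edges, Finset.mem_union, Finset.mem_image, Finset.mem_univ, true_and,
    Finset.mem_erase]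
  constructor
  · rintro (⟨h1, h2⟩ | ⟨i, rfl⟩)
    · exact ⟨Or.inl h2, h1⟩
    · refine ⟨Or.inr ⟨i, rfl⟩, ?_⟩
      rintro rfl
      have := hT.two_le_card _ hS
      simp at this
  · rintro ⟨h1 | h1, h2⟩
    · exact Or.inl ⟨h2, h1⟩
    · exact Or.inr h1

/-- The inputs of a vertex after the internal edge `S` has been contracted. -/
theorem IsTree.mem_inputs_erase {T : Finset (Finset (Fin n))} (hT : IsTree T)
    {S : Finset (Fin n)} (hS : S ∈ T) (v : WithTop (Finset (Fin n))) (C : Finset (Fin n)) :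
    C ∈ inputs (T.erase S) v ↔
      (C ∈ inputs T v ∧ C ≠ S) ∨ (S ∈ inputs T v ∧ C ∈ inputs T (S : WithTop _)) := by
  have hSe : S ∈ edges T := Finset.mem_union_left _ hS
  simp only [inputs, Set.mem_ofPred_eq, hT.mem_edges_erase hS, WithTop.coe_lt_coe]
  constructor
  · rintro ⟨⟨hC, hCS⟩, hCv, hmax⟩
    by_cases h : C ⊂ S ∧ (S : WithTop (Finset (Fin n))) < v
    · right
      refine ⟨⟨hSe, h.2, fun D hD hDv hSD => ?_⟩, hC, h.1, fun D hD hDS hCD => ?_⟩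
      · exact hmax D ⟨hD, hSD.ne'⟩ hDv (h.1.trans hSD)
      · exact hmax D ⟨hD, hDS.ne⟩ ((WithTop.coe_lt_coe.2 hDS).trans h.2) hCD
    · left
      refine ⟨⟨hC, hCv, fun D hD hDv hCD => ?_⟩, hCS⟩
      by_cases hDS : D = S
      · subst hDS; exact h ⟨hCD, hDv⟩
      · exact hmax D ⟨hD, hDS⟩ hDv hCD
  · rintro (⟨⟨hC, hCv, hmax⟩, hCS⟩ | ⟨⟨-, hSv, hSmax⟩, hC, hCS, hCmax⟩)
    · exact ⟨⟨hC, hCS⟩, hCv, fun D hD => hmax D hD.1⟩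
    · refine ⟨⟨hC, hCS.ne⟩, (WithTop.coe_lt_coe.2 hCS).trans hSv, fun D hD hDv hCD => ?_⟩
      rcases hT.edges_nested hD.1 hSe with h | h | h
      · exact hCmax D hD.1 (lt_of_le_of_ne h hD.2) hCD
      · exact hSmax D hD.1 hDv (lt_of_le_of_ne h hD.2.symm)
      · obtain ⟨i, hi⟩ := hT.edges_nonempty hC
        exact Finset.disjoint_left.1 h (hCD.1 hi) (hCS.1 hi)

theorem IsTree.inputs_erase_of_notMem {T : Finset (Finset (Fin n))} (hT : IsTree T)
    {S : Finset (Fin n)} (hS : S ∈ T) {v : WithTop (Finset (Fin n))} (h : S ∉ inputs T v) :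
    inputs T v = inputs (T.erase S) v := by
  ext C
  rw [hT.mem_inputs_erase hS]
  constructor
  · intro hC
    exact Or.inl ⟨hC, fun e => h (e ▸ hC)⟩
  · rintro (hC | hC)
    · exact hC.1
    · exact absurd hC.1 h

theorem notMem_inputs_of_mem_inputs {T : Finset (Finset (Fin n))} {S C : Finset (Fin n)}
    {v : WithTop (Finset (Fin n))} (h : S ∈ inputs T v)
    (hC : C ∈ inputs T (S : WithTop (Finset (Fin n)))) : C ∉ inputs T v :=
  fun hCv => hCv.2.2 S h.1 h.2.1 (WithTop.coe_lt_coe.1 hC.2.1)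

open Classical in
/-- When the internal edge `S`, which is an input of `v`, is contracted, the inputs of the vertex
`S` become inputs of `v`. -/
noncomputable def collapse {T : Finset (Finset (Fin n))} {S : Finset (Fin n)}
    {v : WithTop (Finset (Fin n))} (h : S ∈ inputs T v) (C : inputs (T.erase S) v) : inputs T v :=
  if hC : C.1 ∈ inputs T v then ⟨C.1, hC⟩ else ⟨S, h⟩

theorem collapse_eq_iff {T : Finset (Finset (Fin n))} (hT : IsTree T)
    {S : Finset (Fin n)} (hS : S ∈ T) {v : WithTop (Finset (Fin n))} (h : S ∈ inputs T v)
    (C : inputs (T.erase S) v) :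
    collapse h C = ⟨S, h⟩ ↔ C.1 ∈ inputs T (S : WithTop (Finset (Fin n))) := by
  have hC := (hT.mem_inputs_erase hS v C.1).1 C.2
  constructor
  · intro e
    by_cases h1 : C.1 ∈ inputs T v
    · rw [collapse, dif_pos h1] at e
      rcases hC with hC | hC
      · exact absurd (congrArg Subtype.val e) hC.2
      · exact hC.2
    · rcases hC with hC | hC
      · exact absurd hC.1 h1
      · exact hC.2
  · intro h2
    rw [collapse, dif_neg (notMem_inputs_of_mem_inputs h h2)]

theorem collapse_existsUnique {T : Finset (Finset (Fin n))} (hT : IsTree T)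
    {S : Finset (Fin n)} (hS : S ∈ T) {v : WithTop (Finset (Fin n))} (h : S ∈ inputs T v)
    (b : inputs T v) (hb : b ≠ ⟨S, h⟩) : ∃! C, collapse h C = b := by
  have hbS : b.1 ≠ S := fun e => hb (Subtype.ext e)
  refine ⟨⟨b.1, (hT.mem_inputs_erase hS v b.1).2 (Or.inl ⟨b.2, hbS⟩)⟩, ?_, ?_⟩
  · simp only [collapse]
    rw [dif_pos b.2]
  · rintro C rfl
    apply Subtype.ext
    by_cases h1 : C.1 ∈ inputs T v
    · simp only [collapse, dif_pos h1]
    · exact absurd (by rw [collapse, dif_neg h1]) hb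

/-- The inputs of the vertex `S` are the inputs which are new at `v`. -/
def collapseFiber {T : Finset (Finset (Fin n))} (hT : IsTree T)
    {S : Finset (Fin n)} (hS : S ∈ T) {v : WithTop (Finset (Fin n))} (h : S ∈ inputs T v) :
    inputs T (S : WithTop (Finset (Fin n))) ≃
      {C : inputs (T.erase S) v // collapse h C = ⟨S, h⟩} where
  toFun C := ⟨⟨C.1, (hT.mem_inputs_erase hS v C.1).2 (Or.inr ⟨h, C.2⟩)⟩,
    (collapse_eq_iff hT hS h _).2 C.2⟩
  invFun C := ⟨C.1.1, (collapse_eq_iff hT hS h _).1 C.2⟩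
  left_inv _ := rfl
  right_inv _ := rfl

/-- A vertex has at most one parent. -/
theorem IsTree.parent_unique {T : Finset (Finset (Fin n))} (hT : IsTree T) {S V : Finset (Fin n)}
    (hV : V ∈ T) {v : WithTop (Finset (Fin n))} (hv : v = ⊤ ∨ ∃ W ∈ T, v = W)
    (h : S ∈ inputs T (V : WithTop (Finset (Fin n)))) (h' : S ∈ inputs T v) : v = V := by
  have hVe : V ∈ edges T := Finset.mem_union_left _ hV
  have hSV : S ⊂ V := WithTop.coe_lt_coe.1 h.2.1
  rcases hv with rfl | ⟨W, hW, rfl⟩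
  · exact absurd hSV (h'.2.2 V hVe (WithTop.coe_lt_top V))
  · have hWe : W ∈ edges T := Finset.mem_union_left _ hW
    have hSW : S ⊂ W := WithTop.coe_lt_coe.1 h'.2.1
    rcases hT.nested V hV W hW with hh | hh | hh
    · by_cases e : W = V
      · rw [e]
      · exact absurd hSV (h'.2.2 V hVe (WithTop.coe_lt_coe.2 (lt_of_le_of_ne hh (Ne.symm e))))
    · by_cases e : W = V
      · rw [e]
      · exact absurd hSW (h.2.2 W hWe (WithTop.coe_lt_coe.2 (lt_of_le_of_ne hh e)))
    · obtain ⟨i, hi⟩ := hT.edges_nonempty h.1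
      exact absurd (hSW.1 hi) (Finset.disjoint_left.1 hh (hSV.1 hi))

/-- A non-root vertex has a parent. -/
theorem IsTree.exists_parent {T : Finset (Finset (Fin n))} (hT : IsTree T) {S : Finset (Fin n)}
    (hS : S ∈ T) : S ∈ inputs T ⊤ ∨ ∃ V ∈ T, S ∈ inputs T (V : WithTop (Finset (Fin n))) := by
  have hSe : S ∈ edges T := Finset.mem_union_left _ hS
  have mem_T : ∀ D ∈ edges T, S ⊂ D → D ∈ T := by
    intro D hD hSD
    simp only [edges, Finset.mem_union, Finset.mem_image, Finset.mem_univ, true_and] at hD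
    rcases hD with hD | ⟨i, rfl⟩
    · exact hD
    · have h1 := hT.two_le_card _ hS
      have h2 := Finset.card_lt_card hSD
      simp at h2
      subst h2
      simp at h1
  by_cases h : S ∈ inputs T ⊤
  · exact Or.inl h
  · right
    have hne : (T.filter fun V => S ⊂ V).Nonempty := by
      by_contra hcon
      rw [Finset.not_nonempty_iff_eq_empty, Finset.filter_eq_empty_iff] at hcon
      exact h ⟨hSe, WithTop.coe_lt_top S, fun D hD _ hSD => hcon (mem_T D hD hSD) hSD⟩
    obtain ⟨V, hV, hmin⟩ := Finset.exists_min_image _ Finset.card hne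
    rw [Finset.mem_filter] at hV
    refine ⟨V, hV.1, hSe, WithTop.coe_lt_coe.2 hV.2, fun D hD hDV hSD => ?_⟩
    have h1 := hmin D (Finset.mem_filter.2 ⟨mem_T D hD hSD, hSD⟩)
    have h2 := Finset.card_lt_card (WithTop.coe_lt_coe.1 hDV)
    omega

/-- The inputs of the root of the tree without internal edges are the leaves. -/
noncomputable def rootInputs {T : Finset (Finset (Fin n))} (h : T = ∅) :
    inputs T ⊤ ≃ Fin n :=
  (Equiv.ofBijective (fun i : Fin n => (⟨{i}, by
      subst h
      refine ⟨by simp [edges], WithTop.coe_lt_top _, ?_⟩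
      intro D hD _ hlt
      simp only [edges, Finset.empty_union, Finset.mem_image, Finset.mem_univ, true_and] at hD
      obtain ⟨j, rfl⟩ := hD
      simpa using Finset.card_lt_card hlt⟩ : inputs T ⊤)) (by
    subst h
    constructor
    · intro i j hij
      simpa using congrArg Subtype.val hij
    · rintro ⟨C, hC⟩
      have := hC.1
      simp only [edges, Finset.empty_union, Finset.mem_image, Finset.mem_univ, true_and] at this
      obtain ⟨j, rfl⟩ := this
      exact ⟨j, rfl⟩)).symm

end Trees

/-! ### The cobar construction -/

section Cobar

variable {k : Type u} [Field k] {P : Operad k} {n : ℕ}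

/-- The composition along the edge `S` of the decorations of its two ends, of which `S` is the
lower one and `v` the upper one. -/
noncomputable def RightModule.glue (M : RightModule P) {T : Finset (Finset (Fin n))}
    (hT : IsTree T) {S : Finset (Fin n)} (hS : S ∈ T) {v : WithTop (Finset (Fin n))}
    (h : S ∈ inputs T v) :
    M.obj (inputs T v) →ₗ[k] P.obj (inputs T (S : WithTop (Finset (Fin n)))) →ₗ[k]
      M.obj (inputs (T.erase S) v) :=
  (M.partialComp (collapse h) ⟨S, h⟩ (collapse_existsUnique hT hS h)).compl₂
    (P.map (collapseFiber hT hS h))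

/-- The decoration of a vertex `v` which is not the upper end of the contracted edge `S`. -/
noncomputable def RightModule.keep (M : RightModule P) {T : Finset (Finset (Fin n))}
    (hT : IsTree T) {S : Finset (Fin n)} (hS : S ∈ T) {v : WithTop (Finset (Fin n))}
    (h : S ∉ inputs T v) : M.obj (inputs T v) →ₗ[k] M.obj (inputs (T.erase S) v) :=
  M.map (Equiv.setCongr (hT.inputs_erase_of_notMem hS h))

open Classical in
/-- The decoration of the root after the contraction of the edge `S`. -/
noncomputable def RightModule.contractRoot (M : RightModule P) {T : Finset (Finset (Fin n))}
    (hT : IsTree T) {S : Finset (Fin n)} (hS : S ∈ T) (x : M.obj (inputs T ⊤))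
    (p : ∀ V : {V // V ∈ T}, P.obj (inputs T (V.1 : WithTop (Finset (Fin n))))) :
    M.obj (inputs (T.erase S) ⊤) :=
  if h : S ∈ inputs T ⊤ then M.glue hT hS h x (p ⟨S, hS⟩) else M.keep hT hS h x

open Classical in
/-- The decorations of the other vertices after the contraction of the edge `S`. -/
noncomputable def contractVertex (P : Operad k) {T : Finset (Finset (Fin n))}
    (hT : IsTree T) {S : Finset (Fin n)} (hS : S ∈ T)
    (p : ∀ V : {V // V ∈ T}, P.obj (inputs T (V.1 : WithTop (Finset (Fin n)))))
    (V : {V // V ∈ T.erase S}) :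
    P.obj (inputs (T.erase S) (V.1 : WithTop (Finset (Fin n)))) :=
  if h : S ∈ inputs T (V.1 : WithTop (Finset (Fin n))) then
    P.self.glue hT hS h (p ⟨V.1, Finset.mem_of_mem_erase V.2⟩) (p ⟨S, hS⟩)
  else P.self.keep hT hS h (p ⟨V.1, Finset.mem_of_mem_erase V.2⟩)

/-- The summand `M(in ⊤)^* ⊗ ⨂_{S ∈ T} P(in S)^*` of the free module `M^* ∘ F(P^*)` which belongs
to the tree `T`, as the space of multilinear forms on the decorations of `T`: the root is
decorated by `M`, the other vertices by `P`.  (It is used for `P` and `M` of finite type, i.e.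
with finite-dimensional `P(n)` and `M(n)`, as always when the duals `P^*` and `M^*` are
considered as a cooperad and a comodule.) -/
abbrev RightModule.Form (M : RightModule P) (T : Finset (Finset (Fin n))) : Type u :=
  M.obj (inputs T ⊤) →ₗ[k] MultilinearMap k
    (fun V : {V // V ∈ T} => P.obj (inputs T (V.1 : WithTop (Finset (Fin n))))) k

theorem exists_linear_contract (M : RightModule P) {T : Finset (Finset (Fin n))} (hT : IsTree T)
    {S : Finset (Fin n)} (hS : S ∈ T) [DecidableEq {V // V ∈ T}] (φ : M.Form (T.erase S))
    (x : M.obj (inputs T ⊤))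
    (p : ∀ V : {V // V ∈ T}, P.obj (inputs T (V.1 : WithTop (Finset (Fin n)))))
    (W : {V // V ∈ T}) :
    ∃ L : P.obj (inputs T (W.1 : WithTop (Finset (Fin n)))) →ₗ[k] k, ∀ z,
      φ (M.contractRoot hT hS x (Function.update p W z))
        (contractVertex P hT hS (Function.update p W z)) = L z := by
  classical
  by_cases hWS : W = ⟨S, hS⟩
  · subst hWS
    rcases hT.exists_parent hS with h | ⟨V, hV, h⟩
    · refine ⟨(LinearMap.mk ⟨fun y => φ y (contractVertex P hT hS p), ?_⟩ ?_) ∘ₗ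
        M.glue hT hS h x, ?_⟩
      · intro y y'; simp
      · intro c y; simp
      · intro z
        have e1 : M.contractRoot hT hS x (Function.update p ⟨S, hS⟩ z) = M.glue hT hS h x z := by
          simp [RightModule.contractRoot, h]
        have e2 : contractVertex P hT hS (Function.update p ⟨S, hS⟩ z) =
            contractVertex P hT hS p := by
          funext V
          have hV := Finset.mem_erase.1 V.2
          have hn : S ∉ inputs T (V.1 : WithTop (Finset (Fin n))) := fun h' =>
            WithTop.coe_ne_top (hT.parent_unique hV.2 (Or.inl rfl) h' h).symm
          have hne : (⟨V.1, hV.2⟩ : {V // V ∈ T}) ≠ ⟨S, hS⟩ := fun e =>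
            hV.1 (congrArg Subtype.val e)
          simp [contractVertex, hn, hne]
        rw [e1, e2]; rfl
    · have hVS : V ≠ S := by
        rintro rfl
        exact lt_irrefl _ h.2.1
      have hVe : V ∈ T.erase S := Finset.mem_erase.2 ⟨hVS, hV⟩
      refine ⟨(φ (M.contractRoot hT hS x p)).toLinearMap (contractVertex P hT hS p) ⟨V, hVe⟩ ∘ₗ
        P.self.glue hT hS h (p ⟨V, hV⟩), ?_⟩
      intro z
      have hr : S ∉ inputs T ⊤ := fun h' =>
        WithTop.coe_ne_top (hT.parent_unique hV (Or.inl rfl) h h').symm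
      have e1 : M.contractRoot hT hS x (Function.update p ⟨S, hS⟩ z) =
          M.contractRoot hT hS x p := by
        simp [RightModule.contractRoot, hr]
      have e2 : contractVertex P hT hS (Function.update p ⟨S, hS⟩ z) =
          Function.update (contractVertex P hT hS p) ⟨V, hVe⟩
            (P.self.glue hT hS h (p ⟨V, hV⟩) z) := by
        funext U
        have hU := Finset.mem_erase.1 U.2
        have hne : (⟨U.1, hU.2⟩ : {V // V ∈ T}) ≠ ⟨S, hS⟩ := fun e =>
          hU.1 (congrArg Subtype.val e)
        by_cases hUV : U = ⟨V, hVe⟩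
        · subst hUV
          simp [contractVertex, h, hne]
        · have hn : S ∉ inputs T (U.1 : WithTop (Finset (Fin n))) := fun h' =>
            hUV (Subtype.ext (WithTop.coe_injective
              (hT.parent_unique hV (Or.inr ⟨U.1, hU.2, rfl⟩) h h')))
          simp [contractVertex, hn, hne, hUV]
      rw [e1, e2]; rfl
  · have hWS' : W.1 ≠ S := fun e => hWS (Subtype.ext e)
    have hWe : W.1 ∈ T.erase S := Finset.mem_erase.2 ⟨hWS', W.2⟩
    have hSW : (⟨S, hS⟩ : {V // V ∈ T}) ≠ W := fun e => hWS e.symm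
    have e1 : ∀ z, M.contractRoot hT hS x (Function.update p W z) =
        M.contractRoot hT hS x p := by
      intro z
      simp [RightModule.contractRoot, hSW]
    have e3 : ∀ U : {V // V ∈ T.erase S}, U ≠ ⟨W.1, hWe⟩ →
        ∀ z, contractVertex P hT hS (Function.update p W z) U = contractVertex P hT hS p U := by
      intro U hU z
      have hne : (⟨U.1, Finset.mem_of_mem_erase U.2⟩ : {V // V ∈ T}) ≠ W := fun e =>
        hU (Subtype.ext (congrArg (fun z : {V // V ∈ T} => z.1) e))
      simp [contractVertex, hne, hSW]
    by_cases h : S ∈ inputs T (W.1 : WithTop (Finset (Fin n)))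
    · refine ⟨(φ (M.contractRoot hT hS x p)).toLinearMap (contractVertex P hT hS p) ⟨W.1, hWe⟩ ∘ₗ
        (P.self.glue hT hS h).flip (p ⟨S, hS⟩), fun z => ?_⟩
      have e2 : contractVertex P hT hS (Function.update p W z) =
          Function.update (contractVertex P hT hS p) ⟨W.1, hWe⟩
            (P.self.glue hT hS h z (p ⟨S, hS⟩)) := by
        funext U
        by_cases hU : U = ⟨W.1, hWe⟩
        · subst hU
          simp [contractVertex, h, hSW]
        · rw [e3 U hU]; simp [hU]
      rw [e1, e2]; rfl
    · refine ⟨(φ (M.contractRoot hT hS x p)).toLinearMap (contractVertex P hT hS p) ⟨W.1, hWe⟩ ∘ₗ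
        P.self.keep hT hS h, fun z => ?_⟩
      have e2 : contractVertex P hT hS (Function.update p W z) =
          Function.update (contractVertex P hT hS p) ⟨W.1, hWe⟩ (P.self.keep hT hS h z) := by
        funext U
        by_cases hU : U = ⟨W.1, hWe⟩
        · subst hU
          simp [contractVertex, h]
        · rw [e3 U hU]; simp [hU]
      rw [e1, e2]; rfl

/-- The transpose of the contraction of the edge `S`, i.e. the part of the cooperad and
comodule structure of `P^*` and `M^*` which splits the vertex obtained by the contraction. -/
noncomputable def RightModule.split (M : RightModule P) {T : Finset (Finset (Fin n))}
    (hT : IsTree T) {S : Finset (Fin n)} (hS : S ∈ T) : M.Form (T.erase S) →ₗ[k] M.Form T where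
  toFun φ :=
    { toFun := fun x =>
        { toFun := fun p => φ (M.contractRoot hT hS x p) (contractVertex P hT hS p)
          map_update_add' := by
            intro _ p W y z
            obtain ⟨L, hL⟩ := exists_linear_contract M hT hS φ x p W
            simp only [hL, map_add]
          map_update_smul' := by
            intro _ p W c y
            obtain ⟨L, hL⟩ := exists_linear_contract M hT hS φ x p W
            simp only [hL, map_smul] }
      map_add' := by
        intro x y
        ext p
        by_cases h : S ∈ inputs T ⊤ <;> simp [RightModule.contractRoot, h]
      map_smul' := by
        intro c x
        ext p
        by_cases h : S ∈ inputs T ⊤ <;> simp [RightModule.contractRoot, h] }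
  map_add' := by intro φ ψ; rfl
  map_smul' := by intro c φ; rfl

variable (n) in
/-- The trees with leaves `1, …, n` whose summand has degree `p` in the cobar construction: the
root with `l` inputs contributes the degree `l - 1` of `(s M)^*(l)`, every other
vertex with `m` inputs the degree `m - 2` of the desuspension of `(s P)^*(m)`.  The sum of these
numbers is `n - 1` minus the number of non-root vertices. -/
abbrev TreeOfDegree (p : ℕ) : Type :=
  {T : Finset (Finset (Fin n)) // IsTree T ∧ T.card + p + 1 = n}

/-- The degree `p` part of the arity `n` part of the cobar construction
`Ω((s M)^*, (s P)^*) = ((s M)^* ∘ F(↓ (s P)^*), ∂)`.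

The signs coming from the (de)suspensions amount to the tensor product of the summand of `T` with
the one-dimensional space `det T`, the top exterior power of the vector space spanned by
the internal edges of `T`, and to a global twist by the sign representation of the permutations of
the leaves.  The internal edges, i.e. the elements of `T`, are ordered
colexicographically, which gives a basis element of `det T` and identifies it with `k`. -/
abbrev RightModule.Cobar (M : RightModule P) (n p : ℕ) : Type u :=
  (T : TreeOfDegree n p) → M.Form T.1

/-- The sign of `S ∧ -` in the exterior algebra on `T`, with respect to the basis elements given by
the colexicographic order: `-1` to the number of elements of `T` which precede `S`. -/
def edgeSign (T : Finset (Finset (Fin n))) (S : Finset (Fin n)) : ℤ :=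
  (-1) ^ (T.filter fun S' => toColex S' < toColex S).card

/-- The differential of the cobar construction, of degree `-1`.  It replaces a vertex by two
vertices connected by a new edge `S`, in all possible ways, using the cooperad
structure of `P^*` (or the comodule structure of `M^*`, at the root), and multiplies the orientation
by `S ∧ -`. -/
noncomputable def RightModule.cobarD (M : RightModule P) (n p : ℕ) :
    M.Cobar n (p + 1) →ₗ[k] M.Cobar n p :=
  LinearMap.pi fun T => ∑ S : {S // S ∈ T.1},
    edgeSign T.1 S.1 • (M.split T.2.1 S.2 ∘ₗ
      LinearMap.proj (⟨T.1.erase S.1, T.2.1.erase S.1, by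
        have h1 := Finset.card_erase_of_mem S.2
        have h2 := Finset.card_pos.2 ⟨S.1, S.2⟩
        have h3 := T.2.2
        omega⟩ : TreeOfDegree n (p + 1)))

/-- The composition of all decorations of a tree, by successive contraction of the internal
edges (the result does not depend on their order). -/
noncomputable def RightModule.evalTree (M : RightModule P) : (m : ℕ) →
    (T : Finset (Finset (Fin n))) → IsTree T → T.card = m → M.obj (inputs T ⊤) →
    (∀ V : {V // V ∈ T}, P.obj (inputs T (V.1 : WithTop (Finset (Fin n))))) → M.obj (Fin n)
  | 0, _, _, hm, x, _ => M.map (rootInputs (Finset.card_eq_zero.1 hm)) x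
  | m + 1, T, hT, hm, x, p =>
    have hne : T.Nonempty := Finset.card_pos.1 (by omega)
    M.evalTree m (T.erase hne.choose) (hT.erase _)
      (by have := Finset.card_erase_of_mem hne.choose_spec; omega)
      (M.contractRoot hT hne.choose_spec x p) (contractVertex P hT hne.choose_spec p)

end Cobar

/-! ### The map from the cobar construction to the Koszul dual, and Koszulness -/

section Projection

variable {k : Type u} [Field k] {n : ℕ}

/-- A planar structure `e` on a binary tree orders the two inputs of every non-root vertex.
`Before T e C D` means that the edge `C` precedes the edge `D` in the in-order traversal of the
tree (first the left subtree, then the vertex, then the right subtree), where an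
internal edge is visited together with the vertex at its lower end. -/
def Before (T : Finset (Finset (Fin n)))
    (e : ∀ V : {V // V ∈ T}, Fin 2 ≃ inputs T (V.1 : WithTop (Finset (Fin n))))
    (C D : Finset (Fin n)) : Prop :=
  ∃ V : {V // V ∈ T}, (C ⊆ (e V 0).1 ∧ D ⊆ (e V 1).1) ∨ (C ⊆ (e V 0).1 ∧ D = V.1) ∨
    (C = V.1 ∧ D ⊆ (e V 1).1)

open Classical in
/-- The sign which compares, for a binary tree, the product over the vertices of the sign
representations of their inputs with `det T` times the sign representation of the leaves.
It is the product of the sign of the permutation of the leaves and the sign of the permutation of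
the internal edges (with respect to the colexicographic order) given by the in-order
traversal. -/
noncomputable def planarSign (T : Finset (Finset (Fin n)))
    (e : ∀ V : {V // V ∈ T}, Fin 2 ≃ inputs T (V.1 : WithTop (Finset (Fin n)))) : ℤ :=
  (-1) ^ ((Finset.univ : Finset (Fin n × Fin n)).filter fun x =>
      x.1 < x.2 ∧ Before T e {x.2} {x.1}).card *
  (-1) ^ ((T ×ˢ T).filter fun x => toColex x.1 < toColex x.2 ∧ Before T e x.2 x.1).card

variable {P Q : Operad.{u} k} {M : RightModule.{u} P} {N : RightModule.{u} Q}

/-- The elementary tensor in the summand of a binary tree given by an element `y` of `N(1) = X^*`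
and elements `q V` of `Q(2) = E^* ⊗ sgn`, for the vertices `V`. -/
noncomputable def QuadraticDual.pureForm (D : QuadraticDual M N) (T : Finset (Finset (Fin n)))
    (r : Unit ≃ inputs T ⊤)
    (e : ∀ V : {V // V ∈ T}, Fin 2 ≃ inputs T (V.1 : WithTop (Finset (Fin n))))
    (y : N.obj Unit) (q : {V // V ∈ T} → Q.obj (Fin 2)) : M.Form T :=
  LinearMap.smulRight (D.pairX.flip y ∘ₗ M.map r.symm)
    ((MultilinearMap.mkPiAlgebra k {V // V ∈ T} k).compLinearMap
      fun V => D.pairE.flip (q V) ∘ₗ P.map (e V).symm)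

open Classical in
/-- `π` is the degree `0` part, in arity `n`, of the canonical map
`Ω((s M)^*, (s P)^*) → M^! = N` (which vanishes in positive degrees, as `N` has degree `0`).
It is the map of modules induced by the projection of `(s M)^*` to `(s M)^*(1) = X^* = N(1)`, over
the map of operads induced by the projection of `↓ (s P)^*` to `E^* ⊗ sgn = Q(2)`: the
degree `0` part is spanned by elementary tensors which belong to binary trees with unary root, and
these are sent to the composition of their factors in `N`. -/
def QuadraticDual.IsProjection (D : QuadraticDual M N) (n : ℕ)
    (π : M.Cobar n 0 →ₗ[k] N.obj (Fin n)) : Prop :=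
  ∀ (T : TreeOfDegree n 0) (r : Unit ≃ inputs T.1 ⊤)
    (e : ∀ V : {V // V ∈ T.1}, Fin 2 ≃ inputs T.1 (V.1 : WithTop (Finset (Fin n))))
    (y : N.obj Unit) (q : {V // V ∈ T.1} → Q.obj (Fin 2)),
    π (Pi.single T (D.pureForm T.1 r e y q)) =
      planarSign T.1 e • N.evalTree _ T.1 T.2.1 rfl (N.map r y) (fun V => Q.map (e V) (q V))

/-- The module `M` with Koszul dual `N = M^!` is Koszul: the canonical map
`Ω((s M)^*, (s P)^*) → M^!`, with `M^!` in degree `0` and with zero differential,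
is a homology isomorphism in every arity `n ≥ 1`.  Equivalently, the augmented complex
`⋯ → Ω₂(n) → Ω₁(n) → Ω₀(n) → M^!(n) → 0` is exact. -/
def QuadraticDual.IsKoszul (D : QuadraticDual M N) : Prop :=
  ∀ n : ℕ, 1 ≤ n → ∃ π : M.Cobar n 0 →ₗ[k] N.obj (Fin n), D.IsProjection n π ∧
    Function.Surjective π ∧ Function.Exact (M.cobarD n 0) π ∧
    ∀ p : ℕ, Function.Exact (M.cobarD n (p + 1)) (M.cobarD n p)

end Projection

/-! ### The operad `Ass` and the module `Cycl` -/

section Words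

/-- The words in which every element of `A` occurs exactly once.  For `A = Fin n` these are the
permutations `σ ∈ Σ_n`, written as `σ⁻¹(1) ⋯ σ⁻¹(n)`. -/
def Word (A : Type) : Type := {l : List A // l ≠ [] ∧ l.Nodup ∧ ∀ a, a ∈ l}

/-- The words in which every element of `A` occurs exactly once, up to cyclic rotation.  For
`A = Fin n` these are the cosets in `Z_n \ Σ_n`. -/
def CyclicWord (A : Type) : Type := {c : Cycle A // c ≠ Cycle.nil ∧ c.Nodup ∧ ∀ a, a ∈ c}

instance (A : Type) [Finite A] : Finite (Word A) := by
  classical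
  have := Fintype.ofFinite A
  exact Finite.of_injective (β := {l : List A // l.Nodup}) (fun w => ⟨w.1, w.2.2.1⟩)
    fun v w h => Subtype.ext (congrArg (fun z : {l : List A // l.Nodup} => z.1) h)

/-- The cyclic word of a word. -/
def Word.toCyclic {A : Type} (w : Word A) : CyclicWord A :=
  ⟨(w.1 : Cycle A), by simpa using w.2.1, by simpa using w.2.2.1, by simpa using w.2.2.2⟩

theorem Word.toCyclic_surjective {A : Type} :
    Function.Surjective (Word.toCyclic : Word A → CyclicWord A) := by
  rintro ⟨c, h1, h2, h3⟩
  induction c using Quotient.inductionOn' with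
  | h l => exact ⟨⟨l, by simpa using h1, by simpa using h2, by simpa using h3⟩, rfl⟩

instance (A : Type) [Finite A] : Finite (CyclicWord A) :=
  Finite.of_surjective _ Word.toCyclic_surjective

/-- Relabelling. -/
def Word.map {A B : Type} (e : A ≃ B) (w : Word A) : Word B :=
  ⟨w.1.map e, by simpa using w.2.1, w.2.2.1.map e.injective,
    fun b => List.mem_map.2 ⟨e.symm b, w.2.2.2 _, by simp⟩⟩

/-- The substitution of the words `v a` for the letters `a` of the word `w`.  In terms of
permutations it is the composition `σ(σ₁, …, σ_l) = σ(m₁, …, m_l) · (σ₁ ⊕ ⋯ ⊕ σ_l)`. -/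
def Word.subst {A : Type} {B : A → Type} (w : Word A) (v : ∀ a, Word (B a)) : Word (Σ a, B a) :=
  ⟨w.1.flatMap fun a => (v a).1.map (Sigma.mk a), by
    obtain ⟨a, ha⟩ := List.exists_mem_of_ne_nil _ w.2.1
    obtain ⟨b, hb⟩ := List.exists_mem_of_ne_nil _ (v a).2.1
    exact List.ne_nil_of_mem (List.mem_flatMap.2 ⟨a, ha, List.mem_map.2 ⟨b, hb, rfl⟩⟩), by
    rw [List.nodup_flatMap]
    refine ⟨fun a _ => (v a).2.2.1.map sigma_mk_injective, ?_⟩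
    refine w.2.2.1.imp fun {a a'} hne => ?_
    rw [Function.onFun, List.disjoint_left]
    rintro x hx hx'
    obtain ⟨b, -, rfl⟩ := List.mem_map.1 hx
    obtain ⟨b', -, h⟩ := List.mem_map.1 hx'
    exact hne (congrArg Sigma.fst h).symm,
    fun x => List.mem_flatMap.2 ⟨x.1, w.2.2.2 _, List.mem_map.2 ⟨x.2, (v x.1).2.2.2 _, rfl⟩⟩⟩

theorem isRotated_flatMap {A B : Type} (f : A → List B) {l l' : List A} (h : l ~r l') :
    l.flatMap f ~r l'.flatMap f := by
  obtain ⟨m, hm, rfl⟩ := List.isRotated_iff_mod.1 h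
  rw [List.rotate_eq_drop_append_take hm]
  conv_lhs => rw [← List.take_append_drop m l]
  rw [List.flatMap_append, List.flatMap_append]
  exact List.isRotated_append

/-- Relabelling. -/
def CyclicWord.map {A B : Type} (e : A ≃ B) (c : CyclicWord A) : CyclicWord B :=
  ⟨c.1.map e, by
    obtain ⟨w, rfl⟩ := Word.toCyclic_surjective c
    exact (w.map e).toCyclic.2⟩

/-- The substitution of the words `v a` for the letters `a` of the cyclic word `c`. -/
def CyclicWord.subst {A : Type} {B : A → Type} (c : CyclicWord A) (v : ∀ a, Word (B a)) :
    CyclicWord (Σ a, B a) :=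
  ⟨Quotient.map' (fun l : List A => l.flatMap fun a => (v a).1.map (Sigma.mk a))
    (s₁ := List.IsRotated.setoid A) (s₂ := List.IsRotated.setoid _)
    (fun _ _ h => isRotated_flatMap _ h) c.1, by
    obtain ⟨w, rfl⟩ := Word.toCyclic_surjective c
    exact (w.subst v).toCyclic.2⟩

theorem Word.toCyclic_map {A B : Type} (e : A ≃ B) (w : Word A) :
    w.toCyclic.map e = (w.map e).toCyclic := rfl

theorem Word.toCyclic_subst {A : Type} {B : A → Type} (w : Word A) (v : ∀ a, Word (B a)) :
    w.toCyclic.subst v = (w.subst v).toCyclic := rfl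

theorem Word.map_refl {A : Type} (w : Word A) : w.map (Equiv.refl A) = w :=
  Subtype.ext (by simp [Word.map])

theorem Word.map_trans {A B C : Type} (e : A ≃ B) (f : B ≃ C) (w : Word A) :
    w.map (e.trans f) = (w.map e).map f :=
  Subtype.ext (by simp [Word.map])

theorem Word.subst_map {A A' : Type} {B : A → Type} {B' : A' → Type} (e : A ≃ A')
    (f : ∀ a, B a ≃ B' (e a)) (w : Word A) (v : ∀ a, Word (B a)) (v' : ∀ a, Word (B' a))
    (h : ∀ a, v' (e a) = (v a).map (f a)) :
    (w.subst v).map (Equiv.sigmaCongr e f) = (w.map e).subst v' := by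
  apply Subtype.ext
  simp only [Word.map, Word.subst, List.map_flatMap, List.flatMap_map, List.map_map]
  congr 1
  funext a
  rw [h a]
  simp only [Word.map, List.map_map]
  rfl

theorem Word.subst_assoc {A : Type} {B : A → Type} {C : ∀ a, B a → Type} (w : Word A)
    (v : ∀ a, Word (B a)) (u : ∀ x : (Σ a, B a), Word (C x.1 x.2)) :
    ((w.subst v).subst u).map (Equiv.sigmaAssoc C) =
      w.subst fun a => (v a).subst fun b => u ⟨a, b⟩ := by
  apply Subtype.ext
  simp only [Word.map, Word.subst, List.map_flatMap, List.flatMap_map, List.map_map,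
    List.flatMap_assoc]
  rfl

/-- The word with one letter. -/
def Word.one : Word Unit := ⟨[()], by simp⟩

theorem Word.subst_unit {A : Type} (w : Word A) :
    (w.subst fun _ => Word.one).map (Equiv.sigmaUnique A fun _ => Unit) =
      w := by
  apply Subtype.ext
  simp [Word.map, Word.subst, Word.one, List.map_flatMap]

theorem Word.unit_subst {B : Type} (w : Word B) :
    (Word.one.subst fun _ => w).map
      (Equiv.uniqueSigma fun _ : Unit => B) = w := by
  apply Subtype.ext
  simp only [Word.map, Word.subst, Word.one, List.flatMap_cons, List.flatMap_nil, List.append_nil,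
    List.map_map]
  conv_rhs => rw [← List.map_id w.1]
  rfl

end Words

section Linearization

variable (k : Type u) [Field k]

open Classical in
/-- The multilinear extension of a map `F : W × ∏ₐ V a → Z` to the vector spaces with bases `W`,
`V a` and `Z`. -/
noncomputable def linExt {A W Z : Type} [Finite A] {V : A → Type} [∀ a, Finite (V a)]
    (F : W → (∀ a, V a) → Z) : (W →₀ k) →ₗ[k] MultilinearMap k (fun a => V a →₀ k) (Z →₀ k) :=
  letI := Fintype.ofFinite A
  letI := fun a => Fintype.ofFinite (V a)
  Finsupp.linearCombination k fun w => ∑ v : ∀ a, V a,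
    ((MultilinearMap.mkPiAlgebra k A k).compLinearMap
      fun a => (Finsupp.lapply (v a) : (V a →₀ k) →ₗ[k] k)).smulRight (Finsupp.single (F w v) 1)

variable {k}

theorem linExt_single {A W Z : Type} [Finite A] {V : A → Type} [∀ a, Finite (V a)]
    (F : W → (∀ a, V a) → Z) (w : W) (v : ∀ a, V a) :
    linExt k F (Finsupp.single w 1) (fun a => Finsupp.single (v a) 1) =
      Finsupp.single (F w v) 1 := by
  classical
  let := Fintype.ofFinite A
  let := fun a => Fintype.ofFinite (V a)
  simp only [linExt, Finsupp.linearCombination_single, one_smul, sum_apply,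
    MultilinearMap.smulRight_apply, MultilinearMap.compLinearMap_apply,
    MultilinearMap.mkPiAlgebra_apply, Finsupp.lapply_apply]
  rw [Finset.sum_eq_single v]
  · simp
  · intro v' _ hne
    obtain ⟨a, ha⟩ := Function.ne_iff.1 hne
    rw [Finset.prod_eq_zero (Finset.mem_univ a), zero_smul]
    exact Finsupp.single_eq_of_ne ha
  · simp

theorem multilinear_ext {A : Type} [Finite A] {V : A → Type} {Y : Type u} [AddCommGroup Y]
    [Module k Y] {f g : MultilinearMap k (fun a => V a →₀ k) Y}
    (h : ∀ v : ∀ a, V a, f (fun a => Finsupp.single (v a) 1) =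
      g (fun a => Finsupp.single (v a) 1)) : f = g := by
  refine Module.Basis.ext_multilinear (fun a => Finsupp.basisSingleOne) fun v => ?_
  simpa using h v

theorem lin_comp_map {A A' W W' Z Z' : Type} [Finite A] [Finite A'] {V : A → Type}
    [∀ a, Finite (V a)] {V' : A' → Type} [∀ a, Finite (V' a)] (F : W → (∀ a, V a) → Z)
    (F' : W' → (∀ a, V' a) → Z') (e : A ≃ A') (f : ∀ a, V a → V' (e a)) (g : W → W')
    (h : Z → Z') (H : ∀ w v v', (∀ a, v' (e a) = f a (v a)) → h (F w v) = F' (g w) v')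
    (p : W →₀ k) (q : ∀ a, V a →₀ k) (q' : ∀ a, V' a →₀ k)
    (hq : ∀ a, q' (e a) = Finsupp.lmapDomain k k (f a) (q a)) :
    Finsupp.lmapDomain k k h (linExt k F p q) =
      linExt k F' (Finsupp.lmapDomain k k g p) q' := by
  let re : MultilinearMap k (fun a' => V' a' →₀ k) (Z' →₀ k) →
      MultilinearMap k (fun a => V' (e a) →₀ k) (Z' →₀ k) := fun m =>
    { toFun := fun r => m fun a' => (Equiv.piCongrLeft (fun a' => V' a' →₀ k) e r) a'
      map_update_add' := by
        classical
        intro _ r a x y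
        have key : ∀ z, (fun a' => (Equiv.piCongrLeft (fun a' => V' a' →₀ k) e
            (Function.update r a z)) a') = Function.update (fun a' =>
              (Equiv.piCongrLeft (fun a' => V' a' →₀ k) e r) a') (e a) z := by
          intro z
          funext a'
          obtain ⟨b, rfl⟩ := e.surjective a'
          rw [Equiv.piCongrLeft_apply_apply]
          by_cases hb : b = a
          · subst hb; simp
          · simp [hb, Equiv.piCongrLeft_apply_apply]
        simp only [key, MultilinearMap.map_update_add]
      map_update_smul' := by
        classical
        intro _ r a c x
        have key : ∀ z, (fun a' => (Equiv.piCongrLeft (fun a' => V' a' →₀ k) e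
            (Function.update r a z)) a') = Function.update (fun a' =>
              (Equiv.piCongrLeft (fun a' => V' a' →₀ k) e r) a') (e a) z := by
          intro z
          funext a'
          obtain ⟨b, rfl⟩ := e.surjective a'
          rw [Equiv.piCongrLeft_apply_apply]
          by_cases hb : b = a
          · subst hb; simp
          · simp [hb, Equiv.piCongrLeft_apply_apply]
        simp only [key, MultilinearMap.map_update_smul] }
  have hq' : q' = fun a' => (Equiv.piCongrLeft (fun a' => V' a' →₀ k) e
      (fun a => Finsupp.lmapDomain k k (f a) (q a))) a' := by
    funext a'
    obtain ⟨b, rfl⟩ := e.surjective a'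
    rw [Equiv.piCongrLeft_apply_apply, hq]
  have main : ∀ p : W →₀ k,
      (Finsupp.lmapDomain k k h).compMultilinearMap (linExt k F p) =
      (re (linExt k F' (Finsupp.lmapDomain k k g p))).compLinearMap
        (fun a => Finsupp.lmapDomain k k (f a)) := by
    intro p
    induction p using Finsupp.induction_linear with
    | zero => ext; simp [re]
    | add p p' hp hp' =>
      have : ∀ m m', re (m + m') = re m + re m' := fun _ _ => rfl
      rw [map_add, map_add, map_add, this]
      ext1 q
      have h1 := congrArg (fun m => m q) hp
      have h2 := congrArg (fun m => m q) hp'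
      simp only [LinearMap.compMultilinearMap_apply, MultilinearMap.compLinearMap_apply,
        add_apply, map_add] at h1 h2 ⊢
      rw [h1, h2]
    | single w c =>
      have hc : Finsupp.single w c = c • (Finsupp.single w 1 : W →₀ k) := by simp
      have hs : ∀ m, re (c • m) = c • re m := fun _ => rfl
      have h1 : (Finsupp.lmapDomain k k h).compMultilinearMap
          (linExt k F (Finsupp.single w 1)) =
        (re (linExt k F' (Finsupp.lmapDomain k k g (Finsupp.single w 1)))).compLinearMap
          (fun a => Finsupp.lmapDomain k k (f a)) := by
        refine multilinear_ext fun v => ?_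
        have hv : (fun a' => (Equiv.piCongrLeft (fun a' => V' a' →₀ k) e
            (fun a => Finsupp.single (f a (v a)) 1)) a') =
            fun a' => Finsupp.single ((Equiv.piCongrLeft V' e fun a => f a (v a)) a') 1 := by
          funext a'
          obtain ⟨b, rfl⟩ := e.surjective a'
          rw [Equiv.piCongrLeft_apply_apply, Equiv.piCongrLeft_apply_apply]
        simp only [LinearMap.compMultilinearMap_apply, MultilinearMap.compLinearMap_apply,
          linExt_single, Finsupp.lmapDomain_apply, Finsupp.mapDomain_single]
        change _ = linExt k F' _ (fun a' => (Equiv.piCongrLeft (fun a' => V' a' →₀ k) e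
          (fun a => Finsupp.single (f a (v a)) 1)) a')
        rw [hv, linExt_single, H w v _ fun a => Equiv.piCongrLeft_apply_apply _ _ _ _]
      rw [hc, map_smul, map_smul, map_smul, hs]
      ext1 q
      have h2 := congrArg (fun m => m q) h1
      simp only [LinearMap.compMultilinearMap_apply, MultilinearMap.compLinearMap_apply,
        smul_apply, map_smul] at h2 ⊢
      rw [h2]
  rw [hq']
  exact congrArg (fun m => m q) (main p)

theorem lin_comp_assoc {A W Z Y Y' : Type} [Finite A] {B : A → Type} [∀ a, Finite (B a)]
    {V : A → Type} [∀ a, Finite (V a)] {U : ∀ a, B a → Type} [∀ a b, Finite (U a b)]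
    {X : A → Type} [∀ a, Finite (X a)] (F₁ : W → (∀ a, V a) → Z)
    (F₂ : Z → (∀ x : (Σ a, B a), U x.1 x.2) → Y) (G₁ : ∀ a, V a → (∀ b, U a b) → X a)
    (G₂ : W → (∀ a, X a) → Y') (h : Y → Y')
    (H : ∀ w v u, h (F₂ (F₁ w v) u) = G₂ w fun a => G₁ a (v a) fun b => u ⟨a, b⟩)
    (p : W →₀ k) (q : ∀ a, V a →₀ k) (r : ∀ x : (Σ a, B a), U x.1 x.2 →₀ k) :
    Finsupp.lmapDomain k k h (linExt k F₂ (linExt k F₁ p q) r) =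
      linExt k G₂ p fun a => linExt k (G₁ a) (q a) fun b => r ⟨a, b⟩ := by
  classical
  have h1 : ∀ (w : W) (v : ∀ a, V a) (r : ∀ x : (Σ a, B a), U x.1 x.2 →₀ k),
      Finsupp.lmapDomain k k h (linExt k F₂ (Finsupp.single (F₁ w v) 1) r) =
        linExt k G₂ (Finsupp.single w 1)
          fun a => linExt k (G₁ a) (Finsupp.single (v a) 1) fun b => r ⟨a, b⟩ := by
    intro w v r
    have key : (Finsupp.lmapDomain k k h).compMultilinearMap
        (linExt k F₂ (Finsupp.single (F₁ w v) 1)) =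
        (linExt k G₂ (Finsupp.single w 1)).compMultilinearMap
          fun a => linExt k (G₁ a) (Finsupp.single (v a) 1) := by
      refine multilinear_ext fun u => ?_
      simp only [LinearMap.compMultilinearMap_apply, linExt_single, Finsupp.lmapDomain_apply,
        Finsupp.mapDomain_single, H]
      change _ = linExt k G₂ (Finsupp.single w 1) fun a =>
        linExt k (G₁ a) (Finsupp.single (v a) 1) fun b => Finsupp.single (u ⟨a, b⟩) 1
      simp only [linExt_single]
    exact congrArg (fun m => m r) key
  have h2 : ∀ (w : W) (q : ∀ a, V a →₀ k),
      Finsupp.lmapDomain k k h (linExt k F₂ (linExt k F₁ (Finsupp.single w 1) q) r) =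
        linExt k G₂ (Finsupp.single w 1) fun a => linExt k (G₁ a) (q a) fun b => r ⟨a, b⟩ := by
    intro w q
    have key : (LinearMap.mk ⟨fun z => Finsupp.lmapDomain k k h (linExt k F₂ z r),
          fun _ _ => by rw [map_add, add_apply, map_add]⟩
          fun _ _ => by simp only [map_smul, smul_apply, RingHom.id_apply] :
          (Z →₀ k) →ₗ[k] (Y' →₀ k)).compMultilinearMap (linExt k F₁ (Finsupp.single w 1)) =
        (linExt k G₂ (Finsupp.single w 1)).compLinearMap fun a =>
          LinearMap.mk ⟨fun z => linExt k (G₁ a) z fun b => r ⟨a, b⟩,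
            fun _ _ => by simp⟩ fun _ _ => by simp := by
      refine multilinear_ext fun v => ?_
      simp only [LinearMap.compMultilinearMap_apply, linExt_single,
        MultilinearMap.compLinearMap_apply]
      exact h1 w v r
    exact congrArg (fun m => m q) key
  induction p using Finsupp.induction_linear with
  | zero => simp
  | add p p' hp hp' =>
    rw [map_add, map_add, add_apply, map_add, add_apply, map_add, add_apply, hp, hp']
  | single w c =>
    have hc : Finsupp.single w c = c • (Finsupp.single w 1 : W →₀ k) := by simp
    have := h2 w q
    rw [hc]
    simp only [map_smul, smul_apply, this]

theorem lin_comp_unit {A W Z : Type} [Finite A] {V : A → Type} [∀ a, Finite (V a)]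
    (F : W → (∀ a, V a) → Z) (h : Z → W) (u : ∀ a, V a) (H : ∀ w, h (F w u) = w) (p : W →₀ k) :
    Finsupp.lmapDomain k k h (linExt k F p fun a => Finsupp.single (u a) 1) = p := by
  induction p using Finsupp.induction_linear with
  | zero => simp
  | add p q hp hq => rw [map_add, add_apply, map_add, hp, hq]
  | single w c =>
    have hc : Finsupp.single w c = c • (Finsupp.single w 1 : W →₀ k) := by simp
    rw [hc, map_smul, smul_apply, map_smul, linExt_single, Finsupp.lmapDomain_apply,
      Finsupp.mapDomain_single, H]

theorem lin_unit_comp {V W Z : Type} [Finite V] (F : W → (Unit → V) → Z) (h : Z → V) (w : W)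
    (H : ∀ v, h (F w fun _ => v) = v) (q : V →₀ k) :
    Finsupp.lmapDomain k k h (linExt k (V := fun _ : Unit => V) F (Finsupp.single w 1)
      fun _ => q) = q := by
  have key : (Finsupp.lmapDomain k k h).compMultilinearMap
      (linExt k (V := fun _ : Unit => V) F (Finsupp.single w 1)) =
      MultilinearMap.ofSubsingleton k (V →₀ k) (V →₀ k) () LinearMap.id := by
    refine multilinear_ext fun v => ?_
    have hv : v = fun _ => v () := rfl
    simp only [LinearMap.compMultilinearMap_apply, linExt_single, Finsupp.lmapDomain_apply,
      Finsupp.mapDomain_single, MultilinearMap.ofSubsingleton_apply_apply, LinearMap.id_apply]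
    rw [hv, H]
  exact congrArg (fun m => m fun _ => q) key

end Linearization

section AssCycl

variable (k : Type u) [Field k]

/-- The operad `Ass` for associative algebras, `Ass(n) = k[Σ_n]`. -/
noncomputable def Ass : Operad k where
  obj A _ := Word A →₀ k
  map e := Finsupp.lmapDomain k k (Word.map e)
  map_refl A _ x := by
    have : (Word.map (Equiv.refl A)) = id := funext Word.map_refl
    rw [this]
    exact Finsupp.mapDomain_id
  map_trans e f x := by
    have : Word.map (e.trans f) = Word.map f ∘ Word.map e := funext (Word.map_trans e f)
    rw [this]
    exact Finsupp.mapDomain_comp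
  subsingleton_obj A _ _ := by
    have : IsEmpty (Word A) := ⟨fun w => by
      obtain ⟨a, -⟩ := List.exists_mem_of_ne_nil _ w.2.1
      exact isEmptyElim a⟩
    infer_instance
  comp := linExt k Word.subst
  unit := Finsupp.single Word.one 1
  comp_map e f p q q' hq :=
    lin_comp_map _ _ e (fun a => Word.map (f a)) _ _ (Word.subst_map e f) p q q' hq
  comp_assoc {A} _ {B} _ {C} _ p q r :=
    lin_comp_assoc (B := B) (V := fun a => Word (B a)) (U := fun a b => Word (C a b))
      (X := fun a => Word (Σ b, C a b))
      Word.subst Word.subst (fun a => Word.subst (A := B a) (B := C a)) Word.subst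
      (Word.map (Equiv.sigmaAssoc C)) Word.subst_assoc p q r
  unit_comp q := lin_unit_comp _ _ _ Word.unit_subst q
  comp_unit p := lin_comp_unit _ _ _ Word.subst_unit p

/-- The `Ass`-module `Cycl`, `Cycl(n) = k[Z_n \ Σ_n]`, with the structure induced from `Ass` by
the projections `Σ_n → Z_n \ Σ_n`. -/
noncomputable def Cycl : RightModule (Ass k) where
  obj A _ := CyclicWord A →₀ k
  map e := Finsupp.lmapDomain k k (CyclicWord.map e)
  map_refl A _ x := by
    have : (CyclicWord.map (Equiv.refl A)) = id := by
      funext c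
      obtain ⟨w, rfl⟩ := Word.toCyclic_surjective c
      rw [Word.toCyclic_map, Word.map_refl]; rfl
    rw [this]
    exact Finsupp.mapDomain_id
  map_trans e f x := by
    have : CyclicWord.map (e.trans f) = CyclicWord.map f ∘ CyclicWord.map e := by
      funext c
      obtain ⟨w, rfl⟩ := Word.toCyclic_surjective c
      simp only [Function.comp, Word.toCyclic_map, Word.map_trans]
    rw [this]
    exact Finsupp.mapDomain_comp
  subsingleton_obj A _ _ := by
    have : IsEmpty (CyclicWord A) := ⟨fun c => by
      obtain ⟨w, rfl⟩ := Word.toCyclic_surjective c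
      obtain ⟨a, -⟩ := List.exists_mem_of_ne_nil _ w.2.1
      exact isEmptyElim a⟩
    infer_instance
  comp := linExt k CyclicWord.subst
  comp_map {A A'} _ _ {B} _ {B'} _ e f p q q' hq :=
    lin_comp_map (V := fun a => Word (B a)) (V' := fun a => Word (B' a)) CyclicWord.subst
      CyclicWord.subst e (fun a => Word.map (f a)) (CyclicWord.map e)
      (CyclicWord.map (Equiv.sigmaCongr e f)) (by
      intro c v v' h
      obtain ⟨w, rfl⟩ := Word.toCyclic_surjective c
      simp only [Word.toCyclic_map, Word.toCyclic_subst]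
      rw [Word.subst_map e f w v v' h]) p q q' hq
  comp_assoc {A} _ {B} _ {C} _ p q r :=
    lin_comp_assoc (B := B) (V := fun a => Word (B a)) (U := fun a b => Word (C a b))
      (X := fun a => Word (Σ b, C a b))
      CyclicWord.subst CyclicWord.subst (fun a => Word.subst (A := B a) (B := C a))
      CyclicWord.subst (CyclicWord.map (Equiv.sigmaAssoc C)) (by
      intro c v u
      obtain ⟨w, rfl⟩ := Word.toCyclic_surjective c
      simp only [Word.toCyclic_map, Word.toCyclic_subst]
      rw [Word.subst_assoc]) p q r
  comp_unit p := lin_comp_unit _ _ _ (by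
      intro c
      obtain ⟨w, rfl⟩ := Word.toCyclic_surjective c
      rw [Word.toCyclic_subst, Word.toCyclic_map, Word.subst_unit]) p

end AssCycl

end Koszul

/-!
The cobar construction of `Cycl` in arity `n` has a basis of planar trees with `n` labelled leaves:
basis elements of `Cycl` are cyclic words and basis elements of `Ass` are words, so the decorations
of a tree by basis elements are a cyclic order of the inputs of the root and linear orders of the
inputs of the other vertices (`PlanarTree`).  Composition of words along an edge is the contraction
of the edge, and the differential becomes the signed sum over the contractions (`ev_cobarD`), here
called `coboundary` because the elements of the cobar construction are forms on decorated trees.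

The exactness follows from a discrete Morse matching which depends on the choice of a leaf `o`.
Every planar tree begins with a maximal right comb whose first leaf is `o` (its size is `stage`).
The first leaf above this comb, the `pivot`, is the first leaf of exactly one edge which has a left
neighbour at the same vertex.  The matching joins these two neighbouring edges to a new edge, or
contracts the edge at which they are already joined and which has no other inputs (`toggle`,
`Lower.exists_upper`).  It is acyclic: any other contraction of a tree leads to a smaller `rank`
(`Upper.rank_lt`), since it makes the comb shorter, or replaces an edge at the pivot by a smaller
one, unless the result is itself a tree from which the matching removes an edge.  The only unmatched
trees are the right combs.  They are binary, and there is exactly one for every cyclic word of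
leaves (`eq_of_cyc_eq`).  Hence the homology vanishes in positive degrees (`exact_cobarD`), and in
degree zero it is spanned by the cyclic words.

The map `π` sends the basis element of a binary planar tree to its cyclic word of leaves, times the
sign `sgn` of the tree (`cyclProj`).  It vanishes on boundaries because a planar tree with one edge
less than a binary one has exactly two binary resolutions, with opposite signs
(`exists_flip`, `sign_eq_neg`, `sum_sgn_smul_coboundary`).  Modulo boundaries all elements of degree
zero are combinations of right combs, whose cyclic words are distinct, so that the kernel of `π` is
the space of boundaries (`exact_cobarD_cyclProj`).

The quadratic presentations say that a binary operation with `(ab)c = a(bc)` extends to all words by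
iterated products (`listProd_flatMap`, `wordProd_subst`, `isQuadratic_ass`), and that an element `x`
with `x(ab) = x(ba)` is invariant under rotations of words (`wordValue_append_comm`,
`isQuadratic_cycl`).  For the self-duality, `Ass(2)` is paired with itself so that the words are
orthogonal and their lengths are the signs of the permutations.  The relations identify the basis
elements of the space of quadratic expressions in pairs, namely the two bracketings of each word in
three letters, respectively the two words in two letters.  The two members of a pair have lengths of
opposite signs, so the space of relations is its own annihilator (`annihilator_eq_of_involution`).
-/

namespace Koszul

/-! ### Inputs of the vertices of a tree -/

section TreeInputs

variable {n : ℕ} {T : Finset (Finset (Fin n))}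

theorem singleton_mem_edges (T : Finset (Finset (Fin n))) (i : Fin n) : {i} ∈ edges T :=
  Finset.mem_union_right _ (Finset.mem_image_of_mem _ (Finset.mem_univ i))

theorem mem_edges_of_mem {C : Finset (Fin n)} (h : C ∈ T) : C ∈ edges T :=
  Finset.mem_union_left _ h

theorem mem_edges_iff {C : Finset (Fin n)} : C ∈ edges T ↔ C ∈ T ∨ ∃ i, C = {i} := by
  simp only [edges, Finset.mem_union, Finset.mem_image, Finset.mem_univ, true_and, eq_comm]

theorem IsTree.mem_of_mem_edges {C : Finset (Fin n)} (h : C ∈ edges T) (h2 : 2 ≤ C.card) :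
    C ∈ T := by
  rcases mem_edges_iff.1 h with h | ⟨i, rfl⟩
  · exact h
  · simp at h2

theorem IsTree.inputs_disjoint (hT : IsTree T) {v : WithTop (Finset (Fin n))}
    {C D : Finset (Fin n)} (hC : C ∈ inputs T v) (hD : D ∈ inputs T v) (hne : C ≠ D) :
    Disjoint C D := by
  rcases hT.edges_nested hC.1 hD.1 with h | h | h
  · exact absurd (lt_of_le_of_ne h hne) (hC.2.2 D hD.1 hD.2.1)
  · exact absurd (lt_of_le_of_ne h hne.symm) (hD.2.2 C hC.1 hC.2.1)
  · exact h

theorem IsTree.inputs_eq_of_mem (hT : IsTree T) {v : WithTop (Finset (Fin n))}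
    {C D : Finset (Fin n)} (hC : C ∈ inputs T v) (hD : D ∈ inputs T v) {i : Fin n} (hi : i ∈ C)
    (hi' : i ∈ D) : C = D := by
  by_contra hne
  exact Finset.disjoint_left.1 (hT.inputs_disjoint hC hD hne) hi hi'

theorem exists_mem_inputs_superset {v : WithTop (Finset (Fin n))} {C : Finset (Fin n)}
    (hC : C ∈ edges T) (hv : (C : WithTop (Finset (Fin n))) < v) : ∃ D ∈ inputs T v, C ⊆ D := by
  classical
  obtain ⟨D, hD, hmax⟩ := Finset.exists_max_image
    ((edges T).filter fun D => C ⊆ D ∧ (D : WithTop (Finset (Fin n))) < v) Finset.card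
    ⟨C, Finset.mem_filter.2 ⟨hC, subset_rfl, hv⟩⟩
  simp only [Finset.mem_filter] at hD hmax
  refine ⟨D, ⟨hD.1, hD.2.2, fun E hE hEv hDE => ?_⟩, hD.2.1⟩
  exact absurd (hmax E ⟨hE, hD.2.1.trans hDE.1, hEv⟩) (not_le.2 (Finset.card_lt_card hDE))

theorem IsTree.exists_mem_inputs (hT : IsTree T) {V : Finset (Fin n)} (hV : V ∈ T) {i : Fin n}
    (hi : i ∈ V) : ∃ D ∈ inputs T (V : WithTop (Finset (Fin n))), i ∈ D := by
  have h2 := hT.two_le_card V hV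
  obtain ⟨D, hD, hiD⟩ := exists_mem_inputs_superset (singleton_mem_edges T i)
    (v := (V : WithTop (Finset (Fin n)))) (WithTop.coe_lt_coe.2 (by
      refine lt_of_le_of_ne (Finset.singleton_subset_iff.2 hi) ?_
      rintro rfl
      simp at h2))
  exact ⟨D, hD, hiD (Finset.mem_singleton_self i)⟩

theorem exists_mem_inputs_top (T : Finset (Finset (Fin n))) (i : Fin n) :
    ∃ D ∈ inputs T ⊤, i ∈ D := by
  obtain ⟨D, hD, hiD⟩ := exists_mem_inputs_superset (singleton_mem_edges T i)
    (v := (⊤ : WithTop (Finset (Fin n)))) (WithTop.coe_lt_top _)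
  exact ⟨D, hD, hiD (Finset.mem_singleton_self i)⟩

theorem ssubset_of_mem_inputs {V D : Finset (Fin n)}
    (h : D ∈ inputs T (V : WithTop (Finset (Fin n)))) : D ⊂ V :=
  WithTop.coe_lt_coe.1 h.2.1

theorem IsTree.mem_of_ssubset (hT : IsTree T) {C D : Finset (Fin n)} (hC : C ∈ edges T)
    (hD : D ∈ edges T) (h : C ⊂ D) : D ∈ T := by
  have h1 := Finset.card_pos.2 (hT.edges_nonempty hC)
  have h2 := Finset.card_lt_card h
  exact IsTree.mem_of_mem_edges hD (by omega)

/-- Every edge, be it internal or a leaf, is an input of some vertex. -/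
theorem IsTree.exists_parent_of_mem_edges (hT : IsTree T) {C : Finset (Fin n)}
    (hC : C ∈ edges T) :
    C ∈ inputs T ⊤ ∨ ∃ V ∈ T, C ∈ inputs T (V : WithTop (Finset (Fin n))) := by
  classical
  by_cases h : ∃ V ∈ T, C ⊂ V
  · right
    obtain ⟨V, hV, hmin⟩ := Finset.exists_min_image (T.filter fun V => C ⊂ V) Finset.card
      (by obtain ⟨V, hV, hCV⟩ := h; exact ⟨V, Finset.mem_filter.2 ⟨hV, hCV⟩⟩)
    simp only [Finset.mem_filter] at hV hmin
    refine ⟨V, hV.1, hC, WithTop.coe_lt_coe.2 hV.2, fun D hD hDV hCD => ?_⟩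
    exact absurd (hmin D ⟨hT.mem_of_ssubset hC hD hCD, hCD⟩)
      (not_le.2 (Finset.card_lt_card (WithTop.coe_lt_coe.1 hDV)))
  · left
    exact ⟨hC, WithTop.coe_lt_top _, fun D hD _ hCD => h ⟨D, hT.mem_of_ssubset hC hD hCD, hCD⟩⟩

/-- The parent of an edge is contained in every vertex lying above the edge. -/
theorem IsTree.parent_subset (hT : IsTree T) {C V W : Finset (Fin n)} (hV : V ∈ T)
    (h : C ∈ inputs T (V : WithTop (Finset (Fin n)))) (hW : W ∈ T) (hCW : C ⊂ W) : V ⊆ W := by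
  rcases hT.nested V hV W hW with hh | hh | hh
  · exact hh
  · by_contra hn
    exact h.2.2 W (mem_edges_of_mem hW)
      (WithTop.coe_lt_coe.2 (lt_of_le_of_ne hh (fun e => hn e.ge))) hCW
  · obtain ⟨i, hi⟩ := hT.edges_nonempty h.1
    exact absurd (hCW.1 hi) (Finset.disjoint_left.1 hh ((ssubset_of_mem_inputs h).1 hi))

end TreeInputs

section Lists

variable {α β : Type}

/-- Two rotations of a list without repetitions which start with the same letter agree. -/
theorem isRotated_cons_cons {a : α} {l l' : List α} (hl : (a :: l).Nodup)
    (h : (a :: l) ~r (a :: l')) : l = l' := by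
  obtain ⟨m, hm, he⟩ := List.isRotated_iff_mod.1 h
  rcases Nat.lt_or_ge m (a :: l).length with hlt | hge
  · have h0 : ((a :: l).rotate m)[0]? = some a := by rw [he]; rfl
    rw [List.getElem?_rotate (by simp)] at h0
    have h1 : (a :: l)[0]? = some a := rfl
    rw [Nat.zero_add, Nat.mod_eq_of_lt hlt] at h0
    have := (List.getElem?_inj hlt hl).1 (h0.trans h1.symm)
    subst this
    simpa using he
  · have hme : m = (a :: l).length := le_antisymm hm hge
    subst hme
    rw [List.rotate_length] at he
    exact (List.cons.inj he).2

/-- In a list without repetitions a letter determines the parts before and after it. -/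
theorem nodup_append_cons_inj {a : α} {l₁ l₂ m₁ m₂ : List α}
    (hl : (l₁ ++ a :: l₂).Nodup) (h : l₁ ++ a :: l₂ = m₁ ++ a :: m₂) : l₁ = m₁ ∧ l₂ = m₂ := by
  have hm : (m₁ ++ a :: m₂).Nodup := h ▸ hl
  have h1 : a ∉ l₁ := fun h' => by
    have := List.disjoint_of_nodup_append hl h'
    simp at this
  have h2 : a ∉ m₁ := fun h' => by
    have := List.disjoint_of_nodup_append hm h'
    simp at this
  induction l₁ generalizing m₁ with
  | nil =>
    cases m₁ with
    | nil => simpa using h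
    | cons b m₁ =>
      simp only [List.nil_append, List.cons_append, List.cons.injEq] at h
      exact absurd (by simp [h.1]) h2
  | cons b l₁ ih =>
    cases m₁ with
    | nil =>
      simp only [List.nil_append, List.cons_append, List.cons.injEq] at h
      exact absurd (by simp [h.1]) h1
    | cons c m₁ =>
      simp only [List.cons_append, List.cons.injEq] at h
      have := ih (by simpa using (List.nodup_cons.1 hl).2) h.2
        (by simpa using (List.nodup_cons.1 hm).2)
        (fun h' => h1 (List.mem_cons_of_mem _ h')) (fun h' => h2 (List.mem_cons_of_mem _ h'))
      exact ⟨by rw [h.1, this.1], this.2⟩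

/-- The cyclic list obtained by the substitution of lists for the letters of a cyclic list. -/
def cycleBind (f : α → List β) : Cycle α → Cycle β :=
  Quotient.map' (s₁ := List.IsRotated.setoid α) (s₂ := List.IsRotated.setoid β)
    (fun l : List α => l.flatMap f) fun _ _ h => isRotated_flatMap f h

@[simp] theorem cycleBind_coe (f : α → List β) (l : List α) :
    cycleBind f (l : Cycle α) = (l.flatMap f : List β) := rfl

theorem mem_cycleBind {f : α → List β} {c : Cycle α} {b : β} :
    b ∈ cycleBind f c ↔ ∃ a ∈ c, b ∈ f a := by
  induction c using Quotient.inductionOn' with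
  | h l => exact List.mem_flatMap

theorem nodup_cycleBind {f : α → List β} {c : Cycle α} (hc : c.Nodup)
    (hf : ∀ a ∈ c, (f a).Nodup) (hd : ∀ a ∈ c, ∀ b ∈ c, a ≠ b → List.Disjoint (f a) (f b)) :
    (cycleBind f c).Nodup := by
  induction c using Quotient.inductionOn' with
  | h l =>
    refine List.nodup_flatMap.2 ⟨fun a ha => hf a ha, ?_⟩
    refine List.Pairwise.imp_of_mem ?_ (show l.Nodup from hc)
    intro a b ha hb hab
    exact hd a ha b hb hab

theorem nodup_flatMap_of_disjoint {f : α → List β} {l : List α} (hl : l.Nodup)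
    (hf : ∀ a ∈ l, (f a).Nodup) (hd : ∀ a ∈ l, ∀ b ∈ l, a ≠ b → List.Disjoint (f a) (f b)) :
    (l.flatMap f).Nodup := nodup_cycleBind (c := (l : Cycle α)) hl hf hd

theorem cycleBind_congr {f g : α → List β} {c : Cycle α} (h : ∀ a ∈ c, f a = g a) :
    cycleBind f c = cycleBind g c := by
  induction c using Quotient.inductionOn' with
  | h l => exact congrArg (fun l : List β => (l : Cycle β)) (List.flatMap_congr h)

theorem cycleBind_cycleBind {γ : Type} (f : α → List β) (g : β → List γ) (c : Cycle α) :
    cycleBind g (cycleBind f c) = cycleBind (fun a => (f a).flatMap g) c := by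
  induction c using Quotient.inductionOn' with
  | h l => exact congrArg (fun l : List γ => (l : Cycle γ)) List.flatMap_assoc

theorem exists_cons_of_mem_cycle {c : Cycle α} {a : α} (h : a ∈ c) :
    ∃ l : List α, c = (a :: l : List α) := by
  induction c using Quotient.inductionOn' with
  | h l =>
    obtain ⟨l₁, l₂, rfl⟩ := List.append_of_mem (show a ∈ l from h)
    exact ⟨l₂ ++ l₁, Cycle.coe_eq_coe.2 List.isRotated_append⟩

end Lists

/-- A planar tree: a tree together with a linear order on the inputs of every non-root vertex and
a cyclic order on the inputs of the root.  The orders are lists of sets of leaves; `w` is empty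
outside `T`. -/
@[ext]
structure PlanarTree (n : ℕ) where
  T : Finset (Finset (Fin n))
  isTree : IsTree T
  w : Finset (Fin n) → List (Finset (Fin n))
  root : Cycle (Finset (Fin n))
  nodup_w : ∀ V, (w V).Nodup
  mem_w : ∀ V ∈ T, ∀ C, C ∈ w V ↔ C ∈ inputs T (V : WithTop (Finset (Fin n)))
  w_eq_nil : ∀ V ∉ T, w V = []
  nodup_root : root.Nodup
  mem_root : ∀ C, C ∈ root ↔ C ∈ inputs T ⊤

namespace PlanarTree

variable {n : ℕ} (t : PlanarTree n)

theorem mem_T_of_mem_w {t : PlanarTree n} {V C : Finset (Fin n)} (h : C ∈ t.w V) : V ∈ t.T := by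
  by_contra hV
  simp [t.w_eq_nil V hV] at h

theorem inputs_of_mem_w {t : PlanarTree n} {V C : Finset (Fin n)} (h : C ∈ t.w V) :
    C ∈ inputs t.T (V : WithTop (Finset (Fin n))) := (t.mem_w V (mem_T_of_mem_w h) C).1 h

theorem ssubset_of_mem_w {t : PlanarTree n} {V C : Finset (Fin n)} (h : C ∈ t.w V) : C ⊂ V :=
  ssubset_of_mem_inputs (inputs_of_mem_w h)

theorem mem_edges_of_mem_w {t : PlanarTree n} {V C : Finset (Fin n)} (h : C ∈ t.w V) :
    C ∈ edges t.T := (inputs_of_mem_w h).1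

theorem mem_edges_of_mem_root {t : PlanarTree n} {C : Finset (Fin n)} (h : C ∈ t.root) :
    C ∈ edges t.T := ((t.mem_root C).1 h).1

/-- The leaves below an edge, from left to right. -/
noncomputable def flat (t : PlanarTree n) (C : Finset (Fin n)) : List (Fin n) :=
  open Classical in
  if C ∈ t.T then (t.w C).attach.flatMap fun D => flat t D.1 else C.toList
termination_by C.card
decreasing_by exact Finset.card_lt_card (ssubset_of_mem_w D.2)

theorem flat_of_mem {C : Finset (Fin n)} (h : C ∈ t.T) : t.flat C = (t.w C).flatMap t.flat := by
  rw [flat, if_pos h]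
  conv_rhs => rw [← List.attach_map_subtype_val (t.w C), List.flatMap_map]

theorem flat_of_notMem {C : Finset (Fin n)} (h : C ∉ t.T) : t.flat C = C.toList := by
  rw [flat, if_neg h]

theorem singleton_notMem (i : Fin n) : {i} ∉ t.T := fun h => by
  simpa using t.isTree.two_le_card _ h

@[simp] theorem flat_singleton (i : Fin n) : t.flat {i} = [i] := by
  rw [flat_of_notMem _ (t.singleton_notMem i), Finset.toList_singleton]

theorem mem_flat {C : Finset (Fin n)} (hC : C ∈ edges t.T) {i : Fin n} :
    i ∈ t.flat C ↔ i ∈ C := by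
  induction h : C.card using Nat.strong_induction_on generalizing C with
  | _ m ih =>
    subst h
    by_cases hCT : C ∈ t.T
    · rw [t.flat_of_mem hCT, List.mem_flatMap]
      constructor
      · rintro ⟨D, hD, hi⟩
        have hDC := ssubset_of_mem_w hD
        exact hDC.1 ((ih _ (Finset.card_lt_card hDC) (mem_edges_of_mem_w hD) rfl).1 hi)
      · intro hi
        obtain ⟨D, hD, hiD⟩ := t.isTree.exists_mem_inputs hCT hi
        have hD' := (t.mem_w C hCT D).2 hD
        exact ⟨D, hD', (ih _ (Finset.card_lt_card (ssubset_of_mem_w hD')) hD.1 rfl).2 hiD⟩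
    · rw [t.flat_of_notMem hCT, Finset.mem_toList]

theorem disjoint_flat {v : WithTop (Finset (Fin n))} {C D : Finset (Fin n)}
    (hC : C ∈ inputs t.T v) (hD : D ∈ inputs t.T v) (h : C ≠ D) :
    List.Disjoint (t.flat C) (t.flat D) := by
  rw [List.disjoint_left]
  intro i hi hi'
  exact Finset.disjoint_left.1 (t.isTree.inputs_disjoint hC hD h) ((t.mem_flat hC.1).1 hi)
    ((t.mem_flat hD.1).1 hi')

theorem nodup_flat (C : Finset (Fin n)) : (t.flat C).Nodup := by
  induction h : C.card using Nat.strong_induction_on generalizing C with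
  | _ m ih =>
    subst h
    by_cases hCT : C ∈ t.T
    · rw [t.flat_of_mem hCT]
      refine nodup_flatMap_of_disjoint (t.nodup_w C) (fun D hD => ?_) fun D hD E hE hDE => ?_
      · exact ih _ (Finset.card_lt_card (ssubset_of_mem_w hD)) D rfl
      · exact t.disjoint_flat (inputs_of_mem_w hD) (inputs_of_mem_w hE) hDE
    · rw [t.flat_of_notMem hCT]
      exact Finset.nodup_toList C

theorem toFinset_flat {C : Finset (Fin n)} (hC : C ∈ edges t.T) : (t.flat C).toFinset = C := by
  ext i
  rw [List.mem_toFinset, t.mem_flat hC]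

theorem length_flat {C : Finset (Fin n)} (hC : C ∈ edges t.T) : (t.flat C).length = C.card := by
  rw [← List.toFinset_card_of_nodup (t.nodup_flat C), t.toFinset_flat hC]

theorem flat_ne_nil {C : Finset (Fin n)} (hC : C ∈ edges t.T) : t.flat C ≠ [] := by
  obtain ⟨i, hi⟩ := t.isTree.edges_nonempty hC
  exact List.ne_nil_of_mem ((t.mem_flat hC).2 hi)

/-- The cyclic word of leaves of a planar tree. -/
noncomputable def cyc : Cycle (Fin n) := cycleBind t.flat t.root

theorem nodup_cyc : t.cyc.Nodup :=
  nodup_cycleBind t.nodup_root (fun C _ => t.nodup_flat C) fun C hC D hD h =>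
    t.disjoint_flat ((t.mem_root C).1 hC) ((t.mem_root D).1 hD) h

theorem mem_cyc (i : Fin n) : i ∈ t.cyc := by
  obtain ⟨D, hD, hi⟩ := exists_mem_inputs_top t.T i
  exact mem_cycleBind.2 ⟨D, (t.mem_root D).2 hD, (t.mem_flat hD.1).2 hi⟩

/-! ### Contraction of an edge of a planar tree -/

/-- The replacement of the letter `S` by the inputs of the vertex `S`. -/
def subst (S C : Finset (Fin n)) : List (Finset (Fin n)) := if C = S then t.w S else [C]

variable {t} in
theorem disjoint_subst {S : Finset (Fin n)} {v : WithTop (Finset (Fin n))}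
    {C D : Finset (Fin n)} (hC : C ∈ inputs t.T v) (hD : D ∈ inputs t.T v) (h : C ≠ D) :
    List.Disjoint (t.subst S C) (t.subst S D) := by
  rw [List.disjoint_left]
  intro E hE hE'
  simp only [subst] at hE hE'
  split_ifs at hE hE' with h1 h2 h2
  · exact h (h1.trans h2.symm)
  · rw [List.mem_singleton] at hE'
    subst hE' h1
    exact notMem_inputs_of_mem_inputs hC (inputs_of_mem_w hE) hD
  · rw [List.mem_singleton] at hE
    subst hE h2
    exact notMem_inputs_of_mem_inputs hD (inputs_of_mem_w hE') hC
  · simp only [List.mem_singleton] at hE hE'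
    exact h (hE.symm.trans hE')

variable {t} in
theorem nodup_subst (S C : Finset (Fin n)) : (t.subst S C).Nodup := by
  unfold subst
  split_ifs
  · exact t.nodup_w S
  · simp

variable {t} in
theorem exists_mem_subst_iff {S : Finset (Fin n)} (hS : S ∈ t.T) (v : WithTop (Finset (Fin n)))
    (C : Finset (Fin n)) :
    (∃ D, D ∈ inputs t.T v ∧ C ∈ t.subst S D) ↔ C ∈ inputs (t.T.erase S) v := by
  rw [t.isTree.mem_inputs_erase hS]
  constructor
  · rintro ⟨D, hD, hC⟩
    simp only [subst] at hC
    split_ifs at hC with h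
    · subst h
      exact Or.inr ⟨hD, inputs_of_mem_w hC⟩
    · rw [List.mem_singleton] at hC
      subst hC
      exact Or.inl ⟨hD, h⟩
  · rintro (⟨h1, h2⟩ | ⟨h1, h2⟩)
    · exact ⟨C, h1, by simp [subst, h2]⟩
    · exact ⟨S, h1, by simpa [subst] using (t.mem_w S hS C).2 h2⟩

/-- The contraction of the internal edge `S`. -/
def contract (S : Finset (Fin n)) (hS : S ∈ t.T) : PlanarTree n where
  T := t.T.erase S
  isTree := t.isTree.erase S
  w V := if V = S then [] else (t.w V).flatMap (t.subst S)
  root := cycleBind (t.subst S) t.root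
  nodup_w V := by
    split_ifs with h
    · simp
    · exact nodup_flatMap_of_disjoint (t.nodup_w V) (fun D _ => nodup_subst S D)
        fun D hD E hE hDE => disjoint_subst (inputs_of_mem_w hD) (inputs_of_mem_w hE) hDE
  mem_w V hV C := by
    rw [Finset.mem_erase] at hV
    rw [if_neg hV.1, List.mem_flatMap, ← exists_mem_subst_iff hS]
    simp only [t.mem_w V hV.2]
  w_eq_nil V hV := by
    split_ifs with h
    · rfl
    · rw [t.w_eq_nil V fun h' => hV (Finset.mem_erase.2 ⟨h, h'⟩)]
      rfl
  nodup_root := nodup_cycleBind t.nodup_root (fun D _ => nodup_subst S D)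
        fun D hD E hE hDE => disjoint_subst ((t.mem_root D).1 hD) ((t.mem_root E).1 hE) hDE
  mem_root C := by
    rw [mem_cycleBind, ← exists_mem_subst_iff hS]
    simp only [t.mem_root]

@[simp] theorem contract_T (S : Finset (Fin n)) (hS : S ∈ t.T) :
    (t.contract S hS).T = t.T.erase S := rfl

theorem contract_w {S : Finset (Fin n)} (hS : S ∈ t.T) {V : Finset (Fin n)} (h : V ≠ S) :
    (t.contract S hS).w V = (t.w V).flatMap (t.subst S) := if_neg h

theorem contract_w_of_notMem {S : Finset (Fin n)} (hS : S ∈ t.T) {V : Finset (Fin n)}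
    (h : V ≠ S) (h' : S ∉ t.w V) : (t.contract S hS).w V = t.w V := by
  rw [t.contract_w hS h]
  have : ∀ D ∈ t.w V, t.subst S D = [D] := fun D hD => if_neg (by rintro rfl; exact h' hD)
  rw [List.flatMap_congr this]
  simp

theorem contract_root (S : Finset (Fin n)) (hS : S ∈ t.T) :
    (t.contract S hS).root = cycleBind (t.subst S) t.root := rfl

theorem flat_contract {S : Finset (Fin n)} (hS : S ∈ t.T) {C : Finset (Fin n)} (hC : C ≠ S) :
    (t.contract S hS).flat C = t.flat C := by
  induction h : C.card using Nat.strong_induction_on generalizing C with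
  | _ m ih =>
    subst h
    by_cases hCT : C ∈ t.T
    · rw [flat_of_mem _ (Finset.mem_erase.2 ⟨hC, hCT⟩), flat_of_mem _ hCT, t.contract_w hS hC,
        List.flatMap_assoc]
      refine List.flatMap_congr fun D hD => ?_
      have hDC := ssubset_of_mem_w hD
      by_cases hDS : D = S
      · subst hDS
        simp only [subst, if_pos]
        rw [t.flat_of_mem hS]
        refine List.flatMap_congr fun E hE => ?_
        have hED := ssubset_of_mem_w hE
        exact ih _ (Finset.card_lt_card (hED.trans hDC)) hED.ne rfl
      · simp only [subst, if_neg hDS, List.flatMap_cons, List.flatMap_nil, List.append_nil]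
        exact ih _ (Finset.card_lt_card hDC) hDS rfl
    · rw [flat_of_notMem _ hCT, flat_of_notMem]
      exact fun h => hCT (Finset.mem_of_mem_erase h)

theorem flatMap_subst_flat {S : Finset (Fin n)} (hS : S ∈ t.T) (D : Finset (Fin n)) :
    (t.subst S D).flatMap (t.contract S hS).flat = t.flat D := by
  by_cases hDS : D = S
  · subst hDS
    simp only [subst, if_pos]
    rw [t.flat_of_mem hS]
    exact List.flatMap_congr fun E hE => t.flat_contract hS (ssubset_of_mem_w hE).ne
  · simp only [subst, if_neg hDS, List.flatMap_cons, List.flatMap_nil, List.append_nil]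
    exact t.flat_contract hS hDS

theorem cyc_contract {S : Finset (Fin n)} (hS : S ∈ t.T) : (t.contract S hS).cyc = t.cyc := by
  rw [cyc, cyc, contract_root, cycleBind_cycleBind]
  exact cycleBind_congr fun D _ => t.flatMap_subst_flat hS D

end PlanarTree

/-! ### Joining two neighbouring inputs of a vertex -/

section Insert

variable {n : ℕ} {T : Finset (Finset (Fin n))}

/-- `v` is a vertex of the tree `T`. -/
def IsVertex (T : Finset (Finset (Fin n))) (v : WithTop (Finset (Fin n))) : Prop :=
  v = ⊤ ∨ ∃ V ∈ T, v = (V : WithTop (Finset (Fin n)))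

theorem isVertex_top : IsVertex T ⊤ := Or.inl rfl

theorem isVertex_coe {V : Finset (Fin n)} (h : V ∈ T) : IsVertex T V := Or.inr ⟨V, h, rfl⟩

theorem IsTree.vertex_unique (hT : IsTree T) {v v' : WithTop (Finset (Fin n))}
    {C : Finset (Fin n)} (hv : IsVertex T v) (hv' : IsVertex T v') (h : C ∈ inputs T v)
    (h' : C ∈ inputs T v') : v = v' := by
  rcases hv with rfl | ⟨V, hV, rfl⟩
  · rcases hv' with rfl | ⟨W, hW, rfl⟩
    · rfl
    · exact hT.parent_unique hW (Or.inl rfl) h' h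
  · exact (hT.parent_unique hV hv' h h').symm

variable {v : WithTop (Finset (Fin n))} {X Y : Finset (Fin n)}

theorem IsTree.union_notMem_edges (hT : IsTree T) (hX : X ∈ inputs T v) (hY : Y ∈ inputs T v)
    (hXY : X ≠ Y) (hv : ((X ∪ Y : Finset (Fin n)) : WithTop (Finset (Fin n))) < v) :
    X ∪ Y ∉ edges T := fun h => by
  refine hX.2.2 _ h hv (lt_of_le_of_ne Finset.subset_union_left fun e => ?_)
  have hYX : Y ⊆ X := Finset.union_eq_left.1 e.symm
  obtain ⟨i, hi⟩ := hT.edges_nonempty hY.1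
  exact hXY (hT.inputs_eq_of_mem hX hY (hYX hi) hi)

/-- Two inputs `X` and `Y` of a vertex with further inputs can be joined to a new edge. -/
theorem IsTree.insert_union (hT : IsTree T) (hvT : IsVertex T v) (hX : X ∈ inputs T v)
    (hY : Y ∈ inputs T v) (hXY : X ≠ Y)
    (hv : ((X ∪ Y : Finset (Fin n)) : WithTop (Finset (Fin n))) < v) :
    IsTree (insert (X ∪ Y) T) := by
  have key : ∀ Z ∈ inputs T v, ∀ C ∈ T, Z ⊂ C → X ∪ Y ⊆ C := by
    intro Z hZ C hC hZC
    have hn : ¬ (C : WithTop (Finset (Fin n))) < v := fun h =>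
      hZ.2.2 C (mem_edges_of_mem hC) h hZC
    rcases hvT with rfl | ⟨V, hV, rfl⟩
    · exact absurd (WithTop.coe_lt_top C) hn
    · have hSV := WithTop.coe_lt_coe.1 hv
      rw [WithTop.coe_lt_coe] at hn
      rcases hT.nested C hC V hV with h | h | h
      · rcases eq_or_ne C V with e | e
        · exact e ▸ hSV.1
        · exact absurd (lt_of_le_of_ne h e) hn
      · exact hSV.1.trans h
      · obtain ⟨i, hi⟩ := hT.edges_nonempty hZ.1
        exact absurd ((ssubset_of_mem_inputs hZ).1 hi) (Finset.disjoint_left.1 h (hZC.1 hi))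
  have key2 : ∀ C ∈ T, C ⊆ X ∪ Y ∨ X ∪ Y ⊆ C ∨ Disjoint C (X ∪ Y) := by
    intro C hC
    rcases hT.edges_nested (mem_edges_of_mem hC) hX.1 with h | h | h
    · exact Or.inl (h.trans Finset.subset_union_left)
    · rcases eq_or_ne X C with e | e
      · exact Or.inl (e ▸ Finset.subset_union_left)
      · exact Or.inr (Or.inl (key X hX C hC (lt_of_le_of_ne h e)))
    · rcases hT.edges_nested (mem_edges_of_mem hC) hY.1 with h' | h' | h'
      · exact Or.inl (h'.trans Finset.subset_union_right)
      · rcases eq_or_ne Y C with e | e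
        · exact Or.inl (e ▸ Finset.subset_union_right)
        · exact Or.inr (Or.inl (key Y hY C hC (lt_of_le_of_ne h' e)))
      · exact Or.inr (Or.inr (Finset.disjoint_union_right.2 ⟨h, h'⟩))
  constructor
  · intro S hS
    rcases Finset.mem_insert.1 hS with rfl | hS
    · rw [Finset.card_union_of_disjoint (hT.inputs_disjoint hX hY hXY)]
      have h1 := Finset.card_pos.2 (hT.edges_nonempty hX.1)
      have h2 := Finset.card_pos.2 (hT.edges_nonempty hY.1)
      omega
    · exact hT.two_le_card S hS
  · intro S hS S' hS'
    rcases Finset.mem_insert.1 hS with rfl | hS <;> rcases Finset.mem_insert.1 hS' with rfl | hS'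
    · exact Or.inl subset_rfl
    · rcases key2 S' hS' with h | h | h
      · exact Or.inr (Or.inl h)
      · exact Or.inl h
      · exact Or.inr (Or.inr h.symm)
    · exact key2 S hS
    · exact hT.nested S hS S' hS'

theorem mem_edges_insert {S C : Finset (Fin n)} (h : C ∈ edges (insert S T)) :
    C = S ∨ C ∈ edges T := by
  rcases mem_edges_iff.1 h with h | h
  · rcases Finset.mem_insert.1 h with h | h
    · exact Or.inl h
    · exact Or.inr (mem_edges_of_mem h)
  · exact Or.inr (mem_edges_iff.2 (Or.inr h))

theorem mem_edges_insert_of_mem {S C : Finset (Fin n)} (h : C ∈ edges T) :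
    C ∈ edges (insert S T) := by
  rcases mem_edges_iff.1 h with h | h
  · exact mem_edges_of_mem (Finset.mem_insert_of_mem h)
  · exact mem_edges_iff.2 (Or.inr h)

/-- The inputs of the vertex which is created when two inputs `X` and `Y` of `v` are joined. -/
theorem IsTree.mem_inputs_insert_self (hT : IsTree T) (hX : X ∈ inputs T v)
    (hY : Y ∈ inputs T v) (hXY : X ≠ Y)
    (hv : ((X ∪ Y : Finset (Fin n)) : WithTop (Finset (Fin n))) < v) (C : Finset (Fin n)) :
    C ∈ inputs (insert (X ∪ Y) T) ((X ∪ Y : Finset (Fin n)) : WithTop (Finset (Fin n))) ↔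
      C = X ∨ C = Y := by
  have hss : ∀ Z ∈ inputs T v, Z ⊆ X ∪ Y → Z ⊂ X ∪ Y := fun Z hZ h =>
    lt_of_le_of_ne h fun e => hT.union_notMem_edges hX hY hXY hv (e ▸ hZ.1)
  have hmem : ∀ Z ∈ inputs T v, Z ⊆ X ∪ Y →
      Z ∈ inputs (insert (X ∪ Y) T) ((X ∪ Y : Finset (Fin n)) : WithTop (Finset (Fin n))) := by
    intro Z hZ hZS
    refine ⟨mem_edges_insert_of_mem hZ.1, WithTop.coe_lt_coe.2 (hss Z hZ hZS), ?_⟩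
    intro D hD hDS hZD
    rcases mem_edges_insert hD with rfl | hD
    · exact lt_irrefl _ hDS
    · exact hZ.2.2 D hD (hDS.trans hv) hZD
  constructor
  · rintro ⟨hC, hCS, hmax⟩
    rcases mem_edges_insert hC with rfl | hC
    · exact absurd hCS (lt_irrefl _)
    obtain ⟨D, hD, hCD⟩ := exists_mem_inputs_superset hC (hCS.trans hv)
    obtain ⟨i, hi⟩ := hT.edges_nonempty hC
    have hZ : D = X ∨ D = Y := by
      rcases Finset.mem_union.1 ((WithTop.coe_lt_coe.1 hCS).1 hi) with h | h
      · exact Or.inl (hT.inputs_eq_of_mem hD hX (hCD hi) h)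
      · exact Or.inr (hT.inputs_eq_of_mem hD hY (hCD hi) h)
    have hCD' : C = D := by
      by_contra hne
      have hDS : D ⊆ X ∪ Y := by
        rcases hZ with rfl | rfl
        · exact Finset.subset_union_left
        · exact Finset.subset_union_right
      exact hmax D (mem_edges_insert_of_mem hD.1) (WithTop.coe_lt_coe.2 (hss D hD hDS))
        (lt_of_le_of_ne hCD hne)
    rwa [hCD']
  · rintro (rfl | rfl)
    · exact hmem _ hX Finset.subset_union_left
    · exact hmem _ hY Finset.subset_union_right

theorem IsTree.union_mem_inputs_insert (hX : X ∈ inputs T v)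
    (hv : ((X ∪ Y : Finset (Fin n)) : WithTop (Finset (Fin n))) < v) :
    X ∪ Y ∈ inputs (insert (X ∪ Y) T) v := by
  refine ⟨mem_edges_of_mem (Finset.mem_insert_self _ _), hv, fun D hD hDv hSD => ?_⟩
  rcases mem_edges_insert hD with rfl | hD
  · exact lt_irrefl _ hSD
  · exact hX.2.2 D hD hDv (lt_of_le_of_lt Finset.subset_union_left hSD)

theorem IsTree.mem_inputs_insert (hT : IsTree T) (hvT : IsVertex T v) (hX : X ∈ inputs T v)
    (hY : Y ∈ inputs T v) (hXY : X ≠ Y)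
    (hv : ((X ∪ Y : Finset (Fin n)) : WithTop (Finset (Fin n))) < v)
    {u : WithTop (Finset (Fin n))} (hu : IsVertex T u) (C : Finset (Fin n)) :
    C ∈ inputs (insert (X ∪ Y) T) u ↔
      if u = v then C = X ∪ Y ∨ (C ∈ inputs T v ∧ C ≠ X ∧ C ≠ Y) else C ∈ inputs T u := by
  have hT' := hT.insert_union hvT hX hY hXY hv
  have hS : X ∪ Y ∈ insert (X ∪ Y) T := Finset.mem_insert_self _ _
  have hn := hT.union_notMem_edges hX hY hXY hv
  have he : (insert (X ∪ Y) T).erase (X ∪ Y) = T :=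
    Finset.erase_insert fun h => hn (mem_edges_of_mem h)
  have hvert : ∀ u, IsVertex T u → IsVertex (insert (X ∪ Y) T) u := by
    rintro u (h | ⟨V, hV, h⟩)
    · exact Or.inl h
    · exact Or.inr ⟨V, Finset.mem_insert_of_mem hV, h⟩
  have h1 := hT'.mem_inputs_erase hS u C
  have h2 := hT.mem_inputs_insert_self hX hY hXY hv C
  have h3 := IsTree.union_mem_inputs_insert (Y := Y) hX hv
  rw [he] at h1
  have h4 : X ∪ Y ∈ inputs (insert (X ∪ Y) T) u ↔ u = v := by
    constructor
    · intro h
      exact hT'.vertex_unique (hvert u hu) (hvert v hvT) h h3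
    · rintro rfl; exact h3
  split_ifs with huv
  · subst huv
    rw [h1, h2]
    constructor
    · intro h
      by_cases hCS : C = X ∪ Y
      · exact Or.inl hCS
      · right
        refine ⟨Or.inl ⟨h, hCS⟩, ?_, ?_⟩
        · rintro rfl
          exact notMem_inputs_of_mem_inputs h3
            ((hT.mem_inputs_insert_self hX hY hXY hv C).2 (Or.inl rfl)) h
        · rintro rfl
          exact notMem_inputs_of_mem_inputs h3
            ((hT.mem_inputs_insert_self hX hY hXY hv C).2 (Or.inr rfl)) h
    · rintro (rfl | ⟨h | h, h'⟩)
      · exact h3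
      · exact h.1
      · exact absurd h.2 (by tauto)
  · rw [h1, h4]
    constructor
    · intro h
      refine Or.inl ⟨h, ?_⟩
      rintro rfl
      exact huv (h4.1 h)
    · rintro (h | h)
      · exact h.1
      · exact absurd h.1 huv

end Insert

namespace PlanarTree

variable {n : ℕ} (t : PlanarTree n)

theorem flatMap_subst_of_notMem {S : Finset (Fin n)} {l : List (Finset (Fin n))} (h : S ∉ l) :
    l.flatMap (t.subst S) = l := by
  have : ∀ D ∈ l, t.subst S D = [D] := fun D hD => if_neg (by rintro rfl; exact h hD)
  rw [List.flatMap_congr this]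
  simp

theorem cycleBind_subst_of_notMem {S : Finset (Fin n)} {c : Cycle (Finset (Fin n))} (h : S ∉ c) :
    cycleBind (t.subst S) c = c := by
  induction c using Quotient.inductionOn' with
  | h l => exact congrArg Cycle.ofList (t.flatMap_subst_of_notMem h)

@[simp] theorem subst_self (S : Finset (Fin n)) : t.subst S S = t.w S := if_pos rfl

theorem flatMap_subst_append_cons {S : Finset (Fin n)} {l₁ l₂ : List (Finset (Fin n))}
    (h : (l₁ ++ S :: l₂).Nodup) :
    (l₁ ++ S :: l₂).flatMap (t.subst S) = l₁ ++ (t.w S ++ l₂) := by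
  have h1 : S ∉ l₁ := fun h' => by simpa using List.disjoint_of_nodup_append h h'
  have h2 : S ∉ l₂ := (List.nodup_cons.1 (List.nodup_append.1 h).2.1).1
  rw [List.flatMap_append, List.flatMap_cons, t.flatMap_subst_of_notMem h1,
    t.flatMap_subst_of_notMem h2, t.subst_self]

theorem subst_contract_comm {S S' : Finset (Fin n)} (hS : S ∈ t.T) (hS' : S' ∈ t.T)
    (h : S ≠ S') (D : Finset (Fin n)) :
    (t.subst S D).flatMap ((t.contract S hS).subst S') =
      (t.subst S' D).flatMap ((t.contract S' hS').subst S) := by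
  have key : ∀ {S S' : Finset (Fin n)} (hS : S ∈ t.T) (hS' : S' ∈ t.T), S ≠ S' →
      (t.w S).flatMap ((t.contract S hS).subst S') = (t.contract S' hS').w S := by
    intro S S' hS hS' h
    rw [t.contract_w hS' h]
    refine List.flatMap_congr fun C hC => ?_
    unfold subst
    split_ifs with hC'
    · subst hC'
      refine t.contract_w_of_notMem hS h.symm fun h' => ?_
      exact lt_asymm (ssubset_of_mem_w hC) (ssubset_of_mem_w h')
    · rfl
  by_cases h1 : D = S
  · subst h1
    rw [subst_self, key hS hS' h]
    simp [subst, h]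
  · by_cases h2 : D = S'
    · subst h2
      rw [subst_self, key hS' hS h.symm]
      simp [subst, h1]
    · simp [subst, h1, h2]

theorem mem_contract_T {S S' : Finset (Fin n)} (hS : S ∈ t.T) :
    S' ∈ (t.contract S hS).T ↔ S' ≠ S ∧ S' ∈ t.T := Finset.mem_erase

theorem contract_comm {S S' : Finset (Fin n)} (hS : S ∈ t.T) (hS' : S' ∈ t.T) (h : S ≠ S')
    (h₁ : S' ∈ (t.contract S hS).T) (h₂ : S ∈ (t.contract S' hS').T) :
    (t.contract S hS).contract S' h₁ = (t.contract S' hS').contract S h₂ := by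
  have hw : ∀ V, ((t.contract S hS).contract S' h₁).w V =
      ((t.contract S' hS').contract S h₂).w V := by
    intro V
    by_cases h1 : V = S
    · subst h1
      rw [contract_w _ _ h, w_eq_nil _ V (by simp), w_eq_nil _ V (by simp)]
      rfl
    · by_cases h2 : V = S'
      · subst h2
        rw [contract_w _ _ h1, w_eq_nil _ V (by simp), w_eq_nil _ V (by simp)]
        rfl
      · rw [contract_w _ _ h1, contract_w _ _ h2, contract_w _ _ h1, contract_w _ _ h2,
          List.flatMap_assoc, List.flatMap_assoc]
        exact List.flatMap_congr fun D _ => t.subst_contract_comm hS hS' h D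
  refine PlanarTree.ext Finset.erase_right_comm (funext hw) ?_
  rw [contract_root, contract_root, contract_root, contract_root, cycleBind_cycleBind,
    cycleBind_cycleBind]
  exact cycleBind_congr fun D _ => t.subst_contract_comm hS hS' h D

theorem w_ne_nil {V : Finset (Fin n)} (hV : V ∈ t.T) : t.w V ≠ [] := by
  obtain ⟨i, hi⟩ := t.isTree.edges_nonempty (mem_edges_of_mem hV)
  obtain ⟨D, hD, -⟩ := t.isTree.exists_mem_inputs hV hi
  exact List.ne_nil_of_mem ((t.mem_w V hV D).2 hD)

/-- A planar tree is determined by the contraction of an internal edge `S` and the order of the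
inputs of `S`. -/
theorem eq_of_contract_eq {t₁ t₂ : PlanarTree n} {S : Finset (Fin n)} (h₁ : S ∈ t₁.T)
    (h₂ : S ∈ t₂.T) (hw : t₁.w S = t₂.w S) (h : t₁.contract S h₁ = t₂.contract S h₂) :
    t₁ = t₂ := by
  have hT : t₁.T = t₂.T := by
    have := congrArg PlanarTree.T h
    simp only [contract_T] at this
    rw [← Finset.insert_erase h₁, ← Finset.insert_erase h₂, this]
  have hs : t₁.subst S = t₂.subst S := by
    funext C
    simp only [subst, hw]
  obtain ⟨a, A, hA⟩ := List.exists_cons_of_ne_nil (t₁.w_ne_nil h₁)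
  have hwV : ∀ V, t₁.w V = t₂.w V := by
    intro V
    by_cases hVS : V = S
    · rw [hVS, hw]
    by_cases hVT : V ∈ t₁.T
    swap
    · rw [t₁.w_eq_nil V hVT, t₂.w_eq_nil V (hT ▸ hVT)]
    have he := congrArg (fun t => PlanarTree.w t V) h
    simp only [contract_w _ _ hVS, ← hs] at he
    have hiff : S ∈ t₁.w V ↔ S ∈ t₂.w V := by
      rw [t₁.mem_w V hVT, t₂.mem_w V (hT ▸ hVT), hT]
    by_cases hSV : S ∈ t₁.w V
    · obtain ⟨l₁, l₂, hl⟩ := List.append_of_mem hSV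
      obtain ⟨m₁, m₂, hm⟩ := List.append_of_mem (hiff.1 hSV)
      have hnd : ((t₁.w V).flatMap (t₁.subst S)).Nodup := by
        rw [← contract_w _ h₁ hVS]
        exact nodup_w _ V
      rw [hm, hl, t₁.flatMap_subst_append_cons (hl ▸ t₁.nodup_w V),
        t₁.flatMap_subst_append_cons (hm ▸ t₂.nodup_w V), hA] at he
      rw [hl, t₁.flatMap_subst_append_cons (hl ▸ t₁.nodup_w V), hA] at hnd
      have := nodup_append_cons_inj (l₂ := A ++ l₂) (m₂ := A ++ m₂) hnd he
      rw [hl, hm, this.1, List.append_cancel_left this.2]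
    · rwa [t₁.flatMap_subst_of_notMem hSV,
        t₁.flatMap_subst_of_notMem fun h' => hSV (hiff.2 h')] at he
  refine PlanarTree.ext hT (funext hwV) ?_
  have he := congrArg PlanarTree.root h
  simp only [contract_root, ← hs] at he
  have hiff : S ∈ t₁.root ↔ S ∈ t₂.root := by
    rw [t₁.mem_root, t₂.mem_root, hT]
  by_cases hSV : S ∈ t₁.root
  · obtain ⟨l, hl⟩ := exists_cons_of_mem_cycle hSV
    obtain ⟨m, hm⟩ := exists_cons_of_mem_cycle (hiff.1 hSV)
    have hnd := (t₁.contract S h₁).nodup_root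
    have h1 := t₁.nodup_root
    have h2 := t₂.nodup_root
    rw [hl, Cycle.nodup_coe_iff] at h1
    rw [hm, Cycle.nodup_coe_iff] at h2
    have e1 := t₁.flatMap_subst_append_cons (l₁ := []) h1
    have e2 := t₁.flatMap_subst_append_cons (l₁ := []) h2
    simp only [List.nil_append] at e1 e2
    rw [contract_root, hl, cycleBind_coe, e1, Cycle.nodup_coe_iff, hA] at hnd
    rw [hl, hm, cycleBind_coe, cycleBind_coe, e1, e2, hA, Cycle.coe_eq_coe] at he
    rw [hl, hm, List.append_cancel_left (isRotated_cons_cons hnd he)]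
  · rwa [t₁.cycleBind_subst_of_notMem hSV,
      t₁.cycleBind_subst_of_notMem fun h' => hSV (hiff.2 h')] at he

/-- Two neighbouring inputs of a non-root vertex with at least three inputs can be joined. -/
theorem exists_expand_vertex {V X Y : Finset (Fin n)} {l₁ l₂ : List (Finset (Fin n))}
    (hV : t.w V = l₁ ++ X :: Y :: l₂) (hl : l₁ ++ l₂ ≠ []) :
    ∃ (t' : PlanarTree n) (h : X ∪ Y ∈ t'.T), t'.contract (X ∪ Y) h = t ∧
      t'.w (X ∪ Y) = [X, Y] := by
  have hXw : X ∈ t.w V := by simp [hV]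
  have hYw : Y ∈ t.w V := by simp [hV]
  have hVT := mem_T_of_mem_w hXw
  have hX := inputs_of_mem_w hXw
  have hY := inputs_of_mem_w hYw
  have hnd := t.nodup_w V
  rw [hV] at hnd
  have hnd2 := (List.nodup_append.1 hnd).2.1
  have hXY : X ≠ Y := by
    rintro rfl
    simp at hnd2
  obtain ⟨Z, hZ⟩ := List.exists_mem_of_ne_nil _ hl
  have hZw : Z ∈ t.w V := by
    rw [hV]
    simp only [List.mem_append, List.mem_cons] at hZ ⊢
    tauto
  have hZXY : Z ≠ X ∧ Z ≠ Y := by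
    rw [List.nodup_append] at hnd
    simp only [List.nodup_cons, List.mem_cons] at hnd
    rcases List.mem_append.1 hZ with h | h
    · exact ⟨hnd.2.2 Z h X (by simp), hnd.2.2 Z h Y (by simp)⟩
    · constructor
      · rintro rfl; exact hnd.2.1.1 (Or.inr h)
      · rintro rfl; exact hnd.2.1.2.1 h
  have hv : ((X ∪ Y : Finset (Fin n)) : WithTop (Finset (Fin n))) < V := by
    rw [WithTop.coe_lt_coe]
    have hXs := ssubset_of_mem_w hXw
    have hYs := ssubset_of_mem_w hYw
    refine lt_of_le_of_ne (Finset.union_subset hXs.1 hYs.1) fun e => ?_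
    obtain ⟨i, hi⟩ := t.isTree.edges_nonempty (mem_edges_of_mem_w hZw)
    have hiV : i ∈ X ∪ Y := e ▸ (ssubset_of_mem_w hZw).1 hi
    rcases Finset.mem_union.1 hiV with h | h
    · exact hZXY.1 (t.isTree.inputs_eq_of_mem (inputs_of_mem_w hZw) hX hi h)
    · exact hZXY.2 (t.isTree.inputs_eq_of_mem (inputs_of_mem_w hZw) hY hi h)
  have hvT : IsVertex t.T (V : WithTop (Finset (Fin n))) := isVertex_coe hVT
  have hn := t.isTree.union_notMem_edges hX hY hXY hv
  have hnT : X ∪ Y ∉ t.T := fun h => hn (mem_edges_of_mem h)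
  have hVS : V ≠ X ∪ Y := by rintro e; exact hnT (e ▸ hVT)
  have hS1 : ∀ U, X ∪ Y ∉ t.w U := fun U h => hn (mem_edges_of_mem_w h)
  have hS2 : X ∪ Y ∉ t.root := fun h => hn (mem_edges_of_mem_root h)
  have hndS : (l₁ ++ (X ∪ Y) :: l₂).Nodup := by
    have hSl : ∀ Z, Z ∈ l₁ ∨ Z ∈ l₂ → Z ≠ X ∪ Y := by
      rintro Z hZ rfl
      refine hS1 V ?_
      rw [hV]
      simp only [List.mem_append, List.mem_cons]
      tauto
    rw [List.nodup_append] at hnd ⊢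
    simp only [List.nodup_cons, List.mem_cons] at hnd ⊢
    refine ⟨hnd.1, ⟨fun h => hSl _ (Or.inr h) rfl, hnd.2.1.2.2⟩, ?_⟩
    rintro a ha b (rfl | hb)
    · exact hSl a (Or.inl ha)
    · exact hnd.2.2 a ha b (Or.inr (Or.inr hb))
  let t' : PlanarTree n :=
    { T := insert (X ∪ Y) t.T
      isTree := t.isTree.insert_union hvT hX hY hXY hv
      w := fun U => if U = X ∪ Y then [X, Y] else if U = V then l₁ ++ (X ∪ Y) :: l₂ else t.w U
      root := t.root
      nodup_w := by
        intro U
        split_ifs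
        · simp [hXY]
        · exact hndS
        · exact t.nodup_w U
      mem_w := by
        intro U hU C
        by_cases hUS : U = X ∪ Y
        · subst hUS
          rw [if_pos rfl, t.isTree.mem_inputs_insert_self hX hY hXY hv]
          simp
        · have hUT := Finset.mem_of_mem_insert_of_ne hU hUS
          rw [if_neg hUS, t.isTree.mem_inputs_insert hvT hX hY hXY hv (isVertex_coe hUT)]
          by_cases hUV : U = V
          · subst hUV
            rw [if_pos rfl, if_pos rfl, ← t.mem_w U hUT, hV]
            rw [List.nodup_append] at hnd
            simp only [List.nodup_cons, List.mem_cons] at hnd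
            simp only [List.mem_append, List.mem_cons]
            constructor
            · rintro (h | h | h)
              · exact Or.inr ⟨Or.inl h, hnd.2.2 C h X (by simp), hnd.2.2 C h Y (by simp)⟩
              · exact Or.inl h
              · refine Or.inr ⟨Or.inr (Or.inr (Or.inr h)), ?_, ?_⟩
                · rintro rfl; exact hnd.2.1.1 (Or.inr h)
                · rintro rfl; exact hnd.2.1.2.1 h
            · tauto
          · rw [if_neg hUV, if_neg (by simpa using hUV), t.mem_w U hUT]
      w_eq_nil := by
        intro U hU
        rw [Finset.mem_insert, not_or] at hU
        rw [if_neg hU.1, if_neg (by rintro rfl; exact hU.2 hVT), t.w_eq_nil U hU.2]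
      nodup_root := t.nodup_root
      mem_root := by
        intro C
        rw [t.isTree.mem_inputs_insert hvT hX hY hXY hv isVertex_top, if_neg (by simp),
          t.mem_root] }
  have hwS : t'.w (X ∪ Y) = [X, Y] := if_pos rfl
  refine ⟨t', Finset.mem_insert_self _ _, PlanarTree.ext ?_ (funext fun U => ?_) ?_, hwS⟩
  · exact Finset.erase_insert hnT
  · by_cases hUS : U = X ∪ Y
    · subst hUS
      rw [w_eq_nil _ _ (by simp), t.w_eq_nil _ hnT]
    · rw [contract_w _ _ hUS]
      by_cases hUV : U = V
      · subst hUV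
        have : t'.w U = l₁ ++ (X ∪ Y) :: l₂ := by simp [t', hUS]
        rw [this, t'.flatMap_subst_append_cons hndS, hwS, hV]
        rfl
      · have : t'.w U = t.w U := by simp [t', hUS, hUV]
        rw [this, t'.flatMap_subst_of_notMem (hS1 U)]
  · exact t'.cycleBind_subst_of_notMem hS2

/-- Two neighbouring inputs of the root can be joined. -/
theorem exists_expand_root {X Y : Finset (Fin n)} {l : List (Finset (Fin n))}
    (hr : t.root = (X :: Y :: l : List _)) :
    ∃ (t' : PlanarTree n) (h : X ∪ Y ∈ t'.T), t'.contract (X ∪ Y) h = t ∧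
      t'.w (X ∪ Y) = [X, Y] ∧ t'.root = ((X ∪ Y) :: l : List _) := by
  have hmem : ∀ C, C ∈ t.root ↔ C = X ∨ C = Y ∨ C ∈ l := fun C => by
    rw [hr, Cycle.mem_coe_iff, List.mem_cons, List.mem_cons]
  have hX := (t.mem_root X).1 ((hmem X).2 (by simp))
  have hY := (t.mem_root Y).1 ((hmem Y).2 (by simp))
  have hnd := t.nodup_root
  rw [hr, Cycle.nodup_coe_iff] at hnd
  simp only [List.nodup_cons, List.mem_cons, not_or] at hnd
  have hXY : X ≠ Y := hnd.1.1
  have hv : ((X ∪ Y : Finset (Fin n)) : WithTop (Finset (Fin n))) < ⊤ := WithTop.coe_lt_top _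
  have hn := t.isTree.union_notMem_edges hX hY hXY hv
  have hnT : X ∪ Y ∉ t.T := fun h => hn (mem_edges_of_mem h)
  have hS1 : ∀ U, X ∪ Y ∉ t.w U := fun U h => hn (mem_edges_of_mem_w h)
  have hSl : X ∪ Y ∉ l := fun h => hn (mem_edges_of_mem_root ((hmem _).2 (by tauto)))
  have hndS : ((X ∪ Y) :: l).Nodup := List.nodup_cons.2 ⟨hSl, hnd.2.2⟩
  let t' : PlanarTree n :=
    { T := insert (X ∪ Y) t.T
      isTree := t.isTree.insert_union isVertex_top hX hY hXY hv
      w := fun U => if U = X ∪ Y then [X, Y] else t.w U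
      root := Cycle.ofList ((X ∪ Y) :: l)
      nodup_w := by
        intro U
        split_ifs
        · simp [hXY]
        · exact t.nodup_w U
      mem_w := by
        intro U hU C
        by_cases hUS : U = X ∪ Y
        · subst hUS
          rw [if_pos rfl, t.isTree.mem_inputs_insert_self hX hY hXY hv]
          simp
        · have hUT := Finset.mem_of_mem_insert_of_ne hU hUS
          rw [if_neg hUS, t.isTree.mem_inputs_insert isVertex_top hX hY hXY hv (isVertex_coe hUT),
            if_neg (by simp), t.mem_w U hUT]
      w_eq_nil := by
        intro U hU
        rw [Finset.mem_insert, not_or] at hU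
        rw [if_neg hU.1, t.w_eq_nil U hU.2]
      nodup_root := by rwa [Cycle.nodup_coe_iff]
      mem_root := by
        intro C
        rw [t.isTree.mem_inputs_insert isVertex_top hX hY hXY hv isVertex_top, if_pos rfl,
          ← t.mem_root, hmem, Cycle.mem_coe_iff, List.mem_cons]
        constructor
        · rintro (h | h)
          · exact Or.inl h
          · refine Or.inr ⟨by tauto, ?_, ?_⟩
            · rintro rfl; exact hnd.1.2 h
            · rintro rfl; exact hnd.2.1 h
        · tauto }
  have hwS : t'.w (X ∪ Y) = [X, Y] := if_pos rfl
  refine ⟨t', Finset.mem_insert_self _ _, PlanarTree.ext ?_ (funext fun U => ?_) ?_, hwS, rfl⟩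
  · exact Finset.erase_insert hnT
  · by_cases hUS : U = X ∪ Y
    · subst hUS
      rw [w_eq_nil _ _ (by simp), t.w_eq_nil _ hnT]
    · rw [contract_w _ _ hUS]
      have : t'.w U = t.w U := by simp [t', hUS]
      rw [this, t'.flatMap_subst_of_notMem (hS1 U)]
  · have e := t'.flatMap_subst_append_cons (l₁ := []) hndS
    simp only [List.nil_append] at e
    change cycleBind _ (Cycle.ofList ((X ∪ Y) :: l)) = _
    rw [cycleBind_coe, e, hwS, hr]
    rfl

/-! ### Numbers of inputs -/

theorem two_le_length_w {V : Finset (Fin n)} (hV : V ∈ t.T) : 2 ≤ (t.w V).length := by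
  by_contra hlt
  obtain ⟨C, l, hC⟩ := List.exists_cons_of_ne_nil (t.w_ne_nil hV)
  have hl : l = [] := by
    rw [hC, List.length_cons] at hlt
    exact List.length_eq_zero_iff.1 (by omega)
  subst hl
  have hCV := ssubset_of_mem_w (t := t) (V := V) (C := C) (by simp [hC])
  obtain ⟨i, hi, hiC⟩ := Finset.exists_of_ssubset hCV
  obtain ⟨D, hD, hiD⟩ := t.isTree.exists_mem_inputs hV hi
  have hD' := (t.mem_w V hV D).2 hD
  rw [hC, List.mem_singleton] at hD'
  exact hiC (hD' ▸ hiD)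

theorem card_edges : (edges t.T).card = t.T.card + n := by
  rw [edges, Finset.card_union_of_disjoint, Finset.card_image_of_injective _
    Finset.singleton_injective, Finset.card_univ, Fintype.card_fin]
  rw [Finset.disjoint_left]
  intro C hC hC'
  obtain ⟨i, -, rfl⟩ := Finset.mem_image.1 hC'
  exact t.singleton_notMem i hC

/-- Every edge is an input of exactly one vertex. -/
theorem sum_length_w : ∑ V ∈ t.T, (t.w V).length + t.root.length = t.T.card + n := by
  classical
  obtain ⟨r, hr⟩ : ∃ r : List (Finset (Fin n)), t.root = r :=
    Quotient.inductionOn' t.root fun l => ⟨l, rfl⟩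
  have hndr := t.nodup_root
  have hmr := t.mem_root
  rw [hr, Cycle.nodup_coe_iff] at hndr
  simp only [hr, Cycle.mem_coe_iff] at hmr
  have hU : edges t.T = (t.T.biUnion fun V => (t.w V).toFinset) ∪ r.toFinset := by
    ext C
    simp only [Finset.mem_union, Finset.mem_biUnion, List.mem_toFinset]
    constructor
    · intro hC
      rcases t.isTree.exists_parent_of_mem_edges hC with h | ⟨V, hV, h⟩
      · exact Or.inr ((hmr C).2 h)
      · exact Or.inl ⟨V, hV, (t.mem_w V hV C).2 h⟩
    · rintro (⟨V, -, h⟩ | h)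
      · exact mem_edges_of_mem_w h
      · exact ((hmr C).1 h).1
  rw [← card_edges, hU, Finset.card_union_of_disjoint, Finset.card_biUnion, hr, Cycle.length_coe,
    List.toFinset_card_of_nodup hndr]
  · congr 1
    exact Finset.sum_congr rfl fun V _ => (List.toFinset_card_of_nodup (t.nodup_w V)).symm
  · intro V hV W hW hne
    rw [Function.onFun, Finset.disjoint_left]
    intro C hC hC'
    rw [List.mem_toFinset] at hC hC'
    exact hne (WithTop.coe_injective (t.isTree.vertex_unique (isVertex_coe hV) (isVertex_coe hW)
      (inputs_of_mem_w hC) (inputs_of_mem_w hC')))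
  · rw [Finset.disjoint_left]
    intro C hC hC'
    obtain ⟨V, hV, hC⟩ := Finset.mem_biUnion.1 hC
    rw [List.mem_toFinset] at hC hC'
    exact WithTop.coe_ne_top (t.isTree.vertex_unique (isVertex_coe hV) isVertex_top
      (inputs_of_mem_w hC) ((hmr C).1 hC'))

theorem root_length_pos (hn : 0 < n) : 0 < t.root.length := by
  obtain ⟨D, hD, -⟩ := exists_mem_inputs_top t.T (⟨0, hn⟩ : Fin n)
  obtain ⟨l, hl⟩ := exists_cons_of_mem_cycle ((t.mem_root D).2 hD)
  rw [hl, Cycle.length_coe]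
  simp

theorem card_T_lt (hn : 0 < n) : t.T.card < n := by
  have h1 := t.sum_length_w
  have h2 := t.root_length_pos hn
  have h3 : ∑ V ∈ t.T, 2 ≤ ∑ V ∈ t.T, (t.w V).length :=
    Finset.sum_le_sum fun V hV => t.two_le_length_w hV
  rw [Finset.sum_const, smul_eq_mul] at h3
  omega

end PlanarTree

/-! ### Sublists of lists without repetitions -/

theorem sublist_eq_filter {α : Type} [DecidableEq α] {u l : List α} (hu : u.Nodup)
    (h : l.Sublist u) : l = u.filter (· ∈ l) := by
  have h1 : l.filter (· ∈ l) = l := List.filter_eq_self.2 (by simp)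
  have h2 := h.filter (· ∈ l)
  rw [h1] at h2
  refine h2.eq_of_length ((List.perm_ext_iff_of_nodup (hu.sublist h) (hu.filter _)).2 ?_).length_eq
  intro a
  rw [List.mem_filter]
  constructor
  · intro ha
    exact ⟨h.subset ha, by simpa using ha⟩
  · rintro ⟨-, ha⟩
    simpa using ha

theorem eq_of_sublist {α : Type} [DecidableEq α] {u l l' : List α} (hu : u.Nodup)
    (h : l.Sublist u) (h' : l'.Sublist u) (he : l.toFinset = l'.toFinset) : l = l' := by
  have hm : ∀ a, a ∈ l ↔ a ∈ l' := fun a => by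
    rw [← List.mem_toFinset, he, List.mem_toFinset]
  rw [sublist_eq_filter hu h, sublist_eq_filter hu h']
  simp only [hm]

namespace PlanarTree

variable {n : ℕ} (t : PlanarTree n)

/-! ### Neighbouring edges and their leaves -/

/-- The edges `X` and `Y` are neighbouring inputs of a vertex, in this order. -/
def Adj (X Y : Finset (Fin n)) : Prop :=
  (∃ V l₁ l₂, t.w V = l₁ ++ X :: Y :: l₂) ∨ ∃ l, t.root = Cycle.ofList (X :: Y :: l)

variable {t} {X Y X' Y' : Finset (Fin n)} {y : Fin n}

theorem Adj.exists_vertex (h : t.Adj X Y) :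
    ∃ v, IsVertex t.T v ∧ X ∈ inputs t.T v ∧ Y ∈ inputs t.T v ∧ X ≠ Y := by
  rcases h with ⟨V, l₁, l₂, h⟩ | ⟨l, h⟩
  · have hX : X ∈ t.w V := by simp [h]
    have hY : Y ∈ t.w V := by simp [h]
    refine ⟨V, isVertex_coe (mem_T_of_mem_w hX), inputs_of_mem_w hX, inputs_of_mem_w hY, ?_⟩
    have := t.nodup_w V
    rw [h, List.nodup_append] at this
    simp only [List.nodup_cons, List.mem_cons, not_or] at this
    exact this.2.1.1.1
  · have hX : X ∈ t.root := by rw [h]; exact Cycle.mem_coe_iff.2 (by simp)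
    have hY : Y ∈ t.root := by rw [h]; exact Cycle.mem_coe_iff.2 (by simp)
    refine ⟨⊤, isVertex_top, (t.mem_root X).1 hX, (t.mem_root Y).1 hY, ?_⟩
    have := t.nodup_root
    rw [h] at this
    have := Cycle.nodup_coe_iff.1 this
    simp only [List.nodup_cons, List.mem_cons, not_or] at this
    exact this.1.1

theorem Adj.disjoint (h : t.Adj X Y) : Disjoint X Y := by
  obtain ⟨v, -, hX, hY, hne⟩ := h.exists_vertex
  exact t.isTree.inputs_disjoint hX hY hne

theorem Adj.right_mem (h : t.Adj X Y) : Y ∈ edges t.T := by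
  obtain ⟨v, -, hX, hY, hne⟩ := h.exists_vertex
  exact hY.1

theorem adj_of_w_eq {V : Finset (Fin n)} (h : t.w V = [X, Y]) : t.Adj X Y :=
  Or.inl ⟨V, [], [], h⟩

theorem mem_of_head {C : Finset (Fin n)} (hC : C ∈ edges t.T)
    (h : (t.flat C).head? = some y) : y ∈ C :=
  (t.mem_flat hC).1 (List.mem_of_mem_head? h)

theorem head_flat_of_cons {C D : Finset (Fin n)} {l : List (Finset (Fin n))}
    (h : t.w C = D :: l) : (t.flat C).head? = (t.flat D).head? := by
  have hD : D ∈ t.w C := by simp [h]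
  obtain ⟨a, m, hm⟩ := List.exists_cons_of_ne_nil (t.flat_ne_nil (mem_edges_of_mem_w hD))
  rw [t.flat_of_mem (mem_T_of_mem_w hD), h, List.flatMap_cons, hm]
  rfl

/-- The edges below an edge `Z` which contain the first leaf of `Z` are first inputs. -/
theorem exists_w_eq_cons {Z C : Finset (Fin n)} (hZ : Z ∈ t.T) (hC : C ∈ edges t.T) (hCZ : C ⊂ Z)
    (hy : (t.flat Z).head? = some y) (hyC : y ∈ C) :
    (t.flat C).head? = some y ∧ ∃ V l, t.w V = C :: l := by
  induction h : n - C.card using Nat.strong_induction_on generalizing C with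
  | _ m ih =>
    subst h
    rcases t.isTree.exists_parent_of_mem_edges hC with h | ⟨V, hV, h⟩
    · exact absurd hCZ (h.2.2 Z (mem_edges_of_mem hZ) (WithTop.coe_lt_top _))
    have hVZ := t.isTree.parent_subset hV h hZ hCZ
    have hCV := ssubset_of_mem_inputs h
    have hVy : (t.flat V).head? = some y := by
      rcases eq_or_ne V Z with rfl | hne
      · exact hy
      · refine (ih (n - V.card) ?_ (mem_edges_of_mem hV) (lt_of_le_of_ne hVZ hne)
          (hCV.1 hyC) rfl).1
        have h1 := Finset.card_lt_card hCV
        have h2 := Finset.card_le_univ V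
        rw [Fintype.card_fin] at h2
        omega
    obtain ⟨D, l, hD⟩ := List.exists_cons_of_ne_nil (t.w_ne_nil hV)
    have hDw : D ∈ t.w V := by simp [hD]
    rw [head_flat_of_cons hD] at hVy
    have hCD : C = D := t.isTree.inputs_eq_of_mem h (inputs_of_mem_w hDw) hyC
      (mem_of_head (mem_edges_of_mem_w hDw) hVy)
    subst hCD
    exact ⟨hVy, V, l, hD⟩

theorem Adj.not_first (h : t.Adj X Y) {V : Finset (Fin n)} {l : List (Finset (Fin n))}
    (h' : t.w V = Y :: l) : False := by
  have hY' : Y ∈ t.w V := by simp [h']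
  have hV := isVertex_coe (mem_T_of_mem_w hY')
  rcases h with ⟨W, l₁, l₂, h⟩ | ⟨m, h⟩
  · have hY : Y ∈ t.w W := by simp [h]
    have : W = V := WithTop.coe_injective (t.isTree.vertex_unique
      (isVertex_coe (mem_T_of_mem_w hY)) hV (inputs_of_mem_w hY) (inputs_of_mem_w hY'))
    subst this
    have hnd := t.nodup_w W
    have e : l₁ ++ X :: Y :: l₂ = (l₁ ++ [X]) ++ Y :: l₂ := by simp
    rw [h, e] at hnd
    have := (nodup_append_cons_inj (m₁ := []) hnd (by rw [← e, ← h, h']; rfl)).1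
    simp at this
  · have hY : Y ∈ t.root := by rw [h]; exact Cycle.mem_coe_iff.2 (by simp)
    exact WithTop.coe_ne_top (t.isTree.vertex_unique hV isVertex_top (inputs_of_mem_w hY')
      ((t.mem_root Y).1 hY))

/-- The right one of two neighbouring edges is the largest edge with its first leaf, so it is
determined by this leaf. -/
theorem Adj.right_unique (h : t.Adj X Y) (h' : t.Adj X' Y')
    (hy : (t.flat Y).head? = some y) (hy' : (t.flat Y').head? = some y) : Y = Y' := by
  have key : ∀ {X Y X' Y' : Finset (Fin n)}, t.Adj X Y → t.Adj X' Y' →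
      (t.flat Y).head? = some y → (t.flat Y').head? = some y → Y ⊆ Y' → Y = Y' := by
    intro X Y X' Y' h h' hy hy' hs
    by_contra hne
    have hlt : Y ⊂ Y' := lt_of_le_of_ne hs hne
    obtain ⟨-, V, l, hV⟩ := exists_w_eq_cons
      (t.isTree.mem_of_ssubset h.right_mem h'.right_mem hlt) h.right_mem hlt hy'
      (mem_of_head h.right_mem hy)
    exact h.not_first hV
  rcases t.isTree.edges_nested h.right_mem h'.right_mem with hh | hh | hh
  · exact key h h' hy hy' hh
  · exact (key h' h hy' hy hh).symm
  · exact absurd (mem_of_head h'.right_mem hy')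
      (Finset.disjoint_left.1 hh (mem_of_head h.right_mem hy))

theorem Adj.left_unique (h : t.Adj X Y) (h' : t.Adj X' Y) : X = X' := by
  rcases h with ⟨V, l₁, l₂, h⟩ | ⟨l, h⟩ <;> rcases h' with ⟨W, m₁, m₂, h'⟩ | ⟨m, h'⟩
  · have hY : Y ∈ t.w V := by simp [h]
    have hY' : Y ∈ t.w W := by simp [h']
    have : V = W := WithTop.coe_injective (t.isTree.vertex_unique
      (isVertex_coe (mem_T_of_mem_w hY)) (isVertex_coe (mem_T_of_mem_w hY')) (inputs_of_mem_w hY)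
      (inputs_of_mem_w hY'))
    subst this
    have e : l₁ ++ X :: Y :: l₂ = (l₁ ++ [X]) ++ Y :: l₂ := by simp
    have e' : m₁ ++ X' :: Y :: m₂ = (m₁ ++ [X']) ++ Y :: m₂ := by simp
    have hnd := t.nodup_w V
    rw [h, e] at hnd
    have := (nodup_append_cons_inj (m₁ := m₁ ++ [X']) (m₂ := m₂) hnd
      (by rw [← e, ← e', ← h, ← h'])).1
    simpa using (List.append_inj' this rfl).2
  · have hY : Y ∈ t.w V := by simp [h]
    have hY' : Y ∈ t.root := by rw [h']; exact Cycle.mem_coe_iff.2 (by simp)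
    exact absurd (t.isTree.vertex_unique (isVertex_coe (mem_T_of_mem_w hY)) isVertex_top
      (inputs_of_mem_w hY) ((t.mem_root Y).1 hY')) WithTop.coe_ne_top
  · have hY : Y ∈ t.w W := by simp [h']
    have hY' : Y ∈ t.root := by rw [h]; exact Cycle.mem_coe_iff.2 (by simp)
    exact absurd (t.isTree.vertex_unique (isVertex_coe (mem_T_of_mem_w hY)) isVertex_top
      (inputs_of_mem_w hY) ((t.mem_root Y).1 hY')) WithTop.coe_ne_top
  · have h1 : (X :: Y :: l) ~r (Y :: (l ++ [X])) := List.isRotated_append (l := [X]) (l' := Y :: l)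
    have h2 : (X' :: Y :: m) ~r (Y :: (m ++ [X'])) :=
      List.isRotated_append (l := [X']) (l' := Y :: m)
    have h3 : (X :: Y :: l) ~r (X' :: Y :: m) := Cycle.coe_eq_coe.1 (h.symm.trans h')
    have hnd := t.nodup_root
    rw [h] at hnd
    have hnd' : (Y :: (l ++ [X])).Nodup := h1.nodup_iff.1 (Cycle.nodup_coe_iff.1 hnd)
    have := isRotated_cons_cons hnd' (h1.symm.trans (h3.trans h2))
    simpa using (List.append_inj' this rfl).2

/-- Every leaf `y`, apart from the first leaf of a tree with unary root, is the first leaf of the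
right one of two neighbouring edges: of the largest edge which begins with `y`. -/
theorem exists_adj (hy : ¬ (Finset.univ ∈ t.T ∧ (t.flat Finset.univ).head? = some y))
    (hn : 2 ≤ n) : ∃ X Y, t.Adj X Y ∧ (t.flat Y).head? = some y := by
  classical
  obtain ⟨Y, hY, hmax⟩ := Finset.exists_max_image
    ((edges t.T).filter fun Y => (t.flat Y).head? = some y) Finset.card
    ⟨{y}, Finset.mem_filter.2 ⟨singleton_mem_edges _ _, by simp⟩⟩
  simp only [Finset.mem_filter] at hY hmax
  rcases t.isTree.exists_parent_of_mem_edges hY.1 with h | ⟨V, hV, h⟩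
  · obtain ⟨l, hl⟩ := exists_cons_of_mem_cycle ((t.mem_root Y).2 h)
    rcases List.eq_nil_or_concat l with rfl | ⟨m, X, rfl⟩
    · exfalso
      have hYu : Y = Finset.univ := by
        ext i
        simp only [Finset.mem_univ, iff_true]
        obtain ⟨D, hD, hiD⟩ := exists_mem_inputs_top t.T i
        have := (t.mem_root D).2 hD
        rw [hl, Cycle.mem_coe_iff, List.mem_singleton] at this
        exact this ▸ hiD
      subst hYu
      exact hy ⟨IsTree.mem_of_mem_edges hY.1 (by simpa using hn), hY.2⟩
    · refine ⟨X, Y, Or.inr ⟨m, ?_⟩, hY.2⟩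
      rw [hl]
      refine Cycle.coe_eq_coe.2 ?_
      rw [List.concat_eq_append]
      exact List.isRotated_append (l := Y :: m) (l' := [X])
  · obtain ⟨l₁, l₂, hl⟩ := List.append_of_mem ((t.mem_w V hV Y).2 h)
    rcases List.eq_nil_or_concat l₁ with rfl | ⟨m, X, rfl⟩
    · exact absurd (hmax V ⟨mem_edges_of_mem hV, by rw [head_flat_of_cons hl]; exact hY.2⟩)
        (not_le.2 (Finset.card_lt_card (ssubset_of_mem_inputs h)))
    · exact ⟨X, Y, Or.inl ⟨V, m, l₂, by simpa using hl⟩, hY.2⟩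

theorem w_eq_of_pair {V : Finset (Fin n)} (hV : V = X ∪ Y) {l₁ l₂ : List (Finset (Fin n))}
    (h : t.w V = l₁ ++ X :: Y :: l₂) : t.w V = [X, Y] := by
  have hX : X ∈ t.w V := by simp [h]
  have hY : Y ∈ t.w V := by simp [h]
  have key : ∀ Z, Z ∉ l₁ ++ l₂ := by
    intro Z hZ
    have hZw : Z ∈ t.w V := by
      rw [h]
      simp only [List.mem_append, List.mem_cons] at hZ ⊢
      tauto
    obtain ⟨i, hi⟩ := t.isTree.edges_nonempty (mem_edges_of_mem_w hZw)
    have hiV := (ssubset_of_mem_w hZw).1 hi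
    have hnd := t.nodup_w V
    rw [h, List.nodup_append] at hnd
    simp only [List.nodup_cons, List.mem_cons, not_or] at hnd
    rw [hV] at hiV
    have hZXY : Z = X ∨ Z = Y := by
      rcases Finset.mem_union.1 hiV with h' | h'
      · exact Or.inl (t.isTree.inputs_eq_of_mem (inputs_of_mem_w hZw) (inputs_of_mem_w hX) hi h')
      · exact Or.inr (t.isTree.inputs_eq_of_mem (inputs_of_mem_w hZw) (inputs_of_mem_w hY) hi h')
    rcases List.mem_append.1 hZ with hZ | hZ
    · rcases hZXY with rfl | rfl
      · exact hnd.2.2 Z hZ Z (Or.inl rfl) rfl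
      · exact hnd.2.2 Z hZ Z (Or.inr (Or.inl rfl)) rfl
    · rcases hZXY with rfl | rfl
      · exact hnd.2.1.1.2 hZ
      · exact hnd.2.1.2.1 hZ
  have h0 : l₁ ++ l₂ = [] := List.eq_nil_iff_forall_not_mem.2 key
  rw [List.append_eq_nil_iff] at h0
  rw [h, h0.1, h0.2]
  rfl

theorem eq_union_of_w_eq {V : Finset (Fin n)} (h : t.w V = [X, Y]) : V = X ∪ Y := by
  have hX : X ∈ t.w V := by simp [h]
  have hY : Y ∈ t.w V := by simp [h]
  apply le_antisymm
  · intro i hi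
    obtain ⟨D, hD, hiD⟩ := t.isTree.exists_mem_inputs (mem_T_of_mem_w hX) hi
    have := (t.mem_w V (mem_T_of_mem_w hX) D).2 hD
    rw [h] at this
    simp only [List.mem_cons, List.not_mem_nil, or_false] at this
    rcases this with rfl | rfl
    · exact Finset.mem_union_left _ hiD
    · exact Finset.mem_union_right _ hiD
  · exact Finset.union_subset (ssubset_of_mem_w hX).1 (ssubset_of_mem_w hY).1

/-- If the union of two neighbouring edges is an edge, it has no further inputs. -/
theorem Adj.w_union (h : t.Adj X Y) (ha : X ∪ Y ∈ t.T) : t.w (X ∪ Y) = [X, Y] := by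
  obtain ⟨v, hv, hX, hY, hne⟩ := h.exists_vertex
  have hXs : X ⊂ X ∪ Y := by
    refine lt_of_le_of_ne Finset.subset_union_left fun e => ?_
    obtain ⟨i, hi⟩ := t.isTree.edges_nonempty hY.1
    have : i ∈ X := e ▸ Finset.mem_union_right X hi
    exact hne (t.isTree.inputs_eq_of_mem hX hY this hi)
  rcases h with ⟨V, l₁, l₂, h⟩ | ⟨l, h⟩
  · have hXw : X ∈ t.w V := by simp [h]
    have hYw : Y ∈ t.w V := by simp [h]
    have hVT := mem_T_of_mem_w hXw
    have hVa : V = X ∪ Y := le_antisymm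
      (t.isTree.parent_subset hVT (inputs_of_mem_w hXw) ha hXs)
      (Finset.union_subset (ssubset_of_mem_w hXw).1 (ssubset_of_mem_w hYw).1)
    rw [← hVa]
    exact w_eq_of_pair hVa h
  · have hX : X ∈ t.root := by rw [h]; exact Cycle.mem_coe_iff.2 (by simp)
    exact absurd hXs (((t.mem_root X).1 hX).2.2 _ (mem_edges_of_mem ha) (WithTop.coe_lt_top _))

/-- When an edge with the two inputs `X` and `Y` is contracted, these remain neighbours. -/
theorem adj_contract_of_w_eq {a : Finset (Fin n)} (ha : a ∈ t.T) (h : t.w a = [X, Y]) :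
    (t.contract a ha).Adj X Y := by
  rcases t.isTree.exists_parent_of_mem_edges (mem_edges_of_mem ha) with h' | ⟨V, hV, h'⟩
  · obtain ⟨l, hl⟩ := exists_cons_of_mem_cycle ((t.mem_root a).2 h')
    right
    refine ⟨l, ?_⟩
    have hnd := t.nodup_root
    rw [hl] at hnd
    have e := t.flatMap_subst_append_cons (l₁ := []) (Cycle.nodup_coe_iff.1 hnd)
    simp only [List.nil_append] at e
    rw [contract_root, hl, cycleBind_coe, e, h]
    rfl
  · left
    have hVa : V ≠ a := (ssubset_of_mem_inputs h').ne'
    obtain ⟨l₁, l₂, hl⟩ := List.append_of_mem ((t.mem_w V hV a).2 h')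
    refine ⟨V, l₁, l₂, ?_⟩
    rw [t.contract_w ha hVa, hl, t.flatMap_subst_append_cons (hl ▸ t.nodup_w V), h]
    rfl

/-- The leaves below an edge form a contiguous part of the leaves below each vertex above. -/
theorem flat_infix {C Z : Finset (Fin n)} (hC : C ∈ edges t.T) (hZ : Z ∈ t.T) (hCZ : C ⊆ Z) :
    t.flat C <:+: t.flat Z := by
  induction h : n - C.card using Nat.strong_induction_on generalizing C with
  | _ m ih =>
    subst h
    rcases eq_or_ne C Z with rfl | hne
    · exact List.infix_rfl
    have hCZ' : C ⊂ Z := lt_of_le_of_ne hCZ hne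
    rcases t.isTree.exists_parent_of_mem_edges hC with h | ⟨V, hV, h⟩
    · exact absurd hCZ' (h.2.2 Z (mem_edges_of_mem hZ) (WithTop.coe_lt_top _))
    have hVZ := t.isTree.parent_subset hV h hZ hCZ'
    have hCV := ssubset_of_mem_inputs h
    refine List.IsInfix.trans ?_ (ih (n - V.card) ?_ (mem_edges_of_mem hV) hVZ rfl)
    · obtain ⟨l₁, l₂, hl⟩ := List.append_of_mem ((t.mem_w V hV C).2 h)
      rw [t.flat_of_mem hV, hl, List.flatMap_append, List.flatMap_cons]
      exact ⟨_, _, by rw [List.append_assoc]⟩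
    · have h1 := Finset.card_lt_card hCV
      have h2 := Finset.card_le_univ V
      rw [Fintype.card_fin] at h2
      omega

end PlanarTree
namespace PlanarTree

variable {n : ℕ} (t : PlanarTree n) (o : Fin n)

/-! ### The matching of planar trees -/

/-- The set of leaves, without the first `i` ones, is an edge (for a tree with unary root
whose first leaf is `o`). -/
def HasTail (i : ℕ) : Prop :=
  Finset.univ ∈ t.T ∧ (t.flat Finset.univ).head? = some o ∧
    ((t.flat Finset.univ).drop i).toFinset ∈ t.T

theorem length_flat_univ (h : Finset.univ ∈ t.T) : (t.flat Finset.univ).length = n := by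
  rw [t.length_flat (mem_edges_of_mem h), Finset.card_univ, Fintype.card_fin]

theorem card_drop (h : Finset.univ ∈ t.T) (i : ℕ) :
    ((t.flat Finset.univ).drop i).toFinset.card = n - i := by
  rw [List.toFinset_card_of_nodup ((t.nodup_flat _).sublist (List.drop_sublist _ _)),
    List.length_drop, t.length_flat_univ h]

theorem not_hasTail : ¬ t.HasTail o (n - 1) := fun h => by
  have h1 := t.isTree.two_le_card _ h.2.2
  rw [t.card_drop h.1] at h1
  omega

open Classical in
/-- The number of vertices of the right comb with first leaf `o` which the tree begins
with.  It is at most `n - 1`, and equal to `n - 1` only if the whole tree is this comb. -/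
noncomputable def stage : ℕ :=
  Nat.find (p := fun i => ¬ t.HasTail o i) ⟨n - 1, t.not_hasTail o⟩

theorem not_hasTail_stage : ¬ t.HasTail o (t.stage o) := by
  classical
  exact Nat.find_spec (⟨n - 1, t.not_hasTail o⟩ : ∃ i, ¬ t.HasTail o i)

variable {t o}

theorem hasTail_of_lt {i : ℕ} (h : i < t.stage o) : t.HasTail o i := by
  classical
  exact not_not.1 (Nat.find_min (⟨n - 1, t.not_hasTail o⟩ : ∃ i, ¬ t.HasTail o i) h)

theorem stage_le_of_not {i : ℕ} (h : ¬ t.HasTail o i) : t.stage o ≤ i := by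
  classical
  exact Nat.find_min' (⟨n - 1, t.not_hasTail o⟩ : ∃ i, ¬ t.HasTail o i) h

theorem stage_le : t.stage o ≤ n - 1 := stage_le_of_not (t.not_hasTail o)

theorem hasTail_contract {S : Finset (Fin n)} (hS : S ∈ t.T) {i : ℕ} :
    (t.contract S hS).HasTail o i ↔
      t.HasTail o i ∧ S ≠ Finset.univ ∧ S ≠ ((t.flat Finset.univ).drop i).toFinset := by
  unfold HasTail
  by_cases hu : S = Finset.univ
  · subst hu
    simp
  · rw [t.flat_contract hS (Ne.symm hu), mem_contract_T, mem_contract_T]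
    constructor
    · rintro ⟨⟨-, h1⟩, h2, h3, h4⟩
      exact ⟨⟨h1, h2, h4⟩, hu, h3.symm⟩
    · rintro ⟨⟨h1, h2, h3⟩, h4, h5⟩
      exact ⟨⟨h4.symm, h1⟩, h2, h5.symm, h3⟩

/-- A contraction does not make the initial comb longer. -/
theorem stage_contract_le {S : Finset (Fin n)} (hS : S ∈ t.T) :
    (t.contract S hS).stage o ≤ t.stage o :=
  stage_le_of_not fun h => t.not_hasTail_stage o ((hasTail_contract hS).1 h).1

theorem ne_univ_of_stage_eq {S : Finset (Fin n)} (hS : S ∈ t.T)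
    (h : (t.contract S hS).stage o = t.stage o) (h0 : 0 < t.stage o) : S ≠ Finset.univ :=
  ((hasTail_contract hS).1 (hasTail_of_lt (h ▸ h0))).2.1

theorem stage_contract_eq {S : Finset (Fin n)} (hS : S ∈ t.T)
    (h : ∀ i < t.stage o, S ≠ ((t.flat Finset.univ).drop i).toFinset) :
    (t.contract S hS).stage o = t.stage o := by
  refine le_antisymm (stage_contract_le hS) (le_of_not_gt fun hlt => ?_)
  refine (t.contract S hS).not_hasTail_stage o ((hasTail_contract hS).2 ⟨hasTail_of_lt hlt, ?_,
    h _ hlt⟩)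
  have h0 : 0 < t.stage o := by omega
  have hu := (hasTail_of_lt h0).1
  have := h 0 h0
  rwa [List.drop_zero, t.toFinset_flat (mem_edges_of_mem hu)] at this

variable (t o) in
/-- The leaf at which the matching changes the tree: the first leaf above the initial comb, which is
`o` if there is no comb.  The default value of `getD` is not attained, because the comb has at most
`n - 1` vertices. -/
noncomputable def pivot : Fin n :=
  if t.stage o = 0 then o else ((t.flat Finset.univ)[t.stage o]?).getD o

theorem pivot_contract {S : Finset (Fin n)} (hS : S ∈ t.T)
    (h : (t.contract S hS).stage o = t.stage o) : (t.contract S hS).pivot o = t.pivot o := by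
  unfold pivot
  rw [h]
  split_ifs with h0
  · rfl
  · rw [t.flat_contract hS (ne_univ_of_stage_eq hS h (Nat.pos_of_ne_zero h0)).symm]

theorem head_drop_stage (hu : Finset.univ ∈ t.T) (ho : (t.flat Finset.univ).head? = some o)
    (hs : t.stage o < n) :
    ((t.flat Finset.univ).drop (t.stage o)).head? = some (t.pivot o) := by
  rw [List.head?_drop]
  unfold pivot
  split_ifs with h0
  · rw [h0, ← List.head?_eq_getElem?, ho]
  · have : t.stage o < (t.flat Finset.univ).length := by rwa [t.length_flat_univ hu]
    rw [List.getElem?_eq_getElem this]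
    rfl

theorem pivot_not_first (hs : t.stage o + 1 < n) :
    ¬ (Finset.univ ∈ t.T ∧ (t.flat Finset.univ).head? = some (t.pivot o)) := by
  rintro ⟨hu, hp⟩
  by_cases h0 : t.stage o = 0
  · refine t.not_hasTail_stage o ⟨hu, ?_, ?_⟩
    · rw [hp, pivot, if_pos h0]
    · rw [h0, List.drop_zero, t.toFinset_flat (mem_edges_of_mem hu)]
      exact hu
  · have ho := (hasTail_of_lt (Nat.pos_of_ne_zero h0)).2.1
    have h1 := head_drop_stage hu ho (by omega)
    rw [List.head?_drop, ← hp, List.head?_eq_getElem?] at h1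
    exact h0 ((List.getElem?_inj (by rw [t.length_flat_univ hu]; omega)
      (t.nodup_flat _)).1 h1)

variable (t o) in
/-- The neighbouring edges `X` and `Y` such that the pivot is the first leaf of `Y`.  There is
exactly one such pair as soon as there are two leaves. -/
noncomputable def pivotPair : Finset (Fin n) × Finset (Fin n) :=
  Classical.epsilon fun p : Finset (Fin n) × Finset (Fin n) =>
    t.Adj p.1 p.2 ∧ (t.flat p.2).head? = some (t.pivot o)

theorem pivotPair_eq {X Y : Finset (Fin n)} (h : t.Adj X Y)
    (hy : (t.flat Y).head? = some (t.pivot o)) : t.pivotPair o = (X, Y) := by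
  have hex : ∃ p : Finset (Fin n) × Finset (Fin n),
    t.Adj p.1 p.2 ∧ (t.flat p.2).head? = some (t.pivot o) := ⟨(X, Y), h, hy⟩
  have h1 : t.Adj (t.pivotPair o).1 (t.pivotPair o).2 ∧
    (t.flat (t.pivotPair o).2).head? = some (t.pivot o) := Classical.epsilon_spec hex
  have h2 := h1.1.right_unique h h1.2 hy
  have h3 := h1.1
  rw [h2] at h3
  exact Prod.ext (h3.left_unique h) h2

theorem pivotPair_spec (hs : t.stage o + 1 < n) :
    t.Adj (t.pivotPair o).1 (t.pivotPair o).2 ∧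
      (t.flat (t.pivotPair o).2).head? = some (t.pivot o) := by
  obtain ⟨X, Y, h, hy⟩ := exists_adj (pivot_not_first hs) (by omega)
  rw [pivotPair_eq h hy]
  exact ⟨h, hy⟩

variable (t o) in
/-- The edge which the matching adds to or removes from the tree. -/
noncomputable def toggle : Finset (Fin n) := (t.pivotPair o).1 ∪ (t.pivotPair o).2

variable (t o) in
/-- The trees from which the matching removes an edge. -/
def Upper : Prop := t.stage o + 1 < n ∧ t.toggle o ∈ t.T

variable (t o) in
/-- The trees to which the matching adds an edge. -/
def Lower : Prop := t.stage o + 1 < n ∧ t.toggle o ∉ t.T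

variable (t o) in
/-- The lexicographic rank of the pair consisting of the size of the comb at the beginning of the
tree and the size of the two edges at the pivot.  The latter is at most `2 * n`. -/
noncomputable def rank : ℕ :=
  t.stage o * (2 * n + 1) + ((t.pivotPair o).1.card + (t.pivotPair o).2.card)

theorem card_pivotPair_le : (t.pivotPair o).1.card + (t.pivotPair o).2.card ≤ 2 * n := by
  have h1 := Finset.card_le_univ (t.pivotPair o).1
  have h2 := Finset.card_le_univ (t.pivotPair o).2
  rw [Fintype.card_fin] at h1 h2
  omega

theorem rank_lt_of_stage_lt {t' : PlanarTree n} (h : t.stage o < t'.stage o) :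
    t.rank o < t'.rank o := by
  have h1 := card_pivotPair_le (t := t) (o := o)
  have h2 : (t.stage o + 1) * (2 * n + 1) ≤ t'.stage o * (2 * n + 1) :=
    Nat.mul_le_mul_right _ h
  unfold rank
  rw [add_mul] at h2
  omega

theorem rank_le : t.rank o ≤ n * (2 * n + 1) + 2 * n := by
  have h1 := card_pivotPair_le (t := t) (o := o)
  have h2 : t.stage o * (2 * n + 1) ≤ n * (2 * n + 1) :=
    Nat.mul_le_mul_right _ (stage_le.trans (Nat.sub_le _ _))
  unfold rank
  omega

theorem Upper.w_toggle (h : t.Upper o) :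
    t.w (t.toggle o) = [(t.pivotPair o).1, (t.pivotPair o).2] :=
  (pivotPair_spec h.1).1.w_union h.2

theorem flat_of_w_eq {a X Y : Finset (Fin n)} (h : t.w a = [X, Y]) :
    t.flat a = t.flat X ++ t.flat Y := by
  rw [t.flat_of_mem (mem_T_of_mem_w (C := X) (by simp [h])), h]
  simp

theorem flat_eq_drop (hu : Finset.univ ∈ t.T) {a : Finset (Fin n)} (ha : a ∈ edges t.T) {i : ℕ}
    (h : a = ((t.flat Finset.univ).drop i).toFinset) : t.flat a = (t.flat Finset.univ).drop i :=
  eq_of_sublist (t.nodup_flat _) (flat_infix ha hu (Finset.subset_univ _)).sublist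
    (List.drop_sublist _ _) (by rw [t.toFinset_flat ha, ← h])

/-- The edge at the pivot does not belong to the initial comb, since its second input would prolong
the comb. -/
theorem Upper.stage_contract (h : t.Upper o) :
    (t.contract (t.toggle o) h.2).stage o = t.stage o := by
  refine stage_contract_eq h.2 fun i hi he => ?_
  have hs : t.stage o + 1 < n := h.1
  obtain ⟨hu, ho, -⟩ := hasTail_of_lt hi
  obtain ⟨hadj, hy⟩ := pivotPair_spec h.1
  have h1 := flat_eq_drop hu (mem_edges_of_mem h.2) he
  rw [flat_of_w_eq h.w_toggle] at h1
  have h2 := head_drop_stage hu ho (by omega)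
  have hlen := t.length_flat_univ hu
  set X := (t.pivotPair o).1
  set Y := (t.pivotPair o).2
  have h3 : (t.flat Finset.univ).drop (i + (t.flat X).length) = t.flat Y := by
    rw [← List.drop_drop, ← h1, List.drop_left]
  have h4 : t.stage o = i + (t.flat X).length := by
    rw [List.head?_drop] at h2
    rw [← h3, List.head?_drop] at hy
    exact (List.getElem?_inj (by omega) (t.nodup_flat _)).1 (h2.trans hy.symm)
  rw [← h4] at h3
  refine t.not_hasTail_stage o ⟨hu, ho, ?_⟩
  have hc := t.card_drop hu (t.stage o)
  rw [h3, t.toFinset_flat hadj.right_mem] at hc ⊢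
  exact IsTree.mem_of_mem_edges hadj.right_mem (by omega)

theorem ne_of_w_eq {a X Y : Finset (Fin n)} (h : t.w a = [X, Y]) : X ≠ a ∧ Y ≠ a :=
  ⟨(ssubset_of_mem_w (t := t) (V := a) (C := X) (by simp [h])).ne,
    (ssubset_of_mem_w (t := t) (V := a) (C := Y) (by simp [h])).ne⟩

theorem Upper.pivotPair_contract (h : t.Upper o) :
    (t.contract (t.toggle o) h.2).pivotPair o = t.pivotPair o := by
  refine pivotPair_eq (X := (t.pivotPair o).1) (Y := (t.pivotPair o).2)
    (adj_contract_of_w_eq h.2 h.w_toggle) ?_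
  rw [pivot_contract h.2 h.stage_contract, t.flat_contract h.2 (ne_of_w_eq h.w_toggle).2]
  exact (pivotPair_spec h.1).2

theorem Upper.lower_contract (h : t.Upper o) : (t.contract (t.toggle o) h.2).Lower o := by
  refine ⟨by rw [h.stage_contract]; exact h.1, ?_⟩
  have e : (t.contract (t.toggle o) h.2).toggle o = t.toggle o :=
    congrArg (fun p : Finset (Fin n) × Finset (Fin n) => p.1 ∪ p.2) h.pivotPair_contract
  rw [e, mem_contract_T]
  exact fun h' => h'.1 rfl

theorem Upper.rank_contract (h : t.Upper o) :
    (t.contract (t.toggle o) h.2).rank o = t.rank o := by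
  rw [rank, h.pivotPair_contract, h.stage_contract, rank]

/-- Every lower tree arises from an upper tree by the contraction of the edge at its pivot. -/
theorem Lower.exists_upper (h : t.Lower o) :
    ∃ (U : PlanarTree n) (hU : U.Upper o), U.contract (U.toggle o) hU.2 = t := by
  obtain ⟨hadj, hy⟩ := pivotPair_spec h.1
  have ha := h.2
  rw [toggle] at ha
  obtain ⟨U, hU, hc, hw⟩ : ∃ (U : PlanarTree n)
      (h : (t.pivotPair o).1 ∪ (t.pivotPair o).2 ∈ U.T), U.contract _ h = t ∧
      U.w ((t.pivotPair o).1 ∪ (t.pivotPair o).2) = [(t.pivotPair o).1, (t.pivotPair o).2] := by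
    rcases hadj with ⟨V, l₁, l₂, hV⟩ | ⟨l, hl⟩
    · refine t.exists_expand_vertex hV fun h0 => ha ?_
      rw [List.append_eq_nil_iff] at h0
      rw [h0.1, h0.2] at hV
      rw [← eq_union_of_w_eq hV]
      exact mem_T_of_mem_w (C := (t.pivotPair o).1) (by simp [hV])
    · obtain ⟨U, hU, hc, hw, -⟩ := t.exists_expand_root hl
      exact ⟨U, hU, hc, hw⟩
  set X := (t.pivotPair o).1
  set Y := (t.pivotPair o).2
  have hflat : ∀ C, C ≠ X ∪ Y → t.flat C = U.flat C := fun C hC => by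
    rw [← U.flat_contract hU hC, hc]
  have hYne : Y ≠ X ∪ Y := (ne_of_w_eq hw).2
  have hXU : X ∈ edges U.T := mem_edges_of_mem_w (V := X ∪ Y) (by simp [hw])
  have hstage : (U.contract (X ∪ Y) hU).stage o = U.stage o := by
    refine stage_contract_eq hU fun i hi he => ?_
    obtain ⟨hu, ho, hT⟩ := hasTail_of_lt hi
    have h1 := flat_eq_drop hu (mem_edges_of_mem hU) he
    have hts : t.stage o = i := by
      refine le_antisymm (stage_le_of_not fun hh => ?_) (le_of_not_gt fun hlt => ?_)
      · rw [← hc, hasTail_contract] at hh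
        exact hh.2.2 he
      · have hh := t.not_hasTail_stage o
        rw [← hc, hasTail_contract] at hh
        refine hh ⟨hasTail_of_lt (by rw [hc]; omega), ?_, ?_⟩
        · intro e
          have := U.card_drop hu i
          rw [← he, e, Finset.card_univ, Fintype.card_fin] at this
          have := stage_le (t := U) (o := o)
          omega
        · intro e
          rw [hc, he] at e
          have h2 := U.card_drop hu i
          rw [e, U.card_drop hu] at h2
          have := stage_le (t := U) (o := o)
          omega
    have h2 : ((U.flat Finset.univ).drop i).head? = some (t.pivot o) := by
      by_cases h0 : t.stage o = 0
      · rw [← hts, h0, List.drop_zero, ho, pivot, if_pos h0]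
      · have hu' : Finset.univ ≠ X ∪ Y := fun e => by
          have := U.card_drop hu i
          rw [← he, ← e, Finset.card_univ, Fintype.card_fin] at this
          have := stage_le (t := U) (o := o)
          omega
        have hut : Finset.univ ∈ t.T := by
          rw [← hc, mem_contract_T]
          exact ⟨hu', hu⟩
        have := head_drop_stage (t := t) (o := o) hut (by rw [hflat _ hu', ho])
          (by have := h.1; omega)
        rwa [hflat _ hu', hts] at this
    rw [← h1, flat_of_w_eq hw, List.head?_append_of_ne_nil _ (U.flat_ne_nil hXU)] at h2
    exact Finset.disjoint_left.1 hadj.disjoint (mem_of_head hXU h2)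
      (mem_of_head hadj.right_mem hy)
  have hpivot := pivot_contract hU hstage
  rw [hc] at hpivot hstage
  have hpair : U.pivotPair o = (X, Y) := by
    refine pivotPair_eq (adj_of_w_eq hw) ?_
    rw [← hflat _ hYne, hy, hpivot]
  have htog : U.toggle o = X ∪ Y := by rw [toggle, hpair]
  refine ⟨U, ⟨by rw [← hstage]; exact h.1, by rw [htog]; exact hU⟩, ?_⟩
  simp only [htog]
  exact hc

/-- An upper tree is determined by the lower tree which it is matched with. -/
theorem Upper.eq_of_contract_eq {t' : PlanarTree n} (h : t.Upper o) (h' : t'.Upper o)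
    (he : t.contract (t.toggle o) h.2 = t'.contract (t'.toggle o) h'.2) : t = t' := by
  have h1 : t.pivotPair o = t'.pivotPair o := by
    rw [← h.pivotPair_contract, he, h'.pivotPair_contract]
  have h2 : t.toggle o = t'.toggle o := by rw [toggle, toggle, h1]
  have h3 : t.w (t.toggle o) = t'.w (t.toggle o) := by
    rw [h.w_toggle, h2, h'.w_toggle, h1]
  have h4 : t.toggle o ∈ t'.T := h2 ▸ h'.2
  refine PlanarTree.eq_of_contract_eq h.2 h4 h3 ?_
  rw [he]
  simp only [h2]

/-- The lower trees obtained from an upper tree by other contractions have smaller rank.  Either the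
initial comb becomes shorter, or one of the two edges at the pivot is contracted and replaced by a
smaller one, since otherwise the result is an upper tree. -/
theorem Upper.rank_lt (h : t.Upper o) {S : Finset (Fin n)} (hS : S ∈ t.T) (hne : S ≠ t.toggle o)
    (hl : (t.contract S hS).Lower o) : (t.contract S hS).rank o < t.rank o := by
  rcases (stage_contract_le (o := o) hS).lt_or_eq with hlt | heq
  · exact rank_lt_of_stage_lt hlt
  have hw := h.w_toggle
  obtain ⟨hadj, hy⟩ := pivotPair_spec h.1
  have hp := pivot_contract hS heq
  have hc := t.contract_w hS hne.symm
  have htog : t.toggle o = (t.pivotPair o).1 ∪ (t.pivotPair o).2 := rfl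
  set X := (t.pivotPair o).1 with hXdef
  set Y := (t.pivotPair o).2 with hYdef
  set a := t.toggle o
  have hXY : X ≠ Y := by
    intro e
    obtain ⟨v, -, -, -, h⟩ := hadj.exists_vertex
    exact h e
  rw [hw] at hc
  have hrank : ∀ X' Y', (t.contract S hS).Adj X' Y' →
      ((t.contract S hS).flat Y').head? = some (t.pivot o) →
      X'.card + Y'.card < X.card + Y.card → (t.contract S hS).rank o < t.rank o := by
    intro X' Y' h1 h2 h3
    rw [← hp] at h2
    rw [rank, rank, heq, pivotPair_eq h1 h2]
    exact Nat.add_lt_add_left h3 _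
  by_cases hSX : S = X
  · subst hSX
    simp only [List.flatMap_cons, subst_self, List.flatMap_nil, List.append_nil] at hc
    rw [subst, if_neg hXY.symm] at hc
    rcases List.eq_nil_or_concat (t.w X) with h0 | ⟨m, Z, hm⟩
    · exact absurd h0 (t.w_ne_nil hS)
    · have hZ : Z ∈ t.w X := by simp [hm]
      refine hrank Z Y (Or.inl ⟨a, m, [], by rw [hc, hm]; simp⟩) ?_ ?_
      · rw [t.flat_contract hS hXY.symm, hy]
      · have := Finset.card_lt_card (ssubset_of_mem_w hZ)
        omega
  by_cases hSY : S = Y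
  · subst hSY
    simp only [List.flatMap_cons, subst_self, List.flatMap_nil, List.append_nil] at hc
    rw [subst, if_neg hXY] at hc
    obtain ⟨Z, m, hm⟩ := List.exists_cons_of_ne_nil (t.w_ne_nil hS)
    have hZ : Z ∈ t.w Y := by simp [hm]
    refine hrank X Z (Or.inl ⟨a, [], m, by rw [hc, hm]; simp⟩) ?_ ?_
    · rw [t.flat_contract hS (ssubset_of_mem_w hZ).ne, ← head_flat_of_cons hm, hy]
    · have := Finset.card_lt_card (ssubset_of_mem_w hZ)
      omega
  · exfalso
    have hS' : S ∉ [X, Y] := by simp [hSX, hSY]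
    rw [t.flatMap_subst_of_notMem hS'] at hc
    have hpair : (t.contract S hS).pivotPair o = (X, Y) := by
      refine pivotPair_eq (adj_of_w_eq hc) ?_
      rw [hp, t.flat_contract hS (Ne.symm hSY), hy]
    refine hl.2 ?_
    rw [toggle, hpair, mem_contract_T]
    exact ⟨hne.symm, h.2⟩

end PlanarTree

/-! ### The coboundary and its exactness -/

theorem edgeSign_mul_self {n : ℕ} (T : Finset (Finset (Fin n))) (S : Finset (Fin n)) :
    edgeSign T S * edgeSign T S = 1 := by
  rw [edgeSign, ← pow_add, ← two_mul, pow_mul]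
  simp

/-- The signs of the contraction of two edges in both orders are opposite. -/
theorem edgeSign_anticomm {n : ℕ} {T : Finset (Finset (Fin n))} {S S' : Finset (Fin n)}
    (hS : S ∈ T) (hS' : S' ∈ T) (h : S ≠ S') :
    edgeSign T S * edgeSign (T.erase S) S' = -(edgeSign T S' * edgeSign (T.erase S') S) := by
  classical
  have key : ∀ {S S' : Finset (Fin n)}, S ∈ T → toColex S < toColex S' →
      edgeSign T S * edgeSign (T.erase S) S' = -(edgeSign T S' * edgeSign (T.erase S') S) := by
    intro S S' hS hlt
    have h1 : (T.erase S').filter (fun U => toColex U < toColex S) =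
        T.filter fun U => toColex U < toColex S := by
      ext U
      simp only [Finset.mem_filter, Finset.mem_erase]
      constructor
      · rintro ⟨⟨-, h1⟩, h2⟩; exact ⟨h1, h2⟩
      · rintro ⟨h1, h2⟩
        refine ⟨⟨?_, h1⟩, h2⟩
        rintro rfl
        exact lt_asymm hlt h2
    have hm : S ∈ T.filter fun U => toColex U < toColex S' := by simp [hS, hlt]
    have h2 : (T.filter fun U => toColex U < toColex S').card =
        ((T.erase S).filter fun U => toColex U < toColex S').card + 1 := by
      rw [Finset.filter_erase, Finset.card_erase_of_mem hm]
      have := Finset.card_pos.2 ⟨S, hm⟩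
      omega
    rw [edgeSign, edgeSign, edgeSign, edgeSign, h1, h2, pow_succ]
    ring
  rcases lt_trichotomy (toColex S) (toColex S') with hlt | heq | hgt
  · exact key hS hlt
  · exact absurd (toColex_inj.1 heq) h
  · rw [key hS' hgt, neg_neg]

/-- A list can be recovered from the concatenation of disjoint nonempty lists indexed by it. -/
theorem eq_of_flatMap_eq {α β : Type} {f : α → List β} {l l' : List α}
    (h0 : ∀ a ∈ l, f a ≠ []) (h0' : ∀ a ∈ l', f a ≠ [])
    (hd : ∀ a ∈ l, ∀ b ∈ l', ∀ x, x ∈ f a → x ∈ f b → a = b)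
    (h : l.flatMap f = l'.flatMap f) : l = l' := by
  induction l generalizing l' with
  | nil =>
    cases l' with
    | nil => rfl
    | cons b l' =>
      rw [List.flatMap_nil, List.flatMap_cons] at h
      exact absurd (List.append_eq_nil_iff.1 h.symm).1 (h0' b (by simp))
  | cons a l ih =>
    cases l' with
    | nil =>
      rw [List.flatMap_nil, List.flatMap_cons] at h
      exact absurd (List.append_eq_nil_iff.1 h).1 (h0 a (by simp))
    | cons b l' =>
      rw [List.flatMap_cons, List.flatMap_cons] at h
      obtain ⟨x, m, hx⟩ := List.exists_cons_of_ne_nil (h0 a (by simp))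
      obtain ⟨y, m', hy⟩ := List.exists_cons_of_ne_nil (h0' b (by simp))
      have hxy : x = y := by
        rw [hx, hy] at h
        exact (List.cons.inj h).1
      have hab : a = b := hd a (by simp) b (by simp) x (by simp [hx]) (by simp [hy, hxy])
      subst hab
      rw [ih (fun a ha => h0 a (by simp [ha])) (fun a ha => h0' a (by simp [ha]))
        (fun a ha b hb => hd a (by simp [ha]) b (by simp [hb])) (List.append_cancel_left h)]

namespace PlanarTree

variable {n : ℕ} {k : Type u} [Field k]

/-- The coboundary of a cochain on planar trees, a sum over the contractions of edges. -/
def coboundary (F : PlanarTree n → k) (t : PlanarTree n) : k :=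
  ∑ S : {S // S ∈ t.T}, edgeSign t.T S.1 • F (t.contract S.1 S.2)

theorem coboundary_coboundary (F : PlanarTree n → k) (t : PlanarTree n) :
    coboundary (coboundary F) t = 0 := by
  classical
  simp only [coboundary, Finset.smul_sum, smul_smul]
  rw [Finset.sum_sigma']
  have hne : ∀ x : (S : {S // S ∈ t.T}) × {S' // S' ∈ (t.contract S.1 S.2).T},
      x.2.1 ≠ x.1.1 ∧ x.2.1 ∈ t.T := fun x => (t.mem_contract_T x.1.2).1 x.2.2
  refine Finset.sum_involution (fun x _ => ⟨⟨x.2.1, (hne x).2⟩, ⟨x.1.1,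
    (t.mem_contract_T (hne x).2).2 ⟨(hne x).1.symm, x.1.2⟩⟩⟩) ?_ ?_ ?_ ?_
  · rintro ⟨⟨S, hS⟩, ⟨S', hS'⟩⟩ -
    have h : S' ≠ S ∧ S' ∈ t.T := hne ⟨⟨S, hS⟩, ⟨S', hS'⟩⟩
    have e : edgeSign t.T S * edgeSign (t.contract S hS).T S' =
        -(edgeSign t.T S' * edgeSign (t.contract S' h.2).T S) :=
      edgeSign_anticomm hS h.2 h.1.symm
    dsimp only
    rw [t.contract_comm hS h.2 h.1.symm hS' ((t.mem_contract_T h.2).2 ⟨h.1.symm, hS⟩),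
      ← add_smul, e, neg_add_cancel, zero_smul]
  · intro x _ _ h
    exact (hne x).1 (congrArg (fun y => y.1.1) h)
  · intro x _
    exact Finset.mem_univ _
  · intro x _
    rfl

variable {o : Fin n}

/-- The term of the coboundary which belongs to the edge at the pivot. -/
theorem coboundary_upper (F : PlanarTree n → k) {t : PlanarTree n} (h : t.Upper o) :
    coboundary F t = edgeSign t.T (t.toggle o) • F (t.contract (t.toggle o) h.2) +
      ∑ S ∈ (Finset.univ : Finset {S // S ∈ t.T}).erase ⟨t.toggle o, h.2⟩,
        edgeSign t.T S.1 • F (t.contract S.1 S.2) :=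
  (Finset.add_sum_erase _ (fun S : {S // S ∈ t.T} => edgeSign t.T S.1 • F (t.contract S.1 S.2))
    (Finset.mem_univ (⟨t.toggle o, h.2⟩ : {S // S ∈ t.T}))).symm

theorem edgeSign_smul_smul (T : Finset (Finset (Fin n))) (S : Finset (Fin n)) (x : k) :
    edgeSign T S • edgeSign T S • x = x := by
  rw [smul_smul, edgeSign_mul_self, one_smul]

theorem stage_le_card {t : PlanarTree n} : t.stage o ≤ t.T.card := by
  classical
  rcases Nat.eq_zero_or_pos (t.stage o) with h0 | h0
  · omega
  have hu := (hasTail_of_lt h0).1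
  have := Finset.card_le_card_of_injOn (s := Finset.range (t.stage o)) (t := t.T)
    (fun i => ((t.flat Finset.univ).drop i).toFinset)
    (fun i hi => (hasTail_of_lt (Finset.mem_range.1 hi)).2.2) (by
      intro i hi j hj hij
      have h1 := t.card_drop hu i
      have h2 := t.card_drop hu j
      have h3 : ((t.flat Finset.univ).drop i).toFinset = ((t.flat Finset.univ).drop j).toFinset :=
        hij
      rw [h3] at h1
      have h4 := stage_le (t := t) (o := o)
      have h5 := Finset.mem_range.1 hi
      have h6 := Finset.mem_range.1 hj
      omega)
  simpa using this

/-- A tree with fewer than `n - 1` edges is not a right comb, so it belongs to the matching. -/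
theorem upper_or_lower {t : PlanarTree n} (h : t.T.card + 1 < n) : t.Upper o ∨ t.Lower o := by
  have h1 := stage_le_card (t := t) (o := o)
  by_cases ha : t.toggle o ∈ t.T
  · exact Or.inl ⟨by omega, ha⟩
  · exact Or.inr ⟨by omega, ha⟩

variable (o) in
/-- A cochain is a coboundary on the trees from which the matching removes an edge: the
equations can be solved by recursion on the rank. -/
theorem exists_coboundary_eq (f : PlanarTree n → k) :
    ∃ g : PlanarTree n → k, ∀ t : PlanarTree n, t.Upper o → coboundary g t = f t := by
  classical
  have key : ∀ N : ℕ, ∃ g : PlanarTree n → k, (∀ t : PlanarTree n, ¬ t.Lower o → g t = 0) ∧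
      ∀ t : PlanarTree n, t.Upper o → t.rank o < N → coboundary g t = f t := by
    intro N
    induction N with
    | zero => exact ⟨fun _ => 0, fun _ _ => rfl, fun t _ h => absurd h (Nat.not_lt_zero _)⟩
    | succ N ih =>
      obtain ⟨g, hg0, hg⟩ := ih
      -- The value of `g` at the lower tree matched with `U` is forced by the equation at `U`,
      -- since all other contractions of `U` have smaller rank.
      let c : ∀ t : PlanarTree n, t.Upper o → k := fun U hU =>
        edgeSign U.T (U.toggle o) • (f U -
          ∑ S ∈ (Finset.univ : Finset {S // S ∈ U.T}).erase ⟨U.toggle o, hU.2⟩,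
            edgeSign U.T S.1 • g (U.contract S.1 S.2))
      let g' : PlanarTree n → k := fun t => if h : t.Lower o ∧ t.rank o = N then
        c h.1.exists_upper.choose h.1.exists_upper.choose_spec.choose else g t
      have hg' : ∀ (U : PlanarTree n) (hU : U.Upper o), U.rank o = N →
          g' (U.contract (U.toggle o) hU.2) = c U hU := by
        intro U hU hr
        have hL := hU.lower_contract
        have hcond : (U.contract (U.toggle o) hU.2).Lower o ∧
            (U.contract (U.toggle o) hU.2).rank o = N := ⟨hL, by rw [hU.rank_contract, hr]⟩
        have e : hL.exists_upper.choose = U :=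
          hL.exists_upper.choose_spec.choose.eq_of_contract_eq hU
            hL.exists_upper.choose_spec.choose_spec
        simp only [g']
        rw [dif_pos hcond]
        have hcongr : ∀ (V : PlanarTree n) (hV : V.Upper o), V = U → c V hV = c U hU := by
          rintro V hV rfl
          rfl
        exact hcongr _ hL.exists_upper.choose_spec.choose e
      have hg'' : ∀ t : PlanarTree n, ¬ (t.Lower o ∧ t.rank o = N) → g' t = g t := fun t ht =>
        dif_neg ht
      refine ⟨g', fun t ht => ?_, fun U hU hr => ?_⟩
      · rw [hg'' t fun h => ht h.1, hg0 t ht]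
      · have hface : ∀ S ∈ (Finset.univ : Finset {S // S ∈ U.T}).erase ⟨U.toggle o, hU.2⟩,
            edgeSign U.T S.1 • g' (U.contract S.1 S.2) =
              edgeSign U.T S.1 • g (U.contract S.1 S.2) := by
          intro S hS
          have hne : S.1 ≠ U.toggle o := fun e => (Finset.mem_erase.1 hS).1 (Subtype.ext e)
          rw [hg'']
          rintro ⟨h1, h2⟩
          have := hU.rank_lt S.2 hne h1
          omega
        rw [coboundary_upper g' hU, Finset.sum_congr rfl hface]
        rcases Nat.lt_succ_iff_lt_or_eq.1 hr with hlt | heq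
        · rw [← hg U hU hlt, coboundary_upper g hU, hg'']
          rintro ⟨-, h2⟩
          rw [hU.rank_contract] at h2
          omega
        · rw [hg' U hU heq, edgeSign_smul_smul, sub_add_cancel]
  obtain ⟨g, -, hg⟩ := key (n * (2 * n + 1) + 2 * n + 1)
  exact ⟨g, fun t ht => hg t ht (Nat.lt_succ_of_le rank_le)⟩

/-- A cocycle which vanishes on the trees from which the matching removes an edge also vanishes
on the trees to which it adds one. -/
theorem eq_zero_of_lower {f : PlanarTree n → k} {c : ℕ}
    (h1 : ∀ t : PlanarTree n, t.Upper o → t.T.card = c + 1 → coboundary f t = 0)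
    (h2 : ∀ t : PlanarTree n, t.Upper o → t.T.card = c → f t = 0) (t : PlanarTree n)
    (ht : t.Lower o) (hc : t.T.card = c) : f t = 0 := by
  classical
  induction h : t.rank o using Nat.strong_induction_on generalizing t with
  | _ N ih =>
    subst h
    obtain ⟨U, hU, rfl⟩ := ht.exists_upper
    have hcard : ∀ S, S ∈ U.T → (U.T.erase S).card = c := by
      intro S hS
      rw [Finset.card_erase_of_mem hS, ← hc, contract_T, Finset.card_erase_of_mem hU.2]
    have h := h1 U hU (by
      have h3 := hcard _ hU.2
      rw [Finset.card_erase_of_mem hU.2] at h3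
      have := Finset.card_pos.2 ⟨_, hU.2⟩
      omega)
    rw [coboundary_upper f hU, Finset.sum_eq_zero, add_zero] at h
    · rw [← edgeSign_smul_smul U.T (U.toggle o) (f _), h, smul_zero]
    · intro S hS
      have hne : S.1 ≠ U.toggle o := fun e => (Finset.mem_erase.1 hS).1 (Subtype.ext e)
      have hlt : U.T.card < n := U.card_T_lt (Fin.pos o)
      have hcS : (U.contract S.1 S.2).T.card = c := hcard S.1 S.2
      rcases upper_or_lower (o := o) (t := U.contract S.1 S.2) (by
        have h4 := Finset.card_erase_lt_of_mem S.2
        rw [contract_T]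
        omega) with h' | h'
      · rw [h2 _ h' hcS, smul_zero]
      · rw [ih _ (by rw [hU.rank_contract]; exact hU.rank_lt S.2 hne h') _ h' hcS rfl, smul_zero]

/-- A cocycle is a coboundary on the trees which are not combs. -/
theorem exists_eq_coboundary (o : Fin n) {f : PlanarTree n → k} {c : ℕ}
    (h : ∀ t : PlanarTree n, t.T.card = c + 1 → coboundary f t = 0) :
    ∃ g : PlanarTree n → k, ∀ t : PlanarTree n, (t.Upper o ∨ t.Lower o) → t.T.card = c →
      coboundary g t = f t := by
  obtain ⟨g, hg⟩ := exists_coboundary_eq o f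
  have hsub : ∀ t, coboundary (fun t => f t - coboundary g t) t =
      coboundary f t - coboundary (coboundary g) t := by
    intro t
    simp only [coboundary, smul_sub, Finset.sum_sub_distrib]
  refine ⟨g, fun t ht hc => ?_⟩
  rcases ht with ht | ht
  · exact hg t ht
  · have := eq_zero_of_lower (o := o) (f := fun t => f t - coboundary g t) (c := c)
      (fun t _ hc => by rw [hsub, h t hc, coboundary_coboundary, sub_zero])
      (fun t ht _ => by rw [hg t ht, sub_self]) t ht hc
    exact (sub_eq_zero.1 this).symm

/-! ### Right combs -/

theorem root_eq_of_univ_mem {t : PlanarTree n} (h : Finset.univ ∈ t.T) :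
    t.root = Cycle.ofList [Finset.univ] := by
  have hall : ∀ C ∈ t.root, C = Finset.univ := by
    intro C hC
    by_contra hne
    exact ((t.mem_root C).1 hC).2.2 _ (mem_edges_of_mem h) (WithTop.coe_lt_top _)
      (lt_of_le_of_ne (Finset.subset_univ C) hne)
  have hmem : Finset.univ ∈ t.root := (t.mem_root _).2
    ⟨mem_edges_of_mem h, WithTop.coe_lt_top _, fun D _ _ hD =>
      absurd (Finset.subset_univ D) (not_subset_of_ssubset hD)⟩
  obtain ⟨l, hl⟩ := exists_cons_of_mem_cycle hmem
  have hnd := t.nodup_root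
  rw [hl] at hnd
  have hnd' := Cycle.nodup_coe_iff.1 hnd
  have hl0 : l = [] := by
    refine List.eq_nil_iff_forall_not_mem.2 fun C hC => ?_
    have := hall C (by rw [hl]; exact Cycle.mem_coe_iff.2 (by simp [hC]))
    subst this
    exact (List.nodup_cons.1 hnd').1 hC
  rw [hl, hl0]

theorem cyc_eq_of_univ_mem {t : PlanarTree n} (h : Finset.univ ∈ t.T) :
    t.cyc = Cycle.ofList (t.flat Finset.univ) := by
  rw [cyc, root_eq_of_univ_mem h]
  exact congrArg Cycle.ofList (by simp)

/-- The combs, i.e. the trees which are not changed by the matching, are determined by their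
cyclic words. -/
theorem eq_of_cyc_eq {t t' : PlanarTree n} (hc : t.T.card + 1 = n) (hc' : t'.T.card + 1 = n)
    (hs : ¬ t.stage o + 1 < n) (hs' : ¬ t'.stage o + 1 < n) (h : t.cyc = t'.cyc) : t = t' := by
  classical
  rcases Nat.lt_or_ge 1 n with hn | hn
  · have key : ∀ {t : PlanarTree n}, t.T.card + 1 = n → ¬ t.stage o + 1 < n →
        Finset.univ ∈ t.T ∧ (t.flat Finset.univ).head? = some o ∧
        t.T = (Finset.range (n - 1)).image fun i => ((t.flat Finset.univ).drop i).toFinset := by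
      intro t hc hs
      obtain ⟨hu, ho, -⟩ := hasTail_of_lt (t := t) (o := o) (i := 0) (by omega)
      refine ⟨hu, ho, (Finset.eq_of_subset_of_card_le ?_ ?_).symm⟩
      · intro S hS
        obtain ⟨i, hi, rfl⟩ := Finset.mem_image.1 hS
        rw [Finset.mem_range] at hi
        exact (hasTail_of_lt (t := t) (o := o) (i := i) (by omega)).2.2
      · rw [Finset.card_image_of_injOn, Finset.card_range]
        · omega
        · intro i hi j hj hij
          have h1 := t.card_drop hu i
          have h2 := t.card_drop hu j
          have h3 : ((t.flat Finset.univ).drop i).toFinset =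
            ((t.flat Finset.univ).drop j).toFinset := hij
          rw [h3] at h1
          have h5 := Finset.mem_range.1 hi
          have h6 := Finset.mem_range.1 hj
          omega
    obtain ⟨hu, ho, hT⟩ := key hc hs
    obtain ⟨hu', ho', hT'⟩ := key hc' hs'
    rw [cyc_eq_of_univ_mem hu, cyc_eq_of_univ_mem hu'] at h
    have hflat : t.flat Finset.univ = t'.flat Finset.univ := by
      have hnd := t.nodup_flat Finset.univ
      obtain ⟨l, hl⟩ := List.head?_eq_some_iff.1 ho
      obtain ⟨l', hl'⟩ := List.head?_eq_some_iff.1 ho'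
      rw [hl, hl'] at h
      rw [hl] at hnd
      rw [hl, hl', isRotated_cons_cons hnd (Cycle.coe_eq_coe.1 h)]
    have hTT : t.T = t'.T := by rw [hT, hT', hflat]
    have hV : ∀ C, C ∈ edges t.T → t.flat C = t'.flat C := by
      intro C hC
      rcases mem_edges_iff.1 hC with hC | ⟨i, rfl⟩
      · have hC0 := hC
        rw [hT] at hC
        obtain ⟨i, -, hi⟩ := Finset.mem_image.1 hC
        rw [flat_eq_drop hu (mem_edges_of_mem hC0) hi.symm,
          flat_eq_drop hu' (mem_edges_of_mem (hTT ▸ hC0)) (by rw [← hflat]; exact hi.symm), hflat]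
      · simp
    refine PlanarTree.ext hTT (funext fun V => ?_) ?_
    · by_cases hVT : V ∈ t.T
      · have hVT' : V ∈ t'.T := hTT ▸ hVT
        have hmem : ∀ C ∈ t'.w V, C ∈ inputs t.T (V : WithTop (Finset (Fin n))) := by
          intro C hC
          rw [hTT]
          exact inputs_of_mem_w hC
        refine eq_of_flatMap_eq (f := t.flat) (fun C hC => t.flat_ne_nil (mem_edges_of_mem_w hC))
          (fun C hC => t.flat_ne_nil (hmem C hC).1) ?_ ?_
        · intro C hC D hD x hx hx'
          exact t.isTree.inputs_eq_of_mem (inputs_of_mem_w hC) (hmem D hD)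
            ((t.mem_flat (mem_edges_of_mem_w hC)).1 hx) ((t.mem_flat (hmem D hD).1).1 hx')
        · rw [← t.flat_of_mem hVT, hV V (mem_edges_of_mem hVT), t'.flat_of_mem hVT']
          exact List.flatMap_congr fun C hC => (hV C (hmem C hC).1).symm
      · rw [t.w_eq_nil V hVT, t'.w_eq_nil V (hTT ▸ hVT)]
    · rw [root_eq_of_univ_mem hu, root_eq_of_univ_mem hu']
  · have hT : t.T = ∅ := Finset.card_eq_zero.1 (by omega)
    have hT' : t'.T = ∅ := Finset.card_eq_zero.1 (by omega)
    have key : ∀ {t : PlanarTree n}, t.T = ∅ → t.root = Cycle.ofList [{o}] := by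
      intro t hT
      have hall : ∀ C ∈ t.root, C = {o} := by
        intro C hC
        rcases mem_edges_iff.1 (mem_edges_of_mem_root hC) with hC | ⟨i, rfl⟩
        · rw [hT] at hC
          exact absurd hC (Finset.notMem_empty C)
        · have : i = o := Fin.ext (by omega)
          rw [this]
      obtain ⟨D, hD, -⟩ := exists_mem_inputs_top t.T o
      have hD' := (t.mem_root D).2 hD
      obtain ⟨l, hl⟩ := exists_cons_of_mem_cycle hD'
      have hnd := t.nodup_root
      rw [hl] at hnd
      have hnd' := Cycle.nodup_coe_iff.1 hnd
      have hDo := hall D hD'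
      have hl0 : l = [] := by
        refine List.eq_nil_iff_forall_not_mem.2 fun C hC => ?_
        have := hall C (by rw [hl]; exact Cycle.mem_coe_iff.2 (by simp [hC]))
        rw [this, ← hDo] at hC
        exact (List.nodup_cons.1 hnd').1 hC
      rw [hl, hl0, hDo]
    refine PlanarTree.ext (by rw [hT, hT']) (funext fun V => ?_) (by rw [key hT, key hT'])
    rw [t.w_eq_nil V (by simp [hT]), t'.w_eq_nil V (by simp [hT'])]

/-! ### Planar trees with a given cyclic word -/

theorem inputs_empty_top (C : Finset (Fin n)) :
    C ∈ inputs (∅ : Finset (Finset (Fin n))) ⊤ ↔ ∃ i, C = {i} := by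
  constructor
  · intro h
    rcases mem_edges_iff.1 h.1 with h | h
    · exact absurd h (Finset.notMem_empty C)
    · exact h
  · rintro ⟨i, rfl⟩
    refine ⟨singleton_mem_edges _ i, WithTop.coe_lt_top _, fun D hD _ hlt => ?_⟩
    rcases mem_edges_iff.1 hD with h | ⟨j, rfl⟩
    · exact absurd h (Finset.notMem_empty D)
    · simpa using Finset.card_lt_card hlt

/-- The tree without internal edges. -/
def corolla (l : List (Fin n)) (hl : l.Nodup) (hm : ∀ i, i ∈ l) : PlanarTree n where
  T := ∅
  isTree := ⟨fun S hS => absurd hS (Finset.notMem_empty S),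
    fun S hS => absurd hS (Finset.notMem_empty S)⟩
  w _ := []
  root := Cycle.ofList (l.map singleton)
  nodup_w _ := List.nodup_nil
  mem_w V hV := absurd hV (Finset.notMem_empty V)
  w_eq_nil _ _ := rfl
  nodup_root := Cycle.nodup_coe_iff.2 (hl.map Finset.singleton_injective)
  mem_root C := by
    rw [inputs_empty_top]
    refine Cycle.mem_coe_iff.trans ?_
    rw [List.mem_map]
    constructor
    · rintro ⟨i, -, rfl⟩; exact ⟨i, rfl⟩
    · rintro ⟨i, rfl⟩; exact ⟨i, hm i, rfl⟩

theorem cyc_corolla (l : List (Fin n)) (hl : l.Nodup) (hm : ∀ i, i ∈ l) :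
    (corolla l hl hm).cyc = Cycle.ofList l := by
  refine congrArg Cycle.ofList ?_
  change (l.map singleton).flatMap (corolla l hl hm).flat = l
  rw [List.flatMap_map]
  simp

/-- Joining inputs of the root one after the other, without changing the cyclic word, leads to a
tree with unary root. -/
theorem exists_unary (t : PlanarTree n) (h : 0 < t.root.length) :
    ∃ t' : PlanarTree n, t'.cyc = t.cyc ∧ t'.T.card + 1 = t.T.card + t.root.length := by
  obtain ⟨l, hl⟩ : ∃ l : List (Finset (Fin n)), t.root = Cycle.ofList l :=
    Quotient.inductionOn' t.root fun l => ⟨l, rfl⟩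
  have hlen : t.root.length = l.length := by rw [hl]; exact Cycle.length_coe l
  induction hN : l.length generalizing t l with
  | zero => omega
  | succ N ih =>
    match l, hN with
    | [X], hN => exact ⟨t, rfl, by rw [hlen]; simp⟩
    | X :: Y :: l, hN =>
      obtain ⟨t', h1, h2, h3, h4⟩ := t.exists_expand_root hl
      have h5 : t'.root.length = ((X ∪ Y) :: l).length := by rw [h4]; exact Cycle.length_coe _
      obtain ⟨t'', h6, h7⟩ := ih t' (by rw [h5]; simp) ((X ∪ Y) :: l) h4 h5
        (by simpa using hN)
      refine ⟨t'', by rw [h6, ← h2, cyc_contract], ?_⟩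
      have h8 : t.T.card = t'.T.card - 1 := by
        rw [← h2, contract_T, Finset.card_erase_of_mem h1]
      have h9 := Finset.card_pos.2 ⟨_, h1⟩
      rw [h7, h8, h5, hlen]
      simp only [List.length_cons]
      omega

/-- Every cyclic word is the cyclic word of a binary tree with unary root. -/
theorem exists_cyc_eq {l : List (Fin n)} (hl : l.Nodup) (hm : ∀ i, i ∈ l) (hn : 0 < n) :
    ∃ t : PlanarTree n, t.cyc = Cycle.ofList l ∧ t.T.card + 1 = n := by
  have hlen : l.length = n := by
    rw [← List.toFinset_card_of_nodup hl]
    have : l.toFinset = Finset.univ := by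
      ext i
      simp [hm i]
    rw [this, Finset.card_univ, Fintype.card_fin]
  have h1 : (corolla l hl hm).root.length = n := by
    refine (Cycle.length_coe _).trans ?_
    rw [List.length_map, hlen]
  obtain ⟨t, ht, hc⟩ := exists_unary (corolla l hl hm) (by omega)
  exact ⟨t, by rw [ht, cyc_corolla], by rw [hc, h1]; simp [corolla]⟩

end PlanarTree

/-! ### Numbers of inversions -/

section Inversions

variable {α : Type}

/-- The relation `r` is asymmetric and total on `X`. -/
def IsTournament (r : α → α → Prop) (X : Finset α) : Prop :=
  (∀ x ∈ X, ∀ y ∈ X, r x y → ¬ r y x) ∧ ∀ x ∈ X, ∀ y ∈ X, x ≠ y → r x y ∨ r y x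

theorem isTournament_of_key {r : α → α → Prop} {X : Finset α} (κ : α → ℕ)
    (h : ∀ x ∈ X, ∀ y ∈ X, r x y → κ x < κ y) (ht : ∀ x ∈ X, ∀ y ∈ X, x ≠ y → r x y ∨ r y x) :
    IsTournament r X :=
  ⟨fun x hx y hy h1 h2 => lt_asymm (h x hx y hy h1) (h y hy x hx h2), ht⟩

theorem IsTournament.subset {r : α → α → Prop} {X Y : Finset α} (h : IsTournament r Y)
    (hXY : X ⊆ Y) : IsTournament r X :=
  ⟨fun x hx y hy => h.1 x (hXY hx) y (hXY hy), fun x hx y hy => h.2 x (hXY hx) y (hXY hy)⟩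

open Classical in
/-- The sign given by the number of pairs on which the relations `r` and `B` disagree. -/
noncomputable def invSign (r B : α → α → Prop) (X : Finset α) : ℤ :=
  (-1) ^ ((X ×ˢ X).filter fun x => r x.1 x.2 ∧ B x.2 x.1).card

open Classical in
/-- A change of the relation `B` multiplies the sign by the parity of the number of pairs whose
order is reversed. -/
theorem invSign_change {r B B' : α → α → Prop} {X : Finset α} (hr : IsTournament r X)
    (hB : IsTournament B X) (hB' : IsTournament B' X) :
    invSign r B' X = invSign r B X *
      (-1) ^ ((X ×ˢ X).filter fun x => B x.1 x.2 ∧ B' x.2 x.1).card := by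
  let P := (X ×ˢ X).filter fun x => r x.1 x.2
  have hP : ∀ x ∈ P, (x.1 ∈ X ∧ x.2 ∈ X) ∧ x.1 ≠ x.2 := by
    intro x hx
    have h := Finset.mem_filter.1 hx
    have h2 := Finset.mem_product.1 h.1
    refine ⟨h2, fun e => ?_⟩
    have h3 := h.2
    rw [← e] at h3
    exact hr.1 _ h2.1 _ h2.1 h3 h3
  have split : ∀ p q : α × α → Prop, ((X ×ˢ X).filter fun x => r x.1 x.2 ∧ p x).card =
      (P.filter fun x => p x ∧ q x).card + (P.filter fun x => p x ∧ ¬ q x).card := by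
    intro p q
    have h0 : ((X ×ˢ X).filter fun x => r x.1 x.2 ∧ p x) = P.filter p :=
      (Finset.filter_filter _ _ _).symm
    rw [h0, ← Finset.card_filter_add_card_filter_not (s := P.filter p) q,
      Finset.filter_filter p q P, Finset.filter_filter p (fun x => ¬ q x) P]
  have e1 : ((X ×ˢ X).filter fun x => r x.1 x.2 ∧ B x.2 x.1).card =
      (P.filter fun x => B x.2 x.1 ∧ B' x.2 x.1).card +
      (P.filter fun x => B x.2 x.1 ∧ B' x.1 x.2).card := by
    rw [split (fun x => B x.2 x.1) fun x => B' x.2 x.1]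
    congr 2
    refine Finset.filter_congr fun x hx => ?_
    obtain ⟨⟨h1, h2⟩, h3⟩ := hP x hx
    have h4 := hB'.1 _ h1 _ h2
    have h5 := hB'.2 _ h1 _ h2 h3
    tauto
  have e2 : ((X ×ˢ X).filter fun x => r x.1 x.2 ∧ B' x.2 x.1).card =
      (P.filter fun x => B x.2 x.1 ∧ B' x.2 x.1).card +
      (P.filter fun x => B x.1 x.2 ∧ B' x.2 x.1).card := by
    rw [split (fun x => B' x.2 x.1) fun x => B x.2 x.1]
    congr 2
    · exact Finset.filter_congr fun x _ => and_comm
    · refine Finset.filter_congr fun x hx => ?_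
      obtain ⟨⟨h1, h2⟩, h3⟩ := hP x hx
      have h4 := hB.1 _ h1 _ h2
      have h5 := hB.2 _ h1 _ h2 h3
      tauto
  have e3 : ((X ×ˢ X).filter fun x => B x.1 x.2 ∧ B' x.2 x.1).card =
      (P.filter fun x => B x.1 x.2 ∧ B' x.2 x.1).card +
      (P.filter fun x => B x.2 x.1 ∧ B' x.1 x.2).card := by
    rw [← Finset.card_filter_add_card_filter_not (fun x : α × α => r x.1 x.2)]
    congr 1
    · rw [Finset.filter_filter, Finset.filter_filter]
      exact congrArg _ (Finset.filter_congr fun x _ => and_comm)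
    · rw [← Finset.card_map (Equiv.prodComm α α).toEmbedding]
      congr 1
      ext ⟨x, y⟩
      simp only [Finset.mem_map, Finset.mem_filter, Finset.mem_product, P, Prod.exists,
        Equiv.coe_toEmbedding, Equiv.prodComm_apply, Prod.swap_prod_mk, Prod.mk.injEq]
      constructor
      · rintro ⟨a, b, ⟨⟨⟨h1, h2⟩, h3, h4⟩, h5⟩, rfl, rfl⟩
        have hne : a ≠ b := by
          rintro rfl
          exact hB.1 _ h1 _ h1 h3 h3
        exact ⟨⟨⟨h2, h1⟩, (hr.2 _ h1 _ h2 hne).resolve_left h5⟩, h3, h4⟩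
      · rintro ⟨⟨⟨h1, h2⟩, h5⟩, h3, h4⟩
        exact ⟨y, x, ⟨⟨⟨h2, h1⟩, h3, h4⟩, hr.1 _ h1 _ h2 h5⟩, rfl, rfl⟩
  rw [invSign, invSign, e1, e2, e3, ← pow_add]
  set a := (P.filter fun x => B x.2 x.1 ∧ B' x.2 x.1).card
  set b := (P.filter fun x => B x.1 x.2 ∧ B' x.2 x.1).card
  set c := (P.filter fun x => B x.2 x.1 ∧ B' x.1 x.2).card
  have : a + c + (b + c) = a + b + 2 * c := by ring
  rw [this, pow_add _ (a + b), pow_mul]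
  simp

open Classical in
/-- An element `S` contributes to the sign by the parity of the number of elements before it, with
respect to both relations. -/
theorem invSign_insert [DecidableEq α] {r B : α → α → Prop} {X : Finset α} {S : α} (hS : S ∉ X)
    (hr : IsTournament r (insert S X)) (hB : IsTournament B (insert S X)) :
    (-1) ^ (X.filter fun x => r x S).card * invSign r B (insert S X) =
      (-1) ^ (X.filter fun x => B x S).card * invSign r B X := by
  have hmS := Finset.mem_insert_self S X
  have e1 : (((insert S X) ×ˢ (insert S X)).filter fun x => r x.1 x.2 ∧ B x.2 x.1).card =
      ((X ×ˢ X).filter fun x => r x.1 x.2 ∧ B x.2 x.1).card +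
      (X.filter fun x => r x S ∧ B S x).card + (X.filter fun x => r S x ∧ B x S).card := by
    have : ((insert S X) ×ˢ (insert S X)).filter (fun x => r x.1 x.2 ∧ B x.2 x.1) =
        ((X ×ˢ X).filter fun x => r x.1 x.2 ∧ B x.2 x.1) ∪
        ((X.filter fun x => r x S ∧ B S x).image (fun x => (x, S)) ∪
        (X.filter fun x => r S x ∧ B x S).image (fun x => (S, x))) := by
      ext ⟨x, y⟩
      simp only [Finset.mem_filter, Finset.mem_product, Finset.mem_insert, Finset.mem_union,
        Finset.mem_image, Prod.mk.injEq]
      constructor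
      · rintro ⟨⟨rfl | hx, rfl | hy⟩, h1, h2⟩
        · exact absurd h1 (hr.1 _ hmS _ hmS h1)
        · exact Or.inr (Or.inr ⟨y, ⟨hy, h1, h2⟩, rfl, rfl⟩)
        · exact Or.inr (Or.inl ⟨x, ⟨hx, h1, h2⟩, rfl, rfl⟩)
        · exact Or.inl ⟨⟨hx, hy⟩, h1, h2⟩
      · rintro (⟨⟨hx, hy⟩, h⟩ | ⟨z, ⟨hz, h⟩, rfl, rfl⟩ | ⟨z, ⟨hz, h⟩, rfl, rfl⟩)
        · exact ⟨⟨Or.inr hx, Or.inr hy⟩, h⟩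
        · exact ⟨⟨Or.inr hz, Or.inl rfl⟩, h⟩
        · exact ⟨⟨Or.inl rfl, Or.inr hz⟩, h⟩
    rw [this, Finset.card_union_of_disjoint, Finset.card_union_of_disjoint,
      Finset.card_image_of_injective, Finset.card_image_of_injective, add_assoc]
    · intro x y h; exact (Prod.mk.inj h).2
    · intro x y h; exact (Prod.mk.inj h).1
    · rw [Finset.disjoint_left]
      rintro ⟨x, y⟩ h1 h2
      simp only [Finset.mem_image, Finset.mem_filter, Prod.mk.injEq] at h1 h2
      obtain ⟨a, ha, rfl, rfl⟩ := h1
      obtain ⟨b, hb, h3, rfl⟩ := h2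
      exact hS hb.1
    · rw [Finset.disjoint_left]
      rintro ⟨x, y⟩ h1 h2
      simp only [Finset.mem_union, Finset.mem_image, Finset.mem_filter, Prod.mk.injEq,
        Finset.mem_product] at h1 h2
      rcases h2 with ⟨a, ha, rfl, rfl⟩ | ⟨a, ha, rfl, rfl⟩
      · exact hS h1.1.2
      · exact hS h1.1.1
  have e2 : (X.filter fun x => r x S).card = (X.filter fun x => r x S ∧ B S x).card +
      (X.filter fun x => r x S ∧ B x S).card := by
    rw [← Finset.card_filter_add_card_filter_not (fun x => B S x), Finset.filter_filter,
      Finset.filter_filter]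
    congr 2
    refine Finset.filter_congr fun x hx => ?_
    have hx' := Finset.mem_insert_of_mem (b := S) hx
    have hne : x ≠ S := by rintro rfl; exact hS hx
    have h4 := hB.1 _ hx' _ hmS
    have h5 := hB.2 _ hx' _ hmS hne
    tauto
  have e3 : (X.filter fun x => B x S).card = (X.filter fun x => r x S ∧ B x S).card +
      (X.filter fun x => r S x ∧ B x S).card := by
    rw [← Finset.card_filter_add_card_filter_not (fun x => r x S), Finset.filter_filter,
      Finset.filter_filter]
    congr 2
    · exact Finset.filter_congr fun x _ => and_comm
    · refine Finset.filter_congr fun x hx => ?_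
      have hx' := Finset.mem_insert_of_mem (b := S) hx
      have hne : x ≠ S := by rintro rfl; exact hS hx
      have h4 := hr.1 _ hx' _ hmS
      have h5 := hr.2 _ hx' _ hmS hne
      tauto
  rw [invSign, invSign, e1, e2, e3, ← pow_add, ← pow_add]
  set a := (X.filter fun x => r x S ∧ B S x).card
  set b := (X.filter fun x => r x S ∧ B x S).card
  set c := (X.filter fun x => r S x ∧ B x S).card
  set d := ((X ×ˢ X).filter fun x => r x.1 x.2 ∧ B x.2 x.1).card
  have : a + b + (d + a + c) = b + c + d + 2 * a := by ring
  rw [this, pow_add _ (b + c + d), pow_mul]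
  simp

end Inversions

namespace PlanarTree

variable {n : ℕ} (t : PlanarTree n)

/-- The in-order traversal of the edges below binary vertices. -/
def Precedes (C D : Finset (Fin n)) : Prop :=
  ∃ V A B, t.w V = [A, B] ∧ ((C ⊆ A ∧ D ⊆ B) ∨ (C ⊆ A ∧ D = V) ∨ (C = V ∧ D ⊆ B))

/-- The sign of a binary planar tree: the sign of the order of the leaves times the sign of the
in-order traversal of the internal edges. -/
noncomputable def sgn : ℤ :=
  invSign (fun x y : Fin n => x < y) (fun x y => t.Precedes {x} {y}) Finset.univ *
    invSign (fun C D => toColex C < toColex D) t.Precedes t.T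

/-- The root is unary and all other vertices are binary (and there are at least two leaves). -/
def IsBinary : Prop := Finset.univ ∈ t.T ∧ ∀ V ∈ t.T, ∃ A B, t.w V = [A, B]

/-- The position of the first leaf below an edge. -/
noncomputable def start (C : Finset (Fin n)) : ℕ :=
  ((t.flat C).head?.map fun x => (t.flat Finset.univ).idxOf x).getD 0

/-- The place of an edge in the in-order traversal: twice the position of a leaf, plus one, and
twice the position of the first leaf below the second input of a binary vertex. -/
noncomputable def key (C : Finset (Fin n)) : ℕ :=
  open Classical in
  if C ∈ t.T then 2 * (t.start C + ((t.w C).headD ∅).card) else 2 * t.start C + 1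

variable {t}

theorem start_eq {C : Finset (Fin n)} (hC : C ∈ edges t.T) {p q : List (Fin n)}
    (h : p ++ t.flat C ++ q = t.flat Finset.univ) : t.start C = p.length := by
  obtain ⟨x, m, hm⟩ := List.exists_cons_of_ne_nil (t.flat_ne_nil hC)
  have hnd := t.nodup_flat Finset.univ
  rw [← h, hm, List.append_assoc] at hnd
  have hx : x ∉ p := fun hx => List.disjoint_of_nodup_append hnd hx (by simp)
  rw [start, hm, ← h, hm]
  simp only [List.head?_cons, Option.map_some, Option.getD_some]
  rw [List.append_assoc, List.idxOf_append_of_notMem hx]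
  simp

theorem start_flat {V : Finset (Fin n)} (hu : Finset.univ ∈ t.T) (hV : V ∈ edges t.T) :
    ∃ p q, p ++ t.flat V ++ q = t.flat Finset.univ ∧ t.start V = p.length := by
  obtain ⟨p, q, h⟩ := flat_infix hV hu (Finset.subset_univ V)
  exact ⟨p, q, h, start_eq hV h⟩

theorem start_pair {V A B : Finset (Fin n)} (hu : Finset.univ ∈ t.T) (h : t.w V = [A, B]) :
    t.start A = t.start V ∧ t.start B = t.start V + A.card ∧ V.card = A.card + B.card ∧
      0 < A.card ∧ 0 < B.card := by
  have hA : A ∈ t.w V := by simp [h]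
  have hB : B ∈ t.w V := by simp [h]
  have hAe := mem_edges_of_mem_w hA
  have hBe := mem_edges_of_mem_w hB
  have hV := mem_edges_of_mem (mem_T_of_mem_w hA)
  obtain ⟨p, q, hp, hs⟩ := start_flat hu hV
  have hfl := flat_of_w_eq h
  have hlen := congrArg List.length hfl
  rw [List.length_append, t.length_flat hV, t.length_flat hAe, t.length_flat hBe] at hlen
  rw [hfl] at hp
  refine ⟨?_, ?_, hlen, Finset.card_pos.2 (t.isTree.edges_nonempty hAe),
    Finset.card_pos.2 (t.isTree.edges_nonempty hBe)⟩
  · rw [hs]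
    exact start_eq (q := t.flat B ++ q) hAe (by rw [← hp]; simp)
  · rw [hs, start_eq (p := p ++ t.flat A) (q := q) hBe (by rw [← hp]; simp), List.length_append,
      t.length_flat hAe]

theorem start_mono {C D : Finset (Fin n)} (hu : Finset.univ ∈ t.T) (hC : C ∈ edges t.T)
    (hD : D ∈ edges t.T) (h : C ⊆ D) :
    t.start D ≤ t.start C ∧ t.start C + C.card ≤ t.start D + D.card := by
  rcases eq_or_ne C D with rfl | hne
  · exact ⟨le_rfl, le_rfl⟩
  have hDT := t.isTree.mem_of_ssubset hC hD (lt_of_le_of_ne h hne)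
  obtain ⟨p, q, hp, hs⟩ := start_flat hu hD
  obtain ⟨p', q', hp'⟩ := flat_infix hC hDT h
  have hlen := congrArg List.length hp'
  simp only [List.length_append] at hlen
  rw [t.length_flat hC, t.length_flat hD] at hlen
  have : t.start C = p.length + p'.length := by
    rw [start_eq (p := p ++ p') (q := q' ++ q) hC (by rw [← hp, ← hp']; simp), List.length_append]
  omega

theorem key_of_w_eq {V A B : Finset (Fin n)} (h : t.w V = [A, B]) :
    t.key V = 2 * (t.start V + A.card) := by
  rw [key, if_pos (mem_T_of_mem_w (C := A) (by simp [h])), h]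
  rfl

/-- The leaves below `C` occupy the positions from `t.start C` to `t.start C + C.card - 1`, and the
key lies strictly between twice the ends of this interval. -/
theorem IsBinary.key_bounds (ht : t.IsBinary) {C : Finset (Fin n)} (hC : C ∈ edges t.T) :
    2 * t.start C < t.key C ∧ t.key C < 2 * (t.start C + C.card) := by
  rcases mem_edges_iff.1 hC with h | ⟨i, rfl⟩
  · obtain ⟨A, B, hAB⟩ := ht.2 C h
    obtain ⟨-, -, h3, h4, h5⟩ := start_pair ht.1 hAB
    rw [key_of_w_eq hAB]
    omega
  · rw [key, if_neg (t.singleton_notMem i), Finset.card_singleton]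
    omega

/-- The key increases along the in-order traversal. -/
theorem IsBinary.key_lt (ht : t.IsBinary) {C D : Finset (Fin n)} (hC : C ∈ edges t.T)
    (hD : D ∈ edges t.T) (h : t.Precedes C D) : t.key C < t.key D := by
  obtain ⟨V, A, B, hV, h⟩ := h
  obtain ⟨h1, h2, h3, h4, h5⟩ := start_pair ht.1 hV
  have hk := key_of_w_eq hV
  have hA : A ∈ edges t.T := mem_edges_of_mem_w (V := V) (by simp [hV])
  have hB : B ∈ edges t.T := mem_edges_of_mem_w (V := V) (by simp [hV])
  have hCk := ht.key_bounds hC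
  have hDk := ht.key_bounds hD
  rcases h with ⟨hCA, hDB⟩ | ⟨hCA, rfl⟩ | ⟨rfl, hDB⟩
  · have h6 := start_mono ht.1 hC hA hCA
    have h7 := start_mono ht.1 hD hB hDB
    omega
  · have h6 := start_mono ht.1 hC hA hCA
    omega
  · have h7 := start_mono ht.1 hD hB hDB
    omega

theorem mem_pair {V A B C : Finset (Fin n)} (h : t.w V = [A, B])
    (hC : C ∈ inputs t.T (V : WithTop (Finset (Fin n)))) : C = A ∨ C = B := by
  have hA : A ∈ t.w V := by simp [h]
  have := (t.mem_w V (mem_T_of_mem_w hA) C).2 hC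
  simpa [h] using this

/-- Any two edges are comparable in the in-order traversal: either one contains the other, or they
are separated by the smallest vertex which contains both. -/
theorem IsBinary.precedes_total (ht : t.IsBinary) {C D : Finset (Fin n)} (hC : C ∈ edges t.T)
    (hD : D ∈ edges t.T) (hne : C ≠ D) : t.Precedes C D ∨ t.Precedes D C := by
  have key : ∀ {C D : Finset (Fin n)}, C ∈ edges t.T → D ∈ edges t.T → C ⊂ D →
      t.Precedes C D ∨ t.Precedes D C := by
    intro C D hC hD h
    have hDT := t.isTree.mem_of_ssubset hC hD h
    obtain ⟨A, B, hAB⟩ := ht.2 D hDT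
    obtain ⟨E, hE, hCE⟩ := exists_mem_inputs_superset hC (WithTop.coe_lt_coe.2 h)
    rcases mem_pair hAB hE with rfl | rfl
    · exact Or.inl ⟨D, E, B, hAB, Or.inr (Or.inl ⟨hCE, rfl⟩)⟩
    · exact Or.inr ⟨D, A, E, hAB, Or.inr (Or.inr ⟨rfl, hCE⟩)⟩
  rcases t.isTree.edges_nested hC hD with h | h | h
  · exact key hC hD (lt_of_le_of_ne h hne)
  · exact (key hD hC (lt_of_le_of_ne h hne.symm)).symm
  · obtain ⟨V, hV, hmin⟩ := Finset.exists_min_image (t.T.filter fun V => C ⊆ V ∧ D ⊆ V) Finset.card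
      ⟨Finset.univ, Finset.mem_filter.2 ⟨ht.1, Finset.subset_univ _, Finset.subset_univ _⟩⟩
    simp only [Finset.mem_filter] at hV hmin
    obtain ⟨hVT, hCV, hDV⟩ := hV
    obtain ⟨i, hi⟩ := t.isTree.edges_nonempty hC
    obtain ⟨j, hj⟩ := t.isTree.edges_nonempty hD
    have hCV' : C ⊂ V := lt_of_le_of_ne hCV (by
      rintro rfl
      exact Finset.disjoint_left.1 h (hDV hj) hj)
    have hDV' : D ⊂ V := lt_of_le_of_ne hDV (by
      rintro rfl
      exact Finset.disjoint_left.1 h hi (hCV hi))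
    obtain ⟨E, hE, hCE⟩ := exists_mem_inputs_superset hC (WithTop.coe_lt_coe.2 hCV')
    obtain ⟨F, hF, hDF⟩ := exists_mem_inputs_superset hD (WithTop.coe_lt_coe.2 hDV')
    have hEF : E ≠ F := by
      rintro rfl
      have hET : E ∈ t.T := IsTree.mem_of_mem_edges hE.1 (by
        have h1 := Finset.card_le_card (Finset.union_subset hCE hDF)
        rw [Finset.card_union_of_disjoint h] at h1
        have h2 := Finset.card_pos.2 ⟨i, hi⟩
        have h3 := Finset.card_pos.2 ⟨j, hj⟩
        omega)
      exact absurd (hmin E ⟨hET, hCE, hDF⟩)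
        (not_le.2 (Finset.card_lt_card (ssubset_of_mem_inputs hE)))
    obtain ⟨A, B, hAB⟩ := ht.2 V hVT
    rcases mem_pair hAB hE with rfl | rfl <;> rcases mem_pair hAB hF with rfl | rfl
    · exact absurd rfl hEF
    · exact Or.inl ⟨V, _, _, hAB, Or.inl ⟨hCE, hDF⟩⟩
    · exact Or.inr ⟨V, _, _, hAB, Or.inl ⟨hDF, hCE⟩⟩
    · exact absurd rfl hEF

theorem IsBinary.precedes_iff (ht : t.IsBinary) {C D : Finset (Fin n)} (hC : C ∈ edges t.T)
    (hD : D ∈ edges t.T) : t.Precedes C D ↔ t.key C < t.key D := by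
  refine ⟨ht.key_lt hC hD, fun h => ?_⟩
  have hne : C ≠ D := by
    rintro rfl
    exact lt_irrefl _ h
  exact (ht.precedes_total hC hD hne).resolve_right fun h' =>
    lt_asymm h (ht.key_lt hD hC h')

theorem IsBinary.key_ne (ht : t.IsBinary) {C D : Finset (Fin n)} (hC : C ∈ edges t.T)
    (hD : D ∈ edges t.T) (hne : C ≠ D) : t.key C ≠ t.key D := by
  rcases ht.precedes_total hC hD hne with h | h
  · exact (ht.key_lt hC hD h).ne
  · exact (ht.key_lt hD hC h).ne'

theorem IsBinary.isTournament (ht : t.IsBinary) : IsTournament t.Precedes t.T :=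
  isTournament_of_key t.key
    (fun _ hx _ hy => ht.key_lt (mem_edges_of_mem hx) (mem_edges_of_mem hy))
    fun _ hx _ hy => ht.precedes_total (mem_edges_of_mem hx) (mem_edges_of_mem hy)

theorem IsBinary.isTournament_leaves (ht : t.IsBinary) :
    IsTournament (fun x y : Fin n => t.Precedes {x} {y}) Finset.univ :=
  isTournament_of_key (fun x => t.key {x})
    (fun x _ y _ => ht.key_lt (singleton_mem_edges _ x) (singleton_mem_edges _ y))
    fun x _ y _ hne => ht.precedes_total (singleton_mem_edges _ x) (singleton_mem_edges _ y)
      fun h => hne (Finset.singleton_injective h)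

theorem isTournament_lt (X : Finset (Fin n)) : IsTournament (fun x y : Fin n => x < y) X :=
  ⟨fun _ _ _ _ h => lt_asymm h, fun _ _ _ _ h => lt_or_gt_of_ne h⟩

theorem isTournament_colex (X : Finset (Finset (Fin n))) :
    IsTournament (fun C D : Finset (Fin n) => toColex C < toColex D) X :=
  ⟨fun _ _ _ _ h => lt_asymm h, fun _ _ _ _ h => lt_or_gt_of_ne fun e => h (toColex_inj.1 e)⟩

/-- A binary tree with `m` leaves has `m - 1` internal vertices. -/
theorem IsBinary.card_filter_subset (ht : t.IsBinary) {C : Finset (Fin n)} (hC : C ∈ edges t.T) :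
    (t.T.filter fun x => x ⊆ C).card + 1 = C.card := by
  induction h : C.card using Nat.strong_induction_on generalizing C with
  | _ m ih =>
    subst h
    rcases mem_edges_iff.1 hC with hCT | ⟨i, rfl⟩
    · obtain ⟨A, B, hAB⟩ := ht.2 C hCT
      have hA : A ∈ t.w C := by simp [hAB]
      have hB : B ∈ t.w C := by simp [hAB]
      have hAC := ssubset_of_mem_w hA
      have hBC := ssubset_of_mem_w hB
      have hne : A ≠ B := by
        have := t.nodup_w C
        rw [hAB] at this
        simpa using this
      have hdis := t.isTree.inputs_disjoint (inputs_of_mem_w hA) (inputs_of_mem_w hB) hne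
      have h1 := ih _ (Finset.card_lt_card hAC) (mem_edges_of_mem_w hA) rfl
      have h2 := ih _ (Finset.card_lt_card hBC) (mem_edges_of_mem_w hB) rfl
      obtain ⟨-, -, h3, -, -⟩ := start_pair ht.1 hAB
      have hU : (t.T.filter fun x => x ⊆ C) = insert C ((t.T.filter fun x => x ⊆ A) ∪
          (t.T.filter fun x => x ⊆ B)) := by
        ext D
        simp only [Finset.mem_filter, Finset.mem_insert, Finset.mem_union]
        constructor
        · rintro ⟨hD, hDC⟩
          rcases eq_or_ne D C with e | e
          · exact Or.inl e
          · obtain ⟨E, hE, hDE⟩ := exists_mem_inputs_superset (mem_edges_of_mem hD)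
              (WithTop.coe_lt_coe.2 (lt_of_le_of_ne hDC e))
            rcases mem_pair hAB hE with rfl | rfl
            · exact Or.inr (Or.inl ⟨hD, hDE⟩)
            · exact Or.inr (Or.inr ⟨hD, hDE⟩)
        · rintro (rfl | ⟨h1, h2⟩ | ⟨h1, h2⟩)
          · exact ⟨hCT, subset_rfl⟩
          · exact ⟨h1, h2.trans hAC.1⟩
          · exact ⟨h1, h2.trans hBC.1⟩
      rw [hU, Finset.card_insert_of_notMem, Finset.card_union_of_disjoint]
      · omega
      · rw [Finset.disjoint_left]
        intro D hD hD'
        obtain ⟨i, hi⟩ := t.isTree.edges_nonempty (mem_edges_of_mem (Finset.mem_filter.1 hD).1)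
        exact Finset.disjoint_left.1 hdis ((Finset.mem_filter.1 hD).2 hi)
          ((Finset.mem_filter.1 hD').2 hi)
      · rw [Finset.mem_union, Finset.mem_filter, Finset.mem_filter]
        rintro (⟨-, h⟩ | ⟨-, h⟩)
        · exact hAC.2 h
        · exact hBC.2 h
    · rw [Finset.card_singleton, Finset.filter_eq_empty_iff.2]
      · rfl
      · intro D hD hDi
        have h1 := t.isTree.two_le_card D hD
        have h2 := Finset.card_le_card hDi
        rw [Finset.card_singleton] at h2
        omega

/-- The sign changes when the two inputs of a vertex are exchanged. -/
theorem IsBinary.sgn_swap {t' : PlanarTree n} (ht : t.IsBinary) (ht' : t'.IsBinary)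
    (hT : t'.T = t.T) {V A B : Finset (Fin n)} (hV : t.w V = [A, B]) (hV' : t'.w V = [B, A])
    (hw : ∀ U, U ≠ V → t'.w U = t.w U) : t'.sgn = -t.sgn := by
  classical
  have hsame : ∀ C D, t.Precedes C D → t'.Precedes C D ∨
      ((C ⊆ A ∧ D ⊆ B) ∨ (C ⊆ A ∧ D = V) ∨ (C = V ∧ D ⊆ B)) := by
    rintro C D ⟨U, E, F, hU, h⟩
    by_cases hUV : U = V
    · subst hUV
      rw [hV] at hU
      simp only [List.cons.injEq, and_true] at hU
      rw [hU.1, hU.2]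
      exact Or.inr h
    · exact Or.inl ⟨U, E, F, by rw [hw U hUV, hU], h⟩
  have hdiff : ∀ C D, ((C ⊆ A ∧ D ⊆ B) ∨ (C ⊆ A ∧ D = V) ∨ (C = V ∧ D ⊆ B)) →
      t.Precedes C D ∧ t'.Precedes D C := by
    intro C D h
    exact ⟨⟨V, A, B, hV, h⟩, ⟨V, B, A, hV', by tauto⟩⟩
  have hA : A ∈ t.w V := by simp [hV]
  have hB : B ∈ t.w V := by simp [hV]
  have hAe := mem_edges_of_mem_w hA
  have hBe := mem_edges_of_mem_w hB
  have hVT := mem_T_of_mem_w hA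
  have hAV := ssubset_of_mem_w hA
  have hBV := ssubset_of_mem_w hB
  have hedge : ∀ {C}, C ∈ edges t.T → C ∈ edges t'.T := fun h => by rwa [hT]
  have hiff : ∀ {C D}, C ∈ edges t.T → D ∈ edges t.T → (t.Precedes C D ∧ t'.Precedes D C ↔
      ((C ⊆ A ∧ D ⊆ B) ∨ (C ⊆ A ∧ D = V) ∨ (C = V ∧ D ⊆ B))) := by
    intro C D hC hD
    refine ⟨fun ⟨h1, h2⟩ => (hsame C D h1).resolve_left fun h3 => ?_, hdiff C D⟩
    exact lt_asymm (ht'.key_lt (hedge hC) (hedge hD) h3) (ht'.key_lt (hedge hD) (hedge hC) h2)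
  have hVs : ∀ x : Fin n, {x} ≠ V := by
    rintro x rfl
    exact t.singleton_notMem x hVT
  have e1 := invSign_change (isTournament_lt Finset.univ) ht.isTournament_leaves
    ht'.isTournament_leaves
  have c1 : (((Finset.univ : Finset (Fin n)) ×ˢ Finset.univ).filter fun x =>
      t.Precedes {x.1} {x.2} ∧ t'.Precedes {x.2} {x.1}) = A ×ˢ B := by
    ext ⟨x, y⟩
    simp only [Finset.mem_filter, Finset.mem_product, Finset.mem_univ, true_and, and_self]
    rw [hiff (singleton_mem_edges _ x) (singleton_mem_edges _ y)]
    simp [hVs]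
  rw [c1, Finset.card_product] at e1
  have e2 := invSign_change (isTournament_colex t.T) ht.isTournament
    (hT ▸ ht'.isTournament)
  have c2 : (t.T ×ˢ t.T).filter (fun x => t.Precedes x.1 x.2 ∧ t'.Precedes x.2 x.1) =
      (t.T.filter fun x => x ⊆ A) ×ˢ (t.T.filter fun x => x ⊆ B) ∪
      ((t.T.filter fun x => x ⊆ A) ×ˢ {V} ∪ {V} ×ˢ (t.T.filter fun x => x ⊆ B)) := by
    ext ⟨x, y⟩
    simp only [Finset.mem_filter, Finset.mem_product, Finset.mem_union, Finset.mem_singleton]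
    constructor
    · rintro ⟨⟨hx, hy⟩, h⟩
      rw [hiff (mem_edges_of_mem hx) (mem_edges_of_mem hy)] at h
      tauto
    · intro h
      have hxy : x ∈ t.T ∧ y ∈ t.T := by
        rcases h with h | ⟨h, rfl⟩ | ⟨rfl, h⟩
        · exact ⟨h.1.1, h.2.1⟩
        · exact ⟨h.1, hVT⟩
        · exact ⟨hVT, h.1⟩
      refine ⟨hxy, (hiff (mem_edges_of_mem hxy.1) (mem_edges_of_mem hxy.2)).2 ?_⟩
      tauto
  rw [c2, Finset.card_union_of_disjoint, Finset.card_union_of_disjoint, Finset.card_product,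
    Finset.card_product, Finset.card_product, Finset.card_singleton] at e2
  · have h1 := ht.card_filter_subset hAe
    have h2 := ht.card_filter_subset hBe
    rw [sgn, sgn, hT, e1, e2, ← h1, ← h2]
    set a := (t.T.filter fun x => x ⊆ A).card
    set b := (t.T.filter fun x => x ⊆ B).card
    have h3 : (-1 : ℤ) ^ ((a + 1) * (b + 1)) * (-1) ^ (a * b + (a * 1 + 1 * b)) = -1 := by
      rw [← pow_add]
      have : (a + 1) * (b + 1) + (a * b + (a * 1 + 1 * b)) = 2 * (a * b + a + b) + 1 := by ring
      rw [this, pow_succ, pow_mul]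
      simp
    rw [mul_mul_mul_comm, h3, mul_neg_one]
  · rw [Finset.disjoint_left]
    rintro ⟨x, y⟩ h1 h2
    simp only [Finset.mem_product, Finset.mem_filter, Finset.mem_singleton] at h1 h2
    rw [h2.1] at h1
    exact hAV.2 h1.1.2
  · rw [Finset.disjoint_left]
    rintro ⟨x, y⟩ h1 h2
    simp only [Finset.mem_product, Finset.mem_filter, Finset.mem_singleton,
      Finset.mem_union] at h1 h2
    rcases h2 with h2 | h2
    · rw [h2.2] at h1
      exact hBV.2 h1.2.2
    · rw [h2.1] at h1
      exact hAV.2 h1.1.2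

end PlanarTree

/-! ### The cancellation of binary planar trees -/

section Inversions

variable {α : Type}

theorem invSign_mul_self (r B : α → α → Prop) (X : Finset α) :
    invSign r B X * invSign r B X = 1 := by
  rw [invSign, ← mul_pow]
  simp

theorem invSign_congr {r B B' : α → α → Prop} {X : Finset α}
    (h : ∀ x ∈ X, ∀ y ∈ X, B x y ↔ B' x y) : invSign r B X = invSign r B' X := by
  classical
  unfold invSign
  congr 2
  refine Finset.filter_congr fun x hx => ?_
  have h' := Finset.mem_product.1 hx
  rw [h _ h'.2 _ h'.1]

/-- If the key of a single element `v` drops from `g₂` to `g₁`, the number of inversions changes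
by the number of keys between `g₁` and `g₂`. -/
theorem neg_one_pow_drop_key [DecidableEq α] {X : Finset α} {v : α} (hv : v ∈ X) {κ κ' : α → ℕ}
    {g₁ g₂ : ℕ} (hg : g₁ < g₂) (h1 : κ v = g₂) (h2 : κ' v = g₁)
    (h : ∀ x ∈ X, x ≠ v → κ' x = κ x) (hne : ∀ x ∈ X, κ x ≠ g₁) :
    (-1 : ℤ) ^ (X.filter fun x => κ' x < g₂).card *
      (-1) ^ ((X ×ˢ X).filter fun x => κ x.1 < κ x.2 ∧ κ' x.2 < κ' x.1).card =
      -(-1) ^ (X.filter fun x => κ x < g₁).card := by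
  have e1 : ((X ×ˢ X).filter fun x => κ x.1 < κ x.2 ∧ κ' x.2 < κ' x.1) =
      (X.filter fun x => g₁ < κ x ∧ κ x < g₂) ×ˢ {v} := by
    ext ⟨x, y⟩
    simp only [Finset.mem_filter, Finset.mem_product, Finset.mem_singleton]
    constructor
    · rintro ⟨⟨hx, hy⟩, h3, h4⟩
      by_cases hxv : x = v
      · subst hxv
        have hyx : y ≠ x := by rintro rfl; exact lt_irrefl _ h3
        rw [h y hy hyx] at h4
        omega
      · by_cases hyv : y = v
        · subst hyv
          rw [h x hx hxv] at h4
          exact ⟨⟨hx, by omega, by omega⟩, rfl⟩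
        · rw [h x hx hxv, h y hy hyv] at h4
          omega
    · rintro ⟨⟨hx, h3, h4⟩, rfl⟩
      have hxv : x ≠ y := by rintro rfl; omega
      rw [h x hx hxv]
      exact ⟨⟨hx, hv⟩, by omega, by omega⟩
  have e2 : (X.filter fun x => κ' x < g₂) = insert v ((X.filter fun x => κ x < g₁) ∪
      X.filter fun x => g₁ < κ x ∧ κ x < g₂) := by
    ext x
    simp only [Finset.mem_filter, Finset.mem_insert, Finset.mem_union]
    by_cases hxv : x = v
    · subst hxv
      simp [hv, h2, hg]
    · simp only [hxv, false_or]
      constructor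
      · rintro ⟨hx, h3⟩
        rw [h x hx hxv] at h3
        have := hne x hx
        rcases Nat.lt_or_gt_of_ne this with h4 | h4
        · exact Or.inl ⟨hx, h4⟩
        · exact Or.inr ⟨hx, h4, h3⟩
      · rintro (⟨hx, h3⟩ | ⟨hx, h3, h4⟩)
        · exact ⟨hx, by rw [h x hx hxv]; omega⟩
        · exact ⟨hx, by rw [h x hx hxv]; omega⟩
  rw [e1, e2, Finset.card_insert_of_notMem, Finset.card_union_of_disjoint, Finset.card_product,
    Finset.card_singleton, ← pow_add]
  · set a := (X.filter fun x => κ x < g₁).card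
    set c := (X.filter fun x => g₁ < κ x ∧ κ x < g₂).card
    have : a + c + 1 + c * 1 = a + 1 + 2 * c := by ring
    rw [this, pow_add, pow_succ, pow_mul]
    simp
  · rw [Finset.disjoint_left]
    intro x hx hx'
    have := (Finset.mem_filter.1 hx).2
    have := (Finset.mem_filter.1 hx').2
    omega
  · simp only [Finset.mem_union, Finset.mem_filter, not_or]
    omega

end Inversions

namespace PlanarTree

variable {n : ℕ} {t t' : PlanarTree n}

theorem sgn_mul_self (t : PlanarTree n) : t.sgn * t.sgn = 1 := by
  rw [sgn, mul_mul_mul_comm, invSign_mul_self, invSign_mul_self, one_mul]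

/-- A tree with the maximal number of edges is binary with unary root, because each of its vertices
has at least two inputs and the root at least one. -/
theorem isBinary_of_card (h : t.T.card + 1 = n) (hn : 2 ≤ n) : t.IsBinary := by
  have h1 := t.sum_length_w
  have h2 := t.root_length_pos (by omega)
  have h3 : ∑ V ∈ t.T, 2 ≤ ∑ V ∈ t.T, (t.w V).length :=
    Finset.sum_le_sum fun V hV => t.two_le_length_w hV
  rw [Finset.sum_const, smul_eq_mul] at h3
  refine ⟨?_, ?_⟩
  · have h4 : t.root.length = 1 := by omega
    obtain ⟨D, hD, -⟩ := exists_mem_inputs_top t.T ⟨0, by omega⟩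
    obtain ⟨l, hl⟩ := exists_cons_of_mem_cycle ((t.mem_root D).2 hD)
    have hl0 : l = [] := by
      rw [hl] at h4
      simpa using h4
    have hDu : D = Finset.univ := by
      refine Finset.eq_univ_iff_forall.2 fun i => ?_
      obtain ⟨E, hE, hi⟩ := exists_mem_inputs_top t.T i
      have h5 := (t.mem_root E).2 hE
      rw [hl, hl0] at h5
      have h6 : E = D := by simpa using h5
      exact h6 ▸ hi
    rw [← hDu]
    refine IsTree.mem_of_mem_edges hD.1 ?_
    rw [hDu, Finset.card_univ, Fintype.card_fin]
    exact hn
  · have h4 : ∑ V ∈ t.T, 2 = ∑ V ∈ t.T, (t.w V).length := by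
      rw [Finset.sum_const, smul_eq_mul]
      omega
    have h5 := (Finset.sum_eq_sum_iff_of_le fun V hV => t.two_le_length_w hV).1 h4
    intro V hV
    exact List.length_eq_two.1 (h5 V hV).symm

theorem key_congr {C : Finset (Fin n)} (h1 : t'.flat Finset.univ = t.flat Finset.univ)
    (h2 : t'.flat C = t.flat C) (h3 : C ∈ t'.T ↔ C ∈ t.T) (h4 : t'.w C = t.w C) :
    t'.key C = t.key C := by
  unfold key start
  rw [h1, h2, h4]
  simp only [h3]

open Classical in
/-- The sign of an edge `S` counts the edges before `S` in the colexicographic order.  Together with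
the sign of the tree it becomes the sign of the tree without `S`, times the sign which counts the
edges before `S` in the in-order traversal. -/
theorem IsBinary.edgeSign_mul_sgn (ht : t.IsBinary) {S : Finset (Fin n)} (hS : S ∈ t.T) :
    edgeSign t.T S * t.sgn =
      invSign (fun x y : Fin n => x < y) (fun x y => t.Precedes {x} {y}) Finset.univ *
      ((-1) ^ ((t.T.erase S).filter fun x => t.key x < t.key S).card *
      invSign (fun C D => toColex C < toColex D) t.Precedes (t.T.erase S)) := by
  have h1 := invSign_insert (Finset.notMem_erase S t.T)
    (r := fun C D => toColex C < toColex D) (B := t.Precedes) (isTournament_colex _)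
    (by rw [Finset.insert_erase hS]; exact ht.isTournament)
  rw [Finset.insert_erase hS] at h1
  have h2 : ((t.T.erase S).filter fun x => t.Precedes x S) =
      (t.T.erase S).filter fun x => t.key x < t.key S :=
    Finset.filter_congr fun x hx => ht.precedes_iff
      (mem_edges_of_mem (Finset.mem_of_mem_erase hx)) (mem_edges_of_mem hS)
  rw [h2] at h1
  have h3 : edgeSign t.T S =
      (-1) ^ ((t.T.erase S).filter fun x => toColex x < toColex S).card := by
    rw [edgeSign]
    congr 2
    ext x
    simp only [Finset.mem_filter, Finset.mem_erase]
    constructor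
    · rintro ⟨h4, h5⟩
      exact ⟨⟨by rintro rfl; exact lt_irrefl _ h5, h4⟩, h5⟩
    · rintro ⟨⟨-, h4⟩, h5⟩
      exact ⟨h4, h5⟩
  have h4 : edgeSign t.T S * invSign (fun C D => toColex C < toColex D) t.Precedes t.T =
      (-1) ^ ((t.T.erase S).filter fun x => t.key x < t.key S).card *
      invSign (fun C D => toColex C < toColex D) t.Precedes (t.T.erase S) := by
    rw [← h1, h3]
    congr!
  rw [← h4, sgn, mul_left_comm]

/-- The two binary resolutions of a vertex with three inputs have opposite signs. -/
theorem IsBinary.sign_flip (ht : t.IsBinary) (ht' : t'.IsBinary) {S S' V X Y Z : Finset (Fin n)}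
    (hS : S ∈ t.T) (hS' : S' ∈ t'.T) (hT : t'.T.erase S' = t.T.erase S) (hV : t.w V = [S, Z])
    (hwS : t.w S = [X, Y]) (hV' : t'.w V = [X, S']) (hwS' : t'.w S' = [Y, Z])
    (hw : ∀ U ∈ t.T.erase S, U ≠ V → t'.w U = t.w U)
    (hf : ∀ C, C ≠ S → C ≠ S' → t'.flat C = t.flat C)
    (hSu : S ≠ Finset.univ) (hSu' : S' ≠ Finset.univ) :
    edgeSign t.T S * t.sgn = -(edgeSign t'.T S' * t'.sgn) := by
  classical
  have hSV : S ∈ t.w V := by simp [hV]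
  have hVT := mem_T_of_mem_w hSV
  have hS'V : S' ∈ t'.w V := by simp [hV']
  have hVS : V ≠ S := (ssubset_of_mem_w hSV).ne'
  have hVS' : V ≠ S' := (ssubset_of_mem_w hS'V).ne'
  have hnS : ∀ x : Fin n, {x} ≠ S := by rintro x rfl; exact t.singleton_notMem x hS
  have hnS' : ∀ x : Fin n, {x} ≠ S' := by rintro x rfl; exact t'.singleton_notMem x hS'
  have hfu := hf Finset.univ hSu.symm hSu'.symm
  have hV0 : V ∈ t.T.erase S := Finset.mem_erase.2 ⟨hVS, hVT⟩
  have hmem : ∀ {x}, x ∈ t.T.erase S → x ≠ S' ∧ x ∈ t'.T := fun hx => by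
    rw [← hT] at hx
    exact Finset.mem_erase.1 hx
  obtain ⟨p1, p2, p3, p4, p5⟩ := start_pair ht.1 hV
  obtain ⟨q1, q2, q3, q4, q5⟩ := start_pair ht.1 hwS
  obtain ⟨r1, r2, r3, r4, r5⟩ := start_pair ht'.1 hV'
  obtain ⟨s1, s2, s3, s4, s5⟩ := start_pair ht'.1 hwS'
  have hsV : t'.start V = t.start V := by
    unfold start
    rw [hfu, hf V hVS hVS']
  have k1 := key_of_w_eq hV
  have k2 := key_of_w_eq hwS
  have k3 := key_of_w_eq hV'
  have k4 := key_of_w_eq hwS'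
  have hkl : ∀ x, t'.key {x} = t.key {x} := fun x =>
    key_congr hfu (hf _ (hnS x) (hnS' x))
      (iff_of_false (t'.singleton_notMem x) (t.singleton_notMem x))
      (by rw [t.w_eq_nil _ (t.singleton_notMem x), t'.w_eq_nil _ (t'.singleton_notMem x)])
  have hk : ∀ x ∈ t.T.erase S, x ≠ V → t'.key x = t.key x := fun x hx hxV => by
    have h1 := Finset.mem_erase.1 hx
    have h2 := hmem hx
    exact key_congr hfu (hf x h1.1 h2.1) (iff_of_true h2.2 h1.2) (hw x hx hxV)
  have hleaf : invSign (fun x y : Fin n => x < y) (fun x y => t'.Precedes {x} {y}) Finset.univ =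
      invSign (fun x y : Fin n => x < y) (fun x y => t.Precedes {x} {y}) Finset.univ :=
    invSign_congr fun x _ y _ => by
      rw [ht'.precedes_iff (singleton_mem_edges _ x) (singleton_mem_edges _ y),
        ht.precedes_iff (singleton_mem_edges _ x) (singleton_mem_edges _ y), hkl, hkl]
  have hchange := invSign_change (isTournament_colex (t.T.erase S))
    (ht.isTournament.subset (Finset.erase_subset S _))
    (ht'.isTournament.subset (X := t.T.erase S) (by rw [← hT]; exact Finset.erase_subset S' _))
  have hpairs : ((t.T.erase S ×ˢ t.T.erase S).filter fun x =>
      t.Precedes x.1 x.2 ∧ t'.Precedes x.2 x.1) =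
      (t.T.erase S ×ˢ t.T.erase S).filter fun x =>
        t.key x.1 < t.key x.2 ∧ t'.key x.2 < t'.key x.1 := by
    refine Finset.filter_congr fun x hx => ?_
    have h1 := Finset.mem_product.1 hx
    rw [ht.precedes_iff (mem_edges_of_mem (Finset.mem_of_mem_erase h1.1))
      (mem_edges_of_mem (Finset.mem_of_mem_erase h1.2)),
      ht'.precedes_iff (mem_edges_of_mem (hmem h1.2).2) (mem_edges_of_mem (hmem h1.1).2)]
  rw [hpairs] at hchange
  have hdrop := neg_one_pow_drop_key hV0 (κ := t.key) (κ' := t'.key) (g₁ := t.key S)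
    (g₂ := t.key V) (by omega) rfl (by omega) hk
    (fun x hx => ht.key_ne (mem_edges_of_mem (Finset.mem_of_mem_erase hx)) (mem_edges_of_mem hS)
      (Finset.ne_of_mem_erase hx))
  rw [ht.edgeSign_mul_sgn hS, ht'.edgeSign_mul_sgn hS', hT, hleaf, hchange,
    show t'.key S' = t.key V by omega]
  have h3 : ∀ a b c d e : ℤ, b * c = -e → a * (e * d) = -(a * (b * (d * c))) := by
    intro a b c d e h
    linear_combination (a * d) * h
  exact h3 _ _ _ _ _ hdrop

/-! ### The two binary resolutions of a contracted tree -/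

theorem IsBinary.parent (ht : t.IsBinary) {S : Finset (Fin n)} (hS : S ∈ t.T)
    (hSu : S ≠ Finset.univ) : ∃ V C, t.w V = [S, C] ∨ t.w V = [C, S] := by
  rcases t.isTree.exists_parent_of_mem_edges (mem_edges_of_mem hS) with h | ⟨V, hV, h⟩
  · exact absurd (lt_of_le_of_ne (Finset.subset_univ S) hSu)
      (h.2.2 Finset.univ (mem_edges_of_mem ht.1) (WithTop.coe_lt_top _))
  · obtain ⟨A, B, hAB⟩ := ht.2 V hV
    have := (t.mem_w V hV S).2 h
    rw [hAB] at this
    rcases List.mem_pair.1 this with rfl | rfl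
    · exact ⟨V, B, Or.inl hAB⟩
    · exact ⟨V, A, Or.inr hAB⟩

theorem contract_w_left {V S X Y C : Finset (Fin n)} (hS : S ∈ t.T) (hV : t.w V = [S, C])
    (hwS : t.w S = [X, Y]) : (t.contract S hS).w V = [X, Y, C] := by
  have hSV : S ∈ t.w V := by simp [hV]
  have hnd := t.nodup_w V
  rw [hV] at hnd
  rw [t.contract_w hS (ssubset_of_mem_w hSV).ne', hV]
  exact (t.flatMap_subst_append_cons (l₁ := []) hnd).trans (by simp [hwS])

theorem contract_w_right {V S X Y C : Finset (Fin n)} (hS : S ∈ t.T) (hV : t.w V = [C, S])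
    (hwS : t.w S = [X, Y]) : (t.contract S hS).w V = [C, X, Y] := by
  have hSV : S ∈ t.w V := by simp [hV]
  have hnd := t.nodup_w V
  rw [hV] at hnd
  rw [t.contract_w hS (ssubset_of_mem_w hSV).ne', hV]
  exact (t.flatMap_subst_append_cons (l₁ := [C]) (l₂ := []) hnd).trans (by simp [hwS])

theorem contract_root_univ {X Y : Finset (Fin n)} (hu : Finset.univ ∈ t.T)
    (hwS : t.w Finset.univ = [X, Y]) :
    (t.contract Finset.univ hu).root = Cycle.ofList [X, Y] := by
  rw [contract_root, root_eq_of_univ_mem hu]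
  change Cycle.ofList ([Finset.univ].flatMap (t.subst Finset.univ)) = _
  simp [subst, hwS]

theorem card_T_contract {S : Finset (Fin n)} (hS : S ∈ t.T) :
    (t.contract S hS).T.card + 1 = t.T.card := Finset.card_erase_add_one hS

/-- The contraction of an edge of a binary tree has a second binary resolution: the inputs `X`, `Y`,
`Z` of the contracted vertex can be bracketed as `(X Y) Z` and `X (Y Z)`, and the two inputs of the
root, which are cyclically ordered, can be arranged in two ways. -/
theorem exists_flip (h : t.T.card + 1 = n) {S : Finset (Fin n)} (hS : S ∈ t.T) :
    ∃ (t' : PlanarTree n) (S' : Finset (Fin n)) (hS' : S' ∈ t'.T),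
      t'.contract S' hS' = t.contract S hS ∧ t'.T.card + 1 = n ∧ t'.w S' ≠ t.w S := by
  have hpos := Finset.card_pos.2 ⟨S, hS⟩
  have ht := isBinary_of_card h (by omega)
  have hcard : ∀ {t' : PlanarTree n} {S' : Finset (Fin n)} (hS' : S' ∈ t'.T),
      t'.contract S' hS' = t.contract S hS → t'.T.card + 1 = n := by
    intro t' S' hS' he
    have h1 := card_T_contract hS
    have h2 := card_T_contract hS'
    rw [he] at h2
    omega
  obtain ⟨X, Y, hwS⟩ := ht.2 S hS
  by_cases hSu : S = Finset.univ
  · subst hSu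
    have hr := contract_root_univ hS hwS
    have hr' : (t.contract Finset.univ hS).root = Cycle.ofList [Y, X] := by
      rw [hr]
      -- The inputs of the root only have a cyclic order, so that the two can be rotated.
      exact Cycle.coe_eq_coe.2 ⟨1, rfl⟩
    obtain ⟨t', h', he, hw', -⟩ := exists_expand_root _ hr'
    refine ⟨t', _, h', he, hcard h' he, ?_⟩
    rw [hw', hwS]
    have hnd := t.nodup_w Finset.univ
    rw [hwS] at hnd
    intro e
    simp at e hnd
    exact hnd e.2
  · obtain ⟨V, C, hV | hV⟩ := ht.parent hS hSu
    · have hc := contract_w_left hS hV hwS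
      have hnd := (t.contract S hS).nodup_w V
      rw [hc] at hnd
      obtain ⟨t', h', he, hw'⟩ := exists_expand_vertex _ (l₁ := [X]) (l₂ := []) hc (by simp)
      refine ⟨t', _, h', he, hcard h' he, ?_⟩
      rw [hw', hwS]
      intro e
      simp at e hnd
      exact hnd.1.1 e.1.symm
    · have hc := contract_w_right hS hV hwS
      have hnd := (t.contract S hS).nodup_w V
      rw [hc] at hnd
      obtain ⟨t', h', he, hw'⟩ := exists_expand_vertex _ (l₁ := []) (l₂ := [Y]) hc (by simp)
      refine ⟨t', _, h', he, hcard h' he, ?_⟩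
      rw [hw', hwS]
      intro e
      simp at e hnd
      exact hnd.1.1 e.1

/-- Two binary planar trees with the same contraction along an edge appear with opposite signs in
the coboundary. -/
theorem sign_eq_neg (h : t.T.card + 1 = n) (h' : t'.T.card + 1 = n) {S S' : Finset (Fin n)}
    (hS : S ∈ t.T) (hS' : S' ∈ t'.T) (he : t'.contract S' hS' = t.contract S hS)
    (hne : ¬ (t' = t ∧ S' = S)) :
    edgeSign t.T S * t.sgn = -(edgeSign t'.T S' * t'.sgn) := by
  have hpos := Finset.card_pos.2 ⟨S, hS⟩
  have ht := isBinary_of_card h (by omega)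
  have ht' := isBinary_of_card h' (by omega)
  obtain ⟨X, Y, hwS⟩ := ht.2 S hS
  obtain ⟨X', Y', hwS'⟩ := ht'.2 S' hS'
  have hT : t'.T.erase S' = t.T.erase S := congrArg PlanarTree.T he
  have hw0 : ∀ U, (t'.contract S' hS').w U = (t.contract S hS).w U := fun U => by rw [he]
  have heq : S' = S → t'.w S' ≠ t.w S := by
    rintro rfl e
    exact hne ⟨eq_of_contract_eq hS' hS e he, rfl⟩
  by_cases hSu : S = Finset.univ
  · have hSu' : S' = Finset.univ := by
      by_contra hcon
      have : Finset.univ ∈ t'.T.erase S' := Finset.mem_erase.2 ⟨Ne.symm hcon, ht'.1⟩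
      rw [hT, hSu] at this
      exact Finset.notMem_erase _ _ this
    subst hSu hSu'
    have hr := congrArg PlanarTree.root he
    rw [contract_root_univ hS hwS, contract_root_univ hS' hwS'] at hr
    have hTT : t'.T = t.T := by
      rw [← Finset.insert_erase hS, ← Finset.insert_erase hS', hT]
    have hXY : X' = Y ∧ Y' = X := by
      have hne' := heq rfl
      rw [hwS, hwS'] at hne'
      have hX : X' ∈ Cycle.ofList [X, Y] := hr ▸ (by simp)
      have hY : Y' ∈ Cycle.ofList [X, Y] := hr ▸ (by simp)
      have hX0 : X ∈ Cycle.ofList [X', Y'] := hr ▸ (by simp)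
      have hY0 : Y ∈ Cycle.ofList [X', Y'] := hr ▸ (by simp)
      simp only [Cycle.mem_coe_iff, List.mem_cons, List.not_mem_nil, or_false] at hX hY hX0 hY0
      simp only [ne_eq, List.cons.injEq, and_true, not_and] at hne'
      grind
    have hw : ∀ U, U ≠ Finset.univ → t'.w U = t.w U := by
      intro U hU
      have h1 := hw0 U
      rwa [contract_w_of_notMem _ hS hU, contract_w_of_notMem _ hS' hU] at h1
      · exact fun h2 => (ssubset_of_mem_w h2).2 (Finset.subset_univ _)
      · exact fun h2 => (ssubset_of_mem_w h2).2 (Finset.subset_univ _)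
    rw [hXY.1, hXY.2] at hwS'
    rw [ht.sgn_swap ht' hTT hwS hwS' hw, hTT]
    ring
  · have hSu' : S' ≠ Finset.univ := by
      rintro rfl
      have : Finset.univ ∈ t.T.erase S := Finset.mem_erase.2 ⟨Ne.symm hSu, ht.1⟩
      rw [← hT] at this
      exact Finset.notMem_erase _ _ this
    have hflat : ∀ C, C ≠ S → C ≠ S' → t'.flat C = t.flat C := by
      intro C h1 h2
      rw [← t.flat_contract hS h1, ← t'.flat_contract hS' h2, he]
    -- The parents of the two edges agree: they have three inputs after the contraction.
    have hlen : ∀ {s : PlanarTree n} {R V C : Finset (Fin n)}, s.IsBinary → ∀ hR : R ∈ s.T,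
        (s.w V = [R, C] ∨ s.w V = [C, R]) → ∀ U, ((s.contract R hR).w U).length = 3 → U = V := by
      intro s R V C hs hR hV U hU
      by_contra hUV
      have hUR : U ≠ R := by
        rintro rfl
        simp [contract] at hU
      have hUT : U ∈ s.T := by
        have h1 : U ∈ (s.contract R hR).T := by
          by_contra hcon
          rw [w_eq_nil _ _ hcon] at hU
          simp at hU
        exact ((s.mem_contract_T hR).1 h1).2
      have hRV : R ∈ s.w V := by rcases hV with hV | hV <;> simp [hV]
      have hRU : R ∉ s.w U := fun h1 => hUV (WithTop.coe_injective
        (s.isTree.vertex_unique (isVertex_coe hUT) (isVertex_coe (mem_T_of_mem_w hRV))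
          (inputs_of_mem_w h1) (inputs_of_mem_w hRV)))
      obtain ⟨A, B, hAB⟩ := hs.2 U hUT
      rw [contract_w_of_notMem _ hR hUR hRU, hAB] at hU
      simp at hU
    obtain ⟨V, C, hV⟩ := ht.parent hS hSu
    obtain ⟨V', C', hV'⟩ := ht'.parent hS' hSu'
    have hVV : V = V' := by
      refine hlen ht' hS' hV' V ?_
      rw [hw0]
      rcases hV with hV | hV
      · rw [contract_w_left hS hV hwS]; rfl
      · rw [contract_w_right hS hV hwS]; rfl
    subst hVV
    have hw : ∀ U ∈ t.T.erase S, U ≠ V → t'.w U = t.w U := by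
      intro U hU hUV
      have hU' := hU
      rw [← hT] at hU'
      have h1 := Finset.mem_erase.1 hU
      have h2 := Finset.mem_erase.1 hU'
      have hSV : S ∈ t.w V := by rcases hV with hV | hV <;> simp [hV]
      have hSV' : S' ∈ t'.w V := by rcases hV' with hV' | hV' <;> simp [hV']
      have h3 := hw0 U
      rwa [contract_w_of_notMem _ hS h1.1, contract_w_of_notMem _ hS' h2.1] at h3
      · exact fun h4 => hUV (WithTop.coe_injective
          (t'.isTree.vertex_unique (isVertex_coe h2.2) (isVertex_coe (mem_T_of_mem_w hSV'))
          (inputs_of_mem_w h4) (inputs_of_mem_w hSV')))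
      · exact fun h4 => hUV (WithTop.coe_injective
          (t.isTree.vertex_unique (isVertex_coe h1.2) (isVertex_coe (mem_T_of_mem_w hSV))
          (inputs_of_mem_w h4) (inputs_of_mem_w hSV)))
    have hcV := hw0 V
    have hsame : X' = X → Y' = Y → False := by
      rintro rfl rfl
      exact heq (by rw [eq_union_of_w_eq hwS, eq_union_of_w_eq hwS']) (by rw [hwS, hwS'])
    rcases hV with hV | hV <;> rcases hV' with hV' | hV'
    · rw [contract_w_left hS hV hwS, contract_w_left hS' hV' hwS'] at hcV
      simp only [List.cons.injEq, and_true] at hcV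
      exact (hsame hcV.1 hcV.2.1).elim
    · rw [contract_w_left hS hV hwS, contract_w_right hS' hV' hwS'] at hcV
      simp only [List.cons.injEq, and_true] at hcV
      obtain ⟨rfl, rfl, rfl⟩ := hcV
      exact ht.sign_flip ht' hS hS' hT hV hwS hV' hwS' hw hflat hSu hSu'
    · rw [contract_w_right hS hV hwS, contract_w_left hS' hV' hwS'] at hcV
      simp only [List.cons.injEq, and_true] at hcV
      obtain ⟨rfl, rfl, rfl⟩ := hcV
      have := ht'.sign_flip ht hS' hS hT.symm hV' hwS' hV hwS
        (fun U hU hUV => (hw U (hT ▸ hU) hUV).symm)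
        (fun C h1 h2 => (hflat C h2 h1).symm) hSu' hSu
      rw [this, neg_neg]
    · rw [contract_w_right hS hV hwS, contract_w_right hS' hV' hwS'] at hcV
      simp only [List.cons.injEq, and_true] at hcV
      exact (hsame hcV.2.1 hcV.2.2).elim

end PlanarTree

/-! ### The signed sum over the binary planar trees -/

namespace PlanarTree

variable {n : ℕ} {k : Type u} [Field k]

instance : Finite (PlanarTree n) := by
  refine Finite.of_injective (β := Finset (Finset (Fin n)) ×
    (Finset (Fin n) → {l : List (Finset (Fin n)) // l.Nodup}) ×
    {c : Cycle (Finset (Fin n)) // c.Nodup})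
    (fun t => (t.T, fun V => ⟨t.w V, t.nodup_w V⟩, ⟨t.root, t.nodup_root⟩)) ?_
  intro t t' h
  simp only [Prod.mk.injEq, Subtype.mk.injEq] at h
  exact PlanarTree.ext h.1 (funext fun V => congrArg Subtype.val (congrFun h.2.1 V)) h.2.2

/-- The signed sum over the binary planar trees vanishes on coboundaries, because the two
resolutions of every contracted tree cancel. -/
theorem sum_sgn_smul_coboundary {M : Type u} [AddCommGroup M] [Module k M]
    [Fintype {t : PlanarTree n // t.T.card + 1 = n}] (F : PlanarTree n → k) (G : PlanarTree n → M)
    (hG : ∀ (t : PlanarTree n) (S : Finset (Fin n)) (hS : S ∈ t.T), G (t.contract S hS) = G t) :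
    ∑ t : {t : PlanarTree n // t.T.card + 1 = n}, t.1.sgn • coboundary F t.1 • G t.1 = 0 := by
  classical
  let s : (Σ t : {t : PlanarTree n // t.T.card + 1 = n}, {S // S ∈ t.1.T}) → ℤ := fun a =>
    edgeSign a.1.1.T a.2.1 * a.1.1.sgn
  let c : (Σ t : {t : PlanarTree n // t.T.card + 1 = n}, {S // S ∈ t.1.T}) → PlanarTree n :=
    fun a => a.1.1.contract a.2.1 a.2.2
  have h1 : ∑ t : {t : PlanarTree n // t.T.card + 1 = n}, t.1.sgn • coboundary F t.1 • G t.1 =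
      ∑ a : (Σ t : {t : PlanarTree n // t.T.card + 1 = n}, {S // S ∈ t.1.T}),
        s a • F (c a) • G (c a) := by
    rw [Fintype.sum_sigma]
    refine Finset.sum_congr rfl fun t _ => ?_
    rw [coboundary, Finset.sum_smul, Finset.smul_sum]
    refine Finset.sum_congr rfl fun S _ => ?_
    change _ = (edgeSign t.1.T S.1 * t.1.sgn) • F (t.1.contract S.1 S.2) •
      G (t.1.contract S.1 S.2)
    rw [hG, mul_comm, mul_smul, smul_assoc]
  have hneg : ∀ a b, c b = c a → b ≠ a → s a = -s b := by
    intro a b h hne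
    refine sign_eq_neg a.1.2 b.1.2 a.2.2 b.2.2 h ?_
    rintro ⟨h2, h3⟩
    apply hne
    obtain ⟨⟨ta, ha⟩, ⟨Sa, hSa⟩⟩ := a
    obtain ⟨⟨tb, hb⟩, ⟨Sb, hSb⟩⟩ := b
    dsimp only at h2 h3
    subst h2 h3
    rfl
  have hs0 : ∀ a, s a ≠ 0 := fun a => by
    have h2 := edgeSign_mul_self a.1.1.T a.2.1
    have h3 := sgn_mul_self a.1.1
    intro h4
    have h5 : s a * s a = 1 := by
      change edgeSign _ _ * sgn _ * (edgeSign _ _ * sgn _) = 1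
      rw [mul_mul_mul_comm, h2, h3, one_mul]
    rw [h4] at h5
    simp at h5
  have hex : ∀ a, ∃ b, c b = c a ∧ b ≠ a := by
    intro a
    obtain ⟨t', S', hS', he, hc, hw⟩ := exists_flip a.1.2 a.2.2
    refine ⟨⟨⟨t', hc⟩, ⟨S', hS'⟩⟩, he, ?_⟩
    rintro rfl
    exact hw rfl
  choose g hg hga using hex
  rw [h1]
  refine Finset.sum_involution (fun a _ => g a) (fun a _ => ?_) (fun a _ _ => hga a)
    (fun a _ => Finset.mem_univ _) (fun a _ => ?_)
  · rw [hneg a (g a) (hg a) (hga a), hg, neg_smul, neg_add_cancel]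
  · -- Three different resolutions would have pairwise opposite signs.
    by_contra hne
    have h2 := hneg a (g a) (hg a) (hga a)
    have h3 := hneg (g a) (g (g a)) (hg _) (hga _)
    have h4 := hneg a (g (g a)) ((hg _).trans (hg a)) hne
    exact hs0 a (by omega)

/-- The planar tree with the inputs of the vertices in `A` reversed. -/
def rev (t : PlanarTree n) (A : Finset (Finset (Fin n))) : PlanarTree n where
  T := t.T
  isTree := t.isTree
  w V := if V ∈ A then (t.w V).reverse else t.w V
  root := t.root
  nodup_w V := by
    split_ifs
    · exact List.nodup_reverse.2 (t.nodup_w V)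
    · exact t.nodup_w V
  mem_w V hV C := by
    split_ifs
    · rw [List.mem_reverse]; exact t.mem_w V hV C
    · exact t.mem_w V hV C
  w_eq_nil V hV := by
    rw [t.w_eq_nil V hV]
    simp
  nodup_root := t.nodup_root
  mem_root := t.mem_root

/-- Each reversal of the two inputs of a vertex changes the sign of a binary planar tree. -/
theorem sgn_rev {t : PlanarTree n} (h : t.T.card + 1 = n) (A : Finset (Finset (Fin n)))
    (hA : A ⊆ t.T) : (t.rev A).sgn = (-1) ^ A.card * t.sgn := by
  induction A using Finset.induction_on with
  | empty =>
    have : t.rev ∅ = t := PlanarTree.ext rfl (funext fun V => by simp [rev]) rfl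
    rw [this]
    simp
  | insert V A hVA ih =>
    have hV : V ∈ t.T := hA (Finset.mem_insert_self V A)
    have hn : 2 ≤ n := by
      have := Finset.card_pos.2 ⟨V, hV⟩
      omega
    obtain ⟨X, Y, hXY⟩ := (isBinary_of_card h hn).2 V hV
    have h1 : (t.rev A).IsBinary := isBinary_of_card h hn
    have h2 : (t.rev (insert V A)).IsBinary := isBinary_of_card h hn
    rw [h1.sgn_swap (t' := t.rev (insert V A)) h2 rfl (V := V) (A := X) (B := Y)
      ((if_neg hVA).trans hXY)
      ((if_pos (Finset.mem_insert_self V A)).trans (by rw [hXY]; rfl)) ?_,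
      ih ((Finset.subset_insert V A).trans hA), Finset.card_insert_of_notMem hVA, pow_succ]
    · ring
    · intro U hU
      simp only [rev, Finset.mem_insert, hU, false_or]

end PlanarTree

/-! ### Planar trees as a basis of the cobar construction -/

section Words

variable {A B : Type}

theorem cycle_map_injective {f : A → B} (hf : Function.Injective f) :
    Function.Injective (Cycle.map f) := by
  intro c c' h
  induction c using Quotient.inductionOn' with
  | h l =>
  induction c' using Quotient.inductionOn' with
  | h l' =>
  have h' : Cycle.ofList (l.map f) = Cycle.ofList (l'.map f) := h
  obtain ⟨m, hm⟩ := Cycle.coe_eq_coe.1 h'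
  rw [← List.map_rotate] at hm
  exact Cycle.coe_eq_coe.2 ⟨m, List.map_injective_iff.2 hf hm⟩

theorem Word.ext_of_map {f : A → B} (hf : Function.Injective f) {w w' : Word A}
    (h : w.1.map f = w'.1.map f) : w = w' :=
  Subtype.ext (List.map_injective_iff.2 hf h)

theorem CyclicWord.ext_of_map {f : A → B} (hf : Function.Injective f) {c c' : CyclicWord A}
    (h : c.1.map f = c'.1.map f) : c = c' :=
  Subtype.ext (cycle_map_injective hf h)

/-- There is only one word in an alphabet with one letter. -/
theorem Word.eq_of_existsUnique {p : A → Prop} (h : ∃! a, p a) (w w' : Word {a // p a}) :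
    w = w' := by
  obtain ⟨a, ha, hu⟩ := h
  have key : ∀ v : Word {a // p a}, v.1 = [⟨a, ha⟩] := by
    intro v
    have h1 : ∀ x : {a // p a}, x = ⟨a, ha⟩ := fun x => Subtype.ext (hu x.1 x.2)
    have h2 := List.eq_replicate_of_mem fun x (_ : x ∈ v.1) => h1 x
    have h3 := v.2.2.1
    rw [h2, List.nodup_replicate] at h3
    have h4 := List.length_pos_iff.2 v.2.1
    rw [h2, show v.1.length = 1 by omega]
    rfl
  exact Subtype.ext ((key w).trans (key w').symm)

theorem exists_word {s : Set A} {l : List A} (h0 : l ≠ []) (hl : l.Nodup)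
    (h : ∀ a, a ∈ l ↔ a ∈ s) :
    ∃ w : Word s, w.1.map Subtype.val = l := by
  lift l to List s using fun a ha => (h a).1 ha
  refine ⟨⟨l, fun e => h0 (by rw [e]; rfl), List.Nodup.of_map _ hl, fun a => ?_⟩, rfl⟩
  obtain ⟨b, hb, hba⟩ := List.mem_map.1 ((h a.1).2 a.2)
  rwa [← Subtype.ext hba]

theorem exists_cyclicWord {s : Set A} {c : Cycle A} (h0 : c ≠ Cycle.nil) (hc : c.Nodup)
    (h : ∀ a, a ∈ c ↔ a ∈ s) : ∃ w : CyclicWord s, w.1.map Subtype.val = c := by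
  induction c using Quotient.inductionOn' with
  | h l =>
    obtain ⟨w, hw⟩ := exists_word (s := s) (l := l) (fun e => h0 (by subst e; rfl)) hc h
    exact ⟨w.toCyclic, congrArg Cycle.ofList hw⟩

/-- The substitution of words on the fibres of `f` into a cyclic word, in terms of lists: the words,
relabelled by `g`, replace the letters. -/
theorem CyclicWord.subst_map_fiber {I A B : Type} (f : I → A) (g : I → B) (c : CyclicWord A)
    (u : ∀ b, Word {i // f i = b}) (s : A → List B) (h : ∀ b, (u b).1.map (fun i => g i.1) = s b) :
    ((c.subst u).map (Equiv.sigmaFiberEquiv f)).1.map g = cycleBind s c.1 := by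
  obtain ⟨w, rfl⟩ := Word.toCyclic_surjective c
  change Cycle.ofList (((w.1.flatMap fun a => (u a).1.map (Sigma.mk a)).map
    (Equiv.sigmaFiberEquiv f)).map g) = Cycle.ofList (w.1.flatMap s)
  rw [List.map_flatMap, List.map_flatMap]
  refine congrArg Cycle.ofList (List.flatMap_congr fun a _ => ?_)
  rw [← h, List.map_map, List.map_map]
  rfl

/-- The analogue of `CyclicWord.subst_map_fiber` for words. -/
theorem Word.subst_map_fiber {I A B : Type} (f : I → A) (g : I → B) (w : Word A)
    (u : ∀ b, Word {i // f i = b}) (s : A → List B) (h : ∀ b, (u b).1.map (fun i => g i.1) = s b) :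
    ((w.subst u).map (Equiv.sigmaFiberEquiv f)).1.map g = w.1.flatMap s := by
  change ((w.1.flatMap fun a => (u a).1.map (Sigma.mk a)).map
    (Equiv.sigmaFiberEquiv f)).map g = w.1.flatMap s
  rw [List.map_flatMap, List.map_flatMap]
  refine List.flatMap_congr fun a _ => ?_
  rw [← h, List.map_map, List.map_map]
  rfl

variable {k : Type u} [Field k]

variable (k) in
/-- The basis element of the operad `Ass` given by a word. -/
noncomputable def wordVec [Finite A] (w : Word A) : (Ass k).obj A :=
  (Finsupp.single w 1 : Word A →₀ k)

variable (k) in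
/-- The basis element of the module `Cycl` given by a cyclic word. -/
noncomputable def cycVec [Finite A] (c : CyclicWord A) : (Cycl k).obj A :=
  (Finsupp.single c 1 : CyclicWord A →₀ k)

theorem map_wordVec [Finite A] [Finite B] (e : A ≃ B) (w : Word A) :
    (Ass k).map e (wordVec k w) = wordVec k (w.map e) := Finsupp.mapDomain_single

theorem map_cycVec [Finite A] [Finite B] (e : A ≃ B) (c : CyclicWord A) :
    (Cycl k).map e (cycVec k c) = cycVec k (c.map e) := Finsupp.mapDomain_single

theorem comp_wordVec [Finite A] {B : A → Type} [∀ a, Finite (B a)] (w : Word A)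
    (v : ∀ a, Word (B a)) :
    (Ass k).comp (wordVec k w) (fun a => wordVec k (v a)) = wordVec k (w.subst v) :=
  linExt_single (k := k) Word.subst w v

theorem comp_cycVec [Finite A] {B : A → Type} [∀ a, Finite (B a)] (c : CyclicWord A)
    (v : ∀ a, Word (B a)) :
    (Cycl k).comp (cycVec k c) (fun a => wordVec k (v a)) = cycVec k (c.subst v) :=
  linExt_single (k := k) CyclicWord.subst c v

open Classical in
theorem unitFamily_update {I A : Type} [Finite I] [Finite A] (f : I → A) (a : A)
    (hf : ∀ b, b ≠ a → ∃! i, f i = b) (u : ∀ b, Word {i // f i = b}) :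
    Function.update (unitFamily (Ass k) f a hf) a (wordVec k (u a)) =
      fun b => wordVec k (u b) := by
  funext b
  by_cases hb : b = a
  · subst hb
    rw [Function.update_self]
  · rw [Function.update_of_ne hb, unitFamily, dif_pos hb]
    refine (map_wordVec _ Word.one).trans ?_
    rw [Word.eq_of_existsUnique (hf b hb) (u b)]

/-- A partial composition of basis elements is the substitution of a word for the letter `a`.  The
words `u b` for `b ≠ a` have one letter and only rename `b`. -/
theorem partialComp_cycVec {I A : Type} [Finite I] [Finite A] (f : I → A) (a : A)
    (hf : ∀ b, b ≠ a → ∃! i, f i = b) (u : ∀ b, Word {i // f i = b}) (c : CyclicWord A) :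
    (Cycl k).partialComp f a hf (cycVec k c) (wordVec k (u a)) =
      cycVec k ((c.subst u).map (Equiv.sigmaFiberEquiv f)) := by
  rw [RightModule.partialComp, LinearMap.mk₂_apply, unitFamily_update, comp_cycVec, map_cycVec]

theorem partialComp_wordVec {I A : Type} [Finite I] [Finite A] (f : I → A) (a : A)
    (hf : ∀ b, b ≠ a → ∃! i, f i = b) (u : ∀ b, Word {i // f i = b}) (w : Word A) :
    (Ass k).self.partialComp f a hf (wordVec k w) (wordVec k (u a)) =
      wordVec k ((w.subst u).map (Equiv.sigmaFiberEquiv f)) := by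
  rw [RightModule.partialComp, LinearMap.mk₂_apply, unitFamily_update, comp_wordVec, map_wordVec]

end Words

theorem cobarD_apply {k : Type u} [Field k] {P : Operad k} (M : RightModule P) {n p : ℕ}
    (F : M.Cobar n (p + 1)) (T : TreeOfDegree n p) (x : M.obj (inputs T.1 ⊤))
    (q : ∀ V : {V // V ∈ T.1}, P.obj (inputs T.1 (V.1 : WithTop (Finset (Fin n))))) :
    M.cobarD n p F T x q = ∑ S : {S // S ∈ T.1}, edgeSign T.1 S.1 •
      F ⟨T.1.erase S.1, T.2.1.erase S.1, by
        have h1 := Finset.card_erase_of_mem S.2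
        have h2 := Finset.card_pos.2 ⟨S.1, S.2⟩
        have := T.2.2
        omega⟩ (M.contractRoot T.2.1 S.2 x q) (contractVertex P T.2.1 S.2 q) := by
  rw [RightModule.cobarD, LinearMap.pi_apply, LinearMap.sum_apply, LinearMap.sum_apply, sum_apply]
  rfl

/-- The decorations of the vertices of a tree by basis elements: a cyclic word in the inputs of the
root, and a word in the inputs of every other vertex. -/
abbrev Dec {n : ℕ} (T : Finset (Finset (Fin n))) : Type :=
  CyclicWord (inputs T ⊤) × ∀ V : {V // V ∈ T}, Word (inputs T (V.1 : WithTop (Finset (Fin n))))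

namespace PlanarTree

variable {n : ℕ}

theorem root_ne_nil (hn : 0 < n) (t : PlanarTree n) : t.root ≠ Cycle.nil := fun e => by
  have := t.root_length_pos hn
  rw [e] at this
  simp at this

theorem exists_dec (hn : 0 < n) (t : PlanarTree n) : ∃ d : Dec t.T,
    d.1.1.map Subtype.val = t.root ∧ ∀ V, (d.2 V).1.map Subtype.val = t.w V.1 := by
  obtain ⟨c, hc⟩ := exists_cyclicWord (t.root_ne_nil hn) t.nodup_root t.mem_root
  choose p hp using fun V : {V // V ∈ t.T} =>
    exists_word (t.w_ne_nil V.2) (t.nodup_w V.1) (t.mem_w V.1 V.2)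
  exact ⟨⟨c, p⟩, hc, hp⟩

/-- The decorations of the vertices given by a planar structure. -/
noncomputable def dec (hn : 0 < n) (t : PlanarTree n) : Dec t.T := (t.exists_dec hn).choose

theorem dec_fst (hn : 0 < n) (t : PlanarTree n) :
    (t.dec hn).1.1.map Subtype.val = t.root := (t.exists_dec hn).choose_spec.1

theorem dec_snd (hn : 0 < n) (t : PlanarTree n) (V : {V // V ∈ t.T}) :
    ((t.dec hn).2 V).1.map Subtype.val = t.w V.1 := (t.exists_dec hn).choose_spec.2 V

open Classical in
/-- The planar structure given by decorations of the vertices. -/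
noncomputable def ofDec {T : Finset (Finset (Fin n))} (hT : IsTree T) (d : Dec T) :
    PlanarTree n where
  T := T
  isTree := hT
  w V := if h : V ∈ T then (d.2 ⟨V, h⟩).1.map Subtype.val else []
  root := d.1.1.map Subtype.val
  nodup_w V := by
    split_ifs with h
    · exact (d.2 ⟨V, h⟩).2.2.1.map Subtype.val_injective
    · exact List.nodup_nil
  mem_w V hV C := by
    rw [dif_pos hV]
    constructor
    · intro hC
      obtain ⟨x, -, rfl⟩ := List.mem_map.1 hC
      exact x.2
    · intro hC
      exact List.mem_map.2 ⟨⟨C, hC⟩, (d.2 ⟨V, hV⟩).2.2.2 _, rfl⟩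
  w_eq_nil V hV := dif_neg hV
  nodup_root := by
    obtain ⟨w, hw⟩ := Word.toCyclic_surjective d.1
    rw [← hw]
    exact w.2.2.1.map Subtype.val_injective
  mem_root C := by
    rw [Cycle.mem_map]
    constructor
    · rintro ⟨x, -, rfl⟩
      exact x.2
    · intro hC
      exact ⟨⟨C, hC⟩, d.1.2.2.2 _, rfl⟩

theorem ofDec_w {T : Finset (Finset (Fin n))} (hT : IsTree T) (d : Dec T) (V : {V // V ∈ T}) :
    (ofDec hT d).w V.1 = (d.2 V).1.map Subtype.val := dif_pos V.2

theorem dec_ofDec (hn : 0 < n) {T : Finset (Finset (Fin n))} (hT : IsTree T) (d : Dec T) :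
    (ofDec hT d).dec hn = d := by
  refine Prod.ext ?_ (funext fun V => ?_)
  · exact CyclicWord.ext_of_map Subtype.val_injective ((ofDec hT d).dec_fst hn)
  · exact Word.ext_of_map Subtype.val_injective
      (((ofDec hT d).dec_snd hn V).trans (ofDec_w hT d V))

theorem ofDec_dec (hn : 0 < n) (t : PlanarTree n) : ofDec t.isTree (t.dec hn) = t := by
  refine PlanarTree.ext rfl (funext fun V => ?_) (t.dec_fst hn)
  by_cases hV : V ∈ t.T
  · exact (ofDec_w t.isTree _ ⟨V, hV⟩).trans (t.dec_snd hn ⟨V, hV⟩)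
  · rw [t.w_eq_nil V hV]
    exact dif_neg hV

/-- The cyclic word of the leaves. -/
noncomputable def cyclicWord (hn : 0 < n) (t : PlanarTree n) : CyclicWord (Fin n) :=
  ⟨t.cyc, fun e => by
    have h := t.mem_cyc ⟨0, hn⟩
    rw [e] at h
    exact Cycle.notMem_nil _ h, t.nodup_cyc, t.mem_cyc⟩

variable {k : Type u} [Field k]

variable (k) in
/-- The basis element of the decorations of the root. -/
noncomputable def rootDec (hn : 0 < n) (t : PlanarTree n) : (Cycl k).obj (inputs t.T ⊤) :=
  cycVec k (t.dec hn).1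

variable (k) in
/-- The basis element of the decorations of the other vertices. -/
noncomputable def vertexDec (hn : 0 < n) (t : PlanarTree n) (V : {V // V ∈ t.T}) :
    (Ass k).obj (inputs t.T (V.1 : WithTop (Finset (Fin n)))) :=
  wordVec k ((t.dec hn).2 V)

/-- The words which are substituted for the inputs of a vertex, when an edge is contracted. -/
theorem exists_fiberWord (hn : 0 < n) (t : PlanarTree n) {S : Finset (Fin n)} (hS : S ∈ t.T)
    {v : WithTop (Finset (Fin n))} (h : S ∈ inputs t.T v) :
    ∃ u : ∀ b, Word {C : inputs (t.T.erase S) v // collapse h C = b},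
      (∀ b, (u b).1.map (fun C => C.1.1) = t.subst S b.1) ∧
      u ⟨S, h⟩ = ((t.dec hn).2 ⟨S, hS⟩).map (collapseFiber t.isTree hS h) := by
  have hex : ∀ b, ∃ u : Word {C : inputs (t.T.erase S) v // collapse h C = b},
      u.1.map (fun C => C.1.1) = t.subst S b.1 := by
    intro b
    by_cases hb : b = ⟨S, h⟩
    · subst hb
      refine ⟨((t.dec hn).2 ⟨S, hS⟩).map (collapseFiber t.isTree hS h), ?_⟩
      rw [subst, if_pos rfl, ← t.dec_snd hn ⟨S, hS⟩]
      change (List.map _ _).map _ = _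
      rw [List.map_map]
      rfl
    · obtain ⟨C, hC, hu⟩ := collapse_existsUnique t.isTree hS h b hb
      refine ⟨⟨[⟨C, hC⟩], by simp, by simp, fun x => ?_⟩, ?_⟩
      · rw [List.mem_singleton]
        exact Subtype.ext (hu x.1 x.2)
      · rw [subst, if_neg fun e => hb (Subtype.ext e), List.map_singleton, List.cons.injEq]
        refine ⟨?_, rfl⟩
        by_cases h1 : C.1 ∈ inputs t.T v
        · have h2 : (collapse h C).1 = C.1 := by simp only [collapse, dif_pos h1]
          exact h2.symm.trans (congrArg Subtype.val hC)
        · exact absurd (by rw [← hC, collapse, dif_neg h1]) hb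
  choose u hu using hex
  refine ⟨u, hu, Word.ext_of_map (f := fun C => C.1.1)
    (Subtype.val_injective.comp Subtype.val_injective) ?_⟩
  rw [hu, subst, if_pos rfl, ← t.dec_snd hn ⟨S, hS⟩]
  change _ = (List.map _ _).map _
  rw [List.map_map]
  rfl

theorem map_setCongr {A : Type} {s s' : Set A} (h : s = s') (w : Word s) :
    (w.map (Equiv.setCongr h)).1.map Subtype.val = w.1.map Subtype.val := by
  subst h
  change (List.map _ _).map _ = _
  rw [List.map_map]
  rfl

theorem cyclicWord_map_setCongr {A : Type} {s s' : Set A} (h : s = s') (c : CyclicWord s) :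
    (c.map (Equiv.setCongr h)).1.map Subtype.val = c.1.map Subtype.val := by
  obtain ⟨w, rfl⟩ := Word.toCyclic_surjective c
  exact congrArg Cycle.ofList (map_setCongr h w)

/-- The composition of the decorations along a contracted edge is the decoration of the contracted
planar tree, at the root. -/
theorem contractRoot_dec (hn : 0 < n) (t : PlanarTree n) {S : Finset (Fin n)} (hS : S ∈ t.T) :
    (Cycl k).contractRoot t.isTree hS (t.rootDec k hn) (t.vertexDec k hn) =
      (t.contract S hS).rootDec k hn := by
  unfold RightModule.contractRoot
  split_ifs with h
  · obtain ⟨u, hu, hS'⟩ := t.exists_fiberWord hn hS h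
    have h1 : (Ass k).map (collapseFiber t.isTree hS h) (t.vertexDec k hn ⟨S, hS⟩) =
        wordVec k (u ⟨S, h⟩) := by
      rw [hS']
      exact map_wordVec _ _
    change (Cycl k).partialComp (collapse h) ⟨S, h⟩ _ (t.rootDec k hn)
      ((Ass k).map (collapseFiber t.isTree hS h) (t.vertexDec k hn ⟨S, hS⟩)) = _
    rw [h1]
    refine (partialComp_cycVec _ _ _ u _).trans ?_
    refine congrArg (cycVec k) ?_
    refine CyclicWord.ext_of_map Subtype.val_injective ?_
    refine (CyclicWord.subst_map_fiber _ _ _ u _ hu).trans ?_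
    refine Eq.trans ?_ ((t.contract S hS).dec_fst hn).symm
    rw [contract_root, ← t.dec_fst hn]
    obtain ⟨w, hw⟩ := Word.toCyclic_surjective (t.dec hn).1
    rw [← hw]
    change Cycle.ofList _ = Cycle.ofList ((w.1.map Subtype.val).flatMap _)
    rw [List.flatMap_map]
  · refine (map_cycVec _ _).trans ?_
    refine congrArg (cycVec k) ?_
    refine CyclicWord.ext_of_map Subtype.val_injective ?_
    refine (cyclicWord_map_setCongr _ _).trans ?_
    refine Eq.trans (t.dec_fst hn) (Eq.trans ?_ ((t.contract S hS).dec_fst hn).symm)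
    rw [contract_root, cycleBind_subst_of_notMem]
    exact fun h' => h ((t.mem_root S).1 h')

/-- The composition of the decorations along a contracted edge is the decoration of the contracted
planar tree, at the vertices other than the root. -/
theorem contractVertex_dec (hn : 0 < n) (t : PlanarTree n) {S : Finset (Fin n)} (hS : S ∈ t.T) :
    contractVertex (Ass k) t.isTree hS (t.vertexDec k hn) =
      (t.contract S hS).vertexDec k hn := by
  funext V
  have hV := Finset.mem_erase.1 V.2
  unfold contractVertex
  split_ifs with h
  · obtain ⟨u, hu, hS'⟩ := t.exists_fiberWord hn hS h
    have h1 : (Ass k).map (collapseFiber t.isTree hS h) (t.vertexDec k hn ⟨S, hS⟩) =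
        wordVec k (u ⟨S, h⟩) := by
      rw [hS']
      exact map_wordVec _ _
    change (Ass k).self.partialComp (collapse h) ⟨S, h⟩ _ (t.vertexDec k hn ⟨V.1, hV.2⟩)
      ((Ass k).map (collapseFiber t.isTree hS h) (t.vertexDec k hn ⟨S, hS⟩)) = _
    rw [h1]
    refine (partialComp_wordVec _ _ _ u _).trans ?_
    refine congrArg (wordVec k) ?_
    refine Word.ext_of_map Subtype.val_injective ?_
    refine (Word.subst_map_fiber _ _ _ u _ hu).trans ?_
    refine Eq.trans ?_ ((t.contract S hS).dec_snd hn V).symm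
    rw [contract_w _ hS hV.1, ← t.dec_snd hn ⟨V.1, hV.2⟩, List.flatMap_map]
  · refine (map_wordVec _ _).trans ?_
    refine congrArg (wordVec k) ?_
    refine Word.ext_of_map Subtype.val_injective ?_
    refine (map_setCongr _ _).trans ?_
    refine Eq.trans (t.dec_snd hn ⟨V.1, hV.2⟩)
      (Eq.trans ?_ ((t.contract S hS).dec_snd hn V).symm)
    rw [contract_w_of_notMem _ hS hV.1]
    exact fun h' => h ((t.mem_w V.1 hV.2 S).1 h')

/-- The value of an element of the cobar construction, regarded as a form on decorated trees, at the
basis element given by a planar tree.  It is zero at the planar trees of a different degree. -/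
noncomputable def ev (hn : 0 < n) {p : ℕ} (F : (Cycl k).Cobar n p) (t : PlanarTree n) : k :=
  open Classical in
  if h : t.T.card + p + 1 = n then
    F ⟨t.T, t.isTree, h⟩ (t.rootDec k hn) (t.vertexDec k hn) else 0

theorem ev_of_card (hn : 0 < n) {p : ℕ} (F : (Cycl k).Cobar n p) {t : PlanarTree n}
    (h : t.T.card + p + 1 = n) :
    ev hn F t = F ⟨t.T, t.isTree, h⟩ (t.rootDec k hn) (t.vertexDec k hn) := dif_pos h

/-- The differential of the cobar construction is the coboundary of cochains on planar trees. -/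
theorem ev_cobarD (hn : 0 < n) {p : ℕ} (F : (Cycl k).Cobar n (p + 1)) {t : PlanarTree n}
    (h : t.T.card + p + 1 = n) :
    ev hn ((Cycl k).cobarD n p F) t = coboundary (ev hn F) t := by
  rw [ev_of_card hn _ h, coboundary, cobarD_apply]
  refine Finset.sum_congr rfl fun S _ => ?_
  have hc : (t.contract S.1 S.2).T.card + (p + 1) + 1 = n := by
    have := card_T_contract S.2
    omega
  rw [ev_of_card hn F hc]
  rw [contractRoot_dec, contractVertex_dec]
  rfl

theorem form_ext {T : Finset (Finset (Fin n))} {Φ Ψ : (Cycl k).Form T}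
    (h : ∀ d : Dec T, Φ (cycVec k d.1) (fun V => wordVec k (d.2 V)) =
      Ψ (cycVec k d.1) (fun V => wordVec k (d.2 V))) : Φ = Ψ := by
  refine Finsupp.lhom_ext' (M := k) fun c => LinearMap.ext_ring ?_
  exact multilinear_ext fun v => h (c, v)

/-- An element of the cobar construction is determined by its values at planar trees. -/
theorem cobar_ext (hn : 0 < n) {p : ℕ} {F G : (Cycl k).Cobar n p}
    (h : ∀ t : PlanarTree n, t.T.card + p + 1 = n → ev hn F t = ev hn G t) : F = G := by
  funext T
  refine form_ext fun d => ?_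
  have h1 := h (ofDec T.2.1 d) T.2.2
  rw [ev_of_card hn F (t := ofDec T.2.1 d) T.2.2, ev_of_card hn G (t := ofDec T.2.1 d) T.2.2] at h1
  unfold rootDec vertexDec at h1
  rw [dec_ofDec] at h1
  exact h1

/-- The values at planar trees can be prescribed. -/
theorem exists_ev_eq (hn : 0 < n) (p : ℕ) (φ : PlanarTree n → k) : ∃ F : (Cycl k).Cobar n p,
    ∀ t : PlanarTree n, t.T.card + p + 1 = n → ev hn F t = φ t := by
  refine ⟨fun T => (LinearMap.compMultilinearMapₗ k
    (Finsupp.linearCombination k fun d : Dec T.1 => φ (ofDec T.2.1 d))) ∘ₗ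
      linExt k (V := fun V : {V // V ∈ T.1} =>
        Word (inputs T.1 (V.1 : WithTop (Finset (Fin n))))) Prod.mk, fun t h => ?_⟩
  rw [ev_of_card hn _ h]
  have h1 := linExt_single (k := k) (V := fun V : {V // V ∈ t.T} =>
        Word (inputs t.T (V.1 : WithTop (Finset (Fin n))))) Prod.mk (t.dec hn).1 (t.dec hn).2
  change Finsupp.linearCombination k (fun d : Dec t.T => φ (ofDec t.isTree d)) (linExt k _ _ _) = _
  refine (congrArg _ h1).trans ?_
  rw [Finsupp.linearCombination_single, one_smul]
  exact congrArg φ (t.ofDec_dec hn)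

/-- The composition of all decorations of a planar tree is its cyclic word of leaves. -/
theorem evalTree_dec (hn : 0 < n) (m : ℕ) (t : PlanarTree n) (hm : t.T.card = m) :
    (Cycl k).evalTree m t.T t.isTree hm (t.rootDec k hn) (t.vertexDec k hn) =
      cycVec k (t.cyclicWord hn) := by
  induction m generalizing t with
  | zero =>
    have hT := Finset.card_eq_zero.1 hm
    refine (map_cycVec _ _).trans ?_
    refine congrArg (cycVec k) ?_
    refine Subtype.ext ?_
    change (t.dec hn).1.1.map (rootInputs hT) = cycleBind t.flat t.root
    rw [← t.dec_fst hn]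
    obtain ⟨w, hw⟩ := Word.toCyclic_surjective (t.dec hn).1
    rw [← hw]
    change Cycle.ofList (w.1.map _) = Cycle.ofList ((w.1.map Subtype.val).flatMap _)
    rw [List.flatMap_map, List.map_eq_flatMap]
    refine congrArg Cycle.ofList (List.flatMap_congr fun C _ => ?_)
    have h1 : C.1 = {rootInputs hT C} := by
      conv_lhs => rw [← (rootInputs hT).symm_apply_apply C]
      rfl
    rw [h1, flat_singleton]
  | succ m ih =>
    have hne : t.T.Nonempty := Finset.card_pos.1 (by omega)
    change (Cycl k).evalTree m (t.T.erase hne.choose) _ _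
      ((Cycl k).contractRoot t.isTree hne.choose_spec (t.rootDec k hn) (t.vertexDec k hn))
      (contractVertex (Ass k) t.isTree hne.choose_spec (t.vertexDec k hn)) = _
    rw [contractRoot_dec, contractVertex_dec]
    have hc : (t.contract hne.choose hne.choose_spec).T.card = m := by
      have := card_T_contract hne.choose_spec
      omega
    refine (ih (t.contract hne.choose hne.choose_spec) hc).trans ?_
    refine congrArg (cycVec k) ?_
    exact Subtype.ext (t.cyc_contract hne.choose_spec)

end PlanarTree

/-! ### The projection onto cyclic words -/

section EvalTree

variable {k : Type u} [Field k] {n : ℕ}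

/-- The composition along a tree is multilinear in the decorations of the vertices. -/
theorem exists_form_evalTree {P : Operad k} (M : RightModule P) (φ : M.obj (Fin n) →ₗ[k] k)
    (m : ℕ) (T : Finset (Finset (Fin n))) (hT : IsTree T) (hm : T.card = m) :
    ∃ Φ : M.Form T, ∀ x p, Φ x p = φ (M.evalTree m T hT hm x p) := by
  induction m generalizing T with
  | zero =>
    have hE : IsEmpty {V // V ∈ T} := ⟨fun V => by
      have := Finset.card_pos.2 ⟨V.1, V.2⟩
      omega⟩
    refine ⟨{ toFun := fun x => MultilinearMap.constOfIsEmpty k _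
                (φ (M.map (rootInputs (Finset.card_eq_zero.1 hm)) x))
              map_add' := fun x y => ?_
              map_smul' := fun c x => ?_ }, fun x p => rfl⟩
    · ext p
      simp
    · ext p
      simp
  | succ m ih =>
    have hne : T.Nonempty := Finset.card_pos.1 (by omega)
    obtain ⟨Φ, hΦ⟩ := ih (T.erase hne.choose) (hT.erase _)
      (by have := Finset.card_erase_of_mem hne.choose_spec; omega)
    exact ⟨M.split hT hne.choose_spec Φ, fun x p => hΦ _ _⟩

/-- The coefficient of a word. -/
noncomputable def wordCoeff {A : Type} [Finite A] (w : Word A) : (Ass k).obj A →ₗ[k] k :=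
  (Finsupp.lapply w : (Word A →₀ k) →ₗ[k] k)

/-- The coefficient of a cyclic word. -/
noncomputable def cycCoeff {A : Type} [Finite A] (c : CyclicWord A) : (Cycl k).obj A →ₗ[k] k :=
  (Finsupp.lapply c : (CyclicWord A →₀ k) →ₗ[k] k)

theorem cycCoeff_cycVec {A : Type} [Finite A] (c : CyclicWord A) :
    cycCoeff c (cycVec k c) = 1 := Finsupp.single_eq_same

theorem cycCoeff_cycVec_of_ne {A : Type} [Finite A] {c c' : CyclicWord A} (h : c ≠ c') :
    cycCoeff c (cycVec k c') = 0 := Finsupp.single_eq_of_ne h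

theorem sum_smul_wordVec {A : Type} [Finite A] [Fintype (Word A)] (p : (Ass k).obj A) :
    ∑ w : Word A, wordCoeff w p • wordVec k w = p := by
  refine Eq.trans (Finset.sum_congr rfl fun w _ => ?_)
    (Finsupp.univ_sum_single (p : Word A →₀ k))
  exact (Finsupp.smul_single_one _ _)

theorem sum_smul_cycVec {A : Type} [Finite A] [Fintype (CyclicWord A)] (x : (Cycl k).obj A) :
    ∑ c : CyclicWord A, cycCoeff c x • cycVec k c = x := by
  refine Eq.trans (Finset.sum_congr rfl fun w _ => ?_)
    (Finsupp.univ_sum_single (x : CyclicWord A →₀ k))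
  exact (Finsupp.smul_single_one _ _)

/-- The coefficient of a decoration by basis elements. -/
noncomputable def decCoeff {T : Finset (Finset (Fin n))} (x : (Cycl k).obj (inputs T ⊤))
    (p : ∀ V : {V // V ∈ T}, (Ass k).obj (inputs T (V.1 : WithTop (Finset (Fin n)))))
    (d : Dec T) : k :=
  cycCoeff d.1 x * ∏ V, wordCoeff (d.2 V) (p V)

open Classical in
/-- The expansion of a form in terms of its values at basis elements. -/
theorem form_apply_eq_sum {T : Finset (Finset (Fin n))} [Fintype (Dec T)] (Φ : (Cycl k).Form T)
    (x : (Cycl k).obj (inputs T ⊤))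
    (p : ∀ V : {V // V ∈ T}, (Ass k).obj (inputs T (V.1 : WithTop (Finset (Fin n))))) :
    Φ x p = ∑ d : Dec T, decCoeff x p d • Φ (cycVec k d.1) (fun V => wordVec k (d.2 V)) := by
  let := Fintype.ofFinite (CyclicWord (inputs T ⊤))
  let := fun V : {V // V ∈ T} =>
    Fintype.ofFinite (Word (inputs T (V.1 : WithTop (Finset (Fin n)))))
  have h1 : ∀ c, Φ (cycVec k c) p =
      ∑ v : ∀ V : {V // V ∈ T}, Word (inputs T (V.1 : WithTop (Finset (Fin n)))),
        (∏ V, wordCoeff (v V) (p V)) • Φ (cycVec k c) (fun V => wordVec k (v V)) := by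
    intro c
    have h2 : p = fun V => ∑ w, wordCoeff w (p V) • wordVec k w :=
      funext fun V => (sum_smul_wordVec (p V)).symm
    conv_lhs => rw [h2]
    rw [MultilinearMap.map_sum]
    exact Finset.sum_congr rfl fun v _ => MultilinearMap.map_smul_univ _ _ _
  conv_lhs => rw [← sum_smul_cycVec x]
  rw [map_sum, sum_apply]
  have h3 : ∀ g : Dec T → k, ∑ d : Dec T, g d = ∑ c, ∑ v, g (c, v) := by
    intro g
    convert Fintype.sum_prod_type g
  rw [h3]
  refine Finset.sum_congr rfl fun c _ => ?_
  rw [map_smul, smul_apply, h1, Finset.smul_sum]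
  refine Finset.sum_congr rfl fun v _ => ?_
  rw [smul_smul]
  rfl

theorem evalTree_eq_sum (hn : 0 < n) {T : Finset (Finset (Fin n))} [Fintype (Dec T)]
    (hT : IsTree T) (m : ℕ) (hm : T.card = m) (x : (Cycl k).obj (inputs T ⊤))
    (p : ∀ V : {V // V ∈ T}, (Ass k).obj (inputs T (V.1 : WithTop (Finset (Fin n))))) :
    (Cycl k).evalTree m T hT hm x p =
      ∑ d : Dec T, decCoeff x p d • cycVec k ((PlanarTree.ofDec hT d).cyclicWord hn) := by
  refine Finsupp.ext fun z => ?_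
  let φ : (Cycl k).obj (Fin n) →ₗ[k] k := cycCoeff z
  obtain ⟨Φ, hΦ⟩ := exists_form_evalTree (Cycl k) φ m T hT hm
  change φ _ = φ _
  rw [← hΦ, form_apply_eq_sum, map_sum]
  refine Finset.sum_congr rfl fun d _ => ?_
  rw [map_smul, hΦ]
  congr 2
  have h := PlanarTree.evalTree_dec (k := k) hn m (PlanarTree.ofDec hT d) hm
  unfold PlanarTree.rootDec PlanarTree.vertexDec at h
  rw [PlanarTree.dec_ofDec] at h
  exact h

theorem map_wordVec_apply {A B : Type} [Finite A] [Finite B] (e : A ≃ B) (q : (Ass k).obj A)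
    (w : Word B) : wordCoeff w ((Ass k).map e q) = wordCoeff (w.map e.symm) q := by
  have h1 : w = (w.map e.symm).map e := by
    rw [← Word.map_trans, Equiv.symm_trans_self, Word.map_refl]
  conv_lhs => rw [h1]
  refine Finsupp.mapDomain_apply (fun v v' h => ?_) _ _
  exact Word.ext_of_map e.injective (congrArg Subtype.val h)

theorem map_cycVec_apply {A B : Type} [Finite A] [Finite B] (e : A ≃ B) (y : (Cycl k).obj A)
    (c : CyclicWord B) :
    cycCoeff c ((Cycl k).map e y) = cycCoeff (c.map e.symm) y := by
  have h1 : c = (c.map e.symm).map e := by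
    obtain ⟨w, rfl⟩ := Word.toCyclic_surjective c
    rw [Word.toCyclic_map, Word.toCyclic_map, ← Word.map_trans, Equiv.symm_trans_self,
      Word.map_refl]
  conv_lhs => rw [h1]
  refine Finsupp.mapDomain_apply (fun v v' h => ?_) _ _
  exact CyclicWord.ext_of_map e.injective (congrArg Subtype.val h)

end EvalTree

/-- The sign of a permutation of two letters, written as a word. -/
def wordSign (w : Word (Fin 2)) : ℤ := if w.1 = [0, 1] then 1 else -1

theorem word_fin_two (w : Word (Fin 2)) : w.1 = [0, 1] ∨ w.1 = [1, 0] := by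
  obtain ⟨l, h0, hl, hm⟩ := w
  have h1 : l.length = 2 := by
    have h2 := List.toFinset_card_of_nodup hl
    rw [Finset.eq_univ_iff_forall.2 fun i => List.mem_toFinset.2 (hm i)] at h2
    simpa using h2.symm
  obtain ⟨a, b, rfl⟩ := List.length_eq_two.1 h1
  have key : ∀ a b : Fin 2, [a, b].Nodup → [a, b] = [0, 1] ∨ [a, b] = [1, 0] := by decide
  exact key a b hl

/-- The word `01`. -/
def word01 : Word (Fin 2) := ⟨[0, 1], by simp, by simp, by decide⟩

namespace PlanarTree

variable {n : ℕ}

/-- The sign attached to orders of the inputs of binary vertices is the sign of the corresponding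
planar tree. -/
theorem planarSign_eq_sgn {t : PlanarTree n}
    (e : ∀ V : {V // V ∈ t.T}, Fin 2 ≃ inputs t.T (V.1 : WithTop (Finset (Fin n))))
    (h : ∀ V, t.w V.1 = [(e V 0).1, (e V 1).1]) : planarSign t.T e = t.sgn := by
  have h1 : Before t.T e = t.Precedes := by
    funext C D
    refine propext ⟨?_, ?_⟩
    · rintro ⟨V, hV⟩
      exact ⟨V.1, _, _, h V, hV⟩
    · rintro ⟨V, A, B, hV, h2⟩
      have hVT : V ∈ t.T := mem_T_of_mem_w (C := A) (by simp [hV])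
      have h3 := h ⟨V, hVT⟩
      rw [hV] at h3
      simp only [List.cons.injEq, and_true] at h3
      refine ⟨⟨V, hVT⟩, ?_⟩
      rw [← h3.1, ← h3.2]
      exact h2
  unfold planarSign sgn invSign
  rw [h1, Finset.univ_product_univ]
  congr!

open Classical in
/-- For a planar structure `d` on a binary tree and a numbering `e` of the inputs of its vertices,
the signs of the two planar trees differ by the signs of the words of `d` with respect to `e`. -/
theorem sgn_ofDec_mul_prod {T : Finset (Finset (Fin n))} (hT : IsTree T) (hc : T.card + 1 = n)
    (e : ∀ V : {V // V ∈ T}, Fin 2 ≃ inputs T (V.1 : WithTop (Finset (Fin n)))) (d : Dec T) :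
    (ofDec hT d).sgn * ∏ V, wordSign ((d.2 V).map (e V).symm) = planarSign T e := by
  let d' : Dec T := (d.1, fun V => word01.map (e V))
  let A : Finset (Finset (Fin n)) := (Finset.univ.filter fun V : {V // V ∈ T} =>
    ((d.2 V).map (e V).symm).1 ≠ [0, 1]).map (Function.Embedding.subtype _)
  have hA : A ⊆ (ofDec hT d').T := by
    intro V hV
    obtain ⟨U, -, rfl⟩ := Finset.mem_map.1 hV
    exact U.2
  have hback : ∀ V, (d.2 V).1 = ((d.2 V).map (e V).symm).1.map (e V) := by
    intro V
    change _ = List.map _ (List.map _ _)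
    rw [List.map_map, Equiv.self_comp_symm, List.map_id]
  have h1 : ofDec hT d = (ofDec hT d').rev A := by
    refine PlanarTree.ext rfl (funext fun V => ?_) rfl
    change _ = if V ∈ A then ((ofDec hT d').w V).reverse else (ofDec hT d').w V
    by_cases hV : V ∈ T
    · rw [ofDec_w hT d ⟨V, hV⟩, ofDec_w hT d' ⟨V, hV⟩]
      have hmem : V ∈ A ↔ ((d.2 ⟨V, hV⟩).map (e ⟨V, hV⟩).symm).1 ≠ [0, 1] := by
        constructor
        · intro h
          obtain ⟨U, hU, rfl⟩ := Finset.mem_map.1 h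
          exact (Finset.mem_filter.1 hU).2
        · intro h
          exact Finset.mem_map.2 ⟨⟨V, hV⟩, Finset.mem_filter.2 ⟨Finset.mem_univ _, h⟩, rfl⟩
      rw [hback]
      rcases word_fin_two ((d.2 ⟨V, hV⟩).map (e ⟨V, hV⟩).symm) with h2 | h2
      · rw [if_neg fun h => hmem.1 h h2, h2]
        rfl
      · rw [if_pos (hmem.2 (by rw [h2]; decide)), h2]
        rfl
    · have hVA : V ∉ A := fun h => hV (hA h)
      rw [if_neg hVA, w_eq_nil _ V hV, w_eq_nil _ V hV]
  have h2 : ∏ V, wordSign ((d.2 V).map (e V).symm) = (-1) ^ A.card := by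
    unfold wordSign
    rw [Finset.prod_ite, Finset.prod_const, Finset.prod_const, one_pow, one_mul, Finset.card_map]
  have h3 : planarSign T e = (ofDec hT d').sgn :=
    planarSign_eq_sgn (t := ofDec hT d') e fun V => ofDec_w hT d' V
  rw [h1, h2, h3, sgn_rev (t := ofDec hT d') hc A hA, mul_right_comm, ← mul_pow]
  simp

/-- A sum over trees and decorations is a sum over planar trees. -/
theorem sum_ofDec {p : ℕ} [Fintype (TreeOfDegree n p)] [∀ T : TreeOfDegree n p, Fintype (Dec T.1)]
    [Fintype {t : PlanarTree n // t.T.card + p + 1 = n}] (hn : 0 < n) {M : Type u} [AddCommGroup M]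
    (g : PlanarTree n → M) :
    ∑ T : TreeOfDegree n p, ∑ d : Dec T.1, g (ofDec T.2.1 d) =
      ∑ t : {t : PlanarTree n // t.T.card + p + 1 = n}, g t.1 := by
  rw [← Fintype.sum_sigma' fun (T : TreeOfDegree n p) (d : Dec T.1) => g (ofDec T.2.1 d)]
  refine Fintype.sum_bijective (fun a : (Σ T : TreeOfDegree n p, Dec T.1) =>
    (⟨ofDec a.1.2.1 a.2, a.1.2.2⟩ : {t : PlanarTree n // t.T.card + p + 1 = n})) ⟨?_, ?_⟩ _ _
    fun _ => rfl
  · rintro ⟨⟨T, hT⟩, d⟩ ⟨⟨T', hT'⟩, d'⟩ h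
    have h1 : ofDec hT.1 d = ofDec hT'.1 d' := congrArg Subtype.val h
    have h2 : T = T' := congrArg PlanarTree.T h1
    subst h2
    have h3 : ∀ {t t' : PlanarTree n} (h : t = t'), HEq (t.dec hn) (t'.dec hn) := by
      rintro t _ rfl
      rfl
    have h4 := h3 h1
    rw [dec_ofDec hn hT.1 d, dec_ofDec hn hT'.1 d'] at h4
    rw [eq_of_heq h4]
  · rintro ⟨t, ht⟩
    exact ⟨⟨⟨t.T, t.isTree, ht⟩, t.dec hn⟩, Subtype.ext (t.ofDec_dec hn)⟩

end PlanarTree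

namespace QuadraticDual

variable {k : Type u} [Field k]

open PlanarTree

/-- The map from the cobar construction to the Koszul dual sends the dual basis element of a
binary planar tree to its cyclic word, up to the sign of the tree. -/
noncomputable def cyclProj (k : Type u) [Field k] {n : ℕ} (hn : 0 < n) :
    (Cycl k).Cobar n 0 →ₗ[k] (Cycl k).obj (Fin n) :=
  letI := Fintype.ofFinite (TreeOfDegree n 0)
  letI := fun T : TreeOfDegree n 0 => Fintype.ofFinite (Dec T.1)
  { toFun := fun f => ∑ T : TreeOfDegree n 0, ∑ d : Dec T.1, (ofDec T.2.1 d).sgn •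
      f T (cycVec k d.1) (fun V => wordVec k (d.2 V)) • cycVec k ((ofDec T.2.1 d).cyclicWord hn)
    map_add' := fun f g => by
      rw [← Finset.sum_add_distrib]
      refine Finset.sum_congr rfl fun T _ => ?_
      rw [← Finset.sum_add_distrib]
      refine Finset.sum_congr rfl fun d _ => ?_
      rw [← smul_add, ← add_smul]
      rfl
    map_smul' := fun c f => by
      rw [RingHom.id_apply, Finset.smul_sum]
      refine Finset.sum_congr rfl fun T _ => ?_
      rw [Finset.smul_sum]
      refine Finset.sum_congr rfl fun d _ => ?_
      rw [smul_comm c, smul_smul c]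
      rfl }

theorem cyclProj_eq_sum {n : ℕ} (hn : 0 < n)
    [Fintype {t : PlanarTree n // t.T.card + 1 = n}] (f : (Cycl k).Cobar n 0) :
    cyclProj k hn f = ∑ t : {t : PlanarTree n // t.T.card + 1 = n},
      t.1.sgn • ev hn f t.1 • cycVec k (t.1.cyclicWord hn) := by
  let := Fintype.ofFinite (TreeOfDegree n 0)
  let := fun T : TreeOfDegree n 0 => Fintype.ofFinite (Dec T.1)
  rw [← sum_ofDec (p := 0) hn fun t => t.sgn • ev hn f t • cycVec k (t.cyclicWord hn)]
  refine Finset.sum_congr rfl fun T _ => Finset.sum_congr rfl fun d _ => ?_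
  rw [ev_of_card hn f (t := ofDec T.2.1 d) T.2.2]
  unfold rootDec vertexDec
  rw [dec_ofDec]
  rfl

/-- A decomposable element of the cobar construction in degree zero is sent to the composition,
along its tree, of the decorations in the Koszul dual: expanding it in words, the signs of the words
turn the sign of the numbered tree into the signs of the planar trees. -/
theorem isProjection_cyclProj (D : QuadraticDual (Cycl k) (Cycl k))
    (hE : ∀ (w : Word (Fin 2)) (q : (Ass k).obj (Fin 2)),
      D.pairE (wordVec k w) q = wordSign w • wordCoeff w q)
    (hX : ∀ (c : CyclicWord Unit) (y : (Cycl k).obj Unit),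
      D.pairX (cycVec k c) y = cycCoeff c y) {n : ℕ} (hn : 0 < n) :
    D.IsProjection n (cyclProj k hn) := by
  classical
  intro T r e y q
  let := Fintype.ofFinite (TreeOfDegree n 0)
  let := fun T : TreeOfDegree n 0 => Fintype.ofFinite (Dec T.1)
  have h1 : cyclProj k hn (Pi.single T (D.pureForm T.1 r e y q)) =
      ∑ d : Dec T.1, (ofDec T.2.1 d).sgn •
        (D.pureForm T.1 r e y q) (cycVec k d.1) (fun V => wordVec k (d.2 V)) •
          cycVec k ((ofDec T.2.1 d).cyclicWord hn) := by
    refine (Finset.sum_eq_single T (fun T' _ hne => ?_)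
      fun h => absurd (Finset.mem_univ T) h).trans ?_
    · refine Finset.sum_eq_zero fun d _ => ?_
      rw [Pi.single_eq_of_ne hne]
      simp
    · rw [Pi.single_eq_same]
  rw [evalTree_eq_sum hn T.2.1 _ rfl, Finset.smul_sum]
  refine (by convert h1 : _ = _).trans (Finset.sum_congr rfl fun d _ => ?_)
  rw [← smul_assoc, ← smul_assoc]
  congr 1
  have h2 : (D.pureForm T.1 r e y q) (cycVec k d.1) (fun V => wordVec k (d.2 V)) =
      D.pairX ((Cycl k).map r.symm (cycVec k d.1)) y *
        ∏ V, D.pairE ((Ass k).map (e V).symm (wordVec k (d.2 V))) (q V) := rfl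
  rw [h2, map_cycVec, hX, ← sgn_ofDec_mul_prod T.2.1 T.2.2 e d]
  have h3 : ∀ V, D.pairE ((Ass k).map (e V).symm (wordVec k (d.2 V))) (q V) =
      (wordSign ((d.2 V).map (e V).symm) : k) *
        wordCoeff (d.2 V) ((Ass k).map (e V) (q V)) := by
    intro V
    rw [map_wordVec, hE, map_wordVec_apply, zsmul_eq_mul]
  simp only [h3, Finset.prod_mul_distrib, decCoeff]
  rw [map_cycVec_apply]
  simp only [zsmul_eq_mul, Int.cast_mul, Int.cast_prod]
  ring

/-- Every cyclic word is the cyclic word of a binary planar tree. -/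
theorem surjective_cyclProj {n : ℕ} (hn : 0 < n) : Function.Surjective (cyclProj k hn) := by
  classical
  let := Fintype.ofFinite {t : PlanarTree n // t.T.card + 1 = n}
  have key : ∀ x : CyclicWord (Fin n) →₀ k, ∃ f, cyclProj k hn f = x := by
    intro x
    induction x using Finsupp.induction_linear with
    | zero => exact ⟨0, map_zero _⟩
    | add x y hx hy =>
      obtain ⟨f, hf⟩ := hx
      obtain ⟨g, hg⟩ := hy
      exact ⟨f + g, by rw [map_add, hf, hg]; rfl⟩
    | single c a =>
      obtain ⟨w, rfl⟩ := Word.toCyclic_surjective c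
      obtain ⟨t, ht, hc⟩ := exists_cyc_eq w.2.2.1 w.2.2.2 hn
      obtain ⟨f, hf⟩ := exists_ev_eq (k := k) hn 0 fun s => if s = t then t.sgn • a else 0
      refine ⟨f, ?_⟩
      rw [cyclProj_eq_sum, Finset.sum_eq_single ⟨t, hc⟩]
      · rw [hf t hc, if_pos rfl, smul_assoc, ← mul_smul, sgn_mul_self, one_smul]
        have h1 : t.cyclicWord hn = w.toCyclic := Subtype.ext ht
        rw [h1]
        exact Finsupp.smul_single_one _ _
      · intro s _ hs
        rw [hf s.1 s.2, if_neg fun h => hs (Subtype.ext h), zero_smul, smul_zero]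
      · exact fun h => absurd (Finset.mem_univ _) h
  exact key

/-- Exactness in degree zero.  Modulo coboundaries, an element of the cobar construction is
supported on right combs, whose cyclic words are linearly independent. -/
theorem exact_cobarD_cyclProj {n : ℕ} (hn : 0 < n) :
    Function.Exact ((Cycl k).cobarD n 0) (cyclProj k hn) := by
  classical
  let := Fintype.ofFinite {t : PlanarTree n // t.T.card + 1 = n}
  have hd : ∀ F, cyclProj k hn ((Cycl k).cobarD n 0 F) = 0 := by
    intro F
    rw [cyclProj_eq_sum, ← sum_sgn_smul_coboundary (k := k) (ev hn F)
      (fun t => cycVec k (t.cyclicWord hn)) (fun t S hS => ?_)]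
    · exact Finset.sum_congr rfl fun t _ => by rw [ev_cobarD hn F t.2]
    · exact congrArg (cycVec k) (Subtype.ext (t.cyc_contract hS))
  intro f
  refine ⟨fun hf => ?_, ?_⟩
  · let o : Fin n := ⟨0, hn⟩
    obtain ⟨g, hg⟩ := exists_eq_coboundary o (f := ev hn f) (c := n - 1) (fun t ht => by
      have := t.card_T_lt hn
      omega)
    obtain ⟨G, hG⟩ := exists_ev_eq (k := k) hn 1 g
    refine ⟨G, ?_⟩
    let F := f - (Cycl k).cobarD n 0 G
    have hF0 : cyclProj k hn F = 0 := by
      refine ((cyclProj k hn).map_sub f _).trans ?_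
      rw [hf, hd, sub_zero]
    have hevF : ∀ t : PlanarTree n, t.T.card + 1 = n → (ev hn F t = ev hn f t -
        ev hn ((Cycl k).cobarD n 0 G) t) := by
      intro t ht
      rw [ev_of_card hn F (p := 0) ht, ev_of_card hn f (p := 0) ht,
        ev_of_card hn ((Cycl k).cobarD n 0 G) (p := 0) ht]
      rfl
    -- Only the combs contribute to the difference, and their cyclic words are distinct.
    have hcrit : ∀ t : PlanarTree n, t.T.card + 1 = n → t.stage o + 1 < n → ev hn F t = 0 := by
      intro t ht hs
      have hul : t.Upper o ∨ t.Lower o :=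
        (em (t.toggle o ∈ t.T)).imp (fun h => ⟨hs, h⟩) fun h => ⟨hs, h⟩
      rw [hevF t ht, ev_cobarD hn G ht, ← hg t hul (by omega), sub_eq_zero]
      refine Finset.sum_congr rfl fun S _ => ?_
      rw [hG]
      have := card_T_contract S.2
      omega
    have hzero : ∀ t : PlanarTree n, t.T.card + 1 = n → ev hn F t = 0 := by
      intro t ht
      by_cases hs : t.stage o + 1 < n
      · exact hcrit t ht hs
      · rw [cyclProj_eq_sum] at hF0
        have h1 := congrArg (cycCoeff (t.cyclicWord hn)) hF0
        rw [map_zero, map_sum, Finset.sum_eq_single ⟨t, ht⟩] at h1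
        · rw [← smul_assoc, map_smul, cycCoeff_cycVec, smul_eq_mul, mul_one] at h1
          have h3 := congrArg (fun x => t.sgn • x) h1
          dsimp only at h3
          rwa [← mul_smul, sgn_mul_self, one_smul, smul_zero] at h3
        · intro s _ hs'
          by_cases hss : s.1.stage o + 1 < n
          · rw [hcrit s.1 s.2 hss, zero_smul, smul_zero, map_zero]
          · have hne : t.cyclicWord hn ≠ s.1.cyclicWord hn := fun h =>
              hs' (Subtype.ext (eq_of_cyc_eq s.2 ht hss hs (congrArg Subtype.val h.symm)))
            rw [← smul_assoc, map_smul, cycCoeff_cycVec_of_ne hne, smul_zero]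
        · exact fun h => absurd (Finset.mem_univ _) h
    have hFz : F = 0 := cobar_ext hn fun t ht => by
      rw [hzero t ht, ev_of_card hn _ ht]
      rfl
    exact (sub_eq_zero.1 hFz).symm
  · rintro ⟨F, rfl⟩
    exact hd F

/-- Exactness in positive degrees, where the matching of planar trees leaves no tree unmatched. -/
theorem exact_cobarD {n : ℕ} (hn : 0 < n) (p : ℕ) :
    Function.Exact ((Cycl k).cobarD n (p + 1)) ((Cycl k).cobarD n p) := by
  have hcard : ∀ {t : PlanarTree n} {q : ℕ} (S : {S // S ∈ t.T}), t.T.card + q + 1 = n →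
      (t.contract S.1 S.2).T.card + (q + 1) + 1 = n := fun S h => by
    have := card_T_contract S.2
    omega
  intro f
  constructor
  · intro hf
    let o : Fin n := ⟨0, hn⟩
    by_cases hp : p + 2 ≤ n
    · obtain ⟨g, hg⟩ := exists_eq_coboundary o (f := ev hn f) (c := n - (p + 2)) (fun t ht => by
        rw [← ev_cobarD hn f (by omega), hf, ev_of_card hn _ (by omega)]
        rfl)
      obtain ⟨G, hG⟩ := exists_ev_eq (k := k) hn (p + 2) g
      refine ⟨G, cobar_ext hn fun t ht => ?_⟩
      rw [ev_cobarD hn G ht, ← hg t (upper_or_lower (by omega)) (by omega)]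
      exact Finset.sum_congr rfl fun S _ => by rw [hG _ (hcard S ht)]
    · exact ⟨0, cobar_ext hn fun t ht => by omega⟩
  · rintro ⟨F, rfl⟩
    refine cobar_ext hn fun t ht => ?_
    rw [ev_cobarD hn _ ht]
    have h1 : coboundary (ev hn ((Cycl k).cobarD n (p + 1) F)) t =
        coboundary (coboundary (ev hn F)) t :=
      Finset.sum_congr rfl fun S _ => by rw [ev_cobarD hn F (hcard S ht)]
    rw [h1, coboundary_coboundary, ev_of_card hn _ ht]
    rfl

/-- `Cycl` is Koszul with respect to any duality data whose pairings are diagonal on words, with the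
signs of permutations. -/
theorem isKoszul_cycl (D : QuadraticDual (Cycl k) (Cycl k))
    (hE : ∀ (w : Word (Fin 2)) (q : (Ass k).obj (Fin 2)),
      D.pairE (wordVec k w) q = wordSign w • wordCoeff w q)
    (hX : ∀ (c : CyclicWord Unit) (y : (Cycl k).obj Unit),
      D.pairX (cycVec k c) y = cycCoeff c y) : D.IsKoszul :=
  fun _ hn => ⟨cyclProj k hn, D.isProjection_cyclProj hE hX hn, surjective_cyclProj hn,
    exact_cobarD_cyclProj hn, exact_cobarD hn⟩

end QuadraticDual

/-! ### Iterated products in an operad -/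

instance {X : Type} (l : List X) : Finite {x // x ∈ l} := (List.finite_toSet l).to_subtype

section Partition

variable {I J X : Type} {la : List I} {S : I → List X} {l : List X}

/-- The elements of `l` are distributed to the lists `S i`, for `i` in `la`. -/
def IsPart (la : List I) (S : I → List X) (l : List X) : Prop :=
  (∀ i ∈ la, ∀ x ∈ S i, x ∈ l) ∧ ∀ x ∈ l, ∃! i, i ∈ la ∧ x ∈ S i

theorem isPart_flatMap (h : (la.flatMap S).Nodup) : IsPart la S (la.flatMap S) := by
  refine ⟨fun i hi x hx => List.mem_flatMap.2 ⟨i, hi, hx⟩, fun x hx => ?_⟩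
  obtain ⟨i, hi, hxi⟩ := List.mem_flatMap.1 hx
  refine ⟨i, ⟨hi, hxi⟩, fun j hj => ?_⟩
  by_contra hne
  have h1 := (List.nodup_flatMap.1 h).2
  have h2 : List.Disjoint (S j) (S i) :=
    haveI : Std.Symm (fun a b => List.Disjoint (S a) (S b)) := ⟨fun _ _ h => h.symm⟩
    List.Pairwise.forall h1 hj.1 hi hne
  exact h2 hj.2 hxi

theorem isPart_pair {l₁ l₂ l : List X} (hl : l = l₁ ++ l₂) (h : l.Nodup) :
    IsPart [(0 : Fin 2), 1] ![l₁, l₂] l := by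
  have e : [(0 : Fin 2), 1].flatMap ![l₁, l₂] = l := by simp [hl]
  rw [← e] at h ⊢
  exact isPart_flatMap h

/-- The bijection from the disjoint union of the parts. -/
noncomputable def IsPart.equiv (h : IsPart la S l) :
    (Σ i : {i // i ∈ la}, {x // x ∈ S i.1}) ≃ {x // x ∈ l} :=
  Equiv.ofBijective (fun a => ⟨a.2.1, h.1 a.1.1 a.1.2 _ a.2.2⟩) (by
    constructor
    · rintro ⟨⟨i, hi⟩, ⟨x, hx⟩⟩ ⟨⟨j, hj⟩, ⟨y, hy⟩⟩ he
      obtain rfl : x = y := congrArg Subtype.val he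
      obtain rfl : i = j := (h.2 x (h.1 i hi x hx)).unique ⟨hi, hx⟩ ⟨hj, hy⟩
      rfl
    · rintro ⟨x, hx⟩
      obtain ⟨i, ⟨hi, hxi⟩, -⟩ := h.2 x hx
      exact ⟨⟨⟨i, hi⟩, ⟨x, hxi⟩⟩, rfl⟩)

theorem equiv_ext_val {A : Type} {p : X → Prop} {e e' : A ≃ {x // p x}}
    (h : ∀ a, (e a).1 = (e' a).1) : e = e' := Equiv.ext fun a => Subtype.ext (h a)

theorem IsPart.trans {lj : List J} {S : I → List J} {T : J → List X} {U : I → List X}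
    (h1 : IsPart la S lj) (h2 : IsPart lj T l) (h3 : ∀ i ∈ la, IsPart (S i) T (U i)) :
    IsPart la U l := by
  constructor
  · intro i hi x hx
    obtain ⟨j, ⟨hj, hxj⟩, -⟩ := (h3 i hi).2 x hx
    exact h2.1 j (h1.1 i hi j hj) x hxj
  · intro x hx
    obtain ⟨j, ⟨hj, hxj⟩, hju⟩ := h2.2 x hx
    obtain ⟨i, ⟨hi, hji⟩, hiu⟩ := h1.2 j hj
    refine ⟨i, ⟨hi, (h3 i hi).1 j hji x hxj⟩, ?_⟩
    rintro i' ⟨hi', hx'⟩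
    obtain ⟨j', ⟨hj', hxj'⟩, -⟩ := (h3 i' hi').2 x hx'
    obtain rfl := hju j' ⟨h1.1 i' hi' j' hj', hxj'⟩
    exact hiu i' ⟨hi', hj'⟩

/-- The bijection with the one-element type. -/
def singleEquiv (a : X) : Unit ≃ {x // x ∈ [a]} where
  toFun _ := ⟨a, List.mem_singleton_self a⟩
  invFun _ := ()
  left_inv _ := rfl
  right_inv x := Subtype.ext (List.mem_singleton.1 x.2).symm

/-- The numbering of the elements of a list with two elements. -/
noncomputable def pairEquiv {a b : X} (h : a ≠ b) : Fin 2 ≃ {x // x ∈ [a, b]} :=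
  Equiv.ofBijective (fun i => ⟨![a, b] i, by fin_cases i <;> simp⟩) (by
    constructor
    · intro i j hij
      have hij' : ![a, b] i = ![a, b] j := congrArg Subtype.val hij
      fin_cases i <;> fin_cases j
      · rfl
      · exact absurd hij' h
      · exact absurd hij'.symm h
      · rfl
    · rintro ⟨x, hx⟩
      rcases List.mem_pair.1 hx with rfl | rfl
      · exact ⟨0, rfl⟩
      · exact ⟨1, rfl⟩)

end Partition

namespace Operad

variable {k : Type u} [Field k] (Q : Operad k)

section Graft

variable {I J X : Type} {la : List I}

open Classical in
/-- The composition of an operation whose inputs are the elements of `la` with operations whose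
inputs are the parts `S i` of a list `l`.  It is zero if the lists `S i` are not a partition of
`l`. -/
noncomputable def graft (p : Q.obj {i // i ∈ la}) (S : I → List X) (l : List X)
    (q : ∀ i, Q.obj {x // x ∈ S i}) : Q.obj {x // x ∈ l} :=
  if h : IsPart la S l then Q.map h.equiv (Q.comp p fun i => q i.1) else 0

variable {Q}

theorem graft_of_isPart {S : I → List X} {l : List X} (h : IsPart la S l)
    (p : Q.obj {i // i ∈ la}) (q : ∀ i, Q.obj {x // x ∈ S i}) :
    Q.graft p S l q = Q.map h.equiv (Q.comp p fun i => q i.1) := dif_pos h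

theorem graft_congr {S : I → List X} {l : List X} {p : Q.obj {i // i ∈ la}}
    {q q' : ∀ i, Q.obj {x // x ∈ S i}} (h : ∀ i ∈ la, q i = q' i) :
    Q.graft p S l q = Q.graft p S l q' := by
  unfold graft
  have : (fun i : {i // i ∈ la} => q i.1) = fun i : {i // i ∈ la} => q' i.1 :=
    funext fun i => h i.1 i.2
  rw [this]

/-- Associativity of the composition. -/
theorem graft_graft {lj : List J} {l : List X} {S : I → List J} {T : J → List X}
    {U : I → List X} (h1 : IsPart la S lj) (h2 : IsPart lj T l)
    (h3 : ∀ i ∈ la, IsPart (S i) T (U i)) (p : Q.obj {i // i ∈ la})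
    (q : ∀ i, Q.obj {x // x ∈ S i}) (r : ∀ j, Q.obj {x // x ∈ T j}) :
    Q.graft (Q.graft p S lj q) T l r = Q.graft p U l fun i => Q.graft (q i) T (U i) r := by
  have h4 := h1.trans h2 h3
  rw [graft_of_isPart h1, graft_of_isPart h2, graft_of_isPart h4]
  have e1 : (fun i : {i // i ∈ la} => Q.graft (q i.1) T (U i.1) r) =
      fun i : {i // i ∈ la} => Q.map (h3 i.1 i.2).equiv (Q.comp (q i.1) fun j => r j.1) :=
    funext fun i => graft_of_isPart (h3 i.1 i.2) _ _
  rw [e1]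
  have e2 := Q.comp_map h1.equiv (B := fun x => {y // y ∈ T x.2.1}) (fun _ => Equiv.refl _)
    (Q.comp p fun i => q i.1) (fun x => r x.2.1) (fun j => r j.1)
    (fun x => (Q.map_refl _ _).symm)
  have e3 := Q.comp_assoc (C := fun (i : {i // i ∈ la}) (j : {j // j ∈ S i.1}) =>
    {y // y ∈ T j.1}) p (fun i => q i.1) (fun x => r x.2.1)
  have e4 := Q.comp_map (Equiv.refl _) (fun i => (h3 i.1 i.2).equiv) p
    (fun i => Q.comp (q i.1) fun j => r j.1)
    (fun i => Q.map (h3 i.1 i.2).equiv (Q.comp (q i.1) fun j => r j.1)) (fun _ => rfl)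
  rw [Q.map_refl] at e4
  rw [← e2, ← e4, ← e3, ← Q.map_trans, ← Q.map_trans, ← Q.map_trans]
  congr 2
  all_goals exact equiv_ext_val fun _ => rfl

/-- Substitution into the unit. -/
theorem graft_one {S : I → List X} {i : I} (q : ∀ i, Q.obj {x // x ∈ S i}) :
    Q.graft (Q.map (singleEquiv i) Q.unit) S (S i) q = q i := by
  have h : IsPart [i] S (S i) :=
    ⟨fun j hj x hx => by rwa [← List.mem_singleton.1 hj],
      fun x hx => ⟨i, ⟨List.mem_singleton_self i, hx⟩, fun j hj => List.mem_singleton.1 hj.1⟩⟩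
  rw [graft_of_isPart h]
  have e1 := Q.comp_map (singleEquiv i) (B := fun _ => {x // x ∈ S i}) (fun _ => Equiv.refl _)
    Q.unit (fun _ => q i) (fun j => q j.1) (fun _ => (Q.map_refl _ _).symm)
  have e2 := Q.unit_comp (q i)
  rw [← e1, ← Q.map_trans]
  conv_rhs => rw [← e2]
  congr 2
  all_goals exact equiv_ext_val fun _ => rfl

end Graft

variable (μ : Q.obj (Fin 2)) {X Y : Type}

/-- The binary operation, with inputs in the list `[0, 1]`. -/
noncomputable def mulPair : Q.obj {i : Fin 2 // i ∈ [(0 : Fin 2), 1]} :=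
  Q.map (pairEquiv (by decide)) μ

/-- A family indexed by `{0, 1}`. -/
def pairFam {Q : Operad k} {l₁ l₂ : List X} (x : Q.obj {x // x ∈ l₁}) (y : Q.obj {x // x ∈ l₂}) :
    (i : Fin 2) → Q.obj {x // x ∈ ![l₁, l₂] i}
  | 0 => x
  | 1 => y

/-- The iterated product of the elements of a list, bracketed from the right, for the binary
operation `μ`.  The empty list has no product, and the value is zero. -/
noncomputable def listProd : (l : List X) → Q.obj {x // x ∈ l}
  | [] => 0
  | [a] => Q.map (singleEquiv a) Q.unit
  | a :: b :: l => Q.graft (Q.mulPair μ) ![[a], b :: l] (a :: b :: l)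
      (pairFam (Q.map (singleEquiv a) Q.unit) (listProd (b :: l)))

variable {Q} {μ}

theorem listProd_cons {a : X} {l : List X} (hl : l ≠ []) : Q.listProd μ (a :: l) =
    Q.graft (Q.mulPair μ) ![[a], l] (a :: l) fun i => Q.listProd μ (![[a], l] i) := by
  obtain ⟨b, l, rfl⟩ := List.exists_cons_of_ne_nil hl
  rw [listProd]
  refine graft_congr fun i _ => ?_
  fin_cases i
  · rfl
  · rfl

theorem graft_pair_congr {l₁ l₂ l : List X} {q q' : ∀ i, Q.obj {x // x ∈ ![l₁, l₂] i}}
    (h0 : q 0 = q' 0) (h1 : q 1 = q' 1) :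
    Q.graft (Q.mulPair μ) ![l₁, l₂] l q = Q.graft (Q.mulPair μ) ![l₁, l₂] l q' :=
  graft_congr fun i _ => by
    fin_cases i
    · exact h0
    · exact h1

/-- The product `(x₀ x₁) x₂` is `x₀ (x₁ x₂)`. -/
def IsAssoc (Q : Operad k) (μ : Q.obj (Fin 2)) : Prop :=
  Q.graft (Q.mulPair μ) ![[(0 : Fin 3), 1], [2]] [0, 1, 2]
    (fun i => Q.listProd μ (![[(0 : Fin 3), 1], [2]] i)) = Q.listProd μ [0, 1, 2]

theorem graft_listProd_single {J : Type} (T : J → List X) (j : J) :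
    Q.graft (Q.listProd μ [j]) T (T j) (fun i => Q.listProd μ (T i)) = Q.listProd μ (T j) :=
  graft_one _

/-- Substitution of lists into a product of two lists. -/
theorem graft_graft_pair {J : Type} {m₁ m₂ m : List J} {l₁ l₂ l : List X} {T : J → List X}
    (hm : m = m₁ ++ m₂) (hmd : m.Nodup) (h1 : l₁ = m₁.flatMap T) (h2 : l₂ = m₂.flatMap T)
    (hl : l = m.flatMap T) (hd : l.Nodup)
    (e1 : Q.graft (Q.listProd μ m₁) T l₁ (fun i => Q.listProd μ (T i)) = Q.listProd μ l₁)
    (e2 : Q.graft (Q.listProd μ m₂) T l₂ (fun i => Q.listProd μ (T i)) = Q.listProd μ l₂) :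
    Q.graft (Q.graft (Q.mulPair μ) ![m₁, m₂] m fun i => Q.listProd μ (![m₁, m₂] i)) T l
      (fun i => Q.listProd μ (T i)) =
    Q.graft (Q.mulPair μ) ![l₁, l₂] l fun i => Q.listProd μ (![l₁, l₂] i) := by
  have hl' : l = l₁ ++ l₂ := by rw [hl, hm, h1, h2, List.flatMap_append]
  have hd' := hd
  rw [hl'] at hd'
  rw [graft_graft (U := ![l₁, l₂]) (isPart_pair hm hmd)
    (by rw [hl] at hd ⊢; exact isPart_flatMap hd)]
  · exact graft_pair_congr e1 e2
  · intro i _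
    fin_cases i
    · change IsPart m₁ T l₁
      have := (List.nodup_append.1 hd').1
      rw [h1] at this ⊢
      exact isPart_flatMap this
    · change IsPart m₂ T l₂
      have := (List.nodup_append.1 hd').2.1
      rw [h2] at this ⊢
      exact isPart_flatMap this

/-- For an associative operation, the product of a concatenation is the product of the products. -/
theorem listProd_append (hμ : IsAssoc Q μ) {l₁ l₂ : List X} (h1 : l₁ ≠ []) (h2 : l₂ ≠ [])
    (hd : (l₁ ++ l₂).Nodup) : Q.listProd μ (l₁ ++ l₂) =
      Q.graft (Q.mulPair μ) ![l₁, l₂] (l₁ ++ l₂) fun i => Q.listProd μ (![l₁, l₂] i) := by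
  induction l₁ with
  | nil => exact absurd rfl h1
  | cons a l ih =>
    by_cases hl : l = []
    · subst hl
      exact listProd_cons h2
    · have ih' := ih hl (List.nodup_cons.1 hd).2
      let T : Fin 3 → List X := ![[a], l, l₂]
      have hd1 : (a :: l).Nodup := (List.nodup_append.1 hd).1
      have hd2 : (l ++ l₂).Nodup := (List.nodup_cons.1 hd).2
      have e0 : Q.graft (Q.listProd μ [(0 : Fin 3)]) T [a] (fun i => Q.listProd μ (T i)) =
          Q.listProd μ [a] := graft_listProd_single T 0
      have e1 : Q.graft (Q.listProd μ [(1 : Fin 3)]) T l (fun i => Q.listProd μ (T i)) =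
          Q.listProd μ l := graft_listProd_single T 1
      have e2 : Q.graft (Q.listProd μ [(2 : Fin 3)]) T l₂ (fun i => Q.listProd μ (T i)) =
          Q.listProd μ l₂ := graft_listProd_single T 2
      have e01 : Q.graft (Q.listProd μ [(0 : Fin 3), 1]) T (a :: l) (fun i => Q.listProd μ (T i)) =
          Q.listProd μ (a :: l) := by
        rw [listProd_cons (List.cons_ne_nil _ _), listProd_cons hl]
        exact graft_graft_pair rfl (by decide) (by simp [T]) (by simp [T]) (by simp [T]) hd1 e0 e1
      have e12 : Q.graft (Q.listProd μ [(1 : Fin 3), 2]) T (l ++ l₂)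
          (fun i => Q.listProd μ (T i)) = Q.listProd μ (l ++ l₂) := by
        rw [listProd_cons (List.cons_ne_nil _ _), ih']
        exact graft_graft_pair rfl (by decide) (by simp [T]) (by simp [T]) (by simp [T]) hd2 e1 e2
      have e3 : Q.graft (Q.listProd μ [(0 : Fin 3), 1, 2]) T (a :: (l ++ l₂))
          (fun i => Q.listProd μ (T i)) = Q.listProd μ (a :: (l ++ l₂)) := by
        rw [listProd_cons (List.cons_ne_nil _ _),
          listProd_cons (a := a) (l := l ++ l₂) (by simp [hl])]
        exact graft_graft_pair rfl (by decide) (by simp [T]) (by simp [T]) (by simp [T]) hd e0 e12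
      rw [List.cons_append, ← e3, ← (show _ = Q.listProd μ [(0 : Fin 3), 1, 2] from hμ)]
      exact graft_graft_pair rfl (by decide) (by simp [T]) (by simp [T]) (by simp [T]) hd e01 e2

/-- Substitution of products into a product, which reflects the substitution of words. -/
theorem listProd_flatMap (hμ : IsAssoc Q μ) {J : Type} {m : List J} {T : J → List X}
    (hm : m ≠ []) (hmd : m.Nodup) (hT : ∀ j, T j ≠ []) (hd : (m.flatMap T).Nodup) :
    Q.graft (Q.listProd μ m) T (m.flatMap T) (fun i => Q.listProd μ (T i)) =
      Q.listProd μ (m.flatMap T) := by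
  induction m with
  | nil => exact absurd rfl hm
  | cons j m ih =>
    by_cases h : m = []
    · subst h
      have e : [j].flatMap T = T j := by simp
      rw [e]
      exact graft_listProd_single T j
    · rw [List.flatMap_cons] at hd ⊢
      have hne : m.flatMap T ≠ [] := by
        obtain ⟨i, m, rfl⟩ := List.exists_cons_of_ne_nil h
        simp [hT]
      rw [listProd_append hμ (hT j) hne hd, listProd_cons h]
      exact graft_graft_pair rfl hmd (by simp) rfl (by simp) hd
        (graft_listProd_single T j) (ih h (List.nodup_cons.1 hmd).2 (List.nodup_append.1 hd).2.1)

/-- Relabelling of the elements of a list. -/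
noncomputable def mapEquiv {l : List X} {g : X → Y} (hg : Set.InjOn g {x | x ∈ l}) :
    {x // x ∈ l} ≃ {y // y ∈ l.map g} :=
  Equiv.ofBijective (fun x => ⟨g x.1, List.mem_map_of_mem x.2⟩) (by
    constructor
    · intro x y h
      exact Subtype.ext (hg x.2 y.2 (congrArg Subtype.val h))
    · rintro ⟨y, hy⟩
      obtain ⟨x, hx, rfl⟩ := List.mem_map.1 hy
      exact ⟨⟨x, hx⟩, rfl⟩)

theorem graft_singletons {l : List X} {g : X → Y} (hg : Set.InjOn g {x | x ∈ l})
    (p : Q.obj {x // x ∈ l}) :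
    Q.graft p (fun x => [g x]) (l.map g) (fun x => Q.map (singleEquiv (g x)) Q.unit) =
      Q.map (mapEquiv hg) p := by
  have h : IsPart l (fun x => [g x]) (l.map g) := by
    refine ⟨fun x hx y hy => ?_, fun y hy => ?_⟩
    · rw [List.mem_singleton.1 hy]
      exact List.mem_map_of_mem hx
    · obtain ⟨x, hx, rfl⟩ := List.mem_map.1 hy
      exact ⟨x, ⟨hx, List.mem_singleton_self _⟩, fun x' hx' =>
        (hg hx hx'.1 (List.mem_singleton.1 hx'.2)).symm⟩
  rw [graft_of_isPart h]
  have e1 := Q.comp_map (Equiv.refl _) (fun x : {x // x ∈ l} => singleEquiv (g x.1)) p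
    (fun _ => Q.unit) (fun x => Q.map (singleEquiv (g x.1)) Q.unit) (fun _ => rfl)
  rw [Q.map_refl] at e1
  have e2 := Q.comp_unit p
  rw [← e1, ← Q.map_trans]
  conv_rhs => rw [← e2, ← Q.map_trans]
  congr 2
  all_goals exact equiv_ext_val fun _ => rfl

theorem listProd_map (hμ : IsAssoc Q μ) {l : List X} (hl : l ≠ []) (hd : l.Nodup) {g : X → Y}
    (hg : Set.InjOn g {x | x ∈ l}) :
    Q.listProd μ (l.map g) = Q.map (mapEquiv hg) (Q.listProd μ l) := by
  have e : l.flatMap (fun x => [g x]) = l.map g := (List.map_eq_flatMap).symm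
  have h := listProd_flatMap hμ hl hd (T := fun x => [g x]) (fun _ => List.cons_ne_nil _ _)
    (by rw [e]; exact hd.map_on hg)
  rw [e] at h
  rw [← h]
  exact graft_singletons hg _

theorem listProd_pair {a b : X} (h : a ≠ b) : Q.listProd μ [a, b] = Q.map (pairEquiv h) μ := by
  have hg : Set.InjOn ![a, b] {x | x ∈ [(0 : Fin 2), 1]} := by
    intro i _ j _ hij
    exact (pairEquiv h).injective (Subtype.ext hij)
  have e : Q.listProd μ [a, b] =
      Q.graft (Q.mulPair μ) ![[a], [b]] [a, b] fun i => Q.listProd μ (![[a], [b]] i) :=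
    listProd_cons (List.cons_ne_nil _ _)
  have e2 : ![[a], [b]] = fun i => [![a, b] i] := by
    funext i
    fin_cases i <;> rfl
  rw [e, e2]
  refine (graft_singletons hg _).trans ?_
  rw [mulPair, ← Q.map_trans]
  congr 2
  all_goals exact equiv_ext_val fun i => by fin_cases i <;> rfl

end Operad

/-! ### The quadratic presentation of the associative operad -/

section Associativity

variable {k : Type u} [Field k] {Q : Operad k}

theorem unitFamily_eq {I A : Type} [Finite I] [Finite A] {f : I → A} {a : A}
    (hf : ∀ b, b ≠ a → ∃! i, f i = b) {b : A} (hb : b ≠ a) (g : Unit ≃ {i // f i = b}) :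
    unitFamily Q f a hf b = Q.map g Q.unit := by
  rw [unitFamily, dif_pos hb]
  congr 2
  have : Subsingleton {i // f i = b} := g.symm.subsingleton
  exact Equiv.ext fun _ => Subsingleton.elim _ _

/-- The numbering of the second fibre of `firstTwo`. -/
def lastEquiv : Unit ≃ {i : Fin 3 // firstTwo i = 1} where
  toFun _ := ⟨2, rfl⟩
  invFun _ := ()
  left_inv _ := rfl
  right_inv := by
    rintro ⟨i, hi⟩
    revert i
    decide

/-- The composition `p ∘₁ q` with arbitrary names for the inputs. -/
theorem map_circOne {A C : Type} [Finite A] [Finite C] {B : A → Type} [∀ a, Finite (B a)]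
    (e : Fin 2 ≃ A) (r : ∀ a, Q.obj (B a)) (F : (Σ a, B a) ≃ C) (E : Fin 3 ≃ C)
    (f0 : Fin 2 ≃ B (e 0)) (f1 : Unit ≃ B (e 1)) (p q : Q.obj (Fin 2))
    (h0 : r (e 0) = Q.map f0 q) (h1 : r (e 1) = Q.map f1 Q.unit)
    (hE0 : ∀ i : Fin 2, E i.castSucc = F ⟨e 0, f0 i⟩) (hE1 : E 2 = F ⟨e 1, f1 ()⟩) :
    Q.map E (Q.circOne (p ⊗ₜ q)) = Q.map F (Q.comp (Q.map e p) r) := by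
  have hf : ∀ b, b ≠ (0 : Fin 2) → ∃! i, firstTwo i = b := by unfold ExistsUnique; decide
  let f : ∀ a : Fin 2, {i : Fin 3 // firstTwo i = a} ≃ B (e a)
    | 0 => firstTwoEquiv.symm.trans f0
    | 1 => lastEquiv.symm.trans f1
  have h := Q.comp_map (B := fun a => {i : Fin 3 // firstTwo i = a}) e f p
    (Function.update (unitFamily Q firstTwo 0 hf) 0 (Q.map firstTwoEquiv q)) r (by
      intro a
      fin_cases a
      · change r (e 0) = Q.map (firstTwoEquiv.symm.trans f0)
          (Function.update (unitFamily Q firstTwo 0 hf) 0 (Q.map firstTwoEquiv q) 0)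
        rw [Function.update_self, ← Q.map_trans, h0, ← Equiv.trans_assoc, Equiv.self_trans_symm,
          Equiv.refl_trans]
      · change r (e 1) = Q.map (lastEquiv.symm.trans f1)
          (Function.update (unitFamily Q firstTwo 0 hf) 0 (Q.map firstTwoEquiv q) 1)
        rw [Function.update_of_ne (by decide), unitFamily_eq hf (by decide) lastEquiv,
          ← Q.map_trans, h1, ← Equiv.trans_assoc, Equiv.self_trans_symm, Equiv.refl_trans])
  have he : (Equiv.sigmaFiberEquiv firstTwo).trans E = (Equiv.sigmaCongr e f).trans F := by
    refine Equiv.ext ?_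
    rintro ⟨a, x⟩
    fin_cases a
    · obtain ⟨i, rfl⟩ := firstTwoEquiv.surjective x
      change E i.castSucc = F ⟨e 0, f0 (firstTwoEquiv.symm (firstTwoEquiv i))⟩
      rw [Equiv.symm_apply_apply, hE0]
    · obtain ⟨i, rfl⟩ := lastEquiv.surjective x
      exact hE1
  rw [← h, ← Q.map_trans, ← he, Q.map_trans]
  refine congrArg (Q.map E) ?_
  rw [Operad.circOne, TensorProduct.lift.tmul, LinearMap.compl₂_apply, RightModule.partialComp,
    LinearMap.mk₂_apply]
  congr!

/-- Associativity, expressed by the compositions `∘₁`. -/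
theorem isAssoc_of_circOne {μ : Q.obj (Fin 2)} (h : Q.circOne (μ ⊗ₜ μ) =
    Q.map (finRotate 3) (Q.circOne (Q.map (Equiv.swap 0 1) μ ⊗ₜ μ))) : Q.IsAssoc μ := by
  let E : Fin 3 ≃ {x : Fin 3 // x ∈ [(0 : Fin 3), 1, 2]} :=
    (Equiv.subtypeUnivEquiv (by decide)).symm
  have p1 : IsPart [(0 : Fin 2), 1] ![[(0 : Fin 3), 1], [2]] [0, 1, 2] :=
    isPart_pair rfl (by decide)
  have p2 : IsPart [(0 : Fin 2), 1] ![[(0 : Fin 3)], [1, 2]] [0, 1, 2] :=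
    isPart_pair rfl (by decide)
  have hp : (0 : Fin 2) ≠ 1 := by decide
  have e1 : Q.map E (Q.circOne (μ ⊗ₜ μ)) =
      Q.graft (Q.mulPair μ) ![[(0 : Fin 3), 1], [2]] [0, 1, 2]
        (fun i => Q.listProd μ (![[(0 : Fin 3), 1], [2]] i)) := by
    rw [Operad.graft_of_isPart p1]
    refine map_circOne (pairEquiv hp) _ _ _
      (pairEquiv (a := (0 : Fin 3)) (b := 1) (by decide))
      (singleEquiv (2 : Fin 3)) _ _ ?_ rfl ?_ rfl
    · exact Operad.listProd_pair _
    · intro i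
      fin_cases i <;> rfl
  have e2 : Q.map ((finRotate 3).trans E) (Q.circOne (Q.map (Equiv.swap 0 1) μ ⊗ₜ μ)) =
      Q.listProd μ [(0 : Fin 3), 1, 2] := by
    rw [Operad.listProd_cons (List.cons_ne_nil _ _), Operad.graft_of_isPart p2, Operad.mulPair]
    have hs : pairEquiv hp = (Equiv.swap 0 1).trans ((Equiv.swap 0 1).trans (pairEquiv hp)) := by
      ext i
      simp
    rw [hs, Q.map_trans (Equiv.swap 0 1)]
    refine map_circOne (C := {x : Fin 3 // x ∈ [(0 : Fin 3), 1, 2]})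
      (B := fun i : {i : Fin 2 // i ∈ [(0 : Fin 2), 1]} =>
      {x // x ∈ ![[(0 : Fin 3)], [1, 2]] i.1}) ((Equiv.swap 0 1).trans (pairEquiv hp)) _ _ _
      (pairEquiv (a := (1 : Fin 3)) (b := 2) (by decide)) (singleEquiv (0 : Fin 3)) _ _ ?_ ?_ ?_ ?_
    · exact Operad.listProd_pair _
    · rfl
    · intro i
      fin_cases i <;> rfl
    · rfl
  rw [Operad.IsAssoc, ← e1, ← e2, Q.map_trans, h]

end Associativity

section CircOne

variable {k : Type u} [Field k]

/-- The word obtained from the word `a` in `0`, `1` by the substitution of the word `b` in `0`, `1`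
for `0` and of `2` for `1`. -/
noncomputable def Word.circOne (a b : Word (Fin 2)) : Word (Fin 3) :=
  (a.subst fun
    | 0 => b.map firstTwoEquiv
    | 1 => Word.one.map lastEquiv : Word (Σ i, {j // firstTwo j = i})).map
      (Equiv.sigmaFiberEquiv firstTwo)

theorem circOne_wordVec (a b : Word (Fin 2)) :
    (Ass k).circOne (wordVec k a ⊗ₜ wordVec k b) = wordVec k (a.circOne b) := by
  refine Eq.trans ?_ (partialComp_wordVec firstTwo 0 (by unfold ExistsUnique; decide) (fun
    | 0 => b.map firstTwoEquiv
    | 1 => Word.one.map lastEquiv) a)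
  rw [← map_wordVec firstTwoEquiv b]
  rfl

theorem Word.circOne_val (a b : Word (Fin 2)) : (a.circOne b).1 =
    a.1.flatMap fun i => if i = 0 then b.1.map Fin.castSucc else [2] := by
  rw [Word.circOne, Word.map, Word.subst]
  simp only [List.map_flatMap, List.map_map]
  congr 1
  funext i
  fin_cases i
  · simp only [Word.map, List.map_map]
    rfl
  · rfl

end CircOne

/-! ### The universal property of the associative operad -/

theorem Collection.map_map {k : Type u} [Field k] (Q : Collection k) {A B C : Type} [Finite A]
    [Finite B] [Finite C] {e : A ≃ B} {f : B ≃ C} {g : A ≃ C} (h : ∀ a, f (e a) = g a)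
    (x : Q.obj A) : Q.map f (Q.map e x) = Q.map g x := by
  obtain rfl : e.trans f = g := Equiv.ext h
  exact (Q.map_trans e f x).symm

section WordProd

variable {k : Type u} [Field k] {Q : Operad k} {A : Type}

/-- The letters of a word are the elements of the alphabet. -/
def Word.equiv (w : Word A) : {a // a ∈ w.1} ≃ A := Equiv.subtypeUnivEquiv w.2.2.2

/-- The product of the letters of a word, for the binary operation `μ`. -/
noncomputable def wordProd [Finite A] (μ : Q.obj (Fin 2)) (w : Word A) : Q.obj A :=
  Q.map w.equiv (Q.listProd μ w.1)

variable {μ : Q.obj (Fin 2)}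

theorem wordProd_map [Finite A] {B : Type} [Finite B] (hμ : Q.IsAssoc μ) (e : A ≃ B) (w : Word A) :
    wordProd μ (w.map e) = Q.map e (wordProd μ w) := by
  have h := Operad.listProd_map hμ w.2.1 w.2.2.1 (g := e) e.injective.injOn
  refine (congrArg (Q.map (w.map e).equiv) h).trans ?_
  exact (Q.map_map (fun _ => rfl) _).trans (Q.map_trans w.equiv e _)

/-- Substitution of words corresponds to the composition of their products. -/
theorem wordProd_subst [Finite A] {B : A → Type} [∀ a, Finite (B a)] (hμ : Q.IsAssoc μ)
    (w : Word A) (v : ∀ a, Word (B a)) :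
    wordProd μ (w.subst v) = Q.comp (wordProd μ w) fun a => wordProd μ (v a) := by
  let T : A → List (Σ a, B a) := fun a => (v a).1.map (Sigma.mk a)
  have hinj : ∀ a, Set.InjOn (Sigma.mk a : B a → Σ a, B a) {x | x ∈ (v a).1} := fun a =>
    sigma_mk_injective.injOn
  have hd : (w.1.flatMap T).Nodup := (w.subst v).2.2.1
  have h := Operad.listProd_flatMap hμ (T := T) w.2.1 w.2.2.1
    (fun a => by simpa [T] using (v a).2.1) hd
  rw [Operad.graft_of_isPart (isPart_flatMap hd)] at h
  have hT : ∀ a, Q.listProd μ (T a) = Q.map (Operad.mapEquiv (hinj a)) (Q.listProd μ (v a).1) :=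
    fun a => Operad.listProd_map hμ (v a).2.1 (v a).2.2.1 (hinj a)
  have hc := Q.comp_map w.equiv
    (fun a : {a // a ∈ w.1} => (Operad.mapEquiv (hinj a.1)).symm.trans (v a.1).equiv)
    (Q.listProd μ w.1) (fun a => Q.listProd μ (T a.1)) (fun a => wordProd μ (v a)) (by
      intro a
      change wordProd μ (v a.1) = _
      rw [hT]
      exact (Q.map_map (e := Operad.mapEquiv (hinj a.1))
        (f := (Operad.mapEquiv (hinj a.1)).symm.trans (v a.1).equiv)
        (fun x => congrArg (v a.1).equiv (Equiv.symm_apply_apply _ x)) _).symm)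
  change _ = Q.comp (Q.map w.equiv (Q.listProd μ w.1)) _
  rw [← hc]
  refine (congrArg (Q.map (w.subst v).equiv) h.symm).trans ?_
  refine Q.map_map ?_ _
  rintro ⟨a, x⟩
  obtain ⟨b, rfl⟩ := (Operad.mapEquiv (hinj a.1)).surjective x
  change (⟨a.1, b.1⟩ : Σ a, B a) =
    ⟨a.1, (v a.1).equiv ((Operad.mapEquiv (hinj a.1)).symm (Operad.mapEquiv (hinj a.1) b))⟩
  rw [Equiv.symm_apply_apply]
  rfl

theorem wordProd_one : wordProd μ Word.one = Q.unit := by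
  change Q.map Word.one.equiv (Q.map (singleEquiv ()) Q.unit) = _
  exact Eq.trans (Q.map_map (g := Equiv.refl _) (fun _ => rfl) _) (Q.map_refl _ _)

theorem wordProd_word01 : wordProd μ word01 = μ := by
  have h := Operad.listProd_pair (μ := μ) (a := (0 : Fin 2)) (b := 1) (by decide)
  refine (congrArg (Q.map word01.equiv) h).trans ?_
  refine Eq.trans (Q.map_map (g := Equiv.refl _) (fun i => ?_) μ) (Q.map_refl _ _)
  fin_cases i <;> rfl

theorem Word.exists_eq_map_word01 (w : Word (Fin 2)) : ∃ σ : Equiv.Perm (Fin 2),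
    w = word01.map σ := by
  rcases word_fin_two w with h | h
  · exact ⟨1, Subtype.ext h⟩
  · exact ⟨Equiv.swap 0 1, Subtype.ext h⟩

end WordProd

section Ass

variable {k : Type u} [Field k] {Q : Operad.{u} k}

/-- Linear maps on `Ass` are determined by their values on words. -/
theorem ass_hom_ext {A : Type} [Finite A] {Y : Type u} [AddCommGroup Y] [Module k Y]
    {f g : (Ass k).obj A →ₗ[k] Y} (h : ∀ w, f (wordVec k w) = g (wordVec k w)) : f = g := by
  refine Finsupp.lhom_ext' fun w => LinearMap.ext_ring ?_
  exact h w

/-- Multilinear maps on `Ass` are determined by their values on words. -/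
theorem ass_multilinear_ext {A : Type} [Finite A] {B : A → Type} [∀ a, Finite (B a)] {Y : Type u}
    [AddCommGroup Y] [Module k Y] {f g : MultilinearMap k (fun a => (Ass k).obj (B a)) Y}
    (h : ∀ v : ∀ a, Word (B a), f (fun a => wordVec k (v a)) = g fun a => wordVec k (v a)) :
    f = g := multilinear_ext h

/-- The linear map on `Ass` with given values on words. -/
noncomputable def assLift {A : Type} [Finite A] {Y : Type u} [AddCommGroup Y] [Module k Y]
    (F : Word A → Y) : (Ass k).obj A →ₗ[k] Y := Finsupp.linearCombination k F

theorem assLift_wordVec {A : Type} [Finite A] {Y : Type u} [AddCommGroup Y] [Module k Y]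
    (F : Word A → Y) (w : Word A) : assLift (k := k) F (wordVec k w) = F w :=
  (Finsupp.linearCombination_single k 1 w).trans (one_smul k _)

/-- The morphism of operads from `Ass` given by an associative binary operation. -/
noncomputable def assHom (μ : Q.obj (Fin 2)) (hμ : Q.IsAssoc μ) : Operad.Hom (Ass k) Q where
  app A _ := assLift (wordProd μ)
  app_map {A B} _ _ e p := by
    have h : assLift (wordProd μ) ∘ₗ (Ass k).map e = Q.map e ∘ₗ assLift (wordProd μ) := by
      refine ass_hom_ext fun w => ?_
      simp only [LinearMap.comp_apply, map_wordVec, assLift_wordVec, wordProd_map hμ]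
    exact congrArg (fun f => f p) h
  app_comp {A} _ {B} _ p q := by
    have h : ∀ w : Word A, (assLift (wordProd μ)).compMultilinearMap
        ((Ass k).comp (B := B) (wordVec k w)) =
        (Q.comp (assLift (wordProd μ) (wordVec k w))).compLinearMap
          fun a => assLift (k := k) (wordProd μ) := by
      intro w
      refine ass_multilinear_ext fun v => ?_
      simp only [LinearMap.compMultilinearMap_apply, MultilinearMap.compLinearMap_apply,
        comp_wordVec, assLift_wordVec, wordProd_subst hμ]
    have h' : assLift (wordProd μ) ∘ₗ
        LinearMap.mk ⟨fun p => (Ass k).comp p q, fun _ _ => by rw [map_add, add_apply]⟩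
          (fun _ _ => by simp only [map_smul, smul_apply, RingHom.id_apply]) =
        LinearMap.mk ⟨fun p => Q.comp p fun a => assLift (wordProd μ) (q a),
          fun _ _ => by rw [map_add, add_apply]⟩
          (fun _ _ => by simp only [map_smul, smul_apply, RingHom.id_apply]) ∘ₗ
        assLift (k := k) (wordProd μ) :=
      ass_hom_ext fun w => congrArg (fun m => m q) (h w)
    exact congrArg (fun f => f p) h'
  app_unit := (assLift_wordVec _ Word.one).trans wordProd_one

namespace Operad.Hom

variable {P : Operad.{u} k} (φ : Operad.Hom P Q)

theorem app_graft {I X : Type} {la : List I} (p : P.obj {i // i ∈ la}) (S : I → List X)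
    (l : List X) (q : ∀ i, P.obj {x // x ∈ S i}) :
    φ.app _ (P.graft p S l q) = Q.graft (φ.app _ p) S l fun i => φ.app _ (q i) := by
  by_cases h : IsPart la S l
  · rw [graft_of_isPart h, graft_of_isPart h, φ.app_map, φ.app_comp]
  · rw [graft, graft, dif_neg h, dif_neg h, map_zero]

theorem app_listProd (μ : P.obj (Fin 2)) {X : Type} (l : List X) :
    φ.app _ (P.listProd μ l) = Q.listProd (φ.app _ μ) l := by
  induction l with
  | nil => exact map_zero _
  | cons a l ih =>
    by_cases hl : l = []
    · subst hl
      exact (φ.app_map _ _).trans (congrArg _ φ.app_unit)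
    · rw [listProd_cons hl, listProd_cons hl, app_graft, mulPair, φ.app_map, ← mulPair]
      refine graft_pair_congr ?_ ih
      exact (φ.app_map _ _).trans (congrArg _ φ.app_unit)

theorem app_wordProd (μ : P.obj (Fin 2)) {A : Type} [Finite A] (w : Word A) :
    φ.app A (wordProd μ w) = wordProd (φ.app _ μ) w :=
  (φ.app_map _ _).trans (congrArg _ (φ.app_listProd μ w.1))

end Operad.Hom

/-- In `Ass` the iterated product of the letters of a word is the word itself. -/
theorem listProd_wordVec {X : Type} {l : List X} (hl : l ≠ []) (hd : l.Nodup) :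
    (Ass k).listProd (wordVec k word01) l =
      wordVec k ⟨l.attach, by simpa using hl, hd.attach, l.mem_attach⟩ := by
  induction l with
  | nil => exact absurd rfl hl
  | cons a l ih =>
    by_cases h : l = []
    · subst h
      exact map_wordVec _ _
    · have hp : IsPart [(0 : Fin 2), 1] ![[a], l] (a :: l) := isPart_pair rfl hd
      let v : ∀ i : {i : Fin 2 // i ∈ [(0 : Fin 2), 1]}, Word {x // x ∈ ![[a], l] i.1}
        | ⟨0, _⟩ => ⟨[a].attach, by simp, by simp, List.mem_attach _⟩
        | ⟨1, _⟩ => ⟨l.attach, by simpa using h, (List.nodup_cons.1 hd).2.attach, l.mem_attach⟩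
      have hv : (fun i : {i : Fin 2 // i ∈ [(0 : Fin 2), 1]} =>
          (Ass k).listProd (wordVec k word01) (![[a], l] i.1)) = fun i => wordVec k (v i) := by
        funext ⟨i, hi⟩
        fin_cases i
        · exact map_wordVec _ _
        · exact ih h (List.nodup_cons.1 hd).2
      rw [Operad.listProd_cons h, Operad.graft_of_isPart hp, hv, Operad.mulPair, map_wordVec,
        comp_wordVec, map_wordVec]
      congr 1
      refine Word.ext_of_map Subtype.val_injective ?_
      refine Eq.trans ?_ (a :: l).attach_map_subtype_val.symm
      simp only [Word.map, Word.subst, word01, List.map_cons, List.map_nil, List.flatMap_cons,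
        List.flatMap_nil, List.append_nil, List.map_append, List.map_map]
      exact congrArg (a :: ·) l.attach_map_subtype_val

theorem wordProd_wordVec {A : Type} [Finite A] (w : Word A) :
    wordProd (wordVec k word01) w = wordVec k w := by
  refine (congrArg ((Ass k).map w.equiv) (listProd_wordVec w.2.1 w.2.2.1)).trans ?_
  refine (map_wordVec _ _).trans (congrArg _ (Subtype.ext ?_))
  exact w.1.attach_map_subtype_val

/-- A linear map from `Ass(2)` which respects the quadratic relations of `Ass` extends uniquely to a
morphism of operads: its value at the word `01` is an associative operation, and every word is an
iterated product. -/
theorem isQuadratic_ass : (Ass k).IsQuadratic := by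
  intro Q f hf hrel
  have hμ : Q.IsAssoc (f (wordVec k word01)) := by
    refine isAssoc_of_circOne ?_
    -- The relation `(01)2 = 0(12)`, where the right-hand side is the composition along the second
    -- tree of the opposite product with the product.
    have h := hrel ![wordVec k word01 ⊗ₜ wordVec k word01,
      -((Ass k).map (Equiv.swap 0 1) (wordVec k word01) ⊗ₜ wordVec k word01), 0] (by
        simp only [Operad.evalThree, Fin.sum_univ_three]
        simp only [Matrix.cons_val_zero, Matrix.cons_val_one, Matrix.cons_val, map_neg, map_zero,
          map_wordVec, circOne_wordVec, add_zero]
        rw [add_neg_eq_zero]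
        congr 1)
    simp only [Operad.evalThree, Fin.sum_univ_three] at h
    simp only [Matrix.cons_val_zero, Matrix.cons_val_one, Matrix.cons_val, map_neg, map_zero,
      TensorProduct.map_tmul, hf, add_zero, Fin.val_zero, pow_zero, Fin.val_one, pow_one] at h
    rw [add_neg_eq_zero] at h
    rw [← h]
    exact (Q.map_refl _ _).symm
  refine ⟨assHom _ hμ, ?_, ?_⟩
  · refine ass_hom_ext fun w => ?_
    refine (assLift_wordVec _ w).trans ?_
    obtain ⟨σ, rfl⟩ := w.exists_eq_map_word01
    rw [wordProd_map hμ, wordProd_word01, ← map_wordVec, hf]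
  · rintro φ rfl
    obtain ⟨app, app_map, app_comp, app_unit⟩ := φ
    have key : @app = fun A [Finite A] => assLift (wordProd (app (Fin 2) (wordVec k word01))) := by
      funext A hA
      refine ass_hom_ext fun w => ?_
      rw [assLift_wordVec]
      conv_lhs => rw [← wordProd_wordVec w]
      exact Operad.Hom.app_wordProd ⟨app, app_map, app_comp, app_unit⟩ _ w
    simp only [assHom]
    congr 1

end Ass

/-! ### The quadratic presentation of the module of cyclic words -/

section CyclProd

variable {k : Type u} [Field k] {N : RightModule.{u} (Ass k)} {x : N.obj Unit}

theorem RightModule.evalTwo_tmul {P : Operad k} (M : RightModule P) (x : M.obj Unit)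
    (p : P.obj (Fin 2)) : M.evalTwo (x ⊗ₜ p) = M.comp x fun _ => p := rfl

/-- The value at `x` of the operation given by a word. -/
noncomputable def wordValue (x : N.obj Unit) {A : Type} [Finite A] (w : Word A) : N.obj A :=
  N.map (Equiv.uniqueSigma fun _ : Unit => A) (N.comp x fun _ => wordVec k w)

theorem wordValue_map (x : N.obj Unit) {A B : Type} [Finite A] [Finite B] (e : A ≃ B)
    (w : Word A) : wordValue x (w.map e) = N.map e (wordValue x w) := by
  have h := N.comp_map (Equiv.refl Unit) (B := fun _ => A) (B' := fun _ => B) (fun _ => e) x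
    (fun _ => wordVec k w) (fun _ => wordVec k (w.map e)) (fun _ => (map_wordVec e w).symm)
  rw [N.map_refl] at h
  rw [wordValue, ← h, wordValue]
  exact (N.map_map (fun _ => rfl) _).trans (N.map_trans _ e _)

/-- Substitution into a word corresponds to the action of the operad. -/
theorem wordValue_subst (x : N.obj Unit) {A : Type} [Finite A] {B : A → Type} [∀ a, Finite (B a)]
    (w : Word A) (v : ∀ a, Word (B a)) :
    wordValue x (w.subst v) = N.comp (wordValue x w) fun a => wordVec k (v a) := by
  have h1 := N.comp_assoc (A := Unit) (B := fun _ => A) (C := fun _ a => B a) x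
    (fun _ => wordVec k w) (fun y => wordVec k (v y.2))
  have h2 := N.comp_map (Equiv.uniqueSigma fun _ : Unit => A) (B := fun y => B y.2)
    (fun _ => Equiv.refl _) (N.comp x fun _ => wordVec k w) (fun y => wordVec k (v y.2))
    (fun a => wordVec k (v a)) (fun y => ((Ass k).map_refl _ _).symm)
  rw [wordValue, wordValue, ← h2, ← comp_wordVec, ← h1]
  exact N.map_map (fun _ => rfl) _

theorem wordValue_one (x : N.obj Unit) : wordValue x Word.one = x := by
  refine Eq.trans ?_ (N.comp_unit x)
  exact congrArg (fun e => N.map e _) (Equiv.ext fun _ => rfl)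

/-- Compatibility of the values with the quadratic relation of cyclic words. -/
theorem comp_eq_of_evalTwo (f : (Cycl k).obj Unit →ₗ[k] N.obj Unit)
    (hf : ∀ w : (Cycl k).obj Unit ⊗[k] (Ass k).obj (Fin 2), (Cycl k).evalTwo w = 0 →
      N.evalTwo (TensorProduct.map f LinearMap.id w) = 0) :
    N.comp (f (cycVec k Word.one.toCyclic)) (fun _ => wordVec k word01) =
      N.comp (f (cycVec k Word.one.toCyclic)) fun _ => wordVec k (word01.map (Equiv.swap 0 1)) := by
  have h := hf (cycVec k Word.one.toCyclic ⊗ₜ wordVec k word01 -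
    cycVec k Word.one.toCyclic ⊗ₜ wordVec k (word01.map (Equiv.swap 0 1))) (by
      rw [map_sub, RightModule.evalTwo_tmul, RightModule.evalTwo_tmul, comp_cycVec, comp_cycVec,
        sub_eq_zero]
      congr 1
      exact Subtype.ext (Quotient.sound ⟨1, rfl⟩))
  rw [map_sub, map_sub, sub_eq_zero] at h
  exact h

/-- A trace does not change if a word is rotated. -/
theorem wordValue_append_comm {x : N.obj Unit} (hx : N.comp x (fun _ => wordVec k word01) =
      N.comp x fun _ => wordVec k (word01.map (Equiv.swap 0 1))) {A : Type} [Finite A]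
    {l₁ l₂ : List A} {w w' : Word A} (h : w.1 = l₁ ++ l₂) (h' : w'.1 = l₂ ++ l₁) :
    wordValue x w = wordValue x w' := by
  by_cases h1 : l₁ = []
  · subst h1
    rw [show w = w' from Subtype.ext (by rw [h, h']; simp)]
  by_cases h2 : l₂ = []
  · subst h2
    rw [show w = w' from Subtype.ext (by rw [h, h']; simp)]
  have hd : (l₁ ++ l₂).Nodup := h ▸ w.2.2.1
  have hp : IsPart [(0 : Fin 2), 1] ![l₁, l₂] (l₁ ++ l₂) := isPart_pair rfl hd
  let F : (Σ i : Fin 2, {a // a ∈ ![l₁, l₂] i}) ≃ A :=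
    Equiv.ofBijective (fun y => y.2.1) (by
      constructor
      · rintro ⟨i, a, ha⟩ ⟨j, b, hb⟩ (rfl : a = b)
        have := (hp.2 a (hp.1 i (by fin_cases i <;> simp) a ha)).unique
          (y₁ := i) (y₂ := j) ⟨by fin_cases i <;> simp, ha⟩ ⟨by fin_cases j <;> simp, hb⟩
        subst this
        rfl
      · intro a
        obtain ⟨i, ⟨-, ha⟩, -⟩ := hp.2 a (h ▸ w.2.2.2 a)
        exact ⟨⟨i, a, ha⟩, rfl⟩)
  let v : ∀ i : Fin 2, Word {a // a ∈ ![l₁, l₂] i}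
    | 0 => ⟨l₁.attach, by simpa using h1, (List.nodup_append.1 hd).1.attach, l₁.mem_attach⟩
    | 1 => ⟨l₂.attach, by simpa using h2, (List.nodup_append.1 hd).2.1.attach, l₂.mem_attach⟩
  have key : ∀ u : Word (Fin 2), wordValue x ((u.subst v).map F) =
      N.map F (N.comp (N.map (Equiv.uniqueSigma fun _ : Unit => Fin 2)
        (N.comp x fun _ => wordVec k u)) fun i => wordVec k (v i)) := fun u => by
    rw [wordValue_map, wordValue_subst, wordValue]
  have e : w = (word01.subst v).map F := Subtype.ext (by
    rw [h]
    refine Eq.trans (congrArg₂ (· ++ ·) l₁.attach_map_subtype_val.symm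
      l₂.attach_map_subtype_val.symm) ?_
    simp only [Word.map, Word.subst, word01, List.flatMap_cons,
      List.flatMap_nil, List.append_nil, List.map_append, List.map_map]
    rfl)
  have e' : w' = ((word01.map (Equiv.swap 0 1)).subst v).map F := Subtype.ext (by
    rw [h']
    refine Eq.trans (congrArg₂ (· ++ ·) l₂.attach_map_subtype_val.symm
      l₁.attach_map_subtype_val.symm) ?_
    simp only [Word.map, Word.subst, word01, List.map_cons, List.map_nil, List.flatMap_cons,
      List.flatMap_nil, List.append_nil, List.map_append, List.map_map]
    rfl)
  rw [e, e', key, key, hx]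

/-- The value of a trace at a word only depends on the cyclic word. -/
theorem wordValue_eq_of_toCyclic {x : N.obj Unit} (hx : N.comp x (fun _ => wordVec k word01) =
      N.comp x fun _ => wordVec k (word01.map (Equiv.swap 0 1))) {A : Type} [Finite A]
    {w w' : Word A} (h : w.toCyclic = w'.toCyclic) : wordValue x w = wordValue x w' := by
  have h1 : w.1 ~r w'.1 := Cycle.coe_eq_coe.1 (congrArg Subtype.val h)
  obtain ⟨m, hm, h2⟩ := List.isRotated_iff_mod.1 h1
  rw [List.rotate_eq_drop_append_take hm] at h2
  exact wordValue_append_comm hx (List.take_append_drop m w.1).symm h2.symm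

/-- The value at `x` of the trace given by a cyclic word. -/
noncomputable def cycValue (x : N.obj Unit) {A : Type} [Finite A] (c : CyclicWord A) : N.obj A :=
  wordValue x (Word.toCyclic_surjective c).choose

theorem cycValue_toCyclic {x : N.obj Unit} (hx : N.comp x (fun _ => wordVec k word01) =
      N.comp x fun _ => wordVec k (word01.map (Equiv.swap 0 1))) {A : Type} [Finite A]
    (w : Word A) : cycValue x w.toCyclic = wordValue x w :=
  wordValue_eq_of_toCyclic hx (Word.toCyclic_surjective w.toCyclic).choose_spec

/-- Linear maps on `Cycl` are determined by their values on cyclic words. -/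
theorem cycl_hom_ext {A : Type} [Finite A] {Y : Type u} [AddCommGroup Y] [Module k Y]
    {f g : (Cycl k).obj A →ₗ[k] Y} (h : ∀ w : Word A, f (cycVec k w.toCyclic) =
      g (cycVec k w.toCyclic)) : f = g := by
  refine Finsupp.lhom_ext' fun c => LinearMap.ext_ring ?_
  obtain ⟨w, rfl⟩ := Word.toCyclic_surjective c
  exact h w

/-- The linear map on `Cycl` with given values on cyclic words. -/
noncomputable def cyclLift {A : Type} [Finite A] {Y : Type u} [AddCommGroup Y] [Module k Y]
    (F : CyclicWord A → Y) : (Cycl k).obj A →ₗ[k] Y := Finsupp.linearCombination k F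

theorem cyclLift_cycVec {A : Type} [Finite A] {Y : Type u} [AddCommGroup Y] [Module k Y]
    (F : CyclicWord A → Y) (c : CyclicWord A) : cyclLift (k := k) F (cycVec k c) = F c :=
  (Finsupp.linearCombination_single k 1 c).trans (one_smul k _)

/-- The morphism of modules from `Cycl` given by a trace. -/
noncomputable def cyclHom (x : N.obj Unit) (hx : N.comp x (fun _ => wordVec k word01) =
      N.comp x fun _ => wordVec k (word01.map (Equiv.swap 0 1))) :
    RightModule.Hom (Cycl k) N where
  app A _ := cyclLift (cycValue x)
  app_map {A B} _ _ e p := by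
    have h : cyclLift (cycValue x) ∘ₗ (Cycl k).map e = N.map e ∘ₗ cyclLift (cycValue x) := by
      refine cycl_hom_ext fun w => ?_
      simp only [LinearMap.comp_apply, map_cycVec, cyclLift_cycVec, Word.toCyclic_map,
        cycValue_toCyclic hx, wordValue_map]
    exact congrArg (fun f => f p) h
  app_comp {A} _ {B} _ p q := by
    have h : ∀ w : Word A, (cyclLift (cycValue x)).compMultilinearMap
        ((Cycl k).comp (B := B) (cycVec k w.toCyclic)) =
        N.comp (cyclLift (cycValue x) (cycVec k w.toCyclic)) := by
      intro w
      refine ass_multilinear_ext fun v => ?_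
      simp only [LinearMap.compMultilinearMap_apply, comp_cycVec, cyclLift_cycVec,
        Word.toCyclic_subst, cycValue_toCyclic hx, wordValue_subst]
    have h' : cyclLift (cycValue x) ∘ₗ
        LinearMap.mk ⟨fun p => (Cycl k).comp p q, fun _ _ => by rw [map_add, add_apply]⟩
          (fun _ _ => by simp only [map_smul, smul_apply, RingHom.id_apply]) =
        LinearMap.mk ⟨fun p => N.comp p q, fun _ _ => by rw [map_add, add_apply]⟩
          (fun _ _ => by simp only [map_smul, smul_apply, RingHom.id_apply]) ∘ₗ
        cyclLift (k := k) (cycValue x) :=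
      cycl_hom_ext fun w => congrArg (fun m => m q) (h w)
    exact congrArg (fun f => f p) h'

theorem RightModule.Hom.app_wordValue {M N : RightModule.{u} (Ass k)} (φ : RightModule.Hom M N)
    (x : M.obj Unit) {A : Type} [Finite A] (w : Word A) :
    φ.app A (wordValue x w) = wordValue (φ.app Unit x) w :=
  (φ.app_map _ _).trans (congrArg _ (φ.app_comp _ _))

theorem wordValue_cycVec {A : Type} [Finite A] (w : Word A) :
    wordValue (N := Cycl k) (cycVec k Word.one.toCyclic) w = cycVec k w.toCyclic := by
  rw [wordValue, comp_cycVec, map_cycVec, Word.toCyclic_subst, Word.toCyclic_map, Word.unit_subst]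

theorem Word.eq_one (w : Word Unit) : w = Word.one := by
  refine Subtype.ext ?_
  have h : w.1.length ≤ 1 := by simpa using w.2.2.1.length_le_card
  obtain ⟨a, ha⟩ := List.length_eq_one_iff.1
    (le_antisymm h (List.length_pos_iff.2 w.2.1))
  exact ha

/-- An element `x` which respects the quadratic relation of `Cycl` is a trace, i.e. its values at
words are invariant under rotations.  Therefore it extends uniquely to a morphism from `Cycl`. -/
theorem isQuadratic_cycl : (Cycl k).IsQuadratic := by
  intro N f hf
  have hx := comp_eq_of_evalTwo f hf
  refine ⟨cyclHom _ hx, ?_, ?_⟩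
  · refine cycl_hom_ext fun w => ?_
    refine (cyclLift_cycVec _ _).trans ?_
    rw [w.eq_one, cycValue_toCyclic hx, wordValue_one]
  · rintro φ rfl
    obtain ⟨app, app_map, app_comp⟩ := φ
    have key : @app = fun A [Finite A] =>
        cyclLift (cycValue (app Unit (cycVec k Word.one.toCyclic))) := by
      funext A hA
      refine cycl_hom_ext fun w => ?_
      rw [cyclLift_cycVec, cycValue_toCyclic hx]
      conv_lhs => rw [← wordValue_cycVec w]
      exact RightModule.Hom.app_wordValue ⟨app, app_map, app_comp⟩ _ w
    simp only [cyclHom]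
    congr 1

end CyclProd

/-! ### Koszul self-duality -/

section Annihilator

variable {k : Type u} [Field k]

/-- If a linear map identifies precisely the pairs of basis vectors `b x` and `b (τ x)`, for an
involution `τ` without fixed points, and a diagonal form changes its sign under `τ`, then the kernel
of the map is its own annihilator.  The functionals `ℓ x` express that the images of the pairs are
linearly independent. -/
theorem annihilator_eq_of_involution {X V Y : Type*} [Fintype X] [DecidableEq X] [AddCommGroup V]
    [Module k V] [AddCommGroup Y] [Module k Y] (b : Module.Basis X k V) (L : V →ₗ[k] Y)
    (β : V →ₗ[k] V →ₗ[k] k) {τ : X → X} (hτ : ∀ x, τ (τ x) = x) (hne : ∀ x, τ x ≠ x) {ε : X → k}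
    (h0 : ∀ x, ε x ≠ 0) (hε : ∀ x, ε (τ x) = -ε x)
    (hβ : ∀ x y, β (b x) (b y) = if x = y then ε x else 0)
    (hu : ∀ x, L (b (τ x)) = L (b x)) (ℓ : X → Y →ₗ[k] k)
    (hℓ : ∀ x y, ℓ x (L (b y)) = if y = x ∨ y = τ x then 1 else 0) (v' : V) :
    L v' = 0 ↔ ∀ v, L v = 0 → β v v' = 0 := by
  have hL : ∀ v, L v = 0 ↔ ∀ x, b.repr v x + b.repr v (τ x) = 0 := by
    intro v
    have hv : L v = ∑ x, b.repr v x • L (b x) := by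
      conv_lhs => rw [← b.sum_repr v]
      rw [map_sum]
      simp only [map_smul]
    constructor
    · intro h x
      have h1 := congrArg (ℓ x) (hv.symm.trans h)
      rw [map_zero, map_sum, Finset.sum_eq_add x (τ x) (hne x).symm] at h1
      · simpa [hℓ] using h1
      · rintro y - ⟨h2, h3⟩
        simp [hℓ, h2, h3]
      · simp
      · simp
    · intro h
      rw [hv]
      refine Finset.sum_involution (fun x _ => τ x) (fun x _ => ?_) (fun x _ _ => hne x)
        (fun _ _ => Finset.mem_univ _) (fun x _ => hτ x)
      rw [hu, ← add_smul, h, zero_smul]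
  have hβ1 : ∀ v, β v v' = ∑ x, ε x * (b.repr v x * b.repr v' x) := by
    intro v
    rw [← LinearMap.sum_repr_mul_repr_mul b b]
    rw [Finsupp.sum_fintype _ _ (by simp)]
    refine Finset.sum_congr rfl fun x _ => ?_
    rw [Finsupp.sum_fintype _ _ (by simp), Finset.sum_eq_single x]
    · simp only [hβ, if_true, smul_eq_mul]
      ring
    · intro y _ hy
      simp [hβ, hy.symm]
    · simp
  constructor
  · intro h v hv
    rw [hβ1]
    refine Finset.sum_involution (fun x _ => τ x) (fun x _ => ?_) (fun x _ _ => hne x)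
      (fun _ _ => Finset.mem_univ _) (fun x _ => hτ x)
    have e1 := eq_neg_of_add_eq_zero_right ((hL v').1 h x)
    have e2 := eq_neg_of_add_eq_zero_right ((hL v).1 hv x)
    rw [hε, e1, e2]
    ring
  · intro h
    refine (hL v').2 fun x => ?_
    have h1 : L (b x - b (τ x)) = 0 := by
      refine (hL _).2 fun y => ?_
      have hinj : ∀ {y z}, τ y = z ↔ y = τ z := fun {y z} =>
        ⟨fun h => by rw [← h, hτ], fun h => by rw [h, hτ]⟩
      simp only [map_sub, Finsupp.sub_apply, Module.Basis.repr_self, Finsupp.single_apply]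
      by_cases hx : x = y
      · subst hx
        simp [hne x, (hne x).symm]
      · by_cases hy : τ x = y
        · subst hy
          simp [hτ, hne x, (hne x).symm]
        · have h2 : x ≠ τ y := fun e => hy (by rw [e, hτ])
          have h3 : τ x ≠ τ y := fun e => hx (by rw [← hτ x, e, hτ])
          simp [hx, hy, h2, h3]
    have h2 := h _ h1
    rw [map_sub, LinearMap.sub_apply] at h2
    have h3 : ∀ y, β (b y) v' = ε y * b.repr v' y := by
      intro y
      rw [hβ1, Finset.sum_eq_single y]
      · simp
      · intro z _ hz
        simp [hz.symm]
      · simp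
    rw [h3, h3, hε] at h2
    have h4 : ε x * (b.repr v' x + b.repr v' (τ x)) = 0 := by
      rw [← h2]
      ring
    exact (mul_eq_zero.1 h4).resolve_left (h0 x)

end Annihilator

section Bases

variable (k : Type u) [Field k]

/-- The two words in `0` and `1`. -/
def boolWord : Bool → Word (Fin 2)
  | false => word01
  | true => word01.map (Equiv.swap 0 1)

theorem boolWord_injective : Function.Injective boolWord := by
  intro s t h
  have h' : (boolWord s).1 = (boolWord t).1 := congrArg Subtype.val h
  clear h
  revert h'
  revert s t
  decide

theorem boolWord_surjective : Function.Surjective boolWord := fun w => by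
  rcases word_fin_two w with h | h
  · exact ⟨false, Subtype.ext h.symm⟩
  · exact ⟨true, Subtype.ext h.symm⟩

theorem boolWord_bijective : Function.Bijective boolWord :=
  ⟨boolWord_injective, boolWord_surjective⟩

/-- The basis of `Ass(2)`. -/
noncomputable def assBasis : Module.Basis Bool k ((Ass k).obj (Fin 2)) :=
  (Finsupp.basisSingleOne : Module.Basis (Word (Fin 2)) k (Word (Fin 2) →₀ k)).reindex
    (Equiv.ofBijective boolWord boolWord_bijective).symm

theorem assBasis_apply (s : Bool) : assBasis k s = wordVec k (boolWord s) := by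
  refine (Module.Basis.reindex_apply
    (Finsupp.basisSingleOne : Module.Basis (Word (Fin 2)) k (Word (Fin 2) →₀ k)) _ s).trans ?_
  exact congrFun Finsupp.coe_basisSingleOne (boolWord s)

/-- The basis of `Cycl(1)`. -/
noncomputable def cyclBasis : Module.Basis Unit k ((Cycl k).obj Unit) :=
  (Finsupp.basisSingleOne : Module.Basis (CyclicWord Unit) k (CyclicWord Unit →₀ k)).reindex
    { toFun := fun _ => ()
      invFun := fun _ => Word.one.toCyclic
      left_inv := fun c => by
        obtain ⟨w, rfl⟩ := Word.toCyclic_surjective c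
        rw [w.eq_one]
      right_inv := fun _ => rfl }

theorem cyclBasis_apply (u : Unit) : cyclBasis k u = cycVec k Word.one.toCyclic := by
  refine (Module.Basis.reindex_apply
    (Finsupp.basisSingleOne : Module.Basis (CyclicWord Unit) k (CyclicWord Unit →₀ k)) _ u).trans ?_
  exact congrFun Finsupp.coe_basisSingleOne Word.one.toCyclic

/-- The pairing of `Ass(2)` with itself. -/
noncomputable def pairAss : (Ass k).obj (Fin 2) →ₗ[k] (Ass k).obj (Fin 2) →ₗ[k] k :=
  assLift fun w => wordSign w • wordCoeff w

/-- The pairing of `Cycl(1)` with itself. -/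
noncomputable def pairCycl : (Cycl k).obj Unit →ₗ[k] (Cycl k).obj Unit →ₗ[k] k :=
  cyclLift cycCoeff

variable {k}

theorem pairAss_wordVec (w : Word (Fin 2)) (q : (Ass k).obj (Fin 2)) :
    pairAss k (wordVec k w) q = wordSign w • wordCoeff w q := by
  rw [pairAss, assLift_wordVec, LinearMap.smul_apply]

theorem pairCycl_cycVec (c : CyclicWord Unit) (y : (Cycl k).obj Unit) :
    pairCycl k (cycVec k c) y = cycCoeff c y := by
  rw [pairCycl, cyclLift_cycVec]

theorem wordCoeff_wordVec {A : Type} [Finite A] [DecidableEq (Word A)] (w w' : Word A) :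
    wordCoeff w (wordVec k w') = if w' = w then 1 else 0 := by
  refine Eq.trans (Finsupp.single_apply (M := k)) ?_
  congr!

/-- The sign of a word in `0` and `1`, in terms of its index. -/
def boolSign (s : Bool) : ℤ := wordSign (boolWord s)

theorem pairAss_assBasis (s t : Bool) :
    pairAss k (assBasis k s) (assBasis k t) = if s = t then (boolSign s : k) else 0 := by
  classical
  rw [assBasis_apply, assBasis_apply, pairAss_wordVec, wordCoeff_wordVec]
  by_cases h : s = t
  · subst h
    simp [boolSign]
  · have h' : boolWord t ≠ boolWord s := fun e => h (boolWord_injective e).symm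
    simp [h, h']

theorem pairCycl_cyclBasis (s t : Unit) : pairCycl k (cyclBasis k s) (cyclBasis k t) = 1 := by
  simp only [cyclBasis_apply]
  rw [pairCycl_cycVec, cycCoeff_cycVec]

theorem boolSign_not (s : Bool) : boolSign (!s) = -boolSign s := by
  revert s
  decide

theorem boolSign_mul_self (s : Bool) : boolSign s * boolSign s = 1 := by
  revert s
  decide

/-- A symmetric form with an orthogonal basis of vectors of nonzero length is perfect. -/
theorem isPerfPair_of_orthogonal {X : Type*} [Fintype X] [DecidableEq X] {V : Type*}
    [AddCommGroup V] [Module k V] (b : Module.Basis X k V) (β : V →ₗ[k] V →ₗ[k] k) {ε : X → k}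
    (h0 : ∀ x, ε x ≠ 0) (hβ : ∀ x y, β (b x) (b y) = if x = y then ε x else 0) :
    β.IsPerfPair := by
  have hfd : FiniteDimensional k V := b.finiteDimensional_of_finite
  have hs : β.flip = β := by
    refine b.ext fun x => b.ext fun y => ?_
    rw [LinearMap.flip_apply, hβ, hβ]
    by_cases h : x = y
    · subst h
      simp
    · simp [h, Ne.symm h]
  have hi : Function.Injective β := by
    rw [injective_iff_map_eq_zero]
    intro v hv
    refine b.repr.map_eq_zero_iff.1 (Finsupp.ext fun x => ?_)
    have h1 : β v (b x) = b.repr v x * ε x := by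
      conv_lhs => rw [← b.sum_repr v]
      simp only [map_sum, map_smul, LinearMap.sum_apply, LinearMap.smul_apply, hβ, smul_eq_mul]
      simp
    rw [hv, LinearMap.zero_apply] at h1
    exact (mul_eq_zero.1 h1.symm).resolve_right (h0 x)
  exact LinearMap.IsPerfPair.of_injective hi (by rw [hs]; exact hi)

theorem map_swap_assBasis (s : Bool) :
    (Ass k).map (Equiv.swap 0 1) (assBasis k s) = assBasis k (!s) := by
  rw [assBasis_apply, assBasis_apply, map_wordVec]
  congr 1
  cases s
  · rfl
  · exact Subtype.ext (by decide)

theorem pairAss_map (σ : Equiv.Perm (Fin 2)) (p q : (Ass k).obj (Fin 2)) :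
    pairAss k ((Ass k).map σ p) ((Ass k).map σ q) =
      (Equiv.Perm.sign σ : ℤ) • pairAss k p q := by
  have hσ : ∀ σ : Equiv.Perm (Fin 2), σ = 1 ∨ σ = Equiv.swap 0 1 := by decide
  rcases hσ σ with rfl | rfl
  · have h : ∀ x, (Ass k).map (1 : Equiv.Perm (Fin 2)) x = x := (Ass k).map_refl _
    rw [h, h, Equiv.Perm.sign_one, Units.val_one, one_smul]
  · have h : (pairAss k).compl₁₂ ((Ass k).map (Equiv.swap 0 1)) ((Ass k).map (Equiv.swap 0 1)) =
        -pairAss k := by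
      refine (assBasis k).ext fun s => (assBasis k).ext fun t => ?_
      rw [LinearMap.compl₁₂_apply, map_swap_assBasis, map_swap_assBasis, pairAss_assBasis,
        LinearMap.neg_apply, LinearMap.neg_apply, pairAss_assBasis]
      by_cases hst : s = t
      · subst hst
        simp [boolSign_not]
      · simp [hst]
    rw [Equiv.Perm.sign_swap (by decide), Units.val_neg, Units.val_one, neg_smul, one_smul]
    exact congrArg (fun β : (Ass k).obj (Fin 2) →ₗ[k] (Ass k).obj (Fin 2) →ₗ[k] k => β p q) h

theorem boolSign_ne_zero (s : Bool) : (boolSign s : k) ≠ 0 := fun h => by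
  have h1 := congrArg (Int.cast : ℤ → k) (boolSign_mul_self s)
  rw [Int.cast_mul, h] at h1
  simp at h1

/-- The pairing of tensor products as a bilinear map. -/
noncomputable def tensorPairingHom {V W V' W' : Type u} [AddCommGroup V] [Module k V]
    [AddCommGroup W] [Module k W] [AddCommGroup V'] [Module k V'] [AddCommGroup W'] [Module k W']
    (b : V →ₗ[k] V' →ₗ[k] k) (c : W →ₗ[k] W' →ₗ[k] k) : V ⊗[k] W →ₗ[k] V' ⊗[k] W' →ₗ[k] k :=
  (TensorProduct.dualDistrib k V W ∘ₗ TensorProduct.map b.flip c.flip).flip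

theorem tensorPairingHom_tmul {V W V' W' : Type u} [AddCommGroup V] [Module k V]
    [AddCommGroup W] [Module k W] [AddCommGroup V'] [Module k V'] [AddCommGroup W'] [Module k W']
    (b : V →ₗ[k] V' →ₗ[k] k) (c : W →ₗ[k] W' →ₗ[k] k) (x : V) (y : W) (x' : V') (y' : W') :
    tensorPairingHom b c (x ⊗ₜ y) (x' ⊗ₜ y') = b x x' * c y y' := rfl

/-- The word given by the composition of two binary operations along the `i`-th binary tree with
three leaves. -/
noncomputable def treeWord (x : Σ _ : Fin 3, Bool × Bool) : Word (Fin 3) :=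
  ((boolWord x.2.1).circOne (boolWord x.2.2)).map (finRotate 3 ^ (x.1 : ℕ))

/-- The other composition with the same result: every word in three letters is a product of two
factors in two ways, `(ab)c` and `a(bc)`. -/
def reassoc (x : Σ _ : Fin 3, Bool × Bool) : Σ _ : Fin 3, Bool × Bool :=
  ⟨if x.2.1 = x.2.2 then x.1 + 1 else x.1 - 1, !x.2.1, x.2.2⟩

theorem treeWord_eq_iff (x y : Σ _ : Fin 3, Bool × Bool) :
    treeWord y = treeWord x ↔ y = x ∨ y = reassoc x := by
  have h : ∀ x, (treeWord x).1 = ((boolWord x.2.1).1.flatMap fun i =>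
      if i = 0 then (boolWord x.2.2).1.map Fin.castSucc else [2]).map
        (finRotate 3 ^ (x.1 : ℕ) : Equiv.Perm (Fin 3)) := fun x =>
    congrArg (List.map _) (Word.circOne_val _ _)
  refine Subtype.ext_iff.trans ?_
  rw [h, h]
  revert x y
  decide

variable (k) in
/-- The evaluation of quadratic expressions in `Ass`. -/
noncomputable def assEvalThree :
    (Fin 3 → (Ass k).obj (Fin 2) ⊗[k] (Ass k).obj (Fin 2)) →ₗ[k] (Ass k).obj (Fin 3) :=
  ∑ i : Fin 3, (Ass k).map (finRotate 3 ^ (i : ℕ)) ∘ₗ (Ass k).circOne ∘ₗ LinearMap.proj i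

theorem assEvalThree_apply (w : Fin 3 → (Ass k).obj (Fin 2) ⊗[k] (Ass k).obj (Fin 2)) :
    assEvalThree k w = (Ass k).evalThree w := by
  rw [assEvalThree, Operad.evalThree, LinearMap.sum_apply]
  rfl

variable (k) in
/-- The pairing of quadratic expressions in `Ass`. -/
noncomputable def assPairThree :
    (Fin 3 → (Ass k).obj (Fin 2) ⊗[k] (Ass k).obj (Fin 2)) →ₗ[k]
      (Fin 3 → (Ass k).obj (Fin 2) ⊗[k] (Ass k).obj (Fin 2)) →ₗ[k] k :=
  ∑ i : Fin 3, (tensorPairingHom (pairAss k) (pairAss k)).compl₁₂ (LinearMap.proj i)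
    (LinearMap.proj i)

theorem assPairThree_apply (w w' : Fin 3 → (Ass k).obj (Fin 2) ⊗[k] (Ass k).obj (Fin 2)) :
    assPairThree k w w' = ∑ i, tensorPairing (pairAss k) (pairAss k) (w i) (w' i) := by
  rw [assPairThree, LinearMap.sum_apply, LinearMap.sum_apply]
  rfl

variable (k) in
/-- The basis of the space of quadratic expressions in `Ass`. -/
noncomputable def assBasisThree : Module.Basis (Σ _ : Fin 3, Bool × Bool) k
    (Fin 3 → (Ass k).obj (Fin 2) ⊗[k] (Ass k).obj (Fin 2)) :=
  Pi.basis fun _ => (assBasis k).tensorProduct (assBasis k)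

theorem assBasisThree_apply (x : Σ _ : Fin 3, Bool × Bool) :
    assBasisThree k x = Pi.single x.1 (assBasis k x.2.1 ⊗ₜ assBasis k x.2.2) := by
  rw [assBasisThree, Pi.basis_apply, Module.Basis.tensorProduct_apply]

theorem assEvalThree_basis (x : Σ _ : Fin 3, Bool × Bool) :
    assEvalThree k (assBasisThree k x) = wordVec k (treeWord x) := by
  rw [assEvalThree, LinearMap.sum_apply, Finset.sum_eq_single x.1]
  · rw [LinearMap.comp_apply, LinearMap.comp_apply, LinearMap.proj_apply, assBasisThree_apply,
      Pi.single_eq_same, assBasis_apply, assBasis_apply, circOne_wordVec, map_wordVec]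
    rfl
  · intro i _ hi
    rw [LinearMap.comp_apply, LinearMap.comp_apply, LinearMap.proj_apply, assBasisThree_apply,
      Pi.single_eq_of_ne hi, map_zero, map_zero]
  · simp

theorem assPairThree_basis (x y : Σ _ : Fin 3, Bool × Bool) :
    assPairThree k (assBasisThree k x) (assBasisThree k y) =
      if x = y then (boolSign x.2.1 * boolSign x.2.2 : k) else 0 := by
  rw [assPairThree, LinearMap.sum_apply, LinearMap.sum_apply, Finset.sum_eq_single x.1]
  · rw [LinearMap.compl₁₂_apply, LinearMap.proj_apply, LinearMap.proj_apply, assBasisThree_apply,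
      assBasisThree_apply, Pi.single_eq_same]
    obtain ⟨i, s, t⟩ := x
    obtain ⟨j, s', t'⟩ := y
    by_cases hij : i = j
    · subst hij
      rw [Pi.single_eq_same, tensorPairingHom_tmul, pairAss_assBasis, pairAss_assBasis]
      by_cases hs : s = s' <;> by_cases ht : t = t' <;> simp [hs, ht]
    · rw [Pi.single_eq_of_ne hij, map_zero, if_neg]
      intro e
      exact hij (congrArg Sigma.fst e)
  · intro i _ hi
    rw [LinearMap.compl₁₂_apply, LinearMap.proj_apply, assBasisThree_apply,
      Pi.single_eq_of_ne hi, map_zero, LinearMap.zero_apply]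
  · simp

/-- The associativity relations are their own annihilator. -/
theorem ass_relations (w' : Fin 3 → (Ass k).obj (Fin 2) ⊗[k] (Ass k).obj (Fin 2)) :
    (Ass k).evalThree w' = 0 ↔
      ∀ w : Fin 3 → (Ass k).obj (Fin 2) ⊗[k] (Ass k).obj (Fin 2), (Ass k).evalThree w = 0 →
        ∑ i, tensorPairing (pairAss k) (pairAss k) (w i) (w' i) = 0 := by
  classical
  have h := annihilator_eq_of_involution (assBasisThree k) (assEvalThree k) (assPairThree k)
    (τ := reassoc) (by decide) (by decide)
    (ε := fun x => (boolSign x.2.1 * boolSign x.2.2 : k))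
    (fun x => mul_ne_zero (boolSign_ne_zero _) (boolSign_ne_zero _))
    (fun x => by simp [reassoc, boolSign_not]) assPairThree_basis
    (fun x => by
      rw [assEvalThree_basis, assEvalThree_basis, (treeWord_eq_iff x _).2 (Or.inr rfl)])
    (fun x => wordCoeff (treeWord x))
    (fun x y => by
      rw [assEvalThree_basis, wordCoeff_wordVec]
      simp only [treeWord_eq_iff]) w'
  simpa only [assEvalThree_apply, assPairThree_apply] using h

/-- The two products of two letters have the same cyclic word, which is written here with an
arbitrary order `t` of the letters. -/
theorem evalTwo_cyclBasis (u : Unit) (s t : Bool) :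
    (Cycl k).evalTwo (cyclBasis k u ⊗ₜ assBasis k s) =
      cycVec k (Word.one.toCyclic.subst fun _ => boolWord t) := by
  rw [cyclBasis_apply, assBasis_apply, RightModule.evalTwo_tmul, comp_cycVec]
  congr 1
  cases s <;> cases t
  · rfl
  · exact Subtype.ext (Quotient.sound ⟨1, rfl⟩)
  · exact Subtype.ext (Quotient.sound ⟨1, rfl⟩)
  · rfl

/-- The relation of cyclic words spans its own annihilator. -/
theorem cycl_relations (w' : (Cycl k).obj Unit ⊗[k] (Ass k).obj (Fin 2)) :
    (Cycl k).evalTwo w' = 0 ↔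
      ∀ w : (Cycl k).obj Unit ⊗[k] (Ass k).obj (Fin 2), (Cycl k).evalTwo w = 0 →
        tensorPairing (pairCycl k) (pairAss k) w w' = 0 := by
  refine annihilator_eq_of_involution ((cyclBasis k).tensorProduct (assBasis k)) (Cycl k).evalTwo
    (tensorPairingHom (pairCycl k) (pairAss k)) (τ := fun x => (x.1, !x.2)) (by decide)
    (by decide) (ε := fun x => (boolSign x.2 : k)) (fun x => boolSign_ne_zero _)
    (fun x => by simp [boolSign_not]) ?_ ?_
    (fun _ => cycCoeff (Word.one.toCyclic.subst fun _ => boolWord false)) ?_ w'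
  · rintro ⟨u, s⟩ ⟨v, t⟩
    rw [Module.Basis.tensorProduct_apply, Module.Basis.tensorProduct_apply, tensorPairingHom_tmul,
      pairCycl_cyclBasis, pairAss_assBasis, one_mul]
    by_cases h : s = t <;> simp [h]
  · rintro ⟨u, s⟩
    rw [Module.Basis.tensorProduct_apply, Module.Basis.tensorProduct_apply,
      evalTwo_cyclBasis u _ false, evalTwo_cyclBasis u _ false]
  · rintro ⟨u, s⟩ ⟨v, t⟩
    rw [Module.Basis.tensorProduct_apply, evalTwo_cyclBasis _ _ false, cycCoeff_cycVec, if_pos]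
    revert u v s t
    decide

variable (k) in
/-- The self-duality of `Cycl` over the self-dual operad `Ass`. -/
noncomputable def cyclDual : QuadraticDual (Cycl k) (Cycl k) where
  quadratic_P := isQuadratic_ass
  quadratic_M := isQuadratic_cycl
  quadratic_Q := isQuadratic_ass
  quadratic_N := isQuadratic_cycl
  pairE := pairAss k
  perfect_pairE := isPerfPair_of_orthogonal (assBasis k) _ boolSign_ne_zero pairAss_assBasis
  pairE_map := pairAss_map
  pairX := pairCycl k
  perfect_pairX := isPerfPair_of_orthogonal (cyclBasis k) _ (fun _ => one_ne_zero)
    fun s t => by rw [pairCycl_cyclBasis, if_pos rfl]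
  relations_Q := ass_relations
  relations_N := cycl_relations

end Bases
end Koszul

theorem theorem5p2 (k : Type u) [Field k] :
    ∃ D : Koszul.QuadraticDual (Koszul.Cycl k) (Koszul.Cycl k), D.IsKoszul :=
  ⟨Koszul.cyclDual k, Koszul.QuadraticDual.isKoszul_cycl _ Koszul.pairAss_wordVec
    Koszul.pairCycl_cycVec⟩
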